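/- **Setting.** Let $V$ be a finite set of variables and let $\Sigma$ be a finite schema of atoms $R(X)$, $X\subseteq V$, in which every variable occurs in at least one atom. An instance assigns to each atom $R(X)$ a finite relation $R\subseteq \mathbb N^{X}$ (the domain is $\mathbb N$); its size is $\|\Sigma\|=\sum_R |R|$. The output of the full conjunctive query $Q(V)\;\text{:-}\;\bigwedge_{R(X)\in\Sigma}R(X)$ is the set of all $t\in\mathbb N^V$ with $\pi_X(t)\in R$ for every atom $R(X)$. A monotonicity measure is a pair $\delta=(Y|X)$ of disjoint subsets of $V$, and $h(\delta)=h(X\cup Y)-h(X)$ for $h\in\mathbb R^{2^V}$. A polymatroid is an $h$ with $h(\emptyset)=0$, $h(X\cup Y)-h(X)\ge 0$ and $h(X\cup Y)+h(X\cup Z)-h(X)-h(X\cup Y\cup Z)\ge 0$ for all pairwise disjoint $X,Y,Z\subseteq V$. For a relation $R$ with attribute set $A$, $\deg_R(Y|X)$ is the maximum over $x\in\mathbb N^X$ of the number (possibly $\infty$) of tuples $t\in\mathbb N^{X\cup Y}$ that extend $x$ and agree on $A\cap (X\cup Y)$ with some tuple of $R$; and $\deg_\Sigma(\delta)=\min_{R}\deg_R(\delta)$.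 For a set $\Delta$ of monotonicity measures and numbers $N_\delta\ge 0$ ($\delta\in\Delta$), an instance satisfies $(\Delta,N)$ if $\deg_\Sigma(\delta)\le N_\delta$ for all $\delta\in\Delta$. For real weights $w_\delta\ge 0$ put $B_{\Delta,N}=\prod_{\delta\in\Delta}N_\delta^{w_\delta}$, and say that $w$ is valid for $\Delta$ if $h(V)\le\sum_{\delta\in\Delta}w_\delta h(\delta)$ holds for all polymatroids $h$ (that is, if it is a Shannon inequality). Running time is the number of steps of a deterministic unit-cost random access machine with registers and arrays of natural numbers, whose instructions are loading a constant, copying, increment, truncated subtraction, indirect load and store, and a zero test for branching and looping. The input lists, for each atom, the number of its tuples followed by the tuples in arbitrary order without repetition; the output lists the number of tuples of $Q$ followed by these tuples, in some order without repetition. **Corollary (PANDA for a full conjunctive query).** Let $V$ and $\Sigma$ be as above. 1. For every instance, all degree constraints $(\Delta,N)$ that it satisfies and all $w\ge 0$ valid for $\Delta$, the output satisfies $|Q|\le B_{\Delta,N}=\prod_{\delta\in\Delta}N_\delta^{w_\delta}$. 2. There are a program and constants $C,k$, which depend only on $V$ and $\Sigma$, such that on every instance the program halts with the output of the full conjunctive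 query after a number of steps that is at most $$C\,\bigl(\|\Sigma\|+B_{\Delta,N}+1\bigr)\,\bigl(1+\log(1+\|\Sigma\|)\bigr)^{k}$$ for all degree constraints $(\Delta,N)$ that the instance satisfies and all $w\ge 0$ valid for $\Delta$. In other words, the output is computed in time $\tilde O(\|\Sigma\|+B_{\Delta,N})$, and since the program, $C$ and $k$ do not depend on $w$, this holds for the polymatroid bound, the infimum of $B_{\Delta,N}$ over all valid $w$, as well. -/

import Mathlib

open scoped NNReal ENNReal

namespace Panda

section Databases

variable {n m : ℕ}

/-- Tuples with attribute set `X`, over the countably infinite domain `ℕ`; the variables of the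
query are the elements of `Fin n`. -/
abbrev Tuple (X : Finset (Fin n)) : Type := {v // v ∈ X} → ℕ

/-- A schema with `m` atoms over the variables `Fin n`: atom number `j` has attribute set `vars j`,
and the variables of the schema are exactly the `n` variables, so each occurs in some atom. -/
structure Schema (n m : ℕ) where
  vars : Fin m → Finset (Fin n)
  covers : ∀ v : Fin n, ∃ j : Fin m, v ∈ vars j

/-- An instance assigns a finite relation to each atom. -/
abbrev Inst (S : Schema n m) : Type := (j : Fin m) → Finset (Tuple (S.vars j))

/-- The size `‖Σ‖`: the total number of tuples in the relations. -/
def Inst.size {S : Schema n m} (D : Inst S) : ℕ := ∑ j, (D j).card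

/-- The projection of a tuple over all variables onto `X`. -/
def proj (X : Finset (Fin n)) (t : Fin n → ℕ) : Tuple X := fun v => t v.1

/-- The full natural join, which is the output of the full conjunctive query
`Q(V) :- ⋀ R_j(vars j)`. -/
def fullJoin {S : Schema n m} (D : Inst S) : Set (Fin n → ℕ) :=
  {t | ∀ j, proj (S.vars j) t ∈ D j}

/-- A monotonicity measure `(Y | X)`, with `X` and `Y` disjoint. -/
structure Mon (n : ℕ) where
  Y : Finset (Fin n)
  X : Finset (Fin n)
  disj : Disjoint X Y

/-- A submodularity measure `(Y ; Z | X)`, with `X`, `Y`, `Z` pairwise disjoint. -/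
structure Submod (n : ℕ) where
  Y : Finset (Fin n)
  Z : Finset (Fin n)
  X : Finset (Fin n)
  disjXY : Disjoint X Y
  disjXZ : Disjoint X Z
  disjYZ : Disjoint Y Z

/-- `h(Y | X) = h(XY) - h(X)`. -/
def Mon.eval (h : Finset (Fin n) → ℝ) (δ : Mon n) : ℝ := h (δ.X ∪ δ.Y) - h δ.X

/-- `h(Y ; Z | X) = h(XY) + h(XZ) - h(X) - h(XYZ)`. -/
def Submod.eval (h : Finset (Fin n) → ℝ) (σ : Submod n) : ℝ :=
  h (σ.X ∪ σ.Y) + h (σ.X ∪ σ.Z) - h σ.X - h (σ.X ∪ σ.Y ∪ σ.Z)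

/-- Polymatroids: the vectors that satisfy the basic Shannon inequalities. -/
structure IsPolymatroid (h : Finset (Fin n) → ℝ) : Prop where
  empty : h ∅ = 0
  mono : ∀ μ : Mon n, 0 ≤ μ.eval h
  submod : ∀ σ : Submod n, 0 ≤ σ.eval h

/-- `h(V) ≤ ∑_{δ ∈ Δ} w_δ h(δ)` is a Shannon inequality: it holds for all polymatroids. -/
def IsShannon (Δ : Finset (Mon n)) (w : Mon n → ℝ≥0) : Prop :=
  ∀ h : Finset (Fin n) → ℝ, IsPolymatroid h →
    h Finset.univ ≤ ∑ δ ∈ Δ, (w δ : ℝ) * δ.eval h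

/-- The restriction `Dom^Z ⋉ R` of a relation `R` with attributes `A` to an arbitrary set `Z` of
variables: the `Z`-tuples that agree with some tuple of `R` on the common attributes. For `Z ⊆ A`
this is the projection of `R` onto `Z`. -/
def restrict {A : Finset (Fin n)} (R : Finset (Tuple A)) (Z : Finset (Fin n)) : Set (Tuple Z) :=
  {t | ∃ r ∈ R, ∀ (v : Fin n) (hZ : v ∈ Z) (hA : v ∈ A), t ⟨v, hZ⟩ = r ⟨v, hA⟩}

/-- `deg_R(Y | X = x)`: the number of occurrences of `x` in the restriction of `R` to `X ∪ Y`. -/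
noncomputable def degAt {A : Finset (Fin n)} (R : Finset (Tuple A)) (δ : Mon n) (x : Tuple δ.X) :
    ℕ∞ :=
  {t : Tuple (δ.X ∪ δ.Y) | t ∈ restrict R (δ.X ∪ δ.Y) ∧
    ∀ (v : Fin n) (hv : v ∈ δ.X), t ⟨v, Finset.mem_union_left δ.Y hv⟩ = x ⟨v, hv⟩}.encard

/-- `deg_R(δ)`, the maximum of `deg_R(Y | X = x)` over all `x`. -/
noncomputable def deg {A : Finset (Fin n)} (R : Finset (Tuple A)) (δ : Mon n) : ℕ∞ :=
  ⨆ x : Tuple δ.X, degAt R δ x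

/-- `deg_Σ(δ)`, the minimum of `deg_R(δ)` over the relations of the instance. -/
noncomputable def Inst.deg {S : Schema n m} (D : Inst S) (δ : Mon n) : ℕ∞ :=
  ⨅ j, Panda.deg (D j) δ

/-- The instance satisfies the degree constraints `(Δ, N)`. -/
def Inst.Satisfies {S : Schema n m} (D : Inst S) (Δ : Finset (Mon n)) (N : Mon n → ℝ≥0) : Prop :=
  ∀ δ ∈ Δ, ((D.deg δ : ℕ∞) : ℝ≥0∞) ≤ (N δ : ℝ≥0∞)

/-- `B_{Δ,N} = ∏_{δ ∈ Δ} N_δ ^ w_δ`. -/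
noncomputable def bound (Δ : Finset (Mon n)) (N w : Mon n → ℝ≥0) : ℝ≥0 :=
  ∏ δ ∈ Δ, N δ ^ (w δ : ℝ)

end Databases

section Machine

/-- Programs of a random access machine whose memory consists of registers and of arrays; registers
and arrays are named by numbers that are fixed in the program text, array cells are addressed by
register contents. The only arithmetic is increment and truncated subtraction, so that the largest
number in memory (beyond the constants of the program) grows by at most one per step and unit costs
are justified. -/
inductive Prog : Type
  /-- `r_x := c` -/
  | const (x c : ℕ) : Prog
  /-- `r_x := r_y` -/
  | copy (x y : ℕ) : Prog
  /-- `r_x := r_x + 1` -/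
  | succ (x : ℕ) : Prog
  /-- `r_x := r_y - r_z`, or `0` if `r_y < r_z` -/
  | sub (x y z : ℕ) : Prog
  /-- `r_x := a[r_i]` -/
  | load (x a i : ℕ) : Prog
  /-- `a[r_i] := r_x` -/
  | store (a i x : ℕ) : Prog
  /-- first `p`, then `q` -/
  | seq (p q : Prog) : Prog
  /-- if `r_x ≠ 0` then `p` else `q` -/
  | cond (x : ℕ) (p q : Prog) : Prog
  /-- while `r_x ≠ 0` do `p` -/
  | loop (x : ℕ) (p : Prog) : Prog

/-- Memory contents: `reg x` is the content of register `x`, and `arr a i` that of cell `i` of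
array `a`. -/
structure State where
  reg : ℕ → ℕ
  arr : ℕ → ℕ → ℕ

/-- Write `c` into register `x`. -/
def State.setReg (s : State) (x c : ℕ) : State :=
  { s with reg := Function.update s.reg x c }

/-- Write `c` into cell `i` of array `a`. -/
def State.setArr (s : State) (a i c : ℕ) : State :=
  { s with arr := Function.update s.arr a (Function.update (s.arr a) i c) }

/-- `Exec p s t s'`: started in `s`, the program `p` halts after exactly `t` steps in `s'`. Every
elementary instruction and every test of a register takes one step. -/
inductive Exec : Prog → State → ℕ → State → Prop
  | const (s : State) (x c : ℕ) : Exec (.const x c) s 1 (s.setReg x c)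
  | copy (s : State) (x y : ℕ) : Exec (.copy x y) s 1 (s.setReg x (s.reg y))
  | succ (s : State) (x : ℕ) : Exec (.succ x) s 1 (s.setReg x (s.reg x + 1))
  | sub (s : State) (x y z : ℕ) : Exec (.sub x y z) s 1 (s.setReg x (s.reg y - s.reg z))
  | load (s : State) (x a i : ℕ) : Exec (.load x a i) s 1 (s.setReg x (s.arr a (s.reg i)))
  | store (s : State) (a i x : ℕ) : Exec (.store a i x) s 1 (s.setArr a (s.reg i) (s.reg x))
  | seq {p q : Prog} {s s' s'' : State} {t t' : ℕ} :
      Exec p s t s' → Exec q s' t' s'' → Exec (.seq p q) s (t + t') s''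
  | condTrue {p q : Prog} {s s' : State} {x t : ℕ} :
      s.reg x ≠ 0 → Exec p s t s' → Exec (.cond x p q) s (t + 1) s'
  | condFalse {p q : Prog} {s s' : State} {x t : ℕ} :
      s.reg x = 0 → Exec q s t s' → Exec (.cond x p q) s (t + 1) s'
  | loopDone {p : Prog} {s : State} {x : ℕ} :
      s.reg x = 0 → Exec (.loop x p) s 1 s
  | loopStep {p : Prog} {s s' s'' : State} {x t t' : ℕ} :
      s.reg x ≠ 0 → Exec p s t s' → Exec (.loop x p) s' t' s'' →
      Exec (.loop x p) s (t + t' + 1) s''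

/-- The initial memory on a given input: the input is in array `0`, its length in register `0`, and
everything else is `0`. -/
def startState (input : List ℕ) : State where
  reg := fun x => if x = 0 then input.length else 0
  arr := fun a i => if a = 0 then input.getD i 0 else 0

/-- The output that is found in a memory: it is in array `1`, and its length in register `1`. -/
def State.HasOutput (s : State) (output : List ℕ) : Prop :=
  s.reg 1 = output.length ∧ ∀ i < output.length, s.arr 1 i = output.getD i 0

end Machine

section Encoding

variable {n m : ℕ}

/-- The list `l` enumerates the set `R`, in any order and without repetitions. -/
def Enumerates {α : Type*} (l : List α) (R : Set α) : Prop :=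
  l.Nodup ∧ ∀ t, t ∈ l ↔ t ∈ R

/-- The entries of a tuple, in the order of its attributes. -/
def encodeTuple {X : Finset (Fin n)} (t : Tuple X) : List ℕ :=
  (List.finRange n).filterMap fun v => if h : v ∈ X then some (t ⟨v, h⟩) else none

/-- A relation, given as a list of tuples, is written as the number of its tuples followed by the
tuples. -/
def encodeRel {X : Finset (Fin n)} (l : List (Tuple X)) : List ℕ :=
  l.length :: l.flatMap encodeTuple

/-- An instance is written relation after relation. -/
def encodeInst {S : Schema n m} (L : (j : Fin m) → List (Tuple (S.vars j))) : List ℕ :=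
  (List.finRange m).flatMap fun j => encodeRel (L j)

/-- The output is written as a relation over all variables. -/
def encodeOutput (q : List (Fin n → ℕ)) : List ℕ :=
  q.length :: q.flatMap List.ofFn

end Encoding

end Panda

/-!
For a finite set `Q` of tuples, the entropies of the projections of a uniformly random element
form a polymatroid whose value at `V` is `log |Q|` (`isPolymatroid_entropy`, `entropy_univ`), and
a degree constraint bounds a conditional entropy by the logarithm of the degree
(`entropy_mon_le`). Applied to the output, a Shannon inequality therefore gives the size bound
(`encard_le_bound`).

The algorithm rests on integral certificates. By Farkas' lemma over `ℚ`, a Shannon inequality is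
witnessed by an identity that writes a multiple of `h(V)`, plus monotonicities and
submodularities, as a sum of constraint terms `h(Y | X)`. By Dickson's lemma there are finitely
many minimal certificates for a given number of variables, and for all costs and all weights one
of them is almost as good as the given weights (`exists_bounded_cert`). So certificates have a
length that depends on `n` only, which is why the program does not need to know the constraints or
the weights.

A certificate is turned into a computation on tables, one for each set of variables, by following
it: an unconditional term `h(W)`, represented by a table over `W` of bounded size, cancels against
some other term. If this is a monotonicity or a submodularity, the table is split into buckets by
degree, which decomposes `h(W)` into `h(W ∩ B)` and `h(W | W ∩ B)`, at the price of a factor two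
and of a branching into logarithmically many cases. If it is a conditional term, two tables are
joined. A term whose bound exceeds the size limit is dropped, together with at most one copy of
`h(V)` (`MCert.reset`). Instead of finding the right step, the program performs all possible
splits and joins in a fixed order, a sweep, where joins above the size limit are skipped; each
sweep contains the step that the certificate needs (`sweeps_success`). Hence `K` sweeps yield a
table over `V` in every branch whenever the size limit is at least `2 ^ (K + 1)` times the
polymatroid bound (`exists_success`). Final semijoins with all tables leave in each branch the
part of the output that belongs to its degree buckets, so that the branches enumerate the output
without repetitions (`OutList.mem_iff_fits`, `OutList.nodup`).

On the machine, the values of the instance are first renamed by small numbers, so that vectors can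
be looked up in logarithmic time in a digital search tree (`run_walk`) with the numbers of its
nodes as addresses. This provides grouping, counting, semijoins and joins in almost linear time,
and lists of operations are compiled to programs with a loop over the buckets at each split
(`run_compile`). The size limits `1, 2, 4, …` are tried until no branch fails (`exec_program`).
The last limit is at most a constant times the polymatroid bound plus one, and as the size bounds
of the relations are constraints as well (`exists_trivial_bound`), it is polynomial in the size of
the instance, so that all logarithms are `O(log ‖Σ‖)` (`totalCost_le`).
-/

namespace Panda

/-! ### Farkas' lemma and integral certificates of Shannon inequalities -/

section Farkas

variable {ι E : Type*} [AddCommGroup E] [Module ℚ E]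

/-- Farkas' lemma over the rationals, by induction on the number of functionals: if the last
functional `a j` is needed, there is a point `x` where only it is negative, and the other
functionals can be projected along `x` to the kernel of `a j`. -/
theorem farkas [DecidableEq ι] (s : Finset ι) : ∀ (a : ι → E →ₗ[ℚ] ℚ) (b : E →ₗ[ℚ] ℚ),
    (∀ x, (∀ i ∈ s, 0 ≤ a i x) → 0 ≤ b x) →
      ∃ u : ι → ℚ, (∀ i, 0 ≤ u i) ∧ ∀ x, b x = ∑ i ∈ s, u i * a i x := by
  induction s using Finset.induction_on with
  | empty =>
    intro a b h
    refine ⟨0, fun _ => le_rfl, fun x => ?_⟩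
    have h1 := h x (by simp)
    have h2 := h (-x) (by simp)
    simp only [map_neg] at h2
    simp only [Finset.sum_empty]
    linarith
  | insert j s hj ih =>
    intro a b h
    by_cases hb : ∀ x, (∀ i ∈ s, 0 ≤ a i x) → 0 ≤ b x
    · obtain ⟨u, hu, hx⟩ := ih a b hb
      refine ⟨fun i => if i = j then 0 else u i, fun i => ?_, fun x => ?_⟩
      · dsimp only
        split_ifs
        · exact le_rfl
        · exact hu i
      · rw [Finset.sum_insert hj, hx]
        simp only [if_true, zero_mul, zero_add]
        refine Finset.sum_congr rfl fun i hi => ?_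
        rw [if_neg (ne_of_mem_of_not_mem hi hj)]
    · push Not at hb
      obtain ⟨x, hx, hbx⟩ := hb
      have hjx : a j x < 0 := by
        by_contra hc
        push Not at hc
        exact absurd (h x (by
          intro i hi
          rcases Finset.mem_insert.1 hi with rfl | hi
          · exact hc
          · exact hx i hi)) (not_le.2 hbx)
      have hne : a j x ≠ 0 := hjx.ne
      obtain ⟨u, hu, huv⟩ := ih (fun i => a i - (a i x / a j x) • a j)
        (b - (b x / a j x) • a j) (by
          intro y hy
          have hh := h (y - (a j y / a j x) • x) (by
            intro i hi
            simp only [map_sub, map_smul, smul_eq_mul]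
            rcases Finset.mem_insert.1 hi with rfl | hi
            · field_simp
              simp
            · have := hy i hi
              simp only [LinearMap.sub_apply, LinearMap.smul_apply, smul_eq_mul] at this
              have e : a j y / a j x * a i x = a i x / a j x * a j y := by field_simp
              rw [e]
              exact this)
          simp only [map_sub, map_smul, smul_eq_mul] at hh
          simp only [LinearMap.sub_apply, LinearMap.smul_apply, smul_eq_mul]
          have e : a j y / a j x * b x = b x / a j x * a j y := by field_simp
          rw [← e]
          exact hh)
      refine ⟨fun i => if i = j then b x / a j x - ∑ i ∈ s, u i * (a i x / a j x) else u i,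
        fun i => ?_, fun y => ?_⟩
      · dsimp only
        split_ifs
        · have h1 : 0 ≤ b x / a j x := div_nonneg_of_nonpos hbx.le hjx.le
          have h2 : ∑ i ∈ s, u i * (a i x / a j x) ≤ 0 :=
            Finset.sum_nonpos fun i hi => mul_nonpos_of_nonneg_of_nonpos (hu i)
              (div_nonpos_of_nonneg_of_nonpos (hx i hi) hjx.le)
          linarith
        · exact hu i
      · have e := huv y
        simp only [LinearMap.sub_apply, LinearMap.smul_apply, smul_eq_mul] at e
        rw [Finset.sum_insert hj]
        dsimp only
        rw [if_pos rfl]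
        have e2 : ∑ i ∈ s, (if i = j then b x / a j x - ∑ i ∈ s, u i * (a i x / a j x) else u i) *
            a i y = ∑ i ∈ s, u i * a i y := by
          refine Finset.sum_congr rfl fun i hi => ?_
          rw [if_neg (ne_of_mem_of_not_mem hi hj)]
        rw [e2]
        have e3 : ∑ i ∈ s, u i * (a i y - a i x / a j x * a j y) =
            ∑ i ∈ s, u i * a i y - (∑ i ∈ s, u i * (a i x / a j x)) * a j y := by
          rw [Finset.sum_mul, ← Finset.sum_sub_distrib]
          refine Finset.sum_congr rfl fun i _ => ?_
          ring
        rw [e3] at e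
        linarith

end Farkas

theorem exists_common_denominator {ι : Type*} [Fintype ι] (u : ι → ℚ) (hu : ∀ i, 0 ≤ u i) :
    ∃ q : ℕ, 0 < q ∧ ∃ k : ι → ℕ, ∀ i, (q : ℚ) * u i = k i := by
  classical
  refine ⟨∏ i, (u i).den, Finset.prod_pos fun i _ => (u i).pos,
    fun i => (∏ j ∈ Finset.univ.erase i, (u j).den) * (u i).num.toNat, fun i => ?_⟩
  rw [← Finset.mul_prod_erase Finset.univ _ (Finset.mem_univ i)]
  have h1 : ((u i).num.toNat : ℚ) = (u i).num := by
    exact_mod_cast Int.toNat_of_nonneg (Rat.num_nonneg.2 (hu i))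
  have h2 : ((u i).den : ℚ) * u i = (u i).num := by
    rw [mul_comm]; exact Rat.mul_den_eq_num _
  push_cast
  rw [h1, ← h2]
  ring

section Certificates

variable {n : ℕ}

/-- `h(X ∪ Y) - h(X)` for a pair `(X, Y)` of arbitrary sets. -/
def monoVal {R : Type*} [Sub R] (h : Finset (Fin n) → R) (p : Finset (Fin n) × Finset (Fin n)) :
    R := h (p.1 ∪ p.2) - h p.1

/-- `h(A) + h(B) - h(A ∩ B) - h(A ∪ B)` for a pair `(A, B)` of arbitrary sets. -/
def subVal {R : Type*} [AddGroup R] (h : Finset (Fin n) → R)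
    (p : Finset (Fin n) × Finset (Fin n)) : R :=
  h p.1 + h p.2 - h (p.1 ∩ p.2) - h (p.1 ∪ p.2)

theorem isPolymatroid_of_pairs (h : Finset (Fin n) → ℝ) (h0 : h ∅ = 0)
    (hm : ∀ p, 0 ≤ monoVal h p) (hs : ∀ p, 0 ≤ subVal h p) : IsPolymatroid h where
  empty := h0
  mono μ := hm (μ.X, μ.Y)
  submod σ := by
    have := hs (σ.X ∪ σ.Y, σ.X ∪ σ.Z)
    have e1 : (σ.X ∪ σ.Y) ∩ (σ.X ∪ σ.Z) = σ.X := by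
      rw [← Finset.union_inter_distrib_left, Finset.disjoint_iff_inter_eq_empty.1 σ.disjYZ,
        Finset.union_empty]
    have e2 : (σ.X ∪ σ.Y) ∪ (σ.X ∪ σ.Z) = σ.X ∪ σ.Y ∪ σ.Z := by
      ext v; simp only [Finset.mem_union]; tauto
    simpa only [subVal, e1, e2, Submod.eval] using this

/-- The coefficients `(λ, w, μ, σ)` of an integral certificate: a multiple `λ` of `h(V)`, and
multiplicities of conditional terms, monotonicities and submodularities. -/
abbrev Coef (n : ℕ) : Type :=
  ℕ × (Finset (Fin n) × Finset (Fin n) → ℕ) × (Finset (Fin n) × Finset (Fin n) → ℕ) ×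
    (Finset (Fin n) × Finset (Fin n) → ℕ)

/-- The certificate identity `λ h(V) + ∑ μ + ∑ σ = ∑ w` for all `h` with `h(∅) = 0`. -/
def IsCert (x : Coef n) : Prop :=
  ∀ h : Finset (Fin n) → ℤ, h ∅ = 0 →
    x.1 * h Finset.univ + ∑ p, (x.2.2.1 p : ℤ) * monoVal h p + ∑ p, (x.2.2.2 p : ℤ) * subVal h p =
      ∑ p, (x.2.1 p : ℤ) * monoVal h p

/-- The length of the multiset version of a certificate, where submodularities count three
times. -/
def Coef.measure (x : Coef n) : ℕ := ∑ p, x.2.1 p + ∑ p, x.2.2.1 p + 3 * ∑ p, x.2.2.2 p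

/-- The sum of all coefficients. -/
def Coef.total (x : Coef n) : ℕ := x.1 + ∑ p, x.2.1 p + ∑ p, x.2.2.1 p + ∑ p, x.2.2.2 p

theorem Coef.total_add (x y : Coef n) : (x + y).total = x.total + y.total := by
  simp only [Coef.total, Prod.fst_add, Prod.snd_add, Pi.add_apply, Finset.sum_add_distrib]
  ring

theorem Coef.eq_zero_of_total {x : Coef n} (h : x.total = 0) : x = 0 := by
  simp only [Coef.total, Nat.add_eq_zero_iff, Finset.sum_eq_zero_iff, Finset.mem_univ,
    true_implies] at h
  obtain ⟨⟨⟨h1, h2⟩, h3⟩, h4⟩ := h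
  exact Prod.ext h1 (Prod.ext (funext h2) (Prod.ext (funext h3) (funext h4)))

theorem IsCert.of_add {x y : Coef n} (hxy : IsCert (x + y)) (hx : IsCert x) : IsCert y := by
  intro h h0
  have h1 := hxy h h0
  have h2 := hx h h0
  simp only [Prod.fst_add, Prod.snd_add, Pi.add_apply, Nat.cast_add, add_mul,
    Finset.sum_add_distrib] at h1
  linarith

/-- The nonzero certificates that are minimal in the componentwise order; by Dickson's lemma there
are only finitely many of them. -/
theorem finite_minimal_certs : {x : Coef n | Minimal (fun y => IsCert y ∧ y ≠ 0) x}.Finite :=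
  (setOfPred_minimal_antichain _).finite_of_partiallyWellOrderedOn
    (Set.isPWO_of_wellQuasiOrderedLE _)

/-- A certificate is good for the costs `c` and the value `p` if it shows `h(V) ≤ p` for all
polymatroids that satisfy the constraints `h(Y | X) ≤ c(X, Y)`. -/
def GoodCert (c : Finset (Fin n) × Finset (Fin n) → ℝ) (p : ℝ) (x : Coef n) : Prop :=
  IsCert x ∧ 1 ≤ x.1 ∧ ∑ q, (x.2.1 q : ℝ) * c q ≤ x.1 * p

/-- Below every good certificate there is a good one that is minimal, since otherwise it would be
a sum of two smaller certificates, one of which is again good. -/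
theorem GoodCert.exists_minimal {c : Finset (Fin n) × Finset (Fin n) → ℝ} (hc : ∀ q, 0 ≤ c q)
    {p : ℝ} : ∀ (k : ℕ) (x : Coef n), x.total = k → GoodCert c p x →
      ∃ y ≤ x, GoodCert c p y ∧ Minimal (fun y => IsCert y ∧ y ≠ 0) y := by
  intro k
  induction k using Nat.strong_induction_on with
  | _ k ih =>
    intro x hk hx
    have hx0 : x ≠ 0 := by
      rintro rfl
      exact absurd hx.2.1 (by simp)
    by_cases hmin : Minimal (fun y => IsCert y ∧ y ≠ 0) x
    · exact ⟨x, le_rfl, hx, hmin⟩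
    · have : ∃ y, (IsCert y ∧ y ≠ 0) ∧ y ≤ x ∧ y ≠ x := by
        by_contra hcon
        push Not at hcon
        exact hmin ⟨⟨hx.1, hx0⟩, fun y hy hyx => (hcon y hy hyx).ge⟩
      obtain ⟨y, ⟨hy, hy0⟩, hyx, hne⟩ := this
      obtain ⟨z, rfl⟩ := exists_add_of_le hyx
      have hz : IsCert z := hx.1.of_add hy
      have hz0 : z ≠ 0 := by rintro rfl; simp at hne
      have ty : 0 < y.total := Nat.pos_of_ne_zero fun h => hy0 (Coef.eq_zero_of_total h)
      have tz : 0 < z.total := Nat.pos_of_ne_zero fun h => hz0 (Coef.eq_zero_of_total h)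
      rw [Coef.total_add] at hk
      have hcost := hx.2.2
      simp only [Prod.fst_add, Prod.snd_add, Pi.add_apply, Nat.cast_add, add_mul,
        Finset.sum_add_distrib] at hcost
      have hl := hx.2.1
      simp only [Prod.fst_add] at hl
      have ny : 0 ≤ ∑ q, (y.2.1 q : ℝ) * c q :=
        Finset.sum_nonneg fun q _ => mul_nonneg (Nat.cast_nonneg _) (hc q)
      have nz : 0 ≤ ∑ q, (z.2.1 q : ℝ) * c q :=
        Finset.sum_nonneg fun q _ => mul_nonneg (Nat.cast_nonneg _) (hc q)
      have key : GoodCert c p y ∨ GoodCert c p z := by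
        by_cases y1 : 1 ≤ y.1
        · by_cases z1 : 1 ≤ z.1
          · by_cases hgy : ∑ q, (y.2.1 q : ℝ) * c q ≤ y.1 * p
            · exact Or.inl ⟨hy, y1, hgy⟩
            · exact Or.inr ⟨hz, z1, by push Not at hgy; linarith⟩
          · have : z.1 = 0 := by omega
            rw [this] at hcost
            exact Or.inl ⟨hy, y1, by simp only [Nat.cast_zero, zero_mul] at hcost; linarith⟩
        · have : y.1 = 0 := by omega
          rw [this] at hcost
          exact Or.inr ⟨hz, by omega, by simp only [Nat.cast_zero, zero_mul] at hcost; linarith⟩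
      rcases key with hg | hg
      · obtain ⟨t, ht, h1, h2⟩ := ih y.total (by omega) y rfl hg
        exact ⟨t, ht.trans hyx, h1, h2⟩
      · obtain ⟨t, ht, h1, h2⟩ := ih z.total (by omega) z rfl hg
        exact ⟨t, ht.trans le_add_self, h1, h2⟩

/-- The functionals on pairs `(h, τ)` whose joint nonnegativity says that `h` is a polymatroid
with `h(Y | X) ≤ τ c(X, Y)` for the constraints in `Δ`. -/
noncomputable def shannonFunctional (Δ : Finset (Finset (Fin n) × Finset (Fin n)))
    (c : Finset (Fin n) × Finset (Fin n) → ℚ) :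
    ((Finset (Fin n) × Finset (Fin n)) ⊕ (Finset (Fin n) × Finset (Fin n)) ⊕
      (Finset (Fin n) × Finset (Fin n)) ⊕ Fin 3) → ((Finset (Fin n) → ℚ) × ℚ) →ₗ[ℚ] ℚ
  | .inl p =>
    { toFun := fun y => monoVal y.1 p
      map_add' := fun x y => by simp only [monoVal, Prod.fst_add, Pi.add_apply]; ring
      map_smul' := fun r y => by
        simp only [monoVal, Prod.smul_fst, Pi.smul_apply, smul_eq_mul, RingHom.id_apply]; ring }
  | .inr (.inl p) =>
    { toFun := fun y => subVal y.1 p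
      map_add' := fun x y => by simp only [subVal, Prod.fst_add, Pi.add_apply]; ring
      map_smul' := fun r y => by
        simp only [subVal, Prod.smul_fst, Pi.smul_apply, smul_eq_mul, RingHom.id_apply]; ring }
  | .inr (.inr (.inl p)) =>
    { toFun := fun y => if p ∈ Δ then y.2 * c p - monoVal y.1 p else 0
      map_add' := fun x y => by
        split_ifs
        · simp only [monoVal, Prod.fst_add, Prod.snd_add, Pi.add_apply]; ring
        · simp
      map_smul' := fun r y => by
        split_ifs
        · simp only [monoVal, Prod.smul_fst, Prod.smul_snd, Pi.smul_apply, smul_eq_mul,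
            RingHom.id_apply]; ring
        · simp }
  | .inr (.inr (.inr i)) =>
    { toFun := fun y => if i = 0 then y.2 else if i = 1 then y.1 ∅ else - y.1 ∅
      map_add' := fun x y => by
        split_ifs
        · simp
        · simp
        · simp only [Prod.fst_add, Pi.add_apply]; ring
      map_smul' := fun r y => by split_ifs <;> simp }

/-- LP duality: a real Shannon inequality, with costs that are rational, yields an integral
certificate of at most the same value. -/
theorem exists_goodCert (Δ : Finset (Finset (Fin n) × Finset (Fin n)))
    (w : Finset (Fin n) × Finset (Fin n) → ℝ) (hw : ∀ p, 0 ≤ w p)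
    (hS : ∀ h : Finset (Fin n) → ℝ, IsPolymatroid h → h Finset.univ ≤ ∑ p ∈ Δ, w p * monoVal h p)
    (c : Finset (Fin n) × Finset (Fin n) → ℚ) (v : ℚ) (hv : ∑ p ∈ Δ, w p * c p ≤ v) :
    ∃ x : Coef n, GoodCert (fun p => (c p : ℝ)) v x ∧ ∀ p, x.2.1 p ≠ 0 → p ∈ Δ := by
  classical
  let a := shannonFunctional Δ c
  let b : ((Finset (Fin n) → ℚ) × ℚ) →ₗ[ℚ] ℚ :=
    { toFun := fun y => y.2 * v - y.1 Finset.univ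
      map_add' := fun x y => by simp only [Prod.fst_add, Prod.snd_add, Pi.add_apply]; ring
      map_smul' := fun r y => by
        simp only [Prod.smul_fst, Prod.smul_snd, Pi.smul_apply, smul_eq_mul, RingHom.id_apply]
        ring }
  obtain ⟨u, hu, hub⟩ := farkas Finset.univ a b (by
    intro y hy
    have ht : 0 ≤ y.2 := by simpa [a, shannonFunctional] using hy (.inr (.inr (.inr 0))) (by simp)
    have h1 : 0 ≤ y.1 ∅ := by
      simpa [a, shannonFunctional] using hy (.inr (.inr (.inr 1))) (by simp)
    have h2 : y.1 ∅ ≤ 0 := by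
      simpa [a, shannonFunctional] using hy (.inr (.inr (.inr 2))) (by simp)
    have hpoly : IsPolymatroid (fun U => (y.1 U : ℝ)) := by
      refine isPolymatroid_of_pairs _ ?_ ?_ ?_
      · have : y.1 ∅ = 0 := le_antisymm h2 h1
        simp [this]
      · intro p
        have : 0 ≤ monoVal y.1 p := hy (.inl p) (by simp)
        simp only [monoVal] at this ⊢
        exact_mod_cast this
      · intro p
        have : 0 ≤ subVal y.1 p := hy (.inr (.inl p)) (by simp)
        simp only [subVal] at this ⊢
        exact_mod_cast this
    have hh := hS _ hpoly
    have hle : ∑ p ∈ Δ, w p * monoVal (fun U => (y.1 U : ℝ)) p ≤ ∑ p ∈ Δ, w p * (y.2 * c p) := by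
      refine Finset.sum_le_sum fun p hp => mul_le_mul_of_nonneg_left ?_ (hw p)
      have : 0 ≤ a (.inr (.inr (.inl p))) y := hy _ (by simp)
      simp only [a, shannonFunctional, LinearMap.coe_mk, AddHom.coe_mk, if_pos hp] at this
      have h3 : monoVal y.1 p ≤ y.2 * c p := by linarith
      simp only [monoVal] at h3 ⊢
      exact_mod_cast h3
    have e : ∑ p ∈ Δ, w p * ((y.2 : ℝ) * c p) = y.2 * ∑ p ∈ Δ, w p * c p := by
      rw [Finset.mul_sum]
      refine Finset.sum_congr rfl fun p _ => ?_
      ring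
    have h4 : (y.2 : ℝ) * ∑ p ∈ Δ, w p * c p ≤ y.2 * v :=
      mul_le_mul_of_nonneg_left hv (by exact_mod_cast ht)
    have h5 : (y.1 Finset.univ : ℝ) ≤ y.2 * v := by linarith
    change 0 ≤ y.2 * v - y.1 Finset.univ
    have h6 : y.1 Finset.univ ≤ y.2 * v := by exact_mod_cast h5
    linarith)
  obtain ⟨q, hq, k, hk⟩ := exists_common_denominator u hu
  have hq' : (q : ℚ) ≠ 0 := by exact_mod_cast hq.ne'
  have hkey : ∀ y : (Finset (Fin n) → ℚ) × ℚ, (q : ℚ) * b y = ∑ i, (k i : ℚ) * a i y := by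
    intro y
    rw [hub y, Finset.mul_sum]
    refine Finset.sum_congr rfl fun i _ => ?_
    rw [← hk i]; ring
  refine ⟨(q, fun p => if p ∈ Δ then k (.inr (.inr (.inl p))) else 0, fun p => k (.inl p),
    fun p => k (.inr (.inl p))), ⟨?_, hq, ?_⟩, ?_⟩
  · intro h h0
    have := hkey (fun U => (h U : ℚ), 0)
    simp only [Fintype.sum_sum_type, a, b, shannonFunctional, LinearMap.coe_mk, AddHom.coe_mk,
      Fin.sum_univ_three, h0] at this
    have e : ∑ p, (k (.inr (.inr (.inl p))) : ℚ) *
        (if p ∈ Δ then 0 * c p - monoVal (fun U => (h U : ℚ)) p else 0) =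
        - ∑ p, ((if p ∈ Δ then k (.inr (.inr (.inl p))) else 0 : ℕ) : ℚ) *
          monoVal (fun U => (h U : ℚ)) p := by
      rw [← Finset.sum_neg_distrib]
      refine Finset.sum_congr rfl fun p _ => ?_
      split_ifs <;> simp
    rw [e] at this
    simp only [monoVal, subVal] at this ⊢
    have goal : ((q : ℤ) : ℚ) * h Finset.univ + ∑ p, ((k (.inl p) : ℤ) : ℚ) *
        ((h (p.1 ∪ p.2) : ℚ) - h p.1) +
        ∑ p, ((k (.inr (.inl p)) : ℤ) : ℚ) * ((h p.1 : ℚ) + h p.2 - h (p.1 ∩ p.2) - h (p.1 ∪ p.2))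
        = ∑ p, (((if p ∈ Δ then k (.inr (.inr (.inl p))) else 0 : ℕ) : ℤ) : ℚ) *
          ((h (p.1 ∪ p.2) : ℚ) - h p.1) := by
      simp only [Int.cast_natCast]
      simp only [Int.cast_zero, neg_zero, mul_zero, ite_self, add_zero, zero_mul, zero_sub] at this
      linarith
    exact_mod_cast goal
  · have := hkey (0, 1)
    simp only [Fintype.sum_sum_type, a, b, shannonFunctional, LinearMap.coe_mk, AddHom.coe_mk,
      Fin.sum_univ_three, monoVal, subVal, Pi.zero_apply] at this
    simp only [sub_zero, mul_zero, add_zero, Finset.sum_const_zero, zero_add, one_mul, mul_one,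
      if_true, neg_zero, ite_self] at this
    have h0 : (0 : ℚ) ≤ k (.inr (.inr (.inr 0))) := Nat.cast_nonneg _
    have e : ∑ p, (((if p ∈ Δ then k (.inr (.inr (.inl p))) else 0 : ℕ) : ℚ)) * c p =
        ∑ p, (k (.inr (.inr (.inl p))) : ℚ) * (if p ∈ Δ then c p else 0) := by
      refine Finset.sum_congr rfl fun p _ => ?_
      split_ifs <;> simp
    have h7 : ∑ p, (((if p ∈ Δ then k (.inr (.inr (.inl p))) else 0 : ℕ) : ℚ)) * c p ≤ q * v := by
      rw [e, this]
      simp [h0]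
    have h8 := (Rat.cast_le (K := ℝ)).2 h7
    simp only [Rat.cast_sum, Rat.cast_mul, Rat.cast_natCast] at h8
    exact h8
  · intro p hp
    by_contra hc
    simp [hc] at hp

/-- There is a bound on the length of certificates that depends only on the number of variables,
such that for every Shannon inequality and all costs some certificate within that bound has
almost the same value. -/
theorem exists_bounded_cert (n : ℕ) : ∃ K : ℕ, ∀ (Δ : Finset (Finset (Fin n) × Finset (Fin n)))
    (w : Finset (Fin n) × Finset (Fin n) → ℝ), (∀ p, 0 ≤ w p) →
    (∀ h : Finset (Fin n) → ℝ, IsPolymatroid h → h Finset.univ ≤ ∑ p ∈ Δ, w p * monoVal h p) →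
    ∀ c : Finset (Fin n) × Finset (Fin n) → ℝ, (∀ p, 0 ≤ c p) → ∀ ε : ℝ, 0 < ε →
    ∃ x : Coef n, GoodCert c (∑ p ∈ Δ, w p * c p + ε) x ∧ (∀ p, x.2.1 p ≠ 0 → p ∈ Δ) ∧
      x.measure ≤ K := by
  obtain ⟨K, hK⟩ := ((finite_minimal_certs (n := n)).image Coef.measure).bddAbove
  refine ⟨K, fun Δ w hw hS c hc ε hε => ?_⟩
  set W := ∑ p ∈ Δ, w p with hW
  have hW0 : 0 ≤ W := Finset.sum_nonneg fun p _ => hw p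
  have hη : 0 < ε / (2 * (W + 1)) := by positivity
  choose c' hc1 hc2 using fun p => exists_rat_btwn (lt_add_of_pos_right (c p) hη)
  obtain ⟨v, hv1, hv2⟩ := exists_rat_btwn
    (show ∑ p ∈ Δ, w p * c p + ε / 2 < ∑ p ∈ Δ, w p * c p + ε by linarith)
  have hsum : ∑ p ∈ Δ, w p * (c' p : ℝ) ≤ v := by
    have h1 : ∑ p ∈ Δ, w p * (c' p : ℝ) ≤ ∑ p ∈ Δ, w p * (c p + ε / (2 * (W + 1))) :=
      Finset.sum_le_sum fun p _ => mul_le_mul_of_nonneg_left (hc2 p).le (hw p)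
    have h2 : ∑ p ∈ Δ, w p * (c p + ε / (2 * (W + 1))) =
        ∑ p ∈ Δ, w p * c p + W * (ε / (2 * (W + 1))) := by
      simp only [mul_add, Finset.sum_add_distrib, Finset.sum_mul, hW]
    have h3 : W * (ε / (2 * (W + 1))) ≤ ε / 2 := by
      rw [mul_div_assoc', div_le_div_iff₀ (by positivity) (by positivity)]
      nlinarith
    linarith
  obtain ⟨x, hx, hxΔ⟩ := exists_goodCert Δ w hw hS c' v hsum
  have hx' : GoodCert c (∑ p ∈ Δ, w p * c p + ε) x := by
    refine ⟨hx.1, hx.2.1, ?_⟩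
    have h1 : ∑ q, (x.2.1 q : ℝ) * c q ≤ ∑ q, (x.2.1 q : ℝ) * c' q :=
      Finset.sum_le_sum fun p _ => mul_le_mul_of_nonneg_left (hc1 p).le (Nat.cast_nonneg _)
    have h2 : (x.1 : ℝ) * v ≤ x.1 * (∑ p ∈ Δ, w p * c p + ε) :=
      mul_le_mul_of_nonneg_left hv2.le (Nat.cast_nonneg _)
    linarith [hx.2.2]
  obtain ⟨y, hyx, hy, hmin⟩ := hx'.exists_minimal hc _ x rfl
  refine ⟨y, hy, fun p hp => hxΔ p ?_, hK ⟨y, hmin, rfl⟩⟩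
  have : y.2.1 p ≤ x.2.1 p := hyx.2.1 p
  omega

end Certificates

/-! ### The entropy of the output and the size bound -/

section Entropy

variable {n : ℕ}

theorem proj_eq_iff {X : Finset (Fin n)} {s t : Fin n → ℕ} :
    proj X s = proj X t ↔ ∀ v ∈ X, s v = t v :=
  ⟨fun h v hv => congrFun h ⟨v, hv⟩, fun h => funext fun v => h v.1 v.2⟩

theorem proj_eq_mono {X Y : Finset (Fin n)} (h : X ⊆ Y) {s t : Fin n → ℕ}
    (e : proj Y s = proj Y t) : proj X s = proj X t :=
  proj_eq_iff.2 fun v hv => proj_eq_iff.1 e v (h hv)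

/-- The number of elements of `Q` that agree with `t` on `U`. -/
def classCard (Q : Finset (Fin n → ℕ)) (U : Finset (Fin n)) (t : Fin n → ℕ) : ℕ :=
  (Q.filter fun s => proj U s = proj U t).card

theorem classCard_pos {Q : Finset (Fin n → ℕ)} {U : Finset (Fin n)} {t : Fin n → ℕ} (ht : t ∈ Q) :
    0 < classCard Q U t :=
  Finset.card_pos.2 ⟨t, Finset.mem_filter.2 ⟨ht, rfl⟩⟩

theorem classCard_anti {Q : Finset (Fin n → ℕ)} {U W : Finset (Fin n)} (h : U ⊆ W)
    (t : Fin n → ℕ) : classCard Q W t ≤ classCard Q U t :=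
  Finset.card_le_card fun s hs => by
    simp only [Finset.mem_filter] at hs ⊢
    exact ⟨hs.1, proj_eq_mono h hs.2⟩

theorem classCard_congr {Q : Finset (Fin n → ℕ)} {U : Finset (Fin n)} {s t : Fin n → ℕ}
    (h : proj U s = proj U t) : classCard Q U s = classCard Q U t := by
  simp only [classCard, h]

/-- The Shannon entropy of the projection to `U` of a uniformly random element of `Q`. -/
noncomputable def entropy (Q : Finset (Fin n → ℕ)) (U : Finset (Fin n)) : ℝ :=
  (∑ t ∈ Q, (Real.log Q.card - Real.log (classCard Q U t))) / Q.card

theorem sum_log_nonneg {α : Type*} (Q : Finset α) (r : α → ℝ) (hr : ∀ t ∈ Q, 0 < r t)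
    (hs : ∑ t ∈ Q, r t ≤ Q.card) : 0 ≤ ∑ t ∈ Q, - Real.log (r t) := by
  have h1 : ∑ t ∈ Q, Real.log (r t) ≤ ∑ t ∈ Q, (r t - 1) :=
    Finset.sum_le_sum fun t ht => Real.log_le_sub_one_of_pos (hr t ht)
  have h2 : ∑ t ∈ Q, (r t - 1) = ∑ t ∈ Q, r t - Q.card := by
    simp [Finset.sum_sub_distrib]
  rw [Finset.sum_neg_distrib]
  linarith

/-- Write the product of class sizes as a sum over pairs `(a, b)`: the elements that agree with `a`
on `A` and with `b` on `B` form at most one class over `A ∪ B`. Through `log x ≤ x - 1` this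
inequality gives the submodularity of the entropy. -/
theorem sum_class_ratio_le (Q : Finset (Fin n → ℕ)) (A B : Finset (Fin n)) :
    ∑ t ∈ Q, ((classCard Q A t : ℝ) * classCard Q B t) /
      (classCard Q (A ∩ B) t * classCard Q (A ∪ B) t) ≤ Q.card := by
  have e1 : ∀ t ∈ Q, ((classCard Q A t : ℝ) * classCard Q B t) /
      (classCard Q (A ∩ B) t * classCard Q (A ∪ B) t) =
      ∑ a ∈ Q, ∑ b ∈ Q, if proj A a = proj A t ∧ proj B b = proj B t then
        ((classCard Q (A ∩ B) t : ℝ) * classCard Q (A ∪ B) t)⁻¹ else 0 := by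
    intro t _
    have : ((classCard Q A t : ℝ) * classCard Q B t) =
        ∑ a ∈ Q, ∑ b ∈ Q, if proj A a = proj A t ∧ proj B b = proj B t then (1 : ℝ) else 0 := by
      simp only [classCard, Finset.card_filter, Nat.cast_sum, Nat.cast_ite, Nat.cast_one,
        Nat.cast_zero, Finset.sum_mul_sum, ite_and, mul_ite, mul_one, mul_zero]
      refine Finset.sum_congr rfl fun a _ => Finset.sum_congr rfl fun b _ => ?_
      split_ifs <;> rfl
    rw [div_eq_mul_inv, this, Finset.sum_mul]
    refine Finset.sum_congr rfl fun a _ => ?_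
    rw [Finset.sum_mul]
    refine Finset.sum_congr rfl fun b _ => ?_
    split_ifs <;> simp
  rw [Finset.sum_congr rfl e1, Finset.sum_comm]
  have e2 : ∀ a ∈ Q, ∑ t ∈ Q, ∑ b ∈ Q, (if proj A a = proj A t ∧ proj B b = proj B t then
        ((classCard Q (A ∩ B) t : ℝ) * classCard Q (A ∪ B) t)⁻¹ else 0) ≤ 1 := by
    intro a ha
    rw [Finset.sum_comm]
    have e3 : ∀ b ∈ Q, ∑ t ∈ Q, (if proj A a = proj A t ∧ proj B b = proj B t then
        ((classCard Q (A ∩ B) t : ℝ) * classCard Q (A ∪ B) t)⁻¹ else 0) ≤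
        if proj (A ∩ B) b = proj (A ∩ B) a then ((classCard Q (A ∩ B) a : ℝ))⁻¹ else 0 := by
      intro b _
      rw [← Finset.sum_filter]
      set S := Q.filter fun t => proj A a = proj A t ∧ proj B b = proj B t with hS
      rcases S.eq_empty_or_nonempty with h0 | ⟨t0, ht0⟩
      · rw [h0, Finset.sum_empty]
        split_ifs <;> positivity
      · obtain ⟨ht0Q, ht0a, ht0b⟩ := by simpa [hS] using ht0
        have hI : proj (A ∩ B) b = proj (A ∩ B) a :=
          (proj_eq_mono Finset.inter_subset_right ht0b).trans
            (proj_eq_mono Finset.inter_subset_left ht0a).symm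
        rw [if_pos hI]
        have e4 : ∀ t ∈ S, ((classCard Q (A ∩ B) t : ℝ) * classCard Q (A ∪ B) t)⁻¹ =
            ((classCard Q (A ∩ B) a : ℝ))⁻¹ * (classCard Q (A ∪ B) t0 : ℝ)⁻¹ := by
          intro t ht
          obtain ⟨htQ, hta, htb⟩ := by simpa [hS] using ht
          have hJ : proj (A ∪ B) t = proj (A ∪ B) t0 := by
            rw [proj_eq_iff]
            intro v hv
            rcases Finset.mem_union.1 hv with hv | hv
            · exact proj_eq_iff.1 (hta.symm.trans ht0a) v hv
            · exact proj_eq_iff.1 (htb.symm.trans ht0b) v hv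
          rw [classCard_congr hJ, classCard_congr
            (proj_eq_mono (Finset.inter_subset_left (s₂ := B)) hta.symm), mul_inv]
        rw [Finset.sum_congr rfl e4, Finset.sum_const, nsmul_eq_mul]
        have hle : S.card ≤ classCard Q (A ∪ B) t0 := by
          refine Finset.card_le_card fun t ht => ?_
          obtain ⟨htQ, hta, htb⟩ := by simpa [hS] using ht
          simp only [Finset.mem_filter]
          refine ⟨htQ, proj_eq_iff.2 fun v hv => ?_⟩
          rcases Finset.mem_union.1 hv with hv | hv
          · exact proj_eq_iff.1 (hta.symm.trans ht0a) v hv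
          · exact proj_eq_iff.1 (htb.symm.trans ht0b) v hv
        have hp : (0 : ℝ) < classCard Q (A ∪ B) t0 := by exact_mod_cast classCard_pos ht0Q
        have h5 : (S.card : ℝ) * (classCard Q (A ∪ B) t0 : ℝ)⁻¹ ≤ 1 := by
          rw [← div_eq_mul_inv, div_le_one hp]
          exact_mod_cast hle
        calc (S.card : ℝ) * ((classCard Q (A ∩ B) a : ℝ)⁻¹ * (classCard Q (A ∪ B) t0 : ℝ)⁻¹)
            = (classCard Q (A ∩ B) a : ℝ)⁻¹ * (S.card * (classCard Q (A ∪ B) t0 : ℝ)⁻¹) := by ring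
          _ ≤ (classCard Q (A ∩ B) a : ℝ)⁻¹ * 1 :=
              mul_le_mul_of_nonneg_left h5 (by positivity)
          _ = _ := mul_one _
    refine (Finset.sum_le_sum e3).trans ?_
    rw [← Finset.sum_filter, Finset.sum_const, nsmul_eq_mul]
    have hp : (0 : ℝ) < classCard Q (A ∩ B) a := by exact_mod_cast classCard_pos ha
    exact (mul_inv_cancel₀ hp.ne').le
  refine (Finset.sum_le_sum e2).trans ?_
  simp

theorem entropy_sub_entropy {Q : Finset (Fin n → ℕ)} (U W : Finset (Fin n)) :
    entropy Q W - entropy Q U =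
      (∑ t ∈ Q, - Real.log ((classCard Q W t : ℝ) / classCard Q U t)) / Q.card := by
  rw [entropy, entropy, ← sub_div, ← Finset.sum_sub_distrib]
  congr 1
  refine Finset.sum_congr rfl fun t ht => ?_
  have h1 : (classCard Q W t : ℝ) ≠ 0 := by exact_mod_cast (classCard_pos ht).ne'
  have h2 : (classCard Q U t : ℝ) ≠ 0 := by exact_mod_cast (classCard_pos ht).ne'
  rw [Real.log_div h1 h2]
  ring

theorem entropy_empty {Q : Finset (Fin n → ℕ)} : entropy Q ∅ = 0 := by
  have : ∀ t ∈ Q, classCard Q ∅ t = Q.card := by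
    intro t _
    rw [classCard, Finset.filter_true_of_mem]
    intro s _
    exact proj_eq_iff.2 (by simp)
  rw [entropy, Finset.sum_eq_zero, zero_div]
  intro t ht
  rw [this t ht, sub_self]

/-- The elements of `Q` are determined by all variables, so the full entropy is that of the uniform
distribution. -/
theorem entropy_univ {Q : Finset (Fin n → ℕ)} (hQ : Q.Nonempty) :
    entropy Q Finset.univ = Real.log Q.card := by
  have h1 : ∀ t ∈ Q, classCard Q Finset.univ t = 1 := by
    intro t ht
    rw [classCard, Finset.card_eq_one]
    refine ⟨t, Finset.ext fun s => ?_⟩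
    simp only [Finset.mem_filter, Finset.mem_singleton]
    constructor
    · rintro ⟨_, h⟩
      exact funext fun v => proj_eq_iff.1 h v (Finset.mem_univ v)
    · rintro rfl
      exact ⟨ht, rfl⟩
  have hc : (Q.card : ℝ) ≠ 0 := by exact_mod_cast (Finset.card_pos.2 hQ).ne'
  rw [entropy, Finset.sum_congr rfl (fun t ht => by rw [h1 t ht, Nat.cast_one, Real.log_one,
    sub_zero]), Finset.sum_const, nsmul_eq_mul]
  field_simp

/-- The entropies of the projections of a finite set satisfy the basic Shannon inequalities. -/
theorem isPolymatroid_entropy (Q : Finset (Fin n → ℕ)) : IsPolymatroid (entropy Q) := by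
  refine isPolymatroid_of_pairs _ entropy_empty ?_ ?_
  · rintro ⟨X, Y⟩
    rw [monoVal, entropy_sub_entropy]
    refine div_nonneg (Finset.sum_nonneg fun t ht => ?_) (Nat.cast_nonneg _)
    have h2 : (0 : ℝ) < classCard Q X t := by exact_mod_cast classCard_pos ht
    have h3 : (classCard Q (X ∪ Y) t : ℝ) ≤ classCard Q X t := by
      exact_mod_cast classCard_anti Finset.subset_union_left t
    have := Real.log_nonpos (by positivity) ((div_le_one h2).2 h3)
    linarith
  · rintro ⟨A, B⟩
    have e : subVal (entropy Q) (A, B) = (∑ t ∈ Q, - Real.log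
        (((classCard Q A t : ℝ) * classCard Q B t) /
          (classCard Q (A ∩ B) t * classCard Q (A ∪ B) t))) / Q.card := by
      have e1 : subVal (entropy Q) (A, B) =
          (entropy Q A - entropy Q (A ∩ B)) + (entropy Q B - entropy Q (A ∪ B)) := by
        simp only [subVal]; ring
      rw [e1, entropy_sub_entropy, entropy_sub_entropy, ← add_div, ← Finset.sum_add_distrib]
      congr 1
      refine Finset.sum_congr rfl fun t ht => ?_
      have p : ∀ U, (classCard Q U t : ℝ) ≠ 0 := fun U => by
        exact_mod_cast (classCard_pos ht).ne'
      rw [Real.log_div (p _) (p _), Real.log_div (p _) (p _), Real.log_div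
        (mul_ne_zero (p _) (p _)) (mul_ne_zero (p _) (p _)), Real.log_mul (p _) (p _),
        Real.log_mul (p _) (p _)]
      ring
    rw [e]
    refine div_nonneg (sum_log_nonneg _ _ (fun t ht => ?_) (sum_class_ratio_le Q A B))
      (Nat.cast_nonneg _)
    have p : ∀ U, (0 : ℝ) < classCard Q U t := fun U => by exact_mod_cast classCard_pos ht
    have := p A; have := p B; have := p (A ∩ B); have := p (A ∪ B)
    positivity

/-- The conditional entropy is at most the logarithm of the degree. -/
theorem entropy_mon_le {Q : Finset (Fin n → ℕ)} (hQ : Q.Nonempty) (X W : Finset (Fin n)) {d : ℝ}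
    (hd0 : 0 < d) (hd : ∀ a ∈ Q,
      (((Q.filter fun t => proj X t = proj X a).image (proj W)).card : ℝ) ≤ d) :
    entropy Q W - entropy Q X ≤ Real.log d := by
  have hc : (0 : ℝ) < Q.card := by exact_mod_cast Finset.card_pos.2 hQ
  have key : ∑ t ∈ Q, ((classCard Q X t : ℝ) / classCard Q W t) ≤ Q.card * d := by
    have e1 : ∀ t ∈ Q, ((classCard Q X t : ℝ) / classCard Q W t) =
        ∑ a ∈ Q, if proj X a = proj X t then (classCard Q W t : ℝ)⁻¹ else 0 := by
      intro t _
      rw [← Finset.sum_filter, Finset.sum_const, nsmul_eq_mul, div_eq_mul_inv, classCard]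
    rw [Finset.sum_congr rfl e1, Finset.sum_comm, ← nsmul_eq_mul, ← Finset.sum_const]
    refine Finset.sum_le_sum fun a ha => le_trans ?_ (hd a ha)
    rw [← Finset.sum_filter]
    have e2 : (Q.filter fun t => proj X a = proj X t) = Q.filter fun t => proj X t = proj X a :=
      Finset.filter_congr fun t _ => eq_comm
    rw [e2]
    set S := Q.filter fun t => proj X t = proj X a
    rw [← Finset.sum_fiberwise_of_maps_to (g := proj W) (t := S.image (proj W))
      (fun t ht => Finset.mem_image_of_mem _ ht)]
    refine (Finset.sum_le_sum (g := fun _ => (1 : ℝ)) ?_).trans (by simp)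
    intro y hy
    obtain ⟨t0, ht0, rfl⟩ := Finset.mem_image.1 hy
    have ht0Q : t0 ∈ Q := (Finset.mem_filter.1 ht0).1
    have hp : (0 : ℝ) < classCard Q W t0 := by exact_mod_cast classCard_pos ht0Q
    rw [Finset.sum_congr rfl (g := fun _ => (classCard Q W t0 : ℝ)⁻¹) (fun t ht => by
      rw [classCard_congr (Finset.mem_filter.1 ht).2]), Finset.sum_const, nsmul_eq_mul,
      ← div_eq_mul_inv, div_le_one hp]
    have : (S.filter fun t => proj W t = proj W t0).card ≤ classCard Q W t0 := by
      refine Finset.card_le_card fun t ht => ?_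
      simp only [S, Finset.mem_filter] at ht ⊢
      exact ⟨ht.1.1, ht.2⟩
    exact_mod_cast this
  have h0 := sum_log_nonneg Q (fun t => ((classCard Q X t : ℝ) / classCard Q W t) / d)
    (fun t ht => by
      have p : ∀ U, (0 : ℝ) < classCard Q U t := fun U => by exact_mod_cast classCard_pos ht
      have := p X; have := p W
      positivity)
    (by rw [← Finset.sum_div, div_le_iff₀ hd0]; exact key)
  rw [entropy_sub_entropy, div_le_iff₀ hc]
  have e3 : ∑ t ∈ Q, - Real.log (((classCard Q X t : ℝ) / classCard Q W t) / d) =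
      ∑ t ∈ Q, (Real.log d + Real.log ((classCard Q W t : ℝ) / classCard Q X t)) := by
    refine Finset.sum_congr rfl fun t ht => ?_
    have p : ∀ U, (classCard Q U t : ℝ) ≠ 0 := fun U => by
      exact_mod_cast (classCard_pos ht).ne'
    rw [Real.log_div (div_ne_zero (p _) (p _)) hd0.ne', Real.log_div (p _) (p _),
      Real.log_div (p _) (p _)]
    ring
  rw [e3, Finset.sum_add_distrib, Finset.sum_const, nsmul_eq_mul] at h0
  rw [Finset.sum_neg_distrib]
  linarith

end Entropy

section OutputBound

variable {n m : ℕ} {S : Schema n m}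

/-- Every degree constraint is guarded by a relation. Without relations the degree is infinite,
which the constraint excludes. -/
theorem Inst.Satisfies.exists_guard {D : Inst S} {Δ : Finset (Mon n)} {N : Mon n → ℝ≥0}
    (h : D.Satisfies Δ N) {δ : Mon n} (hδ : δ ∈ Δ) :
    ∃ j, ∃ d : ℕ, Panda.deg (D j) δ = d ∧ (d : ℝ≥0) ≤ N δ := by
  have h1 := h δ hδ
  have hne : Nonempty (Fin m) := by
    by_contra hc
    rw [not_nonempty_iff] at hc
    have : D.deg δ = ⊤ := by simp [Inst.deg]
    rw [this] at h1
    simp at h1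
  obtain ⟨j, hj⟩ := exists_eq_ciInf_of_finite (f := fun j => Panda.deg (D j) δ)
  change Panda.deg (D j) δ = D.deg δ at hj
  rw [← hj] at h1
  have hfin : Panda.deg (D j) δ ≠ ⊤ := by
    intro ht
    rw [ht] at h1
    simp at h1
  obtain ⟨d, hd⟩ := ENat.ne_top_iff_exists.1 hfin
  refine ⟨j, d, hd.symm, ?_⟩
  rw [← hd] at h1
  simpa using h1

theorem fullJoin_finite (D : Inst S) : (fullJoin D).Finite := by
  refine Set.Finite.of_injOn (f := fun t j => proj (S.vars j) t)
    (t := Set.univ.pi fun j => (D j : Set (Tuple (S.vars j)))) ?_ ?_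
    (Set.Finite.pi fun j => Finset.finite_toSet _)
  · intro t ht j _
    exact ht j
  · intro s _ t _ hst
    funext v
    obtain ⟨j, hj⟩ := S.covers v
    exact proj_eq_iff.1 (congrFun hst j) v hj

/-- The size bound: evaluate the Shannon inequality at the entropy of the output. -/
theorem encard_le_bound (D : Inst S) (Δ : Finset (Mon n)) (N w : Mon n → ℝ≥0)
    (hD : D.Satisfies Δ N) (hS : IsShannon Δ w) :
    (((fullJoin D).encard : ℕ∞) : ℝ≥0∞) ≤ (bound Δ N w : ℝ≥0∞) := by
  obtain ⟨Q, hQ⟩ := (fullJoin_finite D).exists_finset_coe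
  rw [← hQ, Set.encard_coe_eq_coe_finsetCard]
  rcases Q.eq_empty_or_nonempty with rfl | hne
  · simp
  have hdeg : ∀ δ ∈ Δ, (1 : ℝ) ≤ N δ ∧ δ.eval (entropy Q) ≤ Real.log (N δ) := by
    intro δ hδ
    obtain ⟨j, d, hd, hdN⟩ := hD.exists_guard hδ
    have hdN' : (d : ℝ) ≤ N δ := by exact_mod_cast hdN
    have hcard : ∀ a ∈ Q, ((Q.filter fun t => proj δ.X t = proj δ.X a).image
        (proj (δ.X ∪ δ.Y))).card ≤ d := by
      intro a _
      have h1 : degAt (D j) δ (proj δ.X a) ≤ d := by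
        rw [← hd]
        exact le_iSup (fun x => degAt (D j) δ x) (proj δ.X a)
      have h2 : (((Q.filter fun t => proj δ.X t = proj δ.X a).image
          (proj (δ.X ∪ δ.Y)) : Finset _) : Set (Tuple (δ.X ∪ δ.Y))).encard ≤
          degAt (D j) δ (proj δ.X a) := by
        refine Set.encard_le_encard ?_
        intro y hy
        obtain ⟨t, ht, rfl⟩ := Finset.mem_image.1 (Finset.mem_coe.1 hy)
        obtain ⟨htQ, htX⟩ := Finset.mem_filter.1 ht
        have htJ : t ∈ fullJoin D := by rw [← hQ]; exact htQ
        exact ⟨⟨proj (S.vars j) t, htJ j, fun v _ _ => rfl⟩,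
          fun v hv => proj_eq_iff.1 htX v hv⟩
      rw [Set.encard_coe_eq_coe_finsetCard] at h2
      exact_mod_cast h2.trans h1
    obtain ⟨a, ha⟩ := hne
    have hd1 : 1 ≤ d := by
      refine le_trans (Finset.card_pos.2 ?_) (hcard a ha)
      exact ⟨_, Finset.mem_image_of_mem _ (Finset.mem_filter.2 ⟨ha, rfl⟩)⟩
    have hd1' : (1 : ℝ) ≤ d := by exact_mod_cast hd1
    refine ⟨hd1'.trans hdN', ?_⟩
    refine entropy_mon_le ⟨a, ha⟩ _ _ (by linarith) fun b hb => ?_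
    exact le_trans (by exact_mod_cast hcard b hb) hdN'
  have h1 := hS _ (isPolymatroid_entropy Q)
  rw [entropy_univ hne] at h1
  have h2 : Real.log Q.card ≤ ∑ δ ∈ Δ, (w δ : ℝ) * Real.log (N δ) :=
    h1.trans (Finset.sum_le_sum fun δ hδ =>
      mul_le_mul_of_nonneg_left (hdeg δ hδ).2 (NNReal.coe_nonneg _))
  have hpos : (0 : ℝ) < Q.card := by exact_mod_cast Finset.card_pos.2 hne
  have h3 : (Q.card : ℝ) ≤ (bound Δ N w : ℝ) := by
    rw [bound, NNReal.coe_prod]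
    have e : ∏ δ ∈ Δ, ((N δ ^ (w δ : ℝ) : ℝ≥0) : ℝ) =
        Real.exp (∑ δ ∈ Δ, (w δ : ℝ) * Real.log (N δ)) := by
      rw [Real.exp_sum]
      refine Finset.prod_congr rfl fun δ hδ => ?_
      rw [NNReal.coe_rpow, Real.rpow_def_of_pos (by linarith [(hdeg δ hδ).1]), mul_comm]
    rw [e, ← Real.exp_log hpos]
    exact Real.exp_le_exp.2 h2
  have h4 : (Q.card : ℝ≥0) ≤ bound Δ N w := by exact_mod_cast h3
  have h5 : ((Q.card : ℝ≥0) : ℝ≥0∞) ≤ (bound Δ N w : ℝ≥0∞) := by exact_mod_cast h4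
  simpa using h5

end OutputBound

/-! ### Families of tables and the operations on them -/

section Tables

variable {n : ℕ}

/-- Vectors over all variables. A tuple with attribute set `X` is represented by a vector that is
`0` outside of `X`. -/
abbrev Vec (n : ℕ) : Type := Fin n → ℕ

/-- The projection to `X`, in the representation of tuples by vectors. -/
def mask (X : Finset (Fin n)) (x : Vec n) : Vec n := fun v => if v ∈ X then x v else 0

theorem mask_eq_iff {X : Finset (Fin n)} {x y : Vec n} :
    mask X x = mask X y ↔ ∀ v ∈ X, x v = y v := by
  constructor
  · intro h v hv
    simpa [mask, hv] using congrFun h v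
  · intro h
    funext v
    by_cases hv : v ∈ X
    · simp [mask, hv, h v hv]
    · simp [mask, hv]

theorem mask_mask (X Y : Finset (Fin n)) (x : Vec n) : mask X (mask Y x) = mask (X ∩ Y) x := by
  funext v
  by_cases h1 : v ∈ X <;> by_cases h2 : v ∈ Y <;> simp [mask, h1, h2]

theorem mask_mask_of_subset {X Y : Finset (Fin n)} (h : X ⊆ Y) (x : Vec n) :
    mask X (mask Y x) = mask X x := by
  rw [mask_mask, Finset.inter_eq_left.2 h]

theorem mask_univ (x : Vec n) : mask Finset.univ x = x := by
  funext v; simp [mask]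

theorem mask_mono {X Y : Finset (Fin n)} (h : X ⊆ Y) {x y : Vec n} (e : mask Y x = mask Y y) :
    mask X x = mask X y :=
  mask_eq_iff.2 fun v hv => mask_eq_iff.1 e v (h hv)

/-- The number of rows of `S` that agree with `f` on `X`. -/
def rowDeg (X : Finset (Fin n)) (S : Finset (Vec n)) (f : Vec n) : ℕ :=
  (S.filter fun g => mask X g = mask X f).card

theorem rowDeg_mono {X : Finset (Fin n)} {S S' : Finset (Vec n)} (h : S ⊆ S') (f : Vec n) :
    rowDeg X S f ≤ rowDeg X S' f :=
  Finset.card_le_card (Finset.filter_subset_filter _ h)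

theorem rowDeg_le_card (X : Finset (Fin n)) (S : Finset (Vec n)) (f : Vec n) :
    rowDeg X S f ≤ S.card := Finset.card_filter_le _ _

theorem rowDeg_pos {X : Finset (Fin n)} {S : Finset (Vec n)} {f : Vec n} (h : f ∈ S) :
    0 < rowDeg X S f :=
  Finset.card_pos.2 ⟨f, Finset.mem_filter.2 ⟨h, rfl⟩⟩

/-- The vector that agrees with `f` on `W` and with `g` elsewhere. -/
def merge (W : Finset (Fin n)) (f g : Vec n) : Vec n := fun v => if v ∈ W then f v else g v

/-- The join of `R` and `S`, where `W` are the attributes of `R` and `X` the common attributes. -/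
def joinSet (W X : Finset (Fin n)) (R S : Finset (Vec n)) : Finset (Vec n) :=
  ((R ×ˢ S).filter fun p => mask X p.1 = mask X p.2).image fun p => merge W p.1 p.2

/-- The rows of `S` that agree on `X` with some row of `R`. -/
def semiSet (X : Finset (Fin n)) (S R : Finset (Vec n)) : Finset (Vec n) :=
  S.filter fun f => ∃ g ∈ R, mask X g = mask X f

/-- The rows of `S` whose degree over `X` lies in the `i`-th dyadic bucket `(2 ^ i / 2, 2 ^ i]`;
the quotient is rounded down, so that the bucket number `0` is `{1}`. -/
def splitSet (X : Finset (Fin n)) (S : Finset (Vec n)) (i : ℕ) : Finset (Vec n) :=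
  S.filter fun f => 2 ^ i / 2 < rowDeg X S f ∧ rowDeg X S f ≤ 2 ^ i

/-- Operations on a family of tables with index type `ι`. -/
inductive Op (ι : Type*) (n : ℕ)
  /-- branch over the degree buckets of table `a` over `X` -/
  | split (a : ι) (X : Finset (Fin n))
  /-- create table `b` as the projection of table `a` to `X`, unless it is there already -/
  | proj (a b : ι) (X : Finset (Fin n))
  /-- create table `z` as the join of `p` and `q`, unless it is there already or exceeds the size
  limit; `W` are the attributes of `p` and `X` the common ones -/
  | join (p q z : ι) (W X : Finset (Fin n))
  /-- keep in table `a` the rows that agree on `X` with some row of table `b` -/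
  | semi (a b : ι) (X : Finset (Fin n))

variable {ι : Type*} [DecidableEq ι]

/-- A family of tables, some of which may be absent. -/
abbrev Tabs (ι : Type*) (n : ℕ) : Type _ := ι → Option (Finset (Vec n))

/-- The new contents of table `a` under `Op.semi a b X`; an absent table has no effect. -/
def semiRes (X : Finset (Fin n)) : Option (Finset (Vec n)) → Option (Finset (Vec n)) →
    Option (Finset (Vec n))
  | some S, some R => some (semiSet X S R)
  | o, _ => o

/-- The new contents of table `b` under `Op.proj a b X`. -/
def projRes (X : Finset (Fin n)) : Option (Finset (Vec n)) → Option (Finset (Vec n)) →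
    Option (Finset (Vec n))
  | _, some S => some S
  | some R, none => some (R.image (mask X))
  | none, none => none

/-- The new contents of table `z` under `Op.join p q z W X` with size limit `M`; the last argument
is the old contents. -/
def joinRes (M : ℕ) (W X : Finset (Fin n)) : Option (Finset (Vec n)) → Option (Finset (Vec n)) →
    Option (Finset (Vec n)) → Option (Finset (Vec n))
  | _, _, some S => some S
  | some R, some R', none =>
    if (joinSet W X R R').card ≤ M then some (joinSet W X R R') else none
  | _, _, none => none

/-- One operation with size limit `M` may lead from the tables `T` to the tables `T'`. -/
def Step (M : ℕ) : Op ι n → Tabs ι n → Tabs ι n → Prop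
  | .split a X, T, T' =>
    (T a = none ∧ T' = T) ∨ ∃ S i, T a = some S ∧ 2 ^ i / 2 < S.card ∧
      T' = Function.update T a (some (splitSet X S i))
  | .proj a b X, T, T' => T' = Function.update T b (projRes X (T a) (T b))
  | .join p q z W X, T, T' => T' = Function.update T z (joinRes M W X (T p) (T q) (T z))
  | .semi a b X, T, T' => T' = Function.update T a (semiRes X (T a) (T b))

/-- A branch of the computation leads from `T` to `T'`. -/
def Leaf (M : ℕ) : List (Op ι n) → Tabs ι n → Tabs ι n → Prop
  | [], T, T' => T' = T
  | op :: ops, T, T' => ∃ T₁, Step M op T T₁ ∧ Leaf M ops T₁ T'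

theorem leaf_append {M : ℕ} {l₁ l₂ : List (Op ι n)} {T T' : Tabs ι n} :
    Leaf M (l₁ ++ l₂) T T' ↔ ∃ T₁, Leaf M l₁ T T₁ ∧ Leaf M l₂ T₁ T' := by
  induction l₁ generalizing T with
  | nil => simp [Leaf]
  | cons op l ih =>
    simp only [List.cons_append, Leaf, ih]
    constructor
    · rintro ⟨T₁, h1, T₂, h2, h3⟩; exact ⟨T₂, ⟨T₁, h1, h2⟩, h3⟩
    · rintro ⟨T₂, ⟨T₁, h1, h2⟩, h3⟩; exact ⟨T₁, h1, T₂, h2, h3⟩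

/-- Every table that is present in `T` is present in `T'`, with fewer rows. -/
def Shrinks (T T' : Tabs ι n) : Prop := ∀ i S, T i = some S → ∃ S' ⊆ S, T' i = some S'

omit [DecidableEq ι] in
theorem Shrinks.refl (T : Tabs ι n) : Shrinks T T := fun _ S h => ⟨S, subset_rfl, h⟩

omit [DecidableEq ι] in
theorem Shrinks.trans {T T' T'' : Tabs ι n} (h : Shrinks T T') (h' : Shrinks T' T'') :
    Shrinks T T'' := fun i S hS => by
  obtain ⟨S', h1, h2⟩ := h i S hS
  obtain ⟨S'', h3, h4⟩ := h' i S' h2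
  exact ⟨S'', h3.trans h1, h4⟩

theorem Shrinks.update {T : Tabs ι n} {a : ι} {o : Option (Finset (Vec n))}
    (h : ∀ S, T a = some S → ∃ S' ⊆ S, o = some S') : Shrinks T (Function.update T a o) := by
  intro i S hS
  by_cases hi : i = a
  · subst hi
    simpa using h S hS
  · exact ⟨S, subset_rfl, by rw [Function.update_of_ne hi, hS]⟩

theorem Step.shrinks {M : ℕ} {op : Op ι n} {T T' : Tabs ι n} (h : Step M op T T') :
    Shrinks T T' := by
  cases op with
  | split a X =>
    rcases h with ⟨_, rfl⟩ | ⟨S, i, hS, _, rfl⟩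
    · exact Shrinks.refl _
    · refine Shrinks.update fun S' hS' => ?_
      rw [hS] at hS'
      cases hS'
      exact ⟨_, Finset.filter_subset _ _, rfl⟩
  | proj a b X =>
    cases h
    exact Shrinks.update fun S hS => ⟨S, subset_rfl, by rw [hS]; cases T a <;> rfl⟩
  | join p q z W X =>
    cases h
    exact Shrinks.update fun S hS => ⟨S, subset_rfl, by
      rw [hS]; cases T p <;> cases T q <;> rfl⟩
  | semi a b X =>
    cases h
    refine Shrinks.update fun S hS => ?_
    rw [hS]
    cases T b with
    | none => exact ⟨S, subset_rfl, rfl⟩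
    | some R => exact ⟨_, Finset.filter_subset _ _, rfl⟩

theorem Leaf.shrinks {M : ℕ} {ops : List (Op ι n)} {T T' : Tabs ι n} (h : Leaf M ops T T') :
    Shrinks T T' := by
  induction ops generalizing T with
  | nil => cases h; exact Shrinks.refl _
  | cons op ops ih =>
    obtain ⟨T₁, h1, h2⟩ := h
    exact h1.shrinks.trans (ih h2)

/-- The rows of table `i` are supported on the attribute set `att i`. -/
def Supp (att : ι → Finset (Fin n)) (T : Tabs ι n) : Prop :=
  ∀ i S, T i = some S → ∀ f ∈ S, mask (att i) f = f

/-- The attribute sets named in the operation fit to those of the tables. -/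
def Op.WF (att : ι → Finset (Fin n)) : Op ι n → Prop
  | .split _ _ => True
  | .proj a b X => att b = X ∧ X ⊆ att a
  | .join p q z W X => att z = att p ∪ att q ∧ W = att p ∧ X = att p ∩ att q
  | .semi a b X => X ⊆ att a ∧ X ⊆ att b

/-- The vector `x` is consistent with all tables. -/
def Fits (att : ι → Finset (Fin n)) (T : Tabs ι n) (x : Vec n) : Prop :=
  ∀ i S, T i = some S → mask (att i) x ∈ S

variable {att : ι → Finset (Fin n)}

omit [DecidableEq ι] in
theorem Fits.of_shrinks {T T' : Tabs ι n} (h : Shrinks T T') {x : Vec n} (hx : Fits att T' x) :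
    Fits att T x := fun i S hS => by
  obtain ⟨S', h1, h2⟩ := h i S hS
  exact h1 (hx i S' h2)

theorem Fits.update {T : Tabs ι n} {a : ι} {o : Option (Finset (Vec n))} {x : Vec n}
    (hx : Fits att T x) (h : ∀ S, o = some S → mask (att a) x ∈ S) :
    Fits att (Function.update T a o) x := by
  intro i S hS
  by_cases hi : i = a
  · subst hi
    rw [Function.update_self] at hS
    exact h S hS
  · rw [Function.update_of_ne hi] at hS
    exact hx i S hS

theorem Supp.update {T : Tabs ι n} {a : ι} {o : Option (Finset (Vec n))}
    (hT : Supp att T) (h : ∀ S, o = some S → ∀ f ∈ S, mask (att a) f = f) :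
    Supp att (Function.update T a o) := by
  intro i S hS
  by_cases hi : i = a
  · subst hi
    rw [Function.update_self] at hS
    exact h S hS
  · rw [Function.update_of_ne hi] at hS
    exact hT i S hS

theorem exists_bucket {d : ℕ} (hd : 0 < d) : ∃ i, 2 ^ i / 2 < d ∧ d ≤ 2 ^ i := by
  refine ⟨Nat.clog 2 d, ?_, Nat.le_pow_clog (by norm_num) d⟩
  rcases Nat.lt_or_ge 1 d with h | h
  · have h1 := Nat.pow_pred_clog_lt_self (b := 2) (by norm_num) h
    have h2 : 0 < Nat.clog 2 d := Nat.clog_pos (by norm_num) h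
    obtain ⟨k, hk⟩ := Nat.exists_eq_succ_of_ne_zero h2.ne'
    rw [hk] at h1 ⊢
    rw [Nat.pow_succ, Nat.mul_div_cancel _ (by norm_num)]
    simpa using h1
  · have : d = 1 := by omega
    subst this
    simp

theorem bucket_unique {d i j : ℕ} (hi : 2 ^ i / 2 < d ∧ d ≤ 2 ^ i)
    (hj : 2 ^ j / 2 < d ∧ d ≤ 2 ^ j) : i = j := by
  have key : ∀ {i j : ℕ}, d ≤ 2 ^ i → 2 ^ j / 2 < d → ¬ i < j := by
    intro i j h1 h2 hlt
    have h3 : 2 ^ (i + 1) ≤ 2 ^ j := Nat.pow_le_pow_right (by norm_num) hlt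
    rw [Nat.pow_succ] at h3
    omega
  have h1 := key hi.2 hj.1
  have h2 := key hj.2 hi.1
  omega

/-- Every consistent vector stays consistent in some branch. -/
theorem Fits.exists_step {M : ℕ} {op : Op ι n} (hop : op.WF att) {T : Tabs ι n} {x : Vec n}
    (hx : Fits att T x) : ∃ T', Step M op T T' ∧ Fits att T' x := by
  cases op with
  | split a X =>
    rcases h : T a with _ | S
    · exact ⟨T, Or.inl ⟨h, rfl⟩, hx⟩
    · have hm := hx a S h
      obtain ⟨i, h1, h2⟩ := exists_bucket (rowDeg_pos (X := X) hm)
      refine ⟨_, Or.inr ⟨S, i, h, h1.trans_le (rowDeg_le_card _ _ _), rfl⟩, hx.update ?_⟩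
      rintro _ ⟨⟩
      exact Finset.mem_filter.2 ⟨hm, h1, h2⟩
  | proj a b X =>
    refine ⟨_, rfl, hx.update fun S hS => ?_⟩
    obtain ⟨hb, hXa⟩ := hop
    rcases h : T b with _ | Sb
    · rcases h' : T a with _ | Sa
      · rw [h, h'] at hS; cases hS
      · rw [h, h'] at hS
        cases hS
        refine Finset.mem_image.2 ⟨_, hx a Sa h', ?_⟩
        rw [mask_mask_of_subset hXa, hb]
    · have : some Sb = some S := by rw [← hS, h]; cases T a <;> rfl
      cases this
      exact hx b S h
  | join p q z W X =>
    refine ⟨_, rfl, hx.update fun S hS => ?_⟩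
    obtain ⟨hz, hW, hX⟩ := hop
    rcases h : T z with _ | Sz
    · rcases hp : T p with _ | Sp
      · rw [h, hp] at hS; cases hS
      · rcases hq : T q with _ | Sq
        · rw [h, hp, hq] at hS; cases hS
        · rw [h, hp, hq] at hS
          simp only [joinRes] at hS
          split_ifs at hS
          cases hS
          refine Finset.mem_image.2 ⟨(mask (att p) x, mask (att q) x),
            Finset.mem_filter.2 ⟨Finset.mem_product.2 ⟨hx p Sp hp, hx q Sq hq⟩, ?_⟩, ?_⟩
          · simp only
            rw [mask_mask_of_subset (by rw [hX]; exact Finset.inter_subset_left),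
              mask_mask_of_subset (by rw [hX]; exact Finset.inter_subset_right)]
          · funext v
            by_cases h1 : v ∈ att p <;> by_cases h2 : v ∈ att q <;>
              simp [merge, mask, hW, hz, h1, h2]
    · have : some Sz = some S := by rw [← hS, h]; cases T p <;> cases T q <;> rfl
      cases this
      exact hx z S h
  | semi a b X =>
    refine ⟨_, rfl, hx.update fun S hS => ?_⟩
    obtain ⟨hXa, hXb⟩ := hop
    rcases h : T a with _ | Sa
    · rw [h] at hS; cases hS
    · rcases h' : T b with _ | Sb
      · rw [h, h'] at hS; cases hS
        exact hx a _ h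
      · rw [h, h'] at hS; cases hS
        refine Finset.mem_filter.2 ⟨hx a Sa h, _, hx b Sb h', ?_⟩
        rw [mask_mask_of_subset hXa, mask_mask_of_subset hXb]

theorem Fits.exists_leaf {M : ℕ} {ops : List (Op ι n)} (hops : ∀ op ∈ ops, op.WF att)
    {T : Tabs ι n} {x : Vec n} (hx : Fits att T x) : ∃ T', Leaf M ops T T' ∧ Fits att T' x := by
  induction ops generalizing T with
  | nil => exact ⟨T, rfl, hx⟩
  | cons op ops ih =>
    obtain ⟨T₁, h1, h2⟩ := hx.exists_step (M := M) (hops op (by simp))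
    obtain ⟨T', h3, h4⟩ := ih (fun o ho => hops o (by simp [ho])) h2
    exact ⟨T', ⟨T₁, h1, h3⟩, h4⟩

/-- Operations preserve that the rows are supported on the attribute sets of their tables. -/
theorem Supp.step {M : ℕ} {op : Op ι n} (hop : op.WF att) {T T' : Tabs ι n} (hT : Supp att T)
    (h : Step M op T T') : Supp att T' := by
  cases op with
  | split a X =>
    rcases h with ⟨_, rfl⟩ | ⟨S, i, hS, _, rfl⟩
    · exact hT
    · refine hT.update ?_
      rintro _ ⟨⟩ f hf
      exact hT a S hS f (Finset.mem_filter.1 hf).1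
  | proj a b X =>
    cases h
    refine hT.update fun S hS => ?_
    obtain ⟨hb, hXa⟩ := hop
    rcases h : T b with _ | Sb
    · rcases h' : T a with _ | Sa
      · rw [h, h'] at hS; cases hS
      · rw [h, h'] at hS
        cases hS
        intro f hf
        obtain ⟨g, _, rfl⟩ := Finset.mem_image.1 hf
        rw [hb, mask_mask, Finset.inter_self]
    · have : some Sb = some S := by rw [← hS, h]; cases T a <;> rfl
      cases this
      exact hT b S h
  | join p q z W X =>
    cases h
    refine hT.update fun S hS => ?_
    obtain ⟨hz, hW, hX⟩ := hop
    rcases h : T z with _ | Sz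
    · rcases hp : T p with _ | Sp
      · rw [h, hp] at hS; cases hS
      · rcases hq : T q with _ | Sq
        · rw [h, hp, hq] at hS; cases hS
        · rw [h, hp, hq] at hS
          simp only [joinRes] at hS
          split_ifs at hS
          cases hS
          intro f hf
          obtain ⟨⟨g, g'⟩, hg, rfl⟩ := Finset.mem_image.1 hf
          obtain ⟨hg1, _⟩ := Finset.mem_filter.1 hg
          obtain ⟨hg1, hg2⟩ := Finset.mem_product.1 hg1
          have e2 := hT q Sq hq _ hg2
          funext v
          have e3 := congrFun e2 v
          simp only [mask] at e3
          by_cases h1 : v ∈ att p <;> by_cases h2 : v ∈ att q <;>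
            simp_all [merge, mask]
    · have : some Sz = some S := by rw [← hS, h]; cases T p <;> cases T q <;> rfl
      cases this
      exact hT z S h
  | semi a b X =>
    cases h
    refine hT.update fun S hS => ?_
    rcases h : T a with _ | Sa
    · rw [h] at hS; cases hS
    · rcases h' : T b with _ | Sb
      · rw [h, h'] at hS; cases hS
        exact hT a _ h
      · rw [h, h'] at hS; cases hS
        intro f hf
        exact hT a Sa h f (Finset.mem_filter.1 hf).1

theorem Supp.leaf {M : ℕ} {ops : List (Op ι n)} (hops : ∀ op ∈ ops, op.WF att)
    {T T' : Tabs ι n} (hT : Supp att T) (h : Leaf M ops T T') : Supp att T' := by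
  induction ops generalizing T with
  | nil => cases h; exact hT
  | cons op ops ih =>
    obtain ⟨T₁, h1, h2⟩ := h
    exact ih (fun o ho => hops o (by simp [ho])) (hT.step (hops op (by simp)) h1) h2

/-! ### The output of a branching computation -/

/-- The final semijoins of table `v` with all tables of a list. -/
def finalOps (att : ι → Finset (Fin n)) (v : ι) (L : List ι) : List (Op ι n) :=
  L.map fun i => .semi v i (att i)

/-- The list `l` is the concatenation of the contents of table `v` in all branches. -/
def OutList (M : ℕ) (v : ι) : List (Op ι n) → Tabs ι n → List (Vec n) → Prop
  | [], T, l => (T v = none ∧ l = []) ∨ ∃ S, T v = some S ∧ l.Nodup ∧ l.toFinset = S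
  | .split a X :: ops, T, l =>
    (T a = none ∧ OutList M v ops T l) ∨
      ∃ S, T a = some S ∧ ∃ (r : ℕ) (ls : ℕ → List (Vec n)), (∀ i, i < r ↔ 2 ^ i / 2 < S.card) ∧
        l = (List.range r).flatMap ls ∧
        ∀ i < r, OutList M v ops (Function.update T a (some (splitSet X S i))) (ls i)
  | .proj a b X :: ops, T, l => OutList M v ops (Function.update T b (projRes X (T a) (T b))) l
  | .join p q z W X :: ops, T, l =>
    OutList M v ops (Function.update T z (joinRes M W X (T p) (T q) (T z))) l
  | .semi a b X :: ops, T, l => OutList M v ops (Function.update T a (semiRes X (T a) (T b))) l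

/-- The output consists of the rows of table `v` at the ends of the branches. -/
theorem OutList.mem_iff {M : ℕ} {v : ι} {ops : List (Op ι n)} {T : Tabs ι n} {l : List (Vec n)}
    (h : OutList M v ops T l) (x : Vec n) :
    x ∈ l ↔ ∃ T' S, Leaf M ops T T' ∧ T' v = some S ∧ x ∈ S := by
  induction ops generalizing T l with
  | nil =>
    rcases h with ⟨h1, rfl⟩ | ⟨S, h1, h2, rfl⟩
    · simp only [Leaf, List.not_mem_nil, false_iff]
      rintro ⟨T', S, rfl, h3, _⟩
      rw [h1] at h3; cases h3
    · constructor
      · intro hx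
        exact ⟨T, _, rfl, h1, List.mem_toFinset.2 hx⟩
      · rintro ⟨T', S, rfl, h3, h4⟩
        rw [h1] at h3; cases h3
        exact List.mem_toFinset.1 h4
  | cons op ops ih =>
    cases op with
    | split a X =>
      rcases h with ⟨h1, h2⟩ | ⟨S, h1, r, ls, hr, rfl, h2⟩
      · rw [ih h2]
        constructor
        · rintro ⟨T', S, h3, h4⟩
          exact ⟨T', S, ⟨T, Or.inl ⟨h1, rfl⟩, h3⟩, h4⟩
        · rintro ⟨T', S, ⟨T₁, h3 | ⟨S', i, h3, _⟩, h4⟩, h5⟩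
          · rw [h3.2] at h4
            exact ⟨T', S, h4, h5⟩
          · rw [h1] at h3; cases h3
      · simp only [List.mem_flatMap, List.mem_range]
        constructor
        · rintro ⟨i, hi, hx⟩
          obtain ⟨T', S', h3, h4⟩ := (ih (h2 i hi)).1 hx
          exact ⟨T', S', ⟨_, Or.inr ⟨S, i, h1, (hr i).1 hi, rfl⟩, h3⟩, h4⟩
        · rintro ⟨T', S', ⟨T₁, h3 | ⟨S'', i, h3, hi, rfl⟩, h4⟩, h5⟩
          · rw [h1] at h3; cases h3.1
          · rw [h1] at h3; cases h3
            exact ⟨i, (hr i).2 hi, (ih (h2 i ((hr i).2 hi))).2 ⟨T', S', h4, h5⟩⟩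
    | proj a b X => rw [ih h]; simp [Leaf, Step]
    | join p q z W X => rw [ih h]; simp [Leaf, Step]
    | semi a b X => rw [ih h]; simp [Leaf, Step]

/-- After the semijoins with the tables of `L`, the rows of table `v`, which has all attributes, are
consistent with these tables. -/
theorem finalOps_sound {M : ℕ} {v : ι} (hv : att v = Finset.univ) {L : List ι} {T T' : Tabs ι n}
    (hT : Supp att T) (h : Leaf M (finalOps att v L) T T') {S' : Finset (Vec n)}
    (hS' : T' v = some S') {x : Vec n} (hx : x ∈ S') :
    ∀ i ∈ L, ∀ S, T i = some S → mask (att i) x ∈ S := by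
  induction L generalizing T with
  | nil => simp
  | cons j L ih =>
    obtain ⟨T₁, h1, h2⟩ := h
    have hsh := (Leaf.shrinks h2)
    have hT1 : Supp att T₁ := hT.step (op := .semi v j (att j)) ⟨by simp [hv], subset_rfl⟩ h1
    have ih' := ih hT1 h2
    have hsh1 := Step.shrinks h1
    intro i hi S hS
    by_cases hiv : i = v
    · subst hiv
      obtain ⟨S1, hs1, e1⟩ := (hsh1.trans hsh) i S hS
      rw [hS'] at e1; cases e1
      rw [hv, mask_univ]
      exact hs1 hx
    · rcases List.mem_cons.1 hi with rfl | hi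
      · rcases hv' : T v with _ | Sv
        · exfalso
          -- an absent table stays absent under semijoins
          have : ∀ (L : List ι) (T T' : Tabs ι n), T v = none → Leaf M (finalOps att v L) T T' →
              T' v = none := by
            intro L
            induction L with
            | nil => rintro T T' h ⟨⟩; exact h
            | cons k L ihL =>
              rintro T T' h ⟨T₂, e, h'⟩
              refine ihL _ _ ?_ h'
              cases e
              rw [Function.update_self, h]
              rfl
          have h3 := this (i :: L) T T' hv' ⟨T₁, h1, h2⟩
          rw [hS'] at h3; cases h3
        · cases h1
          obtain ⟨S1, hs1, e1⟩ := hsh v (semiSet (att i) Sv S) (by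
            rw [Function.update_self, hv', hS]; rfl)
          rw [hS'] at e1; cases e1
          obtain ⟨_, g, hg, e⟩ := Finset.mem_filter.1 (hs1 hx)
          rw [← e, hT i S hS g hg]
          exact hg
      · refine ih' i hi S ?_
        cases h1
        rw [Function.update_of_ne hiv, hS]

theorem OutList.fits {M : ℕ} {v : ι} (hv : att v = Finset.univ) {L : List ι} (hL : ∀ i, i ∈ L)
    {ops : List (Op ι n)} (hops : ∀ op ∈ ops, op.WF att) {T : Tabs ι n} (hT : Supp att T)
    {l : List (Vec n)} (h : OutList M v (ops ++ finalOps att v L) T l) {x : Vec n} (hx : x ∈ l) :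
    Fits att T x := by
  obtain ⟨T', S, h1, h2, h3⟩ := (h.mem_iff x).1 hx
  obtain ⟨T₁, h4, h5⟩ := leaf_append.1 h1
  exact Fits.of_shrinks h4.shrinks
    fun i S hS => finalOps_sound hv (hT.leaf hops h4) h5 h2 h3 i (hL i) S hS

/-- In different branches of a split the outputs are disjoint, hence the output has no
repetitions. -/
theorem OutList.nodup {M : ℕ} {v : ι} (hv : att v = Finset.univ) {L : List ι} (hL : ∀ i, i ∈ L)
    {ops : List (Op ι n)} (hops : ∀ op ∈ ops, op.WF att) {T : Tabs ι n} (hT : Supp att T)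
    {l : List (Vec n)} (h : OutList M v (ops ++ finalOps att v L) T l) : l.Nodup := by
  induction ops generalizing T l with
  | nil =>
    have : ∀ (L : List ι) (T : Tabs ι n), OutList M v (finalOps att v L) T l → l.Nodup := by
      intro L
      induction L with
      | nil =>
        rintro T (⟨_, rfl⟩ | ⟨S, _, h, _⟩)
        · exact List.nodup_nil
        · exact h
      | cons i L ih => intro T h; exact ih _ h
    exact this L T h
  | cons op ops ih =>
    have hops' : ∀ o ∈ ops, o.WF att := fun o ho => hops o (by simp [ho])
    have hop := hops op (by simp)
    cases op with
    | split a X =>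
      rcases h with ⟨h1, h2⟩ | ⟨S, h1, r, ls, hr, rfl, h2⟩
      · exact ih hops' hT h2
      · have hTi : ∀ i < r, Supp att (Function.update T a (some (splitSet X S i))) :=
          fun i hi => hT.step (M := M) (op := .split a X) hop
            (Or.inr ⟨S, i, h1, (hr i).1 hi, rfl⟩)
        rw [List.nodup_flatMap]
        refine ⟨fun i hi => ih hops' (hTi i (List.mem_range.1 hi)) (h2 i (List.mem_range.1 hi)), ?_⟩
        refine List.Pairwise.imp_of_mem ?_ (List.nodup_range (n := r))
        intro i j hi hj hij x hxi hxj
        have f : ∀ k < r, x ∈ ls k → mask (att a) x ∈ splitSet X S k := fun k hk hx =>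
          OutList.fits hv hL hops' (hTi k hk) (h2 k hk) hx a _ (Function.update_self ..)
        exact hij (bucket_unique
          (Finset.mem_filter.1 (f i (List.mem_range.1 hi) hxi)).2
          (Finset.mem_filter.1 (f j (List.mem_range.1 hj) hxj)).2)
    | proj a b X => exact ih hops' (hT.step (M := M) (op := .proj a b X) hop rfl) h
    | join p q z W X => exact ih hops' (hT.step (M := M) (op := .join p q z W X) hop rfl) h
    | semi a b X => exact ih hops' (hT.step (M := M) (op := .semi a b X) hop rfl) h

/-- Table `v` is present at the end of every branch. -/
def Success (M : ℕ) (v : ι) (ops : List (Op ι n)) (T : Tabs ι n) : Prop :=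
  ∀ T', Leaf M ops T T' → (T' v).isSome

/-- If table `v` is present at the end of every branch, the output is the set of all vectors that
are consistent with the tables: each of them survives in the branch that follows its degree buckets.
-/
theorem OutList.mem_iff_fits {M : ℕ} {v : ι} (hv : att v = Finset.univ) {L : List ι}
    (hL : ∀ i, i ∈ L) {ops : List (Op ι n)} (hops : ∀ op ∈ ops, op.WF att) {T : Tabs ι n}
    (hT : Supp att T) {l : List (Vec n)} (h : OutList M v (ops ++ finalOps att v L) T l)
    (hs : Success M v (ops ++ finalOps att v L) T) (x : Vec n) : x ∈ l ↔ Fits att T x := by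
  refine ⟨h.fits hv hL hops hT, fun hx => ?_⟩
  obtain ⟨T', h1, h2⟩ := hx.exists_leaf (M := M) (ops := ops ++ finalOps att v L) (by
    intro op hop
    rcases List.mem_append.1 hop with hop | hop
    · exact hops op hop
    · obtain ⟨i, _, rfl⟩ := List.mem_map.1 hop
      exact ⟨by simp [hv], subset_rfl⟩)
  obtain ⟨S, hS⟩ := Option.isSome_iff_exists.1 (hs T' h1)
  have := h2 v S hS
  rw [hv, mask_univ] at this
  exact (h.mem_iff x).2 ⟨T', S, h1, hS, this⟩

end Tables

/-! ### Sweeps and certificates -/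

section Game

variable {n : ℕ} {κ : Type*} [DecidableEq κ]

/-- Table `U` supports the conditional term `h(P ∪ U) - h(P)` with degree bound `d`. -/
def Has (T : Tabs (Finset (Fin n) ⊕ κ) n) (P U : Finset (Fin n)) (d : ℕ) : Prop :=
  ∃ S, T (.inl U) = some S ∧ ∀ f ∈ S, rowDeg (P ∩ U) S f ≤ d

omit [DecidableEq κ] in
theorem Has.shrink {T T' : Tabs (Finset (Fin n) ⊕ κ) n} (h : Shrinks T T')
    {P U : Finset (Fin n)} {d : ℕ} (hd : Has T P U d) : Has T' P U d := by
  obtain ⟨S, h1, h2⟩ := hd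
  obtain ⟨S', h3, h4⟩ := h _ S h1
  exact ⟨S', h4, fun f hf => (rowDeg_mono h3 f).trans (h2 f (h3 hf))⟩

theorem rowDeg_empty (S : Finset (Vec n)) (f : Vec n) : rowDeg ∅ S f = S.card := by
  rw [rowDeg, Finset.filter_true_of_mem]
  intro g _
  exact mask_eq_iff.2 (by simp)

omit [DecidableEq κ] in
theorem has_empty_iff {T : Tabs (Finset (Fin n) ⊕ κ) n} {U : Finset (Fin n)} {d : ℕ} :
    Has T ∅ U d ↔ ∃ S, T (.inl U) = some S ∧ S.card ≤ d := by
  constructor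
  · rintro ⟨S, h1, h2⟩
    refine ⟨S, h1, ?_⟩
    rcases S.eq_empty_or_nonempty with rfl | ⟨f, hf⟩
    · simp
    · simpa only [Finset.empty_inter, rowDeg_empty] using h2 f hf
  · rintro ⟨S, h1, h2⟩
    refine ⟨S, h1, fun f _ => ?_⟩
    rw [Finset.empty_inter, rowDeg_empty]
    exact h2

/-- Splitting a table decomposes its size into the size of a projection and a degree, at the price
of a factor of two. -/
theorem card_image_splitSet_le (X : Finset (Fin n)) (S : Finset (Vec n)) (i : ℕ) :
    ((splitSet X S i).image (mask X)).card * 2 ^ i ≤ 2 * S.card := by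
  have h1 : ((splitSet X S i).image (mask X)).card * (2 ^ i / 2 + 1) ≤ S.card := by
    rw [mul_comm]
    refine (Finset.mul_card_image_le_card_of_maps_to (s := S.filter fun f =>
      mask X f ∈ (splitSet X S i).image (mask X)) (f := mask X)
      (t := (splitSet X S i).image (mask X)) ?_ (2 ^ i / 2 + 1) ?_).trans
      (Finset.card_filter_le _ _)
    · intro f hf
      exact (Finset.mem_filter.1 hf).2
    · intro y hy
      obtain ⟨f, hf, rfl⟩ := Finset.mem_image.1 hy
      obtain ⟨hfS, hlo, _⟩ := Finset.mem_filter.1 hf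
      refine hlo.trans_le (Finset.card_le_card fun g hg => ?_)
      obtain ⟨hgS, hg⟩ := Finset.mem_filter.1 hg
      exact Finset.mem_filter.2 ⟨Finset.mem_filter.2 ⟨hgS, hg ▸ hy⟩, hg⟩
  have h2 : 2 ^ i ≤ 2 * (2 ^ i / 2 + 1) := by omega
  calc _ ≤ ((splitSet X S i).image (mask X)).card * (2 * (2 ^ i / 2 + 1)) :=
        Nat.mul_le_mul_left _ h2
    _ = 2 * (((splitSet X S i).image (mask X)).card * (2 ^ i / 2 + 1)) := by ring
    _ ≤ _ := Nat.mul_le_mul_left _ h1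

/-- Split table `A` over `X`, and use it to bound table `X`. -/
def splitOps (κ : Type*) (A X : Finset (Fin n)) : List (Op (Finset (Fin n) ⊕ κ) n) :=
  [.split (.inl A) X, .proj (.inl A) (.inl X) X, .semi (.inl X) (.inl A) X]

/-- Join tables `W` and `U`, or restrict table `W ∪ U` to the join. -/
def joinOps (κ : Type*) (W U : Finset (Fin n)) : List (Op (Finset (Fin n) ⊕ κ) n) :=
  [.join (.inl W) (.inl U) (.inl (W ∪ U)) W (W ∩ U), .semi (.inl (W ∪ U)) (.inl W) W,
    .semi (.inl (W ∪ U)) (.inl U) U]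

/-- All splits and all joins, one after the other. -/
noncomputable def sweep (n : ℕ) (κ : Type*) : List (Op (Finset (Fin n) ⊕ κ) n) :=
  ((Finset.univ : Finset (Finset (Fin n) × Finset (Fin n))).toList.map
      (fun p => splitOps κ p.1 (p.1 ∩ p.2)) ++
    (Finset.univ : Finset (Finset (Fin n) × Finset (Fin n))).toList.map
      (fun p => joinOps κ p.1 p.2)).flatten

theorem exists_flatten_eq_append {α : Type*} {L : List (List α)} {l : List α} (h : l ∈ L) :
    ∃ a b, L.flatten = a ++ (l ++ b) := by
  obtain ⟨a, b, rfl⟩ := List.append_of_mem h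
  exact ⟨a.flatten, b.flatten, by simp⟩

omit [DecidableEq κ] in
theorem splitOps_in_sweep (A B : Finset (Fin n)) :
    ∃ l₁ l₂, sweep n κ = l₁ ++ (splitOps κ A (A ∩ B) ++ l₂) :=
  exists_flatten_eq_append (List.mem_append_left _ (List.mem_map.2 ⟨(A, B), by simp, rfl⟩))

omit [DecidableEq κ] in
theorem joinOps_in_sweep (W U : Finset (Fin n)) :
    ∃ l₁ l₂, sweep n κ = l₁ ++ (joinOps κ W U ++ l₂) :=
  exists_flatten_eq_append (List.mem_append_right _ (List.mem_map.2 ⟨(W, U), by simp, rfl⟩))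

omit [DecidableEq κ] in
theorem sweep_wf {att : Finset (Fin n) ⊕ κ → Finset (Fin n)} (hatt : ∀ U, att (.inl U) = U) :
    ∀ op ∈ sweep n κ, op.WF att := by
  intro op hop
  obtain ⟨l, hl, hop⟩ := List.mem_flatten.1 hop
  rcases List.mem_append.1 hl with hl | hl
  · obtain ⟨⟨A, B⟩, _, rfl⟩ := List.mem_map.1 hl
    simp only [splitOps, List.mem_cons, List.not_mem_nil, or_false] at hop
    rcases hop with rfl | rfl | rfl
    · trivial
    · exact ⟨hatt _, by rw [hatt]; exact Finset.inter_subset_left⟩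
    · exact ⟨by rw [hatt], by rw [hatt]; exact Finset.inter_subset_left⟩
  · obtain ⟨⟨W, U⟩, _, rfl⟩ := List.mem_map.1 hl
    simp only [joinOps, List.mem_cons, List.not_mem_nil, or_false] at hop
    rcases hop with rfl | rfl | rfl
    · simp [Op.WF, hatt]
    · exact ⟨by rw [hatt]; exact Finset.subset_union_left, by rw [hatt]⟩
    · exact ⟨by rw [hatt]; exact Finset.subset_union_right, by rw [hatt]⟩

variable {att : Finset (Fin n) ⊕ κ → Finset (Fin n)}

/-- A split in the tables: `h(A) = h(A ∩ B) + h(A | A ∩ B)`, where the second term also supports the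
term `h(A ∪ B) - h(B)`, as required by submodularity. -/
theorem splitOps_has (hatt : ∀ U, att (.inl U) = U) {M : ℕ} {A B : Finset (Fin n)}
    {T T' : Tabs (Finset (Fin n) ⊕ κ) n} (hT' : Supp att T') {d : ℕ}
    (hd : Has T ∅ A d) (h : Leaf M (splitOps κ A (A ∩ B)) T T') :
    ∃ d₁ d₂, 1 ≤ d₁ ∧ 1 ≤ d₂ ∧ d₁ * d₂ ≤ 2 * d ∧ Has T' ∅ (A ∩ B) d₁ ∧ Has T' B A d₂ := by
  obtain ⟨T₁, h1, T₂, h2, T₃, h3, rfl⟩ := h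
  obtain ⟨S, hS, hSd⟩ := has_empty_iff.1 hd
  rcases h1 with ⟨h1, _⟩ | ⟨S', i, hS', hi, e1⟩
  · rw [hS] at h1; cases h1
  rw [hS] at hS'; cases hS'
  have hA1 : T₁ (.inl A) = some (splitSet (A ∩ B) S i) := by rw [e1, Function.update_self]
  obtain ⟨SA2, hSA2, hA2⟩ := h2.shrinks _ _ hA1
  have hX2 : ∃ R, T₂ (.inl (A ∩ B)) = some R := by
    cases h2
    rw [Function.update_self, hA1]
    cases T₁ (.inl (A ∩ B)) with
    | none => exact ⟨_, rfl⟩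
    | some R => exact ⟨_, rfl⟩
  obtain ⟨R, hR⟩ := hX2
  have hX3 : T' (.inl (A ∩ B)) = some (semiSet (A ∩ B) R SA2) := by
    cases h3
    rw [Function.update_self, hR, hA2]
    rfl
  have h2sh := h2.shrinks
  have h3sh := h3.shrinks
  refine ⟨max 1 (semiSet (A ∩ B) R SA2).card, 2 ^ i, le_max_left _ _, Nat.one_le_two_pow, ?_,
    has_empty_iff.2 ⟨_, hX3, le_max_right _ _⟩, ?_⟩
  · have hsub : semiSet (A ∩ B) R SA2 ⊆ (splitSet (A ∩ B) S i).image (mask (A ∩ B)) := by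
      intro f hf
      obtain ⟨_, g, hg, e⟩ := Finset.mem_filter.1 hf
      have hs := hT' _ _ hX3 f hf
      rw [hatt] at hs
      exact Finset.mem_image.2 ⟨g, hSA2 hg, e.trans hs⟩
    have h4 := Finset.card_le_card hsub
    have h5 := card_image_splitSet_le (A ∩ B) S i
    rcases max_choice 1 (semiSet (A ∩ B) R SA2).card with e | e
    · rw [e]
      omega
    · rw [e]
      exact (Nat.mul_le_mul_right _ h4).trans (h5.trans (by omega))
  · refine Has.shrink (h2sh.trans h3sh) ⟨_, hA1, fun f hf => ?_⟩
    rw [Finset.inter_comm]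
    exact (rowDeg_mono (Finset.filter_subset _ _) f).trans (Finset.mem_filter.1 hf).2.2

/-- A table over `W ∪ U` whose projections lie in tables over `W` and `U` has at most as many rows
as the size of the first times the degree of the second. -/
theorem card_le_of_projections {W U : Finset (Fin n)} {Z SW SU : Finset (Vec n)} {e : ℕ}
    (hU : ∀ f ∈ SU, rowDeg (W ∩ U) SU f ≤ e) (hZ : ∀ z ∈ Z, mask (W ∪ U) z = z)
    (h1 : ∀ z ∈ Z, mask W z ∈ SW) (h2 : ∀ z ∈ Z, mask U z ∈ SU) : Z.card ≤ SW.card * e := by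
  have := Finset.card_le_mul_card_image_of_maps_to (s := Z) (t := SW) (f := mask W) h1 e (by
    intro y hy
    rcases (Z.filter fun z => mask W z = y).eq_empty_or_nonempty with h0 | ⟨z0, hz0⟩
    · rw [h0]; simp
    · obtain ⟨hz0Z, rfl⟩ := Finset.mem_filter.1 hz0
      refine le_trans (Finset.card_le_card_of_injOn (mask U) ?_ ?_) (hU _ (h2 z0 hz0Z))
      · intro z hz
        obtain ⟨hz, he⟩ := Finset.mem_filter.1 (Finset.mem_coe.1 hz)
        refine Finset.mem_coe.2 (Finset.mem_filter.2 ⟨h2 z hz, ?_⟩)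
        rw [mask_mask_of_subset Finset.inter_subset_right,
          mask_mask_of_subset Finset.inter_subset_right]
        exact mask_mono Finset.inter_subset_left he
      · intro z hz z' hz' he
        obtain ⟨hz, hw⟩ := Finset.mem_filter.1 (Finset.mem_coe.1 hz)
        obtain ⟨hz', hw'⟩ := Finset.mem_filter.1 (Finset.mem_coe.1 hz')
        rw [← hZ z hz, ← hZ z' hz', mask_eq_iff]
        intro v hv
        rcases Finset.mem_union.1 hv with hv | hv
        · exact mask_eq_iff.1 (hw.trans hw'.symm) v hv
        · exact mask_eq_iff.1 he v hv)
  linarith [Nat.mul_comm e SW.card]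

theorem joinSet_projections {W U : Finset (Fin n)} {SW SU : Finset (Vec n)}
    (hW : ∀ f ∈ SW, mask W f = f) (hU : ∀ f ∈ SU, mask U f = f) {z : Vec n}
    (hz : z ∈ joinSet W (W ∩ U) SW SU) :
    mask (W ∪ U) z = z ∧ mask W z ∈ SW ∧ mask U z ∈ SU := by
  obtain ⟨⟨f, g⟩, hp, rfl⟩ := Finset.mem_image.1 hz
  obtain ⟨hp, he⟩ := Finset.mem_filter.1 hp
  obtain ⟨hf, hg⟩ := Finset.mem_product.1 hp
  simp only at hf hg he ⊢
  have eg := hU g hg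
  have ef := hW f hf
  have e1 : mask W (merge W f g) = f := by
    rw [← ef, mask_eq_iff]
    intro v hv
    simp [merge, mask, hv]
  have e2 : mask U (merge W f g) = g := by
    rw [← eg, mask_eq_iff]
    intro v hv
    by_cases hw : v ∈ W
    · simpa [merge, mask, hv, hw] using mask_eq_iff.1 he v (Finset.mem_inter.2 ⟨hw, hv⟩)
    · simp [merge, mask, hv, hw]
  refine ⟨?_, e1.symm ▸ hf, e2.symm ▸ hg⟩
  funext v
  have e3 := congrFun eg v
  by_cases hw : v ∈ W <;> by_cases hu : v ∈ U <;> simp_all [merge, mask]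

/-- A join in the tables: `h(W ∪ U) = h(W) + (h(W ∪ U) - h(W))`. -/
theorem joinOps_has (hatt : ∀ U, att (.inl U) = U) {M : ℕ} {W U : Finset (Fin n)}
    {T T' : Tabs (Finset (Fin n) ⊕ κ) n} (hT : Supp att T) {d e : ℕ}
    (hd : Has T ∅ W d) (he : Has T W U e) (hde : d * e ≤ M)
    (h : Leaf M (joinOps κ W U) T T') : Has T' ∅ (W ∪ U) (d * e) := by
  have hwf : ∀ op ∈ joinOps κ W U, op.WF att := by
    intro op hop
    obtain ⟨l₁, l₂, e⟩ := joinOps_in_sweep (κ := κ) W U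
    exact sweep_wf hatt op (by rw [e]; simp [hop])
  have hT' := hT.leaf hwf h
  obtain ⟨T₁, h1, T₂, h2, T₃, h3, rfl⟩ := h
  obtain ⟨SW, hSW, hWd⟩ := has_empty_iff.1 hd
  obtain ⟨SU, hSU, hUe⟩ := he
  have hW' : ∀ f ∈ SW, mask W f = f := fun f hf => by simpa [hatt] using hT _ _ hSW f hf
  have hU' : ∀ f ∈ SU, mask U f = f := fun f hf => by simpa [hatt] using hT _ _ hSU f hf
  have hZ1 : ∃ Z, T₁ (.inl (W ∪ U)) = some Z := by
    cases h1
    rw [Function.update_self, hSW, hSU]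
    cases T (.inl (W ∪ U)) with
    | some Z => exact ⟨Z, rfl⟩
    | none =>
      refine ⟨joinSet W (W ∩ U) SW SU, if_pos ?_⟩
      refine le_trans (card_le_of_projections hUe (fun z hz => (joinSet_projections hW' hU' hz).1)
        (fun z hz => (joinSet_projections hW' hU' hz).2.1)
        (fun z hz => (joinSet_projections hW' hU' hz).2.2)) ?_
      exact (Nat.mul_le_mul_right _ hWd).trans hde
  obtain ⟨Z1, hZ1⟩ := hZ1
  obtain ⟨SW1, sW1, hSW1⟩ := h1.shrinks _ _ hSW
  obtain ⟨Z2, sZ2, hZ2⟩ := h2.shrinks _ _ hZ1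
  obtain ⟨SU2, sU2, hSU2⟩ := (h1.shrinks.trans h2.shrinks) _ _ hSU
  obtain ⟨Z3, sZ3, hZ3⟩ := h3.shrinks _ _ hZ2
  have p2 : Z2 = semiSet W Z1 SW1 := by
    cases h2
    rw [Function.update_self, hZ1, hSW1] at hZ2
    cases hZ2
    rfl
  have p3 : Z3 = semiSet U Z2 SU2 := by
    cases h3
    rw [Function.update_self, hZ2, hSU2] at hZ3
    cases hZ3
    rfl
  refine has_empty_iff.2 ⟨Z3, hZ3, ?_⟩
  refine le_trans (card_le_of_projections hUe (W := W) (SW := SW) ?_ ?_ ?_)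
    (Nat.mul_le_mul_right _ hWd)
  · intro z hz
    simpa [hatt] using hT' _ _ hZ3 z hz
  · intro z hz
    have := sZ3 hz
    rw [p2] at this
    obtain ⟨_, g, hg, e⟩ := Finset.mem_filter.1 this
    rw [← e, hW' g (sW1 hg)]
    exact sW1 hg
  · intro z hz
    rw [p3] at hz
    obtain ⟨_, g, hg, e⟩ := Finset.mem_filter.1 hz
    rw [← e, hU' g (sU2 hg)]
    exact sU2 hg

/-- A certificate with multisets instead of multiplicities, in which every conditional term
`(P, U, d)` carries a degree bound `d`. -/
def MCert (lam : ℕ) (D : Multiset (Finset (Fin n) × Finset (Fin n) × ℕ))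
    (μ σ : Multiset (Finset (Fin n) × Finset (Fin n))) : Prop :=
  ∀ h : Finset (Fin n) → ℤ, h ∅ = 0 →
    lam * h Finset.univ + (μ.map (monoVal h)).sum + (σ.map (subVal h)).sum =
      (D.map fun t => monoVal h (t.1, t.2.1)).sum

/-- An unconditional term `h(W)` is cancelled by some other term of the identity. -/
theorem MCert.exists_cancel {lam : ℕ} {D : Multiset (Finset (Fin n) × Finset (Fin n) × ℕ)}
    {μ σ : Multiset (Finset (Fin n) × Finset (Fin n))} {W : Finset (Fin n)} {d : ℕ}
    (hW : W ≠ ∅) (hW' : W ≠ Finset.univ) (h : MCert lam ((∅, W, d) ::ₘ D) μ σ) :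
    (∃ q ∈ μ, q.1 ∪ q.2 = W) ∨ (∃ q ∈ σ, q.1 = W ∨ q.2 = W) ∨ ∃ t ∈ D, t.1 = W := by
  by_contra hc
  push Not at hc
  obtain ⟨h1, h2, h3⟩ := hc
  have e := h (fun U => if U = W then 1 else 0) (by simp [hW.symm])
  have n1 : (μ.map (monoVal fun U => if U = W then (1 : ℤ) else 0)).sum ≤ 0 := by
    rw [← neg_nonneg, ← Multiset.sum_map_neg']
    refine Multiset.sum_nonneg fun x hx => ?_
    obtain ⟨y, hy, rfl⟩ := Multiset.mem_map.1 hx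
    obtain ⟨q, hq, rfl⟩ := Multiset.mem_map.1 hy
    simp only [monoVal, h1 q hq, if_false]
    split_ifs <;> simp
  have n2 : (σ.map (subVal fun U => if U = W then (1 : ℤ) else 0)).sum ≤ 0 := by
    rw [← neg_nonneg, ← Multiset.sum_map_neg']
    refine Multiset.sum_nonneg fun x hx => ?_
    obtain ⟨y, hy, rfl⟩ := Multiset.mem_map.1 hx
    obtain ⟨q, hq, rfl⟩ := Multiset.mem_map.1 hy
    simp only [subVal, h2 q hq, if_false]
    split_ifs <;> simp
  have n3 : 0 ≤ (D.map fun t => monoVal (fun U => if U = W then (1 : ℤ) else 0)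
      (t.1, t.2.1)).sum := by
    refine Multiset.sum_nonneg fun x hx => ?_
    obtain ⟨q, hq, rfl⟩ := Multiset.mem_map.1 hx
    simp only [monoVal, h3 q hq, if_false]
    split_ifs <;> simp
  simp only [Multiset.map_cons, Multiset.sum_cons, if_neg (Ne.symm hW'), mul_zero] at e
  simp only [monoVal, Finset.empty_union, if_true, if_neg (Ne.symm hW)] at e n1 n2 n3
  linarith

/-- In a certificate with a positive multiple of `h(V)`, some unconditional term `h(U)` with `U ≠ ∅`
occurs: evaluate the identity at the polymatroid that is `1` on nonempty sets. -/
theorem MCert.exists_unconditional {lam : ℕ} (hlam : 1 ≤ lam)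
    {D : Multiset (Finset (Fin n) × Finset (Fin n) × ℕ)}
    {μ σ : Multiset (Finset (Fin n) × Finset (Fin n))} (h : MCert lam D μ σ)
    (hV : (Finset.univ : Finset (Fin n)) ≠ ∅) : ∃ t ∈ D, t.1 = ∅ ∧ t.2.1 ≠ ∅ := by
  by_contra hc
  push Not at hc
  have e := h (fun U => if U = ∅ then 0 else 1) (by simp)
  have n1 : 0 ≤ (μ.map (monoVal fun U => if U = ∅ then (0 : ℤ) else 1)).sum := by
    refine Multiset.sum_nonneg fun x hx => ?_
    obtain ⟨q, hq, rfl⟩ := Multiset.mem_map.1 hx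
    by_cases h1 : q.1 = ∅ <;> by_cases h2 : q.2 = ∅ <;>
      simp [monoVal, h1, h2, Finset.union_eq_empty]
  have n2 : 0 ≤ (σ.map (subVal fun U => if U = ∅ then (0 : ℤ) else 1)).sum := by
    refine Multiset.sum_nonneg fun x hx => ?_
    obtain ⟨q, hq, rfl⟩ := Multiset.mem_map.1 hx
    by_cases h1 : q.1 = ∅ <;> by_cases h2 : q.2 = ∅ <;>
      simp [subVal, h1, h2, Finset.union_eq_empty]
    split_ifs <;> simp
  have n3 : (D.map fun t => monoVal (fun U => if U = ∅ then (0 : ℤ) else 1)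
      (t.1, t.2.1)).sum = 0 := by
    refine Multiset.sum_eq_zero fun x hx => ?_
    obtain ⟨q, hq, rfl⟩ := Multiset.mem_map.1 hx
    by_cases h1 : q.1 = ∅
    · simp [monoVal, h1, hc q hq h1]
    · simp [monoVal, h1, Finset.union_eq_empty]
  rw [n3, if_neg hV] at e
  have : (1 : ℤ) ≤ lam := by exact_mod_cast hlam
  linarith

/-- The reset lemma: an unconditional term can be dropped from a certificate, together with at
most one of the copies of `h(V)`. -/
theorem MCert.reset : ∀ (k lam : ℕ) (D : Multiset (Finset (Fin n) × Finset (Fin n) × ℕ))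
    (μ σ : Multiset (Finset (Fin n) × Finset (Fin n))) (W : Finset (Fin n)) (d : ℕ),
    MCert lam ((∅, W, d) ::ₘ D) μ σ → 1 ≤ lam → D.card + μ.card + 3 * σ.card = k →
    ∃ lam' D' μ' σ', MCert lam' D' μ' σ' ∧ lam ≤ lam' + 1 ∧ D' ≤ D ∧
      D'.card + μ'.card + 3 * σ'.card ≤ k := by
  intro k
  induction k using Nat.strong_induction_on with
  | _ k ih =>
    intro lam D μ σ W d h hlam hk
    by_cases hW : W = ∅
    · refine ⟨lam, D, μ, σ, fun f f0 => ?_, by omega, le_rfl, hk.le⟩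
      have := h f f0
      rw [hW, Multiset.map_cons, Multiset.sum_cons] at this
      rw [this]
      simp [monoVal]
    by_cases hW' : W = Finset.univ
    · refine ⟨lam - 1, D, μ, σ, fun f f0 => ?_, by omega, le_rfl, hk.le⟩
      have := h f f0
      rw [hW', Multiset.map_cons, Multiset.sum_cons] at this
      simp only [monoVal, Finset.empty_union, f0, sub_zero] at this ⊢
      push_cast [Nat.cast_sub hlam]
      linarith
    rcases h.exists_cancel hW hW' with ⟨q, hq, e⟩ | ⟨q, hq, e⟩ | ⟨t, ht, e⟩
    · obtain ⟨μ', rfl⟩ := Multiset.exists_cons_of_mem hq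
      simp only [Multiset.card_cons] at hk
      obtain ⟨lam', D', μ'', σ', h1, h2, h3, h4⟩ := ih (k - 1) (by omega) lam D μ' σ q.1 d (by
        intro f f0
        have := h f f0
        simp only [Multiset.map_cons, Multiset.sum_cons, monoVal, Finset.empty_union, f0,
          e] at this ⊢
        linarith) hlam (by omega)
      exact ⟨lam', D', μ'', σ', h1, h2, h3, by omega⟩
    · obtain ⟨σ', rfl⟩ := Multiset.exists_cons_of_mem hq
      simp only [Multiset.card_cons] at hk
      have key : ∃ B, ∀ f : Finset (Fin n) → ℤ,
          subVal f q = f W + f B - f (W ∩ B) - f (W ∪ B) := by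
        rcases e with e | e
        · exact ⟨q.2, fun f => by rw [subVal, e]⟩
        · exact ⟨q.1, fun f => by rw [subVal, e, Finset.inter_comm, Finset.union_comm]; ring⟩
      obtain ⟨B, hB⟩ := key
      obtain ⟨lam', D', μ'', σ', h1, h2, h3, h4⟩ := ih (k - 2) (by omega) lam D
        ((W ∩ B, B) ::ₘ μ) σ' (W ∪ B) d (by
        intro f f0
        have := h f f0
        have e2 : W ∩ B ∪ B = B := Finset.union_eq_right.2 Finset.inter_subset_right
        simp only [Multiset.map_cons, Multiset.sum_cons, monoVal, Finset.empty_union, f0,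
          hB, e2] at this ⊢
        linarith) hlam (by simp only [Multiset.card_cons]; omega)
      exact ⟨lam', D', μ'', σ', h1, h2, h3, by omega⟩
    · obtain ⟨D', rfl⟩ := Multiset.exists_cons_of_mem ht
      simp only [Multiset.card_cons] at hk
      obtain ⟨lam', D'', μ'', σ', h1, h2, h3, h4⟩ := ih (k - 1) (by omega) lam D' μ σ
        (W ∪ t.2.1) d (by
        intro f f0
        have := h f f0
        simp only [Multiset.map_cons, Multiset.sum_cons, monoVal, Finset.empty_union, f0,
          e] at this ⊢
        linarith) hlam (by omega)
      exact ⟨lam', D'', μ'', σ', h1, h2, h3.trans (Multiset.le_cons_self _ _), by omega⟩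

/-- `k` sweeps. -/
noncomputable def sweeps (n : ℕ) (κ : Type*) (k : ℕ) : List (Op (Finset (Fin n) ⊕ κ) n) :=
  (List.replicate k (sweep n κ)).flatten

/-- The terms of a certificate whose degree bound is available in the tables, or exceeds the size
limit (in which case the term is unconditional). -/
def Available (M : ℕ) (T : Tabs (Finset (Fin n) ⊕ κ) n)
    (D : Multiset (Finset (Fin n) × Finset (Fin n) × ℕ)) : Prop :=
  ∀ t ∈ D, 1 ≤ t.2.2 ∧ ((t.1 = ∅ ∧ M < t.2.2) ∨ Has T t.1 t.2.1 t.2.2)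

omit [DecidableEq κ] in
theorem Available.shrink {M : ℕ} {T T' : Tabs (Finset (Fin n) ⊕ κ) n}
    {D D' : Multiset (Finset (Fin n) × Finset (Fin n) × ℕ)} (h : Available M T D)
    (hT : Shrinks T T') (hD : D' ≤ D) : Available M T' D' := fun t ht => by
  obtain ⟨h1, h2⟩ := h t (Multiset.mem_of_le hD ht)
  exact ⟨h1, h2.imp_right fun h => h.shrink hT⟩

omit [DecidableEq κ] in
theorem Available.one_le_prod {M : ℕ} {T : Tabs (Finset (Fin n) ⊕ κ) n}
    {D : Multiset (Finset (Fin n) × Finset (Fin n) × ℕ)} (h : Available M T D) :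
    1 ≤ (D.map fun t => t.2.2).prod := by
  refine Nat.one_le_iff_ne_zero.2 (Multiset.prod_ne_zero fun h0 => ?_)
  obtain ⟨t, ht, e⟩ := Multiset.mem_map.1 h0
  have := (h t ht).1
  omega

/-- Every sweep makes progress: as long as a certificate has value at most `M`, a term of it is
used up, and after as many sweeps as the certificate has terms, the table over all variables is
present. -/
theorem sweeps_success (hV : (Finset.univ : Finset (Fin n)) ≠ ∅) (hatt : ∀ U, att (.inl U) = U)
    {M : ℕ} (hM : 1 ≤ M) : ∀ (r k lam : ℕ) (T T' : Tabs (Finset (Fin n) ⊕ κ) n)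
    (D : Multiset (Finset (Fin n) × Finset (Fin n) × ℕ))
    (μ σ : Multiset (Finset (Fin n) × Finset (Fin n))), Supp att T → MCert lam D μ σ → 1 ≤ lam →
    D.card + μ.card + 3 * σ.card = r → r ≤ k → Available M T D →
    (D.map fun t => t.2.2).prod * 2 ^ r ≤ M ^ lam → Leaf M (sweeps n κ k) T T' →
    ∃ S, T' (.inl Finset.univ) = some S := by
  intro r
  induction r using Nat.strong_induction_on with
  | _ r ih =>
    intro k lam T T' D μ σ hT hcert hlam hr hrk hav hprod hleaf
    obtain ⟨⟨P, W, d⟩, ht, hP, hW⟩ := hcert.exists_unconditional hlam hV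
    simp only at hP hW
    subst hP
    obtain ⟨D, rfl⟩ := Multiset.exists_cons_of_mem ht
    simp only [Multiset.map_cons, Multiset.prod_cons, Multiset.card_cons] at hprod hr
    have havD := hav.shrink (Shrinks.refl _) (Multiset.le_cons_self D _)
    obtain ⟨hd1, hWhas⟩ := hav _ ht
    simp only [true_and] at hd1 hWhas
    by_cases hdM : M < d
    · -- the term exceeds the size limit: drop it
      obtain ⟨lam', D', μ', σ', h1, h2, h3, h4⟩ := MCert.reset _ lam D μ σ W d hcert hlam rfl
      have hav' := havD.shrink (Shrinks.refl _) h3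
      have hle : (D'.map fun t => t.2.2).prod ≤ (D.map fun t => t.2.2).prod := by
        obtain ⟨E, rfl⟩ := Multiset.le_iff_exists_add.1 h3
        rw [Multiset.map_add, Multiset.prod_add]
        refine Nat.le_mul_of_pos_right _ (Available.one_le_prod (M := M) (T := T) ?_)
        exact havD.shrink (Shrinks.refl _) (Multiset.le_add_left _ _)
      have hpw : 2 ^ (D'.card + μ'.card + 3 * σ'.card) ≤ 2 ^ r :=
        Nat.pow_le_pow_right (by norm_num) (by omega)
      have hlt : (D'.map fun t => t.2.2).prod * 2 ^ (D'.card + μ'.card + 3 * σ'.card) * M <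
          M ^ lam := by
        have a1 := hav'.one_le_prod
        calc _ ≤ (D.map fun t => t.2.2).prod * 2 ^ r * M :=
              Nat.mul_le_mul_right _ (Nat.mul_le_mul hle hpw)
          _ < (D.map fun t => t.2.2).prod * 2 ^ r * d := by
              refine Nat.mul_lt_mul_of_pos_left hdM (Nat.mul_pos ?_ (by positivity))
              exact havD.one_le_prod
          _ = d * (D.map fun t => t.2.2).prod * 2 ^ r := by ring
          _ ≤ _ := hprod
      obtain ⟨l, rfl⟩ := Nat.exists_eq_succ_of_ne_zero (Nat.one_le_iff_ne_zero.1 hlam)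
      rw [Nat.pow_succ] at hlt
      have hlt' := Nat.lt_of_mul_lt_mul_right hlt
      have hl : 1 ≤ l := by
        by_contra hc
        have : l = 0 := by omega
        subst this
        have a1 := hav'.one_le_prod
        have a2 : 1 ≤ 2 ^ (D'.card + μ'.card + 3 * σ'.card) := Nat.one_le_two_pow
        have := Nat.mul_le_mul a1 a2
        rw [pow_zero] at hlt'
        omega
      exact ih _ (by omega) k lam' T T' D' μ' σ' hT h1 (by omega) rfl (by omega) hav'
        (hlt'.le.trans (Nat.pow_le_pow_right hM (by omega))) hleaf
    have hWhas : Has T ∅ W d := hWhas.resolve_left hdM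
    by_cases hWV : W = Finset.univ
    · subst hWV
      obtain ⟨S, hS, _⟩ := hWhas
      obtain ⟨S', _, h⟩ := hleaf.shrinks _ _ hS
      exact ⟨S', h⟩
    obtain ⟨k, rfl⟩ := Nat.exists_eq_succ_of_ne_zero (show k ≠ 0 by omega)
    rw [sweeps, List.replicate_succ, List.flatten_cons] at hleaf
    obtain ⟨T₁, hsw, hrest⟩ := leaf_append.1 hleaf
    have hT1 := hT.leaf (sweep_wf hatt) hsw
    have hsh := hsw.shrinks
    have hpow : 2 ^ r = 2 * 2 ^ (r - 1) := by
      rw [← Nat.pow_succ']; congr 1; omega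
    rcases hcert.exists_cancel hW hWV with ⟨q, hq, e⟩ | ⟨q, hq, e⟩ | ⟨⟨P, U, e'⟩, ht', e⟩
    · -- monotonicity: use the projection of the table
      obtain ⟨μ', rfl⟩ := Multiset.exists_cons_of_mem hq
      simp only [Multiset.card_cons] at hr
      have hqW : q.1 ⊆ W := e ▸ Finset.subset_union_left
      obtain ⟨l₁, l₂, hl⟩ := splitOps_in_sweep (κ := κ) W q.1
      rw [hl] at hsw
      obtain ⟨Ta, ha, hsw⟩ := leaf_append.1 hsw
      obtain ⟨Tb, hb, hc⟩ := leaf_append.1 hsw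
      have wf := sweep_wf (κ := κ) hatt
      rw [hl] at wf
      have hTa := hT.leaf (fun o ho => wf o (by simp [ho])) ha
      have hTb := hTa.leaf (fun o ho => wf o (by simp [ho])) hb
      obtain ⟨d₁, d₂, g1, g2, g3, g4, g5⟩ := splitOps_has hatt hTb
        (hWhas.shrink ha.shrinks) hb
      rw [Finset.inter_eq_right.2 hqW] at g4
      have hd₁ : d₁ ≤ 2 * d := (Nat.le_mul_of_pos_right _ g2).trans g3
      refine ih (r - 1) (by omega) k lam T₁ T' ((∅, q.1, d₁) ::ₘ D) μ' σ hT1 ?_ hlam (by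
        simp only [Multiset.card_cons]; omega) (by omega) ?_ ?_ hrest
      · intro f f0
        have := hcert f f0
        simp only [Multiset.map_cons, Multiset.sum_cons, monoVal, Finset.empty_union, f0,
          e] at this ⊢
        linarith
      · intro t ht
        rcases Multiset.mem_cons.1 ht with rfl | ht
        · exact ⟨g1, Or.inr (g4.shrink hc.shrinks)⟩
        · exact havD.shrink hsh le_rfl t ht
      · simp only [Multiset.map_cons, Multiset.prod_cons]
        refine le_trans ?_ hprod
        rw [hpow]
        calc _ ≤ 2 * d * (D.map fun t => t.2.2).prod * 2 ^ (r - 1) :=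
              Nat.mul_le_mul_right _ (Nat.mul_le_mul_right _ hd₁)
          _ = _ := by ring
    · -- submodularity: split the table
      obtain ⟨σ', rfl⟩ := Multiset.exists_cons_of_mem hq
      simp only [Multiset.card_cons] at hr
      have key : ∃ B, ∀ f : Finset (Fin n) → ℤ,
          subVal f q = f W + f B - f (W ∩ B) - f (W ∪ B) := by
        rcases e with e | e
        · exact ⟨q.2, fun f => by rw [subVal, e]⟩
        · exact ⟨q.1, fun f => by rw [subVal, e, Finset.inter_comm, Finset.union_comm]; ring⟩
      obtain ⟨B, hB⟩ := key
      obtain ⟨l₁, l₂, hl⟩ := splitOps_in_sweep (κ := κ) W B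
      rw [hl] at hsw
      obtain ⟨Ta, ha, hsw⟩ := leaf_append.1 hsw
      obtain ⟨Tb, hb, hc⟩ := leaf_append.1 hsw
      have wf := sweep_wf (κ := κ) hatt
      rw [hl] at wf
      have hTa := hT.leaf (fun o ho => wf o (by simp [ho])) ha
      have hTb := hTa.leaf (fun o ho => wf o (by simp [ho])) hb
      obtain ⟨d₁, d₂, g1, g2, g3, g4, g5⟩ := splitOps_has hatt hTb
        (hWhas.shrink ha.shrinks) hb
      have hr2 : (D.card + 1 + 1) + μ.card + 3 * σ'.card ≤ r - 1 := by omega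
      refine ih _ (show (D.card + 1 + 1) + μ.card + 3 * σ'.card < r by omega) k lam T₁ T'
        ((∅, W ∩ B, d₁) ::ₘ (B, W, d₂) ::ₘ D) μ σ' hT1 ?_ hlam (by
        simp only [Multiset.card_cons]) (by omega) ?_ ?_ hrest
      · intro f f0
        have := hcert f f0
        simp only [Multiset.map_cons, Multiset.sum_cons, monoVal, Finset.empty_union, f0,
          hB, Finset.union_comm B W] at this ⊢
        linarith
      · intro t ht
        rcases Multiset.mem_cons.1 ht with rfl | ht
        · exact ⟨g1, Or.inr (g4.shrink hc.shrinks)⟩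
        · rcases Multiset.mem_cons.1 ht with rfl | ht
          · exact ⟨g2, Or.inr (g5.shrink hc.shrinks)⟩
          · exact havD.shrink hsh le_rfl t ht
      · simp only [Multiset.map_cons, Multiset.prod_cons]
        refine le_trans ?_ hprod
        rw [hpow]
        calc _ ≤ d₁ * (d₂ * (D.map fun t => t.2.2).prod) * 2 ^ (r - 1) :=
              Nat.mul_le_mul_left _ (Nat.pow_le_pow_right (by norm_num) hr2)
          _ = d₁ * d₂ * (D.map fun t => t.2.2).prod * 2 ^ (r - 1) := by ring
          _ ≤ 2 * d * (D.map fun t => t.2.2).prod * 2 ^ (r - 1) :=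
              Nat.mul_le_mul_right _ (Nat.mul_le_mul_right _ g3)
          _ = _ := by ring
    · -- a conditional term: join the two tables
      simp only at e
      subst e
      obtain ⟨D, rfl⟩ := Multiset.exists_cons_of_mem ht'
      simp only [Multiset.card_cons, Multiset.map_cons, Multiset.prod_cons] at hr hprod
      have havD' := havD.shrink (Shrinks.refl _) (Multiset.le_cons_self D _)
      obtain ⟨he1, hU⟩ := havD _ ht'
      simp only at he1 hU
      have hU : Has T P U e' := hU.resolve_left fun h => hW h.1
      refine ih (r - 1) (by omega) k lam T₁ T' ((∅, P ∪ U, d * e') ::ₘ D) μ σ hT1 ?_ hlam (by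
        simp only [Multiset.card_cons]; omega) (by omega) ?_ ?_ hrest
      · intro f f0
        have := hcert f f0
        simp only [Multiset.map_cons, Multiset.sum_cons, monoVal, Finset.empty_union, f0] at this ⊢
        linarith
      · intro t ht
        rcases Multiset.mem_cons.1 ht with rfl | ht
        · refine ⟨Nat.mul_pos hd1 he1, ?_⟩
          by_cases hde : d * e' ≤ M
          · right
            obtain ⟨l₁, l₂, hl⟩ := joinOps_in_sweep (κ := κ) P U
            rw [hl] at hsw
            obtain ⟨Ta, ha, hsw⟩ := leaf_append.1 hsw
            obtain ⟨Tb, hb, hc⟩ := leaf_append.1 hsw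
            have wf := sweep_wf (κ := κ) hatt
            rw [hl] at wf
            have hTa := hT.leaf (fun o ho => wf o (by simp [ho])) ha
            exact (joinOps_has hatt hTa (hWhas.shrink ha.shrinks) (hU.shrink ha.shrinks) hde
              hb).shrink hc.shrinks
          · exact Or.inl ⟨rfl, by simpa using hde⟩
        · exact havD'.shrink hsh le_rfl t ht
      · simp only [Multiset.map_cons, Multiset.prod_cons]
        refine le_trans ?_ hprod
        rw [hpow]
        calc d * e' * (D.map fun t => t.2.2).prod * 2 ^ (r - 1)
            ≤ 2 * (d * e' * (D.map fun t => t.2.2).prod * 2 ^ (r - 1)) := by omega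
          _ = _ := by ring

end Game

/-! ### The initial tables of an instance -/

section Instance

variable {n m : ℕ} {S : Schema n m}

/-- The vector of a tuple, with its values renamed by `κ`. -/
def encVec (κ : ℕ → ℕ) {X : Finset (Fin n)} (t : Tuple X) : Vec n :=
  fun v => if h : v ∈ X then κ (t ⟨v, h⟩) else 0

/-- The attributes of the tables: there is one table for each set of variables and one for each
atom. -/
def attrs (S : Schema n m) : Finset (Fin n) ⊕ Fin m → Finset (Fin n)
  | .inl U => U
  | .inr j => S.vars j

/-- Initially the tables of the atoms contain the given relations, and the table over the empty
set of variables contains the empty tuple. -/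
def initTabs (D : Inst S) (κ : ℕ → ℕ) : Tabs (Finset (Fin n) ⊕ Fin m) n
  | .inl U => if U = ∅ then some {0} else none
  | .inr j => some ((D j).image (encVec κ))

/-- Restrict table `U` to the projection of relation `j`. -/
def guardOps (n : ℕ) {m : ℕ} (j : Fin m) (U : Finset (Fin n)) :
    List (Op (Finset (Fin n) ⊕ Fin m) n) :=
  [.proj (.inr j) (.inl U) U, .semi (.inl U) (.inr j) U]

/-- Create the tables of all sets of variables that are contained in an atom. -/
noncomputable def initOps (S : Schema n m) : List (Op (Finset (Fin n) ⊕ Fin m) n) :=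
  ((Finset.univ.filter fun p : Fin m × Finset (Fin n) => p.2 ⊆ S.vars p.1).toList.map
    fun p => guardOps n p.1 p.2).flatten

/-- The indices of all tables. -/
noncomputable def allIdx (n m : ℕ) : List (Finset (Fin n) ⊕ Fin m) := Finset.univ.toList

/-- All operations before the final semijoins. -/
noncomputable def mainOps (S : Schema n m) (K : ℕ) : List (Op (Finset (Fin n) ⊕ Fin m) n) :=
  initOps S ++ sweeps n (Fin m) K

/-- All operations. The final semijoins with all tables remove the rows of table `V` that are not in
the output, and make the outputs of different branches disjoint. -/
noncomputable def allOps (S : Schema n m) (K : ℕ) : List (Op (Finset (Fin n) ⊕ Fin m) n) :=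
  mainOps S K ++ finalOps (attrs S) (.inl Finset.univ) (allIdx n m)

theorem mask_encVec (κ : ℕ → ℕ) {X : Finset (Fin n)} (t : Tuple X) :
    mask X (encVec κ t) = encVec κ t := by
  funext v
  by_cases h : v ∈ X <;> simp [mask, encVec, h]

theorem supp_initTabs (D : Inst S) (κ : ℕ → ℕ) : Supp (attrs S) (initTabs D κ) := by
  rintro (U | j) R hR f hf
  · simp only [initTabs] at hR
    split_ifs at hR
    cases hR
    rw [Finset.mem_singleton] at hf
    subst hf
    funext v
    simp [mask]
  · cases hR
    obtain ⟨t, _, rfl⟩ := Finset.mem_image.1 hf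
    exact mask_encVec κ t

theorem initOps_wf : ∀ op ∈ initOps S, op.WF (attrs S) := by
  intro op hop
  obtain ⟨l, hl, hop⟩ := List.mem_flatten.1 hop
  obtain ⟨⟨j, U⟩, hp, rfl⟩ := List.mem_map.1 hl
  have hU : U ⊆ S.vars j := (Finset.mem_filter.1 (Finset.mem_toList.1 hp)).2
  simp only [guardOps, List.mem_cons, List.not_mem_nil, or_false] at hop
  rcases hop with rfl | rfl
  · exact ⟨rfl, hU⟩
  · exact ⟨subset_rfl, hU⟩

theorem sweeps_wf (k : ℕ) : ∀ op ∈ sweeps n (Fin m) k, op.WF (attrs S) := by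
  intro op hop
  obtain ⟨l, hl, hop⟩ := List.mem_flatten.1 hop
  rw [List.eq_of_mem_replicate hl] at hop
  exact sweep_wf (fun U => rfl) op hop

theorem mainOps_wf (K : ℕ) : ∀ op ∈ mainOps S K, op.WF (attrs S) := by
  intro op hop
  rcases List.mem_append.1 hop with h | h
  · exact initOps_wf op h
  · exact sweeps_wf K op h

/-- The initial operations leave the tables of the atoms unchanged. -/
theorem initOps_inr {M : ℕ} {T T' : Tabs (Finset (Fin n) ⊕ Fin m) n} {l l' : List _}
    (hl : initOps S = l ++ l') (h : Leaf M l T T') (j : Fin m) : T' (.inr j) = T (.inr j) := by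
  have hmem : ∀ op ∈ l, op ∈ initOps S := fun op hop => by rw [hl]; simp [hop]
  clear hl
  induction l generalizing T with
  | nil => cases h; rfl
  | cons op l ih =>
    obtain ⟨T₁, h1, h2⟩ := h
    rw [ih h2 fun o ho => hmem o (by simp [ho])]
    obtain ⟨l₀, hl₀, hop⟩ := List.mem_flatten.1 (hmem op (by simp))
    obtain ⟨⟨j', U⟩, hp, rfl⟩ := List.mem_map.1 hl₀
    simp only [guardOps, List.mem_cons, List.not_mem_nil, or_false] at hop
    rcases hop with rfl | rfl <;> cases h1 <;> simp

/-- After the initial operations, there is a table over each subset `U` of an atom, within the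
projection of the relation of that atom. -/
theorem initOps_table {M : ℕ} {D : Inst S} {κ : ℕ → ℕ} {T' : Tabs (Finset (Fin n) ⊕ Fin m) n}
    (h : Leaf M (initOps S) (initTabs D κ) T') {j : Fin m} {U : Finset (Fin n)}
    (hU : U ⊆ S.vars j) :
    ∃ R ⊆ ((D j).image (encVec κ)).image (mask U), T' (.inl U) = some R := by
  obtain ⟨a, b, hab⟩ : ∃ a b, initOps S = a ++ (guardOps n j U ++ b) :=
    exists_flatten_eq_append (List.mem_map.2 ⟨(j, U), Finset.mem_toList.2
      (Finset.mem_filter.2 ⟨Finset.mem_univ _, hU⟩), rfl⟩)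
  have h' := h
  rw [hab] at h
  obtain ⟨Ta, ha, h⟩ := leaf_append.1 h
  obtain ⟨Tb, hb, hc⟩ := leaf_append.1 h
  have hj := initOps_inr hab ha j
  have hwf := initOps_wf (S := S)
  rw [hab] at hwf
  have hTa := (supp_initTabs D κ).leaf (fun o ho => hwf o (by simp [ho])) ha
  have hTb := hTa.leaf (fun o ho => hwf o (by simp [ho])) hb
  obtain ⟨T₁, h1, T₂, h2, rfl⟩ := hb
  have hU1 : ∃ R, T₁ (.inl U) = some R := by
    cases h1
    rw [Function.update_self, hj]
    cases Ta (.inl U) with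
    | none => exact ⟨_, rfl⟩
    | some R => exact ⟨_, rfl⟩
  obtain ⟨R, hR⟩ := hU1
  have hj1 : T₁ (.inr j) = some ((D j).image (encVec κ)) := by
    cases h1
    rw [Function.update_of_ne (by simp), hj]
    rfl
  have hU2 : Tb (.inl U) = some (semiSet U R ((D j).image (encVec κ))) := by
    cases h2
    rw [Function.update_self, hR, hj1]
    rfl
  obtain ⟨R', hR', e⟩ := hc.shrinks _ _ hU2
  refine ⟨R', fun f hf => ?_, e⟩
  have hf := hR' hf
  obtain ⟨_, g, hg, e⟩ := Finset.mem_filter.1 hf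
  exact Finset.mem_image.2 ⟨g, hg, e.trans (hTb _ _ hU2 f hf)⟩

/-- The values that occur in the relations of an instance. -/
def Inst.vals (D : Inst S) : Set ℕ := {a | ∃ j, ∃ r ∈ D j, ∃ v, r v = a}

/-- A finite degree of a nonempty relation is positive, and it bounds only variables of that
relation. -/
theorem deg_guard {A : Finset (Fin n)} {R : Finset (Tuple A)} (hR : R.Nonempty) {δ : Mon n} {d : ℕ}
    (hd : deg R δ = d) : 1 ≤ d ∧ δ.Y ⊆ A := by
  obtain ⟨r, hr⟩ := hR
  let ext : ℕ → (Fin n → ℕ) := fun a v => if h : v ∈ A then r ⟨v, h⟩ else a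
  let x : Tuple δ.X := proj δ.X (ext 0)
  have hx : degAt R δ x ≤ d := by rw [← hd]; exact le_iSup (fun x => degAt R δ x) x
  constructor
  · have : 1 ≤ degAt R δ x := by
      rw [degAt, Set.one_le_encard_iff_nonempty]
      refine ⟨proj _ (ext 0), ⟨r, hr, fun v hZ hA => ?_⟩, fun v hv => rfl⟩
      simp [proj, ext, hA]
    exact_mod_cast this.trans hx
  · by_contra hc
    obtain ⟨v, hv, hvA⟩ := Finset.not_subset.1 hc
    have hvX : v ∉ δ.X := fun h => Finset.disjoint_left.1 δ.disj h hv
    have hinf : degAt R δ x = ⊤ := by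
      rw [degAt, Set.encard_eq_top_iff]
      refine Set.infinite_of_injective_forall_mem
        (f := fun a : ℕ => proj (δ.X ∪ δ.Y) (Function.update (ext 0) v a)) ?_ ?_
      · intro a b hab
        simpa using proj_eq_iff.1 hab v (Finset.mem_union_right _ hv)
      · intro a
        refine ⟨⟨r, hr, fun u hZ hA => ?_⟩, fun u hu => ?_⟩
        · have : u ≠ v := fun e => hvA (e ▸ hA)
          simp [proj, ext, hA, this]
        · have : u ≠ v := fun e => hvX (e ▸ hu)
          simp [proj, x, this]
    rw [hinf] at hx
    simp at hx

/-- In the representation by vectors, the degree of a relation bounds the degrees in its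
projection to the variables of the constraint that it contains. -/
theorem rowDeg_image_le {D : Inst S} {κ : ℕ → ℕ} (hκ : Set.InjOn κ D.vals) {j : Fin m} {δ : Mon n}
    {d : ℕ} (hd : deg (D j) δ = d) (hY : δ.Y ⊆ S.vars j) {f : Vec n}
    (hf : f ∈ ((D j).image (encVec κ)).image (mask (δ.Y ∪ (δ.X ∩ S.vars j)))) :
    rowDeg (δ.X ∩ (δ.Y ∪ (δ.X ∩ S.vars j)))
      (((D j).image (encVec κ)).image (mask (δ.Y ∪ (δ.X ∩ S.vars j)))) f ≤ d := by
  set U := δ.Y ∪ (δ.X ∩ S.vars j) with hU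
  have hUA : U ⊆ S.vars j := Finset.union_subset hY Finset.inter_subset_right
  obtain ⟨_, hf', rfl⟩ := Finset.mem_image.1 hf
  obtain ⟨r, hr, rfl⟩ := Finset.mem_image.1 hf'
  clear hf hf'
  let x : Tuple δ.X := fun v => if h : v.1 ∈ S.vars j then r ⟨v.1, h⟩ else 0
  have hx : degAt (D j) δ x ≤ d := by rw [← hd]; exact le_iSup (fun x => degAt (D j) δ x) x
  let φ : Tuple (δ.X ∪ δ.Y) → Vec n := fun t v =>
    if h : v ∈ δ.X ∪ δ.Y then (if v ∈ U then κ (t ⟨v, h⟩) else 0) else 0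
  have hUXY : U ⊆ δ.X ∪ δ.Y := by
    intro v hv
    simp only [hU, Finset.mem_union, Finset.mem_inter] at hv ⊢
    tauto
  have hsub : ((((D j).image (encVec κ)).image (mask U)).filter fun g =>
      mask (δ.X ∩ U) g = mask (δ.X ∩ U) (mask U (encVec κ r)) : Set (Vec n)) ⊆
      φ '' {t | t ∈ restrict (D j) (δ.X ∪ δ.Y) ∧
        ∀ (v : Fin n) (hv : v ∈ δ.X), t ⟨v, Finset.mem_union_left δ.Y hv⟩ = x ⟨v, hv⟩} := by
    intro g hg
    obtain ⟨hg, he⟩ := Finset.mem_filter.1 (Finset.mem_coe.1 hg)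
    obtain ⟨_, hg', rfl⟩ := Finset.mem_image.1 hg
    obtain ⟨r', hr', rfl⟩ := Finset.mem_image.1 hg'
    rw [mask_mask_of_subset Finset.inter_subset_right,
      mask_mask_of_subset Finset.inter_subset_right, mask_eq_iff] at he
    have hrr : ∀ v (hX : v ∈ δ.X) (hA : v ∈ S.vars j), r' ⟨v, hA⟩ = r ⟨v, hA⟩ := by
      intro v hX hA
      have := he v (by simp [hU, hX, hA])
      simp only [encVec, hA, dif_pos] at this
      exact hκ ⟨j, r', hr', _, rfl⟩ ⟨j, r, hr, _, rfl⟩ this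
    refine ⟨fun v => if h : v.1 ∈ S.vars j then r' ⟨v.1, h⟩ else 0,
      ⟨⟨r', hr', fun v hZ hA => by simp [hA]⟩, fun v hv => ?_⟩, ?_⟩
    · by_cases hA : v ∈ S.vars j
      · simp [x, hA, hrr v hv hA]
      · simp [x, hA]
    · funext v
      by_cases hv : v ∈ U
      · simp [φ, Finset.mem_union.1 (hUXY hv), hv, mask, encVec, hUA hv]
      · simp [φ, hv, mask]
  have h1 := (Set.encard_le_encard hsub).trans ((Set.encard_image_le _ _).trans hx)
  rw [Set.encard_coe_eq_coe_finsetCard] at h1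
  exact_mod_cast h1

/-- The multiset in which `f q` occurs `k q` times. -/
def multi {α β : Type*} [Fintype α] (k : α → ℕ) (f : α → β) : Multiset β :=
  (Finset.univ : Finset α).val.bind fun q => Multiset.replicate (k q) (f q)

theorem card_multi {α β : Type*} [Fintype α] (k : α → ℕ) (f : α → β) :
    (multi k f).card = ∑ q, k q := by
  simp only [multi, Multiset.card_bind, Function.comp_def, Multiset.card_replicate]
  rfl

theorem sum_map_multi {α β R : Type*} [Fintype α] [CommSemiring R] (k : α → ℕ) (f : α → β)
    (g : β → R) : ((multi k f).map g).sum = ∑ q, (k q : R) * g (f q) := by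
  simp only [multi, Multiset.map_bind, Multiset.map_replicate, Multiset.sum_bind,
    Multiset.sum_replicate, nsmul_eq_mul]
  rfl

theorem prod_map_multi {α β R : Type*} [Fintype α] [CommSemiring R] (k : α → ℕ) (f : α → β)
    (g : β → R) : ((multi k f).map g).prod = ∏ q, g (f q) ^ k q := by
  simp only [multi, Multiset.map_bind, Multiset.map_replicate, Multiset.prod_bind,
    Multiset.prod_replicate]
  rfl

theorem mem_multi {α β : Type*} [Fintype α] {k : α → ℕ} {f : α → β} {b : β} (h : b ∈ multi k f) :
    ∃ q, k q ≠ 0 ∧ f q = b := by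
  obtain ⟨q, _, h⟩ := Multiset.mem_bind.1 h
  obtain ⟨h1, h2⟩ := Multiset.mem_replicate.1 h
  exact ⟨q, h1, h2.symm⟩

theorem Mon.pair_injective :
    Function.Injective fun δ : Mon n => ((δ.X, δ.Y) : Finset (Fin n) × Finset (Fin n)) := by
  rintro ⟨Y, X, h⟩ ⟨Y', X', h'⟩ e
  simp only [Prod.mk.injEq] at e
  obtain ⟨rfl, rfl⟩ := e
  rfl

theorem bound_eq_exp {Δ : Finset (Mon n)} {N w : Mon n → ℝ≥0} (hN : ∀ δ ∈ Δ, (0 : ℝ) < N δ) :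
    (bound Δ N w : ℝ) = Real.exp (∑ δ ∈ Δ, (w δ : ℝ) * Real.log (N δ)) := by
  rw [bound, NNReal.coe_prod, Real.exp_sum]
  refine Finset.prod_congr rfl fun δ hδ => ?_
  rw [NNReal.coe_rpow, Real.rpow_def_of_pos (hN δ hδ), mul_comm]

/-- Within a size limit that exceeds the polymatroid bound by a constant factor, the table over
all variables is present in all branches. -/
theorem exists_success (n : ℕ) : ∃ K : ℕ, ∀ {m : ℕ} (S : Schema n m) (D : Inst S) (κ : ℕ → ℕ),
    (∀ j, (D j).Nonempty) → Set.InjOn κ D.vals → ∀ (Δ : Finset (Mon n)) (N w : Mon n → ℝ≥0),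
    D.Satisfies Δ N → IsShannon Δ w → ∀ M : ℕ, 2 ^ (K + 1) * (bound Δ N w : ℝ) ≤ M → 1 ≤ M →
    Success M (.inl Finset.univ) (allOps S K) (initTabs D κ) := by
  classical
  obtain ⟨K, hK⟩ := exists_bounded_cert n
  refine ⟨K, fun {m} S D κ hne hκ Δ N w hsat hsh M hM hM1 T' hT' => ?_⟩
  rw [allOps] at hT'
  obtain ⟨T2, hT2, hfin⟩ := leaf_append.1 hT'
  suffices h : ∃ R, T2 (.inl Finset.univ) = some R by
    obtain ⟨R, hR⟩ := h
    obtain ⟨R', _, hR'⟩ := hfin.shrinks _ _ hR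
    rw [hR']; rfl
  by_cases hV : (Finset.univ : Finset (Fin n)) = ∅
  · obtain ⟨R', _, hR'⟩ := hT2.shrinks (.inl Finset.univ) {0} (by simp [initTabs, hV])
    exact ⟨R', hR'⟩
  obtain ⟨T1, hT1, hsw⟩ := leaf_append.1 hT2
  -- the data of a guard for each constraint
  have hguard : ∀ δ : Mon n, ∃ (U : Finset (Fin n)) (d : ℕ), δ ∈ Δ →
      1 ≤ d ∧ (d : ℝ) ≤ N δ ∧ δ.X ∪ U = δ.X ∪ δ.Y ∧ Has T1 δ.X U d := by
    intro δ
    by_cases hδ : δ ∈ Δ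
    · obtain ⟨j, d, hd, hdN⟩ := hsat.exists_guard hδ
      obtain ⟨hd1, hY⟩ := deg_guard (hne j) hd
      refine ⟨δ.Y ∪ (δ.X ∩ S.vars j), d, fun _ => ⟨hd1, by exact_mod_cast hdN, ?_, ?_⟩⟩
      · ext v; simp only [Finset.mem_union, Finset.mem_inter]; tauto
      · obtain ⟨R, hR, e⟩ := initOps_table hT1
          (Finset.union_subset hY (Finset.inter_subset_right (s₁ := δ.X)))
        exact ⟨R, e, fun f hf => (rowDeg_mono hR f).trans (rowDeg_image_le hκ hd hY (hR hf))⟩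
    · exact ⟨∅, 0, fun h => absurd h hδ⟩
  choose U d hUd using hguard
  let pr : Mon n → Finset (Fin n) × Finset (Fin n) := fun δ => (δ.X, δ.Y)
  have : Nonempty (Mon n) := ⟨⟨∅, ∅, by simp⟩⟩
  let inv := Function.invFun pr
  have hinv : ∀ δ, inv (pr δ) = δ := Function.leftInverse_invFun Mon.pair_injective
  let c : Finset (Fin n) × Finset (Fin n) → ℝ := fun p =>
    if p ∈ Δ.image pr then Real.log (d (inv p)) else 0
  let w' : Finset (Fin n) × Finset (Fin n) → ℝ := fun p => w (inv p)
  have hsum : ∀ g : Finset (Fin n) × Finset (Fin n) → ℝ,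
      ∑ p ∈ Δ.image pr, w' p * g p = ∑ δ ∈ Δ, (w δ : ℝ) * g (pr δ) := by
    intro g
    rw [Finset.sum_image (fun a _ b _ h => Mon.pair_injective h)]
    refine Finset.sum_congr rfl fun δ _ => ?_
    change (w (inv (pr δ)) : ℝ) * _ = _
    rw [hinv]
  obtain ⟨x, ⟨hx1, hx2, hx3⟩, hxΔ, hxK⟩ := hK (Δ.image pr) w' (fun p => NNReal.coe_nonneg _)
    (fun h hh => by rw [hsum]; exact hsh h hh) c (fun p => by
      simp only [c]
      split_ifs with hp
      · obtain ⟨δ, hδ, rfl⟩ := Finset.mem_image.1 hp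
        rw [hinv]
        exact Real.log_nonneg (by exact_mod_cast (hUd δ hδ).1)
      · exact le_rfl) (Real.log 2) (Real.log_pos (by norm_num))
  have hN : ∀ δ ∈ Δ, (1 : ℝ) ≤ N δ := fun δ hδ =>
    le_trans (by exact_mod_cast (hUd δ hδ).1) (hUd δ hδ).2.1
  have hval : ∑ p ∈ Δ.image pr, w' p * c p ≤ ∑ δ ∈ Δ, (w δ : ℝ) * Real.log (N δ) := by
    rw [hsum]
    refine Finset.sum_le_sum fun δ hδ => mul_le_mul_of_nonneg_left ?_ (NNReal.coe_nonneg _)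
    simp only [c, Finset.mem_image_of_mem pr hδ, if_true, hinv]
    exact Real.log_le_log (by exact_mod_cast (hUd δ hδ).1) (hUd δ hδ).2.1
  set B := (bound Δ N w : ℝ) with hB
  have hBexp := bound_eq_exp (w := w) (fun δ hδ => lt_of_lt_of_le one_pos (hN δ hδ))
  rw [← hB] at hBexp
  have hB0 : 0 < B := by rw [hBexp]; exact Real.exp_pos _
  let term : Finset (Fin n) × Finset (Fin n) → Finset (Fin n) × Finset (Fin n) × ℕ :=
    fun q => (q.1, U (inv q), d (inv q))
  have hsupp : ∀ q, x.2.1 q ≠ 0 → ∃ δ ∈ Δ, q = pr δ ∧ inv q = δ := by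
    intro q hq
    obtain ⟨δ, hδ, rfl⟩ := Finset.mem_image.1 (hxΔ q hq)
    exact ⟨δ, hδ, rfl, hinv δ⟩
  refine sweeps_success hV (att := attrs S) (fun U => rfl) hM1 _ K x.1 T1 T2 (multi x.2.1 term)
    (multi x.2.2.1 id) (multi x.2.2.2 id)
    ((supp_initTabs D κ).leaf initOps_wf hT1) ?_ hx2 rfl ?_ ?_ ?_ hsw
  · intro h h0
    rw [sum_map_multi, sum_map_multi, sum_map_multi]
    have := hx1 h h0
    simp only [id]
    rw [this]
    refine Finset.sum_congr rfl fun q _ => ?_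
    by_cases hq : x.2.1 q = 0
    · simp [hq]
    · obtain ⟨δ, hδ, rfl, e⟩ := hsupp q hq
      simp only [term, e, monoVal, pr, (hUd δ hδ).2.2.1]
  · rw [card_multi, card_multi, card_multi]
    exact hxK
  · intro t ht
    obtain ⟨q, hq, rfl⟩ := mem_multi ht
    obtain ⟨δ, hδ, rfl, e⟩ := hsupp q hq
    simp only [term, e, pr]
    exact ⟨(hUd δ hδ).1, Or.inr (hUd δ hδ).2.2.2⟩
  · rw [card_multi, card_multi, card_multi, prod_map_multi]
    have hprod : ((∏ q, (term q).2.2 ^ x.2.1 q : ℕ) : ℝ) =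
        Real.exp (∑ q, (x.2.1 q : ℝ) * c q) := by
      rw [Real.exp_sum]
      push_cast
      refine Finset.prod_congr rfl fun q _ => ?_
      by_cases hq : x.2.1 q = 0
      · simp [hq]
      · obtain ⟨δ, hδ, rfl, e⟩ := hsupp q hq
        have hpos : (0 : ℝ) < d δ := by exact_mod_cast (hUd δ hδ).1
        simp only [term, c, e, Finset.mem_image_of_mem pr hδ, if_true]
        rw [mul_comm, Real.exp_mul, Real.exp_log hpos, Real.rpow_natCast]
    have h1 : Real.exp (∑ q, (x.2.1 q : ℝ) * c q) ≤ (2 * B) ^ x.1 := by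
      have e2 : (2 * B) = Real.exp (∑ δ ∈ Δ, (w δ : ℝ) * Real.log (N δ) + Real.log 2) := by
        rw [Real.exp_add, ← hBexp, Real.exp_log (by norm_num), mul_comm]
      rw [e2, ← Real.exp_nat_mul]
      refine Real.exp_le_exp.2 (hx3.trans (mul_le_mul_of_nonneg_left ?_ (Nat.cast_nonneg _)))
      linarith
    have h2 : (2 : ℝ) ^ (∑ q, x.2.1 q + ∑ q, x.2.2.1 q + 3 * ∑ q, x.2.2.2 q) ≤ (2 ^ K) ^ x.1 := by
      rw [← pow_mul]
      refine pow_le_pow_right₀ (by norm_num) (hxK.trans ?_)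
      exact Nat.le_mul_of_pos_right _ hx2
    have h3 : ((2 * B) ^ x.1 * (2 ^ K) ^ x.1 : ℝ) ≤ (M : ℝ) ^ x.1 := by
      rw [← mul_pow]
      refine pow_le_pow_left₀ (by positivity) ?_ _
      calc 2 * B * 2 ^ K = 2 ^ (K + 1) * B := by ring
        _ ≤ M := hM
    have h4 : ((∏ q, (term q).2.2 ^ x.2.1 q : ℕ) : ℝ) *
        2 ^ (∑ q, x.2.1 q + ∑ q, x.2.2.1 q + 3 * ∑ q, x.2.2.2 q) ≤ (M : ℝ) ^ x.1 := by
      rw [hprod]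
      exact (mul_le_mul h1 h2 (by positivity) (by positivity)).trans h3
    exact_mod_cast h4

/-- The trivial constraints by the sizes of the relations: the polymatroid bound is at most a
power of the size of the instance. -/
theorem exists_trivial_bound (D : Inst S) :
    ∃ (Δ : Finset (Mon n)) (N w : Mon n → ℝ≥0), D.Satisfies Δ N ∧ IsShannon Δ w ∧
      (bound Δ N w : ℝ) ≤ ((D.size : ℝ) + 1) ^ m := by
  classical
  let e : Fin m → Mon n := fun j => ⟨S.vars j, ∅, by simp⟩
  refine ⟨Finset.univ.image e, fun _ => D.size, fun _ => 1, ?_, ?_, ?_⟩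
  · intro δ hδ
    obtain ⟨j, _, rfl⟩ := Finset.mem_image.1 hδ
    have h1 : Panda.deg (D j) (e j) ≤ (D.size : ℕ∞) := by
      refine iSup_le fun x => ?_
      have hsub : {t : Tuple ((e j).X ∪ (e j).Y) | t ∈ restrict (D j) ((e j).X ∪ (e j).Y) ∧
          ∀ (v : Fin n) (hv : v ∈ (e j).X), t ⟨v, Finset.mem_union_left (e j).Y hv⟩ = x ⟨v, hv⟩} ⊆
          (fun (r : Tuple (S.vars j)) (v : {v // v ∈ (e j).X ∪ (e j).Y}) =>
            r ⟨v.1, by simpa [e] using v.2⟩) '' (D j : Set (Tuple (S.vars j))) := by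
        rintro t ⟨⟨r, hr, ht⟩, _⟩
        refine ⟨r, hr, funext fun v => (ht v.1 v.2 (by simpa [e] using v.2)).symm⟩
      refine (Set.encard_le_encard hsub).trans ((Set.encard_image_le _ _).trans ?_)
      rw [Set.encard_coe_eq_coe_finsetCard]
      have : (D j).card ≤ D.size := Finset.single_le_sum (f := fun j => (D j).card)
        (fun _ _ => Nat.zero_le _) (Finset.mem_univ j)
      exact_mod_cast this
    have h2 : D.deg (e j) ≤ (D.size : ℕ∞) := (iInf_le _ j).trans h1
    have h3 : ((D.deg (e j) : ℕ∞) : ℝ≥0∞) ≤ ((D.size : ℕ∞) : ℝ≥0∞) := by exact_mod_cast h2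
    simpa using h3
  · intro h hh
    have hmono : ∀ A B : Finset (Fin n), A ⊆ B → h A ≤ h B := by
      intro A B hAB
      have := hh.mono ⟨B \ A, A, Finset.disjoint_sdiff⟩
      simp only [Mon.eval, Finset.union_sdiff_of_subset hAB] at this
      linarith
    have hsub : ∀ A B : Finset (Fin n), h (A ∪ B) ≤ h A + h B := by
      intro A B
      have := hh.submod ⟨A, B \ A, ∅, by simp, by simp, Finset.disjoint_sdiff⟩
      simp only [Submod.eval, Finset.empty_union, hh.empty, Finset.union_sdiff_self_eq_union]
        at this
      have := hmono (B \ A) B Finset.sdiff_subset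
      linarith
    have hall : ∀ s : Finset (Mon n), (∀ δ ∈ s, δ.X = ∅) →
        h (s.biUnion Mon.Y) ≤ ∑ δ ∈ s, ((1 : ℝ≥0) : ℝ) * δ.eval h := by
      intro s
      induction s using Finset.induction_on with
      | empty => simp [hh.empty]
      | insert δ s hδ ih =>
        intro hs
        rw [Finset.biUnion_insert, Finset.sum_insert hδ]
        have h1 := hsub δ.Y (s.biUnion Mon.Y)
        have h2 := ih fun δ' h' => hs δ' (Finset.mem_insert_of_mem h')
        have h3 : δ.eval h = h δ.Y := by
          simp [Mon.eval, hs δ (Finset.mem_insert_self _ _), hh.empty]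
        rw [h3]
        simp only [NNReal.coe_one, one_mul] at h2 ⊢
        linarith
    have h1 := hall (Finset.univ.image e) (by
      intro δ hδ
      obtain ⟨j, _, rfl⟩ := Finset.mem_image.1 hδ
      rfl)
    have h2 : (Finset.univ.image e).biUnion Mon.Y = Finset.univ := by
      refine Finset.eq_univ_iff_forall.2 fun v => ?_
      obtain ⟨j, hj⟩ := S.covers v
      exact Finset.mem_biUnion.2 ⟨e j, Finset.mem_image_of_mem _ (Finset.mem_univ j), hj⟩
    rwa [h2] at h1
  · simp only [bound, NNReal.coe_one, NNReal.rpow_one, Finset.prod_const]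
    push_cast
    have h1 : (D.size : ℝ) ^ (Finset.univ.image e).card ≤
        ((D.size : ℝ) + 1) ^ (Finset.univ.image e).card :=
      pow_le_pow_left₀ (Nat.cast_nonneg _) (by linarith) _
    refine h1.trans (pow_le_pow_right₀ ?_ ?_)
    · have : (0 : ℝ) ≤ D.size := Nat.cast_nonneg _
      linarith
    · exact Finset.card_image_le.trans (by simp)

/-- When all relations are nonempty, the bound of a valid constraint set is at least `1`. -/
theorem one_le_bound (D : Inst S) (hne : ∀ j, (D j).Nonempty) {Δ : Finset (Mon n)}
    {N w : Mon n → ℝ≥0} (hsat : D.Satisfies Δ N) : (1 : ℝ) ≤ bound Δ N w := by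
  have : (1 : ℝ≥0) ≤ bound Δ N w := by
    refine Finset.one_le_prod' fun δ hδ => ?_
    obtain ⟨j, d, hd, hdN⟩ := hsat.exists_guard hδ
    have h1 : (1 : ℝ≥0) ≤ d := by exact_mod_cast (deg_guard (hne j) hd).1
    exact NNReal.one_le_rpow (h1.trans hdN) (NNReal.coe_nonneg _)
  exact_mod_cast this

end Instance

/-! ### Program logic for the machine -/

section Logic

/-- Names of the registers. Apart from the output length, the input length (register `0`) is not
used. The registers `x v` and `y v` hold vectors, `len b` and `pres b` belong to bank `b` of the
memory for tables, and `lo b` and `hi b` are the limits of a degree bucket. -/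
inductive Rg
  | out | junk | nd | z | zh | pb | ch | ncnt | idx | rem | ct | lo0 | hi0 | t1 | t2 | jj | bud
  | left | ok | fail | ocnt | go | idn | val | ptr | hlf | ne
  | x (v : ℕ) | y (v : ℕ) | len (b : ℕ) | pres (b : ℕ) | lo (b : ℕ) | hi (b : ℕ)
  deriving DecidableEq

/-- The number of a register; register `1` holds the length of the output. -/
def Rg.code : Rg → ℕ
  | .out => 1
  | .junk => 8 | .nd => 16 | .z => 24 | .zh => 32 | .pb => 40 | .ch => 48 | .ncnt => 56
  | .idx => 64 | .rem => 72 | .ct => 80 | .lo0 => 88 | .hi0 => 96 | .t1 => 104 | .t2 => 112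
  | .jj => 120 | .bud => 128 | .left => 136 | .ok => 144 | .fail => 152 | .ocnt => 160
  | .go => 168 | .idn => 176 | .val => 184 | .ptr => 192 | .hlf => 200 | .ne => 208
  | .x v => 8 * v + 2 | .y v => 8 * v + 3 | .len b => 8 * b + 4 | .pres b => 8 * b + 5
  | .lo b => 8 * b + 6 | .hi b => 8 * b + 7

theorem Rg.code_injective : Function.Injective Rg.code := by
  intro a b h
  cases a <;> cases b <;> simp only [Rg.code] at h <;> first | rfl | omega | (congr 1; omega)

/-- Names of the arrays: input, output, the quotients and remainders modulo two, the renaming of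
values and its inverse, counters and heads of lists for groups of rows, links of these lists, the
edges of the dictionary, and the columns of the banks. -/
inductive Ar
  | inp | out | half | par | cmp | dec | cnt | head | nxt
  | chl (v e : ℕ) | col (b v : ℕ)
  deriving DecidableEq

/-- The number of an array; the input is in array `0` and the output in array `1`. -/
def Ar.code : Ar → ℕ
  | .inp => 0 | .out => 1 | .half => 8 | .par => 16 | .cmp => 24 | .dec => 32 | .cnt => 40
  | .head => 48 | .nxt => 56
  | .chl v e => 8 * Nat.pair v e + 2 | .col b v => 8 * Nat.pair b v + 3

theorem Ar.code_injective : Function.Injective Ar.code := by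
  intro a b h
  cases a <;> cases b <;> simp only [Ar.code] at h <;> first | rfl | omega | skip
  · rename_i v e v' e'
    obtain ⟨rfl, rfl⟩ := Nat.pair_eq_pair.1 (show Nat.pair v e = Nat.pair v' e' by omega)
    rfl
  · rename_i v e v' e'
    obtain ⟨rfl, rfl⟩ := Nat.pair_eq_pair.1 (show Nat.pair v e = Nat.pair v' e' by omega)
    rfl

/-- The contents of a named register. -/
def State.r (s : State) (a : Rg) : ℕ := s.reg a.code

/-- The contents of the named arrays. -/
def State.m (s : State) (a : Ar) (i : ℕ) : ℕ := s.arr a.code i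

/-- Write `c` into a named register. -/
def State.setr (s : State) (a : Rg) (c : ℕ) : State := s.setReg a.code c

/-- Write `c` into cell `i` of a named array. -/
def State.setm (s : State) (a : Ar) (i c : ℕ) : State := s.setArr a.code i c

@[simp] theorem State.r_setr (s : State) (a b : Rg) (c : ℕ) [Decidable (b = a)] :
    (s.setr a c).r b = if b = a then c else s.r b := by
  simp only [State.r, State.setr, State.setReg, Function.update_apply, Rg.code_injective.eq_iff]

@[simp] theorem State.m_setr (s : State) (a : Rg) (c : ℕ) : (s.setr a c).m = s.m := rfl

@[simp] theorem State.r_setm (s : State) (a : Ar) (i c : ℕ) : (s.setm a i c).r = s.r := rfl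

theorem State.m_setm (s : State) (a b : Ar) (i c j : ℕ) [Decidable (b = a ∧ j = i)] :
    (s.setm a i c).m b j = if b = a ∧ j = i then c else s.m b j := by
  simp only [State.m, State.setm, State.setArr, Function.update_apply, Ar.code_injective.eq_iff]
  by_cases h1 : b = a
  · subst h1
    by_cases h2 : j = i <;> simp [h2]
  · simp [h1]

theorem State.m_setm_ne (s : State) {a b : Ar} (i c : ℕ) (h : b ≠ a) :
    (s.setm a i c).m b = s.m b := by
  classical
  funext j
  rw [State.m_setm, if_neg (fun e => h e.1)]

/-- `a := c` -/
def cst (a : Rg) (c : ℕ) : Prog := .const a.code c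

/-- `a := b` -/
def mov (a b : Rg) : Prog := .copy a.code b.code

/-- `a := a + 1` -/
def inc (a : Rg) : Prog := .succ a.code

/-- `a := b - c`, truncated at `0` -/
def dif (a b c : Rg) : Prog := .sub a.code b.code c.code

/-- `a := A[i]` -/
def lod (a : Rg) (A : Ar) (i : Rg) : Prog := .load a.code A.code i.code

/-- `A[i] := a` -/
def sto (A : Ar) (i a : Rg) : Prog := .store A.code i.code a.code

/-- If `a ≠ 0` then `p` else `q`. -/
def ite' (a : Rg) (p q : Prog) : Prog := .cond a.code p q

/-- While `a ≠ 0` do `p`. -/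
def whl (a : Rg) (p : Prog) : Prog := .loop a.code p

/-- Do nothing: the only effect is on a register that is never read. -/
def skp : Prog := cst .junk 0

infixr:60 " ;; " => Prog.seq

/-- Started in `s`, the program halts within `T` steps in a state that satisfies `Q`. -/
def Run (P : Prog) (s : State) (T : ℕ) (Q : State → Prop) : Prop :=
  ∃ t s', Exec P s t s' ∧ t ≤ T ∧ Q s'

theorem Run.mono {P : Prog} {s : State} {T T' : ℕ} {Q Q' : State → Prop} (h : Run P s T Q)
    (hT : T ≤ T') (hQ : ∀ s', Q s' → Q' s') : Run P s T' Q' := by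
  obtain ⟨t, s', h1, h2, h3⟩ := h
  exact ⟨t, s', h1, h2.trans hT, hQ s' h3⟩

theorem Run.post {P : Prog} {s : State} {T : ℕ} {Q Q' : State → Prop} (h : Run P s T Q)
    (hQ : ∀ s', Q s' → Q' s') : Run P s T Q' := h.mono le_rfl hQ

theorem run_cst {a : Rg} {c : ℕ} {s : State} {Q : State → Prop} (h : Q (s.setr a c)) :
    Run (cst a c) s 1 Q := ⟨1, _, .const .., le_rfl, h⟩

theorem run_mov {a b : Rg} {s : State} {Q : State → Prop} (h : Q (s.setr a (s.r b))) :
    Run (mov a b) s 1 Q := ⟨1, _, .copy .., le_rfl, h⟩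

theorem run_inc {a : Rg} {s : State} {Q : State → Prop} (h : Q (s.setr a (s.r a + 1))) :
    Run (inc a) s 1 Q := ⟨1, _, .succ .., le_rfl, h⟩

theorem run_dif {a b c : Rg} {s : State} {Q : State → Prop} (h : Q (s.setr a (s.r b - s.r c))) :
    Run (dif a b c) s 1 Q := ⟨1, _, .sub .., le_rfl, h⟩

theorem run_lod {a : Rg} {A : Ar} {i : Rg} {s : State} {Q : State → Prop}
    (h : Q (s.setr a (s.m A (s.r i)))) : Run (lod a A i) s 1 Q := ⟨1, _, .load .., le_rfl, h⟩

theorem run_sto {A : Ar} {i a : Rg} {s : State} {Q : State → Prop}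
    (h : Q (s.setm A (s.r i) (s.r a))) : Run (sto A i a) s 1 Q := ⟨1, _, .store .., le_rfl, h⟩

theorem run_skp {s : State} {Q : State → Prop} (h : Q (s.setr .junk 0)) : Run skp s 1 Q :=
  run_cst h

theorem run_seq {p q : Prog} {s : State} {T T' : ℕ} {Q : State → Prop}
    (h : Run p s T fun s' => Run q s' T' Q) : Run (p ;; q) s (T + T') Q := by
  obtain ⟨t, s', h1, h2, t', s'', h3, h4, h5⟩ := h
  exact ⟨t + t', s'', .seq h1 h3, by omega, h5⟩

theorem run_ite {a : Rg} {p q : Prog} {s : State} {T : ℕ} {Q : State → Prop}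
    (h1 : s.r a ≠ 0 → Run p s T Q) (h2 : s.r a = 0 → Run q s T Q) :
    Run (ite' a p q) s (T + 1) Q := by
  by_cases h : s.r a = 0
  · obtain ⟨t, s', e1, e2, e3⟩ := h2 h
    exact ⟨t + 1, s', .condFalse h e1, by omega, e3⟩
  · obtain ⟨t, s', e1, e2, e3⟩ := h1 h
    exact ⟨t + 1, s', .condTrue h e1, by omega, e3⟩

theorem run_whl_zero {a : Rg} {p : Prog} {s : State} {Q : State → Prop} (h : s.r a = 0) (hQ : Q s) :
    Run (whl a p) s 1 Q := ⟨1, s, .loopDone h, le_rfl, hQ⟩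

theorem run_whl_step {a : Rg} {p : Prog} {s : State} {T T' : ℕ} {Q : State → Prop}
    (h : s.r a ≠ 0) (hp : Run p s T fun s' => Run (whl a p) s' T' Q) :
    Run (whl a p) s (T + T' + 1) Q := by
  obtain ⟨t, s', h1, h2, t', s'', h3, h4, h5⟩ := hp
  exact ⟨t + t' + 1, s'', .loopStep h h1 h3, by omega, h5⟩

/-- The program writes to the register with number `x`. -/
def Prog.WR : Prog → ℕ → Prop
  | .const a _, x => x = a
  | .copy a _, x => x = a
  | .succ a, x => x = a
  | .sub a _ _, x => x = a
  | .load a _ _, x => x = a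
  | .store _ _ _, _ => False
  | .seq p q, x => p.WR x ∨ q.WR x
  | .cond _ p q, x => p.WR x ∨ q.WR x
  | .loop _ p, x => p.WR x

/-- The program writes to the array with number `x`. -/
def Prog.WA : Prog → ℕ → Prop
  | .store a _ _, x => x = a
  | .seq p q, x => p.WA x ∨ q.WA x
  | .cond _ p q, x => p.WA x ∨ q.WA x
  | .loop _ p, x => p.WA x
  | _, _ => False

/-- The program writes to the named register. -/
def Prog.wr (P : Prog) (a : Rg) : Prop := P.WR a.code

/-- The program writes to the named array. -/
def Prog.wa (P : Prog) (a : Ar) : Prop := P.WA a.code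

@[simp] theorem wr_cst (a b : Rg) (c : ℕ) : (cst a c).wr b ↔ b = a := Rg.code_injective.eq_iff
@[simp] theorem wr_mov (a b c : Rg) : (mov a c).wr b ↔ b = a := Rg.code_injective.eq_iff
@[simp] theorem wr_inc (a b : Rg) : (inc a).wr b ↔ b = a := Rg.code_injective.eq_iff
@[simp] theorem wr_dif (a b c d : Rg) : (dif a c d).wr b ↔ b = a := Rg.code_injective.eq_iff
@[simp] theorem wr_lod (a b i : Rg) (A : Ar) : (lod a A i).wr b ↔ b = a :=
  Rg.code_injective.eq_iff
@[simp] theorem wr_sto (a b i : Rg) (A : Ar) : (sto A i a).wr b ↔ False := Iff.rfl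
@[simp] theorem wr_skp (b : Rg) : skp.wr b ↔ b = .junk := wr_cst ..
@[simp] theorem wr_seq (p q : Prog) (b : Rg) : (p ;; q).wr b ↔ p.wr b ∨ q.wr b := Iff.rfl
@[simp] theorem wr_ite' (a : Rg) (p q : Prog) (b : Rg) : (ite' a p q).wr b ↔ p.wr b ∨ q.wr b :=
  Iff.rfl
@[simp] theorem wr_whl (a : Rg) (p : Prog) (b : Rg) : (whl a p).wr b ↔ p.wr b := Iff.rfl

@[simp] theorem wa_cst (a : Rg) (b : Ar) (c : ℕ) : (cst a c).wa b ↔ False := Iff.rfl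
@[simp] theorem wa_mov (a c : Rg) (b : Ar) : (mov a c).wa b ↔ False := Iff.rfl
@[simp] theorem wa_inc (a : Rg) (b : Ar) : (inc a).wa b ↔ False := Iff.rfl
@[simp] theorem wa_dif (a c d : Rg) (b : Ar) : (dif a c d).wa b ↔ False := Iff.rfl
@[simp] theorem wa_lod (a i : Rg) (A b : Ar) : (lod a A i).wa b ↔ False := Iff.rfl
@[simp] theorem wa_sto (a i : Rg) (A b : Ar) : (sto A i a).wa b ↔ b = A :=
  Ar.code_injective.eq_iff
@[simp] theorem wa_skp (b : Ar) : skp.wa b ↔ False := Iff.rfl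
@[simp] theorem wa_seq (p q : Prog) (b : Ar) : (p ;; q).wa b ↔ p.wa b ∨ q.wa b := Iff.rfl
@[simp] theorem wa_ite' (a : Rg) (p q : Prog) (b : Ar) : (ite' a p q).wa b ↔ p.wa b ∨ q.wa b :=
  Iff.rfl
@[simp] theorem wa_whl (a : Rg) (p : Prog) (b : Ar) : (whl a p).wa b ↔ p.wa b := Iff.rfl

/-- `s'` differs from `s` only in what the program `P` may write. -/
def Frame (P : Prog) (s s' : State) : Prop :=
  (∀ a, ¬ P.wr a → s'.r a = s.r a) ∧ ∀ a, ¬ P.wa a → s'.m a = s.m a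

theorem Frame.refl (P : Prog) (s : State) : Frame P s s := ⟨fun _ _ => rfl, fun _ _ => rfl⟩

theorem Frame.trans {P : Prog} {s s' s'' : State} (h : Frame P s s') (h' : Frame P s' s'') :
    Frame P s s'' :=
  ⟨fun a ha => (h'.1 a ha).trans (h.1 a ha), fun a ha => (h'.2 a ha).trans (h.2 a ha)⟩

theorem Frame.mono {P P' : Prog} {s s' : State} (h : Frame P s s') (hr : ∀ a, P.wr a → P'.wr a)
    (ha : ∀ a, P.wa a → P'.wa a) : Frame P' s s' :=
  ⟨fun a h' => h.1 a fun e => h' (hr a e), fun a h' => h.2 a fun e => h' (ha a e)⟩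

theorem Exec.unchanged {P : Prog} {s s' : State} {t : ℕ} (h : Exec P s t s') :
    (∀ x, ¬ P.WR x → s'.reg x = s.reg x) ∧ ∀ x, ¬ P.WA x → s'.arr x = s.arr x := by
  induction h with
  | const | copy | succ | sub | load =>
    exact ⟨fun x hx => Function.update_of_ne hx _ _, fun _ _ => rfl⟩
  | store => exact ⟨fun _ _ => rfl, fun x hx => Function.update_of_ne hx _ _⟩
  | seq _ _ ih1 ih2 =>
    simp only [Prog.WR, Prog.WA, not_or]
    exact ⟨fun x hx => (ih2.1 x hx.2).trans (ih1.1 x hx.1),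
      fun x hx => (ih2.2 x hx.2).trans (ih1.2 x hx.1)⟩
  | condTrue _ _ ih =>
    simp only [Prog.WR, Prog.WA, not_or]
    exact ⟨fun x hx => ih.1 x hx.1, fun x hx => ih.2 x hx.1⟩
  | condFalse _ _ ih =>
    simp only [Prog.WR, Prog.WA, not_or]
    exact ⟨fun x hx => ih.1 x hx.2, fun x hx => ih.2 x hx.2⟩
  | loopDone => exact ⟨fun _ _ => rfl, fun _ _ => rfl⟩
  | loopStep _ _ _ ih1 ih2 =>
    exact ⟨fun x hx => (ih2.1 x hx).trans (ih1.1 x hx),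
      fun x hx => (ih2.2 x hx).trans (ih1.2 x hx)⟩

theorem Run.frame {P : Prog} {s : State} {T : ℕ} {Q : State → Prop} (h : Run P s T Q) :
    Run P s T fun s' => Q s' ∧ Frame P s s' := by
  obtain ⟨t, s', h1, h2, h3⟩ := h
  exact ⟨t, s', h1, h2, h3, fun a ha => h1.unchanged.1 _ ha,
    fun a ha => funext fun i => congrFun (h1.unchanged.2 _ ha) i⟩

/-- Loops with a variant `k`, the number of remaining rounds, which take `c` steps each. -/
theorem run_whl {a : Rg} {p : Prog} (I : ℕ → State → Prop) (c : ℕ) {s₀ : State}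
    (hz : ∀ k s, I k s → (s.r a = 0 ↔ k = 0))
    (hstep : ∀ k s, Frame p s₀ s → I (k + 1) s → Run p s c (I k)) {k : ℕ} (h : I k s₀) :
    Run (whl a p) s₀ (k * (c + 1) + 1) (I 0) := by
  suffices ∀ k s, Frame p s₀ s → I k s → Run (whl a p) s (k * (c + 1) + 1) (I 0) from
    this k s₀ (Frame.refl _ _) h
  intro k
  induction k with
  | zero =>
    intro s _ hs
    simpa using run_whl_zero ((hz 0 s hs).2 rfl) hs
  | succ k ih =>
    intro s hf hs
    have h1 : s.r a ≠ 0 := fun e => by simpa using (hz _ s hs).1 e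
    refine (run_whl_step h1 ((hstep k s hf hs).frame.post fun s' h' =>
      ih s' (hf.trans h'.2) h'.1)).mono ?_ fun _ h => h
    have : (k + 1) * (c + 1) = k * (c + 1) + (c + 1) := by ring
    omega

/-- The sequence of programs in a list. -/
def seqs : List Prog → Prog
  | [] => skp
  | p :: l => p ;; seqs l

theorem wr_seqs (l : List Prog) (a : Rg) : (seqs l).wr a ↔ a = .junk ∨ ∃ p ∈ l, p.wr a := by
  induction l with
  | nil => simp [seqs]
  | cons p l ih => simp [seqs, ih]; tauto

theorem wa_seqs (l : List Prog) (a : Ar) : (seqs l).wa a ↔ ∃ p ∈ l, p.wa a := by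
  induction l with
  | nil => simp [seqs]
  | cons p l ih => simp [seqs, ih]

variable {n : ℕ}

/-- The programs `f v`, for all variables `v` in order. -/
def forV (f : Fin n → Prog) : Prog := seqs ((List.finRange n).map f)

@[simp] theorem wr_forV (f : Fin n → Prog) (a : Rg) :
    (forV f).wr a ↔ a = .junk ∨ ∃ v, (f v).wr a := by
  simp [forV, wr_seqs]

@[simp] theorem wa_forV (f : Fin n → Prog) (a : Ar) : (forV f).wa a ↔ ∃ v, (f v).wa a := by
  simp [forV, wa_seqs]

theorem run_forV {f : Fin n → Prog} {s₀ : State} (c : ℕ) (I : ℕ → State → Prop)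
    (h0 : I 0 s₀) (hI : ∀ (v : Fin n) s, Frame (forV f) s₀ s → I v s → Run (f v) s c (I (v + 1)))
    {Q : State → Prop} (hQ : ∀ s, I n s → Q (s.setr .junk 0)) :
    Run (forV f) s₀ (n * c + 1) Q := by
  suffices ∀ k ≤ n, ∀ s, Frame (forV f) s₀ s → I (n - k) s →
      Run (seqs (((List.finRange n).drop (n - k)).map f)) s (k * c + 1) Q by
    have := this n le_rfl s₀ (Frame.refl _ _) (by simpa using h0)
    simpa [forV] using this
  intro k
  induction k with
  | zero =>
    intro _ s _ hs
    have : (List.finRange n).drop (n - 0) = [] := by simp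
    rw [this]
    simp only [List.map_nil, seqs, zero_mul, zero_add]
    exact run_skp (hQ s hs)
  | succ k ih =>
    intro hk s hf hs
    have hlt : n - (k + 1) < (List.finRange n).length := by simp; omega
    rw [List.drop_eq_getElem_cons hlt]
    simp only [List.getElem_finRange, Fin.cast_mk, List.map_cons, seqs]
    have e : n - (k + 1) + 1 = n - k := by omega
    refine (run_seq ((hI ⟨n - (k + 1), by omega⟩ s hf hs).frame.post fun s' h' => ?_)).mono
      (show c + (k * c + 1) ≤ (k + 1) * c + 1 by rw [add_mul]; omega) fun _ h => h
    have h1 := h'.1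
    simp only [e] at h1 ⊢
    refine ih (by omega) s' (hf.trans (h'.2.mono ?_ ?_)) h1
    · intro a ha; rw [wr_forV]; exact Or.inr ⟨_, ha⟩
    · intro a ha; rw [wa_forV]; exact ⟨_, ha⟩

/-! ### Banks of rows -/

/-- Row `i` of bank `b`. -/
def rowAt (n : ℕ) (m : Ar → ℕ → ℕ) (b i : ℕ) : Vec n := fun v => m (.col b v) i

/-- The rows of bank `b`. -/
def rows (n : ℕ) (s : State) (b : ℕ) : List (Vec n) :=
  (List.range (s.r (.len b))).map (rowAt n s.m b)

theorem length_rows (s : State) (b : ℕ) : (rows n s b).length = s.r (.len b) := by simp [rows]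

theorem rows_congr {s s' : State} {b : ℕ} (h1 : s'.r (.len b) = s.r (.len b))
    (h2 : ∀ v : Fin n, s'.m (.col b v) = s.m (.col b v)) : rows n s' b = rows n s b := by
  rw [rows, rows, h1]
  refine List.map_congr_left fun i _ => ?_
  funext v
  exact congrFun (h2 v) i

/-- Load row `i` of bank `b` into the vector registers `dst`. -/
def loadRow (n : ℕ) (dst : ℕ → Rg) (b : ℕ) (i : Rg) : Prog :=
  forV fun v : Fin n => lod (dst v) (.col b v) i

/-- Append the vector registers `src` to bank `b`. -/
def appendRow (n : ℕ) (src : ℕ → Rg) (b : ℕ) : Prog :=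
  (forV fun v : Fin n => sto (.col b v) (.len b) (src v)) ;; inc (.len b)

theorem run_loadRow {dst : ℕ → Rg} (hinj : Function.Injective dst) {b : ℕ} {i : Rg}
    (hi : ∀ v, i ≠ dst v) (hi' : i ≠ .junk) (hj : ∀ v, dst v ≠ .junk) (s : State) :
    Run (loadRow n dst b i) s (n + 1) fun s' =>
      (∀ v : Fin n, s'.r (dst v) = rowAt n s.m b (s.r i) v) ∧ s'.m = s.m ∧
      ∀ a, (∀ v, a ≠ dst v) → a ≠ .junk → s'.r a = s.r a := by
  refine (run_forV 1 (fun k s' => (∀ v : Fin n, v.val < k → s'.r (dst v) =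
    rowAt n s.m b (s.r i) v) ∧ s'.m = s.m ∧
    ∀ a, (∀ v, a ≠ dst v) → a ≠ .junk → s'.r a = s.r a) ?_ ?_ ?_).mono (by omega) fun _ h => h
  · exact ⟨fun v hv => absurd hv (by omega), rfl, fun _ _ _ => rfl⟩
  · rintro v s' _ ⟨h1, h2, h3⟩
    refine run_lod ⟨fun u hu => ?_, h2, fun a ha ha' => ?_⟩
    · by_cases huv : u = v
      · subst huv
        simp [h2, h3 i hi hi', rowAt]
      · have : dst u ≠ dst v := fun e => huv (Fin.ext (hinj e))
        rw [State.r_setr, if_neg this]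
        exact h1 u (by have : u.val ≠ v.val := fun e => huv (Fin.ext e); omega)
    · rw [State.r_setr, if_neg (ha v)]
      exact h3 a ha ha'
  · rintro s' ⟨h1, h2, h3⟩
    refine ⟨fun v => ?_, h2, fun a ha ha' => ?_⟩
    · rw [State.r_setr, if_neg (hj v)]
      exact h1 v v.2
    · rw [State.r_setr, if_neg ha']
      exact h3 a ha ha'

theorem run_appendRow {src : ℕ → Rg} {b : ℕ} (s : State) :
    Run (appendRow n src b) s (n + 2) fun s' =>
      rows n s' b = rows n s b ++ [fun v : Fin n => s.r (src v)] ∧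
      (∀ a, (∀ v : Fin n, a ≠ .col b v) → s'.m a = s.m a) ∧
      ∀ a, a ≠ .len b → a ≠ .junk → s'.r a = s.r a := by
  refine (run_seq (T := n * 1 + 1) (T' := 1) (run_forV 1 (fun k s' =>
    (∀ v : Fin n, v.val < k → s'.m (.col b v) (s.r (.len b)) = s.r (src v)) ∧
    (∀ v : Fin n, ∀ i ≠ s.r (.len b), s'.m (.col b v) i = s.m (.col b v) i) ∧
    (∀ a, (∀ v : Fin n, a ≠ .col b v) → s'.m a = s.m a) ∧ s'.r = s.r) ?_ ?_ ?_)).mono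
    (by omega) fun _ h => h
  · exact ⟨fun v hv => absurd hv (by omega), fun _ _ _ => rfl, fun _ _ => rfl, rfl⟩
  · rintro v s' _ ⟨h1, h2, h3, h4⟩
    refine run_sto ⟨fun u hu => ?_, fun u i hi => ?_, fun a ha => ?_, h4⟩
    · rw [State.m_setm, h4]
      by_cases huv : u = v
      · subst huv; simp
      · rw [if_neg]
        · exact h1 u (by have : u.val ≠ v.val := fun e => huv (Fin.ext e); omega)
        · rintro ⟨e, _⟩
          simp only [Ar.col.injEq, true_and] at e
          exact huv (Fin.ext e)
    · rw [State.m_setm, h4, if_neg (fun e => hi e.2)]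
      exact h2 u i hi
    · rw [State.m_setm_ne _ _ _ (ha v)]
      exact h3 a ha
  · rintro s' ⟨h1, h2, h3, h4⟩
    refine run_inc ⟨?_, fun a ha => h3 a ha, fun a ha ha' => ?_⟩
    · have e : (((s'.setr .junk 0).setr (.len b) ((s'.setr .junk 0).r (.len b) + 1)).r (.len b)) =
          s.r (.len b) + 1 := by simp [h4]
      rw [rows, e, List.range_succ, List.map_append]
      congr 1
      · refine List.map_congr_left fun i hi => ?_
        funext v
        exact h2 v i (by rw [List.mem_range] at hi; omega)
      · simp only [List.map_cons, List.map_nil]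
        congr 1
        funext v
        exact h1 v v.2
    · rw [State.r_setr, if_neg ha, State.r_setr, if_neg ha', h4]

/-- Execute `body` for all rows of bank `b`, loaded into the vector registers `x`. -/
def forRows (n b : ℕ) (body : Prog) : Prog :=
  cst .idx 0 ;; mov .rem (.len b) ;;
    whl .rem (loadRow n .x b .idx ;; body ;; inc .idx ;; dif .rem (.len b) .idx)

/-- The rule for loops over the rows of a bank. The invariant `J` speaks about the rows that have
been processed, and must not depend on the registers that belong to the loop. -/
theorem run_forRows {b : ℕ} {body : Prog} {s₀ : State} {l : List (Vec n)} (hl : rows n s₀ b = l)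
    (cost : Vec n → ℕ) (J : List (Vec n) → State → Prop)
    (hw1 : ¬ body.wr .idx) (hw2 : ¬ body.wr (.len b)) (hw3 : ∀ v : Fin n, ¬ body.wa (.col b v))
    (hstab : ∀ l s s', s'.m = s.m → (∀ a, a ≠ .idx → a ≠ .rem → (∀ v, a ≠ .x v) → a ≠ .junk →
      s'.r a = s.r a) → J l s → J l s')
    (h0 : J [] s₀)
    (hbody : ∀ done x rest s, l = done ++ x :: rest → Frame (forRows n b body) s₀ s → J done s →
      (∀ v : Fin n, s.r (.x v) = x v) → s.r .idx = done.length → Run body s (cost x)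
        (J (done ++ [x]))) :
    Run (forRows n b body) s₀ ((l.map fun x => cost x + n + 4).sum + 3) fun s' =>
      J l s' ∧ Frame (forRows n b body) s₀ s' := by
  set F := Frame (forRows n b body) with hF
  refine Run.post (Run.frame (Q := J l) ?_) (fun s h => h)
  have hloop : ∀ rest done s, l = done ++ rest → F s₀ s → J done s → s.r .idx = done.length →
      s.r .rem = rest.length →
      Run (whl .rem (loadRow n .x b .idx ;; body ;; inc .idx ;; dif .rem (.len b) .idx)) s
        ((rest.map fun x => cost x + n + 4).sum + 1) (J l) := by
    intro rest
    induction rest with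
    | nil =>
      intro done s hls _ hJ _ hr
      rw [hls, List.append_nil]
      exact run_whl_zero hr hJ
    | cons x rest ih =>
      intro done s hls hf hJ hi hr
      have hrow : ∀ s, F s₀ s → rows n s b = l := by
        intro s hf
        rw [← hl]
        refine rows_congr (hf.1 _ ?_) (fun v => hf.2 _ ?_)
        · simp [forRows, loadRow, hw2]
        · simp [forRows, loadRow, hw3]
      have hlen : ∀ s, F s₀ s → s.r (.len b) = l.length := fun s hf => by
        rw [← length_rows (n := n), hrow s hf]
      have hx : rowAt n s.m b (s.r .idx) = x := by
        have h1 : (rows n s b)[done.length]? = some x := by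
          rw [hrow s hf, hls]; simp
        rw [rows, List.getElem?_map, List.getElem?_range (by rw [hlen s hf, hls]; simp)] at h1
        rw [hi]
        simpa using h1
      refine (run_whl_step (T := (n + 1) + (cost x + (1 + 1))) (by rw [hr]; simp) ?_).mono
        (T := ((n + 1) + (cost x + (1 + 1))) + ((rest.map fun x => cost x + n + 4).sum + 1) + 1)
        (by simp only [List.map_cons, List.sum_cons]; omega) (fun _ h => h)
      refine run_seq ((run_loadRow (fun a b h => by simpa using h) (by simp) (by simp) (by simp)
        s).frame.post fun s1 h1 => ?_)
      obtain ⟨⟨h11, h12, h13⟩, f1⟩ := h1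
      have hf1 : F s₀ s1 := hf.trans (f1.mono (fun a ha => by simp [forRows, ha])
        (fun a ha => by simp [forRows, ha]))
      have hJ1 : J done s1 := hstab _ s _ h12 (fun a _ _ h3 h4 => h13 a h3 h4) hJ
      refine run_seq ((hbody done x rest s1 hls hf1 hJ1 (fun v => by rw [h11 v, hx])
        (by rw [h13 _ (by simp) (by simp), hi])).frame.post fun s2 h2 => ?_)
      obtain ⟨h21, f2⟩ := h2
      have hf2 : F s₀ s2 := hf1.trans (f2.mono (fun a ha => by simp [forRows, ha])
        (fun a ha => by simp [forRows, ha]))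
      have hi2 : s2.r .idx = done.length := by
        rw [f2.1 _ hw1, h13 _ (by simp) (by simp), hi]
      refine run_seq (run_inc (run_dif ?_))
      refine ih (done ++ [x]) _ (by rw [hls]; simp) ?_ ?_ ?_ ?_
      · refine ⟨fun a ha => ?_, fun a ha => by simpa using hf2.2 a ha⟩
        have ha' := ha
        simp only [forRows, wr_seq, wr_cst, wr_mov, wr_whl, wr_inc, wr_dif, not_or] at ha'
        simp only [State.r_setr, ha'.1, ha'.2.1, if_false]
        exact hf2.1 a ha
      · refine hstab _ s2 _ rfl (fun a h1 h2 _ _ => by simp [h1, h2]) h21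
      · simp [hi2]
      · have := hlen s2 hf2
        simp only [State.r_setr, reduceCtorEq, if_false, if_true, this, hls, hi2]
        simp
        omega
  refine (run_seq (T := 1) (T' := 1 + ((l.map fun x => cost x + n + 4).sum + 1)) (run_cst
    (run_seq (run_mov ?_)))).mono (by omega) fun _ h => h
  refine hloop l [] _ rfl ?_ ?_ ?_ ?_
  · refine ⟨fun a ha => ?_, fun a ha => rfl⟩
    simp only [forRows, wr_seq, wr_cst, wr_mov, not_or] at ha
    simp only [State.r_setr, ha.1, ha.2.1, if_false]
  · exact hstab _ s₀ _ rfl (fun a h1 h2 _ _ => by simp [h1, h2]) h0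
  · simp
  · have := length_rows (n := n) s₀ b
    rw [hl] at this
    simp [this]

end Logic

/-! ### The dictionary of vectors -/

section Dictionary

variable {n : ℕ}

/-- The path of a vector in the dictionary: the binary digits of its entries, least significant
digits first, labelled with the variables. -/
def path (x : Vec n) : List (ℕ × ℕ) :=
  (List.finRange n).flatMap fun v => (Nat.digits 2 (x v)).map fun e => (v.val, e)

/-- The binary expansions can be read off from the path, since the digits are labelled with their
variables. -/
theorem path_injective : Function.Injective (path (n := n)) := by
  intro x y h
  have key : ∀ (x : Vec n) (v : Fin n), ((path x).filter fun p => p.1 = v.val).map Prod.snd =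
      Nat.digits 2 (x v) := by
    intro x v
    suffices ∀ L : List (Fin n), L.Nodup →
        ((L.flatMap fun v => (Nat.digits 2 (x v)).map fun e => (v.val, e)).filter
          fun p => p.1 = v.val).map Prod.snd = if v ∈ L then Nat.digits 2 (x v) else [] by
      simpa [path] using this _ (List.nodup_finRange n)
    intro L hL
    induction L with
    | nil => simp
    | cons u L ih =>
      obtain ⟨hu, hL⟩ := List.nodup_cons.1 hL
      rw [List.flatMap_cons, List.filter_append, List.map_append, ih hL]
      by_cases huv : u = v
      · subst huv
        simp [hu, List.filter_map, Function.comp_def]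
      · have h1 : ∀ p ∈ (Nat.digits 2 (x u)).map fun e => (u.val, e),
            ¬ (decide (p.1 = v.val)) = true := by
          intro p hp
          obtain ⟨e, _, rfl⟩ := List.mem_map.1 hp
          simpa using fun e => huv (Fin.ext e)
        rw [List.filter_eq_nil_iff.2 h1]
        have h2 : v ≠ u := fun e => huv e.symm
        simp [h2]
  funext v
  exact Nat.digits_inj_iff.1 (by rw [← key x v, ← key y v, h])

/-- The edges of the dictionary with the given labels lead from node `p` to node `q`. The node `0`
is the root, which is not the target of an edge, so an entry `0` means that there is no edge. -/
def Walks (m : Ar → ℕ → ℕ) : List (ℕ × ℕ) → ℕ → ℕ → Prop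
  | [], p, q => q = p
  | e :: l, p, q => m (.chl e.1 e.2) p ≠ 0 ∧ Walks m l (m (.chl e.1 e.2) p) q

theorem walks_append {m : Ar → ℕ → ℕ} {l l' : List (ℕ × ℕ)} {p q : ℕ} :
    Walks m (l ++ l') p q ↔ ∃ r, Walks m l p r ∧ Walks m l' r q := by
  induction l generalizing p with
  | nil => simp [Walks]
  | cons e l ih => simp [Walks, ih, and_assoc]

/-- The dictionary is a tree, all of whose nodes are less than `c`. -/
structure Trie (m : Ar → ℕ → ℕ) (c : ℕ) : Prop where
  pos : 0 < c
  lt : ∀ v e p, m (.chl v e) p < c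
  inj : ∀ v e p v' e' p', m (.chl v e) p ≠ 0 → m (.chl v e) p = m (.chl v' e') p' →
    v = v' ∧ e = e' ∧ p = p'

/-- All edges of the dictionary `m` are in `m'`. -/
def Ext (m m' : Ar → ℕ → ℕ) : Prop :=
  ∀ v e p, m (.chl v e) p ≠ 0 → m' (.chl v e) p = m (.chl v e) p

theorem Ext.refl (m : Ar → ℕ → ℕ) : Ext m m := fun _ _ _ _ => rfl

theorem Ext.trans {m m' m'' : Ar → ℕ → ℕ} (h : Ext m m') (h' : Ext m' m'') : Ext m m'' :=
  fun v e p hp => by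
    have := h v e p hp
    rw [h' v e p (by rw [this]; exact hp), this]

theorem Ext.of_eq {m m' : Ar → ℕ → ℕ} (h : ∀ v e, m' (.chl v e) = m (.chl v e)) : Ext m m' :=
  fun v e p _ => by rw [h]

theorem Walks.ext {m m' : Ar → ℕ → ℕ} (h : Ext m m') {l : List (ℕ × ℕ)} {p q : ℕ}
    (hw : Walks m l p q) : Walks m' l p q := by
  induction l generalizing p with
  | nil => exact hw
  | cons e l ih =>
    obtain ⟨h1, h2⟩ := hw
    have := h e.1 e.2 p h1
    refine ⟨by rw [this]; exact h1, ?_⟩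
    rw [this]
    exact ih h2

/-- Node `k` of the dictionary is that of the vector `x`. -/
def Key (m : Ar → ℕ → ℕ) (x : Vec n) (k : ℕ) : Prop := Walks m (path x) 0 k

theorem Key.ext {m m' : Ar → ℕ → ℕ} (h : Ext m m') {x : Vec n} {k : ℕ} (hk : Key m x k) :
    Key m' x k := Walks.ext h hk

theorem Key.unique {m : Ar → ℕ → ℕ} {x : Vec n} {k k' : ℕ} (h : Key m x k) (h' : Key m x k') :
    k = k' := by
  have : ∀ (l : List (ℕ × ℕ)) (p : ℕ), Walks m l p k → Walks m l p k' → k = k' := by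
    intro l
    induction l with
    | nil => rintro p rfl h; exact h.symm
    | cons e l ih => intro p h1 h2; exact ih _ h1.2 h2.2
  exact this _ _ h h'

/-- Different vectors have different nodes: in a tree, the path to a node can be traced back. -/
theorem Key.inj {m : Ar → ℕ → ℕ} {c : ℕ} (hm : Trie m c) {x y : Vec n} {k : ℕ} (h : Key m x k)
    (h' : Key m y k) : x = y := by
  refine path_injective ?_
  have : ∀ (l l' : List (ℕ × ℕ)) (k : ℕ), Walks m l 0 k → Walks m l' 0 k → l = l' := by
    intro l
    induction l using List.reverseRecOn with
    | nil =>
      intro l' k h h'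
      obtain rfl : k = 0 := h
      rcases List.eq_nil_or_concat l' with rfl | ⟨l'', e, rfl⟩
      · rfl
      · obtain ⟨r, _, h2, h3⟩ := walks_append.1 (by simpa using h')
        exact absurd h3.symm h2
    | append_singleton l e ih =>
      intro l' k h h'
      obtain ⟨r, h1, h2, h3⟩ := walks_append.1 h
      rcases List.eq_nil_or_concat l' with rfl | ⟨l'', e', rfl⟩
      · obtain rfl : k = 0 := h'
        exact absurd h3.symm h2
      · obtain ⟨r', h1', h2', h3'⟩ := walks_append.1 (by simpa using h')
        simp only [Walks] at h3 h3'
        obtain ⟨e1, e2, rfl⟩ := hm.inj _ _ _ _ _ _ h2 (h3.symm.trans h3')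
        have : e = e' := Prod.ext e1 e2
        subst this
        simp [ih _ _ h1 h1']
  exact this _ _ _ h h'

/-- The tables of quotients and remainders modulo two are correct for numbers less than `d`, and
the dictionary is correct. -/
structure Good (d : ℕ) (s : State) : Prop where
  pos : 0 < d
  bits : ∀ j < d, s.m .half j = j / 2 ∧ s.m .par j = j % 2
  trie : Trie s.m (s.r .ncnt)

theorem Good.of_eq {d : ℕ} {s s' : State} (h : Good d s) (h1 : s'.m .half = s.m .half)
    (h2 : s'.m .par = s.m .par) (h3 : ∀ v e, s'.m (.chl v e) = s.m (.chl v e))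
    (h4 : s'.r .ncnt = s.r .ncnt) : Good d s' :=
  ⟨h.pos, fun j hj => by rw [h1, h2]; exact h.bits j hj,
    ⟨by rw [h4]; exact h.trie.pos, fun v e p => by rw [h3, h4]; exact h.trie.lt v e p,
      fun v e p v' e' p' => by rw [h3, h3]; exact h.trie.inj v e p v' e' p'⟩⟩

/-- Move from node `nd` along the edge with label `(v, e)` to node `ch`; the edge is created if
necessary. -/
def child (v e : ℕ) : Prog :=
  lod .ch (.chl v e) .nd ;; ite' .ch skp (mov .ch .ncnt ;; inc .ncnt ;; sto (.chl v e) .nd .ch)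

theorem run_child {d v e : ℕ} {s : State} (h : Good d s) :
    Run (child v e) s 5 fun s' => Good d s' ∧ Ext s.m s'.m ∧ s'.r .ch ≠ 0 ∧
      s'.m (.chl v e) (s.r .nd) = s'.r .ch := by
  refine (run_seq (T := 1) (T' := 4) (run_lod (run_ite (fun h0 => ?_) fun h0 => ?_)))
  · refine Run.mono (run_skp ?_) (show 1 ≤ 3 by omega) fun _ h => h
    simp only [State.r_setr, if_true] at h0
    refine ⟨h.of_eq rfl rfl (fun _ _ => rfl) (by simp), Ext.refl _, by simpa using h0, by simp⟩
  · simp only [State.r_setr, if_true] at h0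
    refine run_seq (T := 1) (T' := 2) (run_mov (run_seq (T := 1) (T' := 1) (run_inc
      (run_sto ?_))))
    have ht := h.trie
    have hm : ∀ a j, (((((s.setr .ch (s.m (.chl v e) (s.r .nd))).setr .ch
        (s.r .ncnt)).setr .ncnt (s.r .ncnt + 1))).setm (.chl v e) (s.r .nd) (s.r .ncnt)).m a j =
        if a = .chl v e ∧ j = s.r .nd then s.r .ncnt else s.m a j := by
      intro a j; rw [State.m_setm]; rfl
    have hr : ∀ a, (((((s.setr .ch (s.m (.chl v e) (s.r .nd))).setr .ch
        (s.r .ncnt)).setr .ncnt (s.r .ncnt + 1))).setm (.chl v e) (s.r .nd) (s.r .ncnt)).r a =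
        if a = .ncnt then s.r .ncnt + 1 else if a = .ch then s.r .ncnt else s.r a := by
      intro a
      simp only [State.r_setm, State.r_setr]
      split_ifs <;> rfl
    simp only [State.r_setr, if_true, reduceCtorEq, if_false]
    generalize (((((s.setr .ch (s.m (.chl v e) (s.r .nd))).setr .ch
        (s.r .ncnt)).setr .ncnt (s.r .ncnt + 1))).setm (.chl v e) (s.r .nd) (s.r .ncnt)) = s'
      at hm hr ⊢
    refine ⟨⟨h.pos, fun j hj => ?_, ⟨by simp [hr], fun v' e' p => ?_, ?_⟩⟩, ?_, ?_, ?_⟩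
    · rw [hm, hm, if_neg (by simp), if_neg (by simp)]
      exact h.bits j hj
    · have := ht.lt v' e' p
      rw [hm, hr, if_pos rfl]
      split_ifs <;> omega
    · intro v1 e1 p1 v2 e2 p2
      rw [hm, hm]
      have l1 := ht.lt v1 e1 p1
      have l2 := ht.lt v2 e2 p2
      split_ifs with c1 c2 c2
      · rintro - -
        simp only [Ar.chl.injEq] at c1 c2
        obtain ⟨⟨rfl, rfl⟩, rfl⟩ := c1
        obtain ⟨⟨rfl, rfl⟩, rfl⟩ := c2
        exact ⟨rfl, rfl, rfl⟩
      · intro _ e; omega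
      · intro _ e; omega
      · exact ht.inj v1 e1 p1 v2 e2 p2
    · intro v' e' p hp
      rw [hm, if_neg]
      rintro ⟨e1, rfl⟩
      rw [e1] at hp
      exact hp h0
    · simp [hr, ht.pos.ne']
    · simp [hm, hr]

/-- Follow the edges for the number in `z`, labelled with `v`. -/
def walkNum (v : ℕ) : Prog :=
  whl .z (lod .pb .par .z ;; lod .zh .half .z ;; ite' .pb (child v 1) (child v 0) ;;
    mov .nd .ch ;; mov .z .zh)

/-- The registers and the arrays that are changed while looking up a vector in the dictionary. -/
def Rg.aux (a : Rg) : Prop :=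
  a = .nd ∨ a = .z ∨ a = .zh ∨ a = .pb ∨ a = .ch ∨ a = .ncnt ∨ a = .junk

/-- The array holds edges of the dictionary. -/
def Ar.isChl (a : Ar) : Prop := ∃ v e, a = .chl v e

theorem child_frame {v e : ℕ} : (∀ a, (child v e).wr a → a.aux) ∧
    ∀ a, (child v e).wa a → a.isChl := by
  constructor
  · intro a
    simp only [child, wr_seq, wr_lod, wr_ite', wr_skp, wr_mov, wr_inc, wr_sto, Rg.aux]
    tauto
  · intro a
    simp only [child, wa_seq, wa_lod, wa_ite', wa_skp, wa_mov, wa_inc, wa_sto, Ar.isChl, false_or]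
    exact fun h => ⟨v, e, h⟩

theorem walkNum_frame {v : ℕ} : (∀ a, (walkNum v).wr a → a.aux) ∧
    ∀ a, (walkNum v).wa a → a.isChl := by
  constructor
  · intro a
    have h0 := (child_frame (v := v) (e := 0)).1 a
    have h1 := (child_frame (v := v) (e := 1)).1 a
    simp only [walkNum, wr_seq, wr_whl, wr_lod, wr_ite', wr_mov]
    rintro (rfl | rfl | (h | h) | rfl | rfl)
    · simp [Rg.aux]
    · simp [Rg.aux]
    · exact h1 h
    · exact h0 h
    · simp [Rg.aux]
    · simp [Rg.aux]
  · intro a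
    have h0 := (child_frame (v := v) (e := 0)).2 a
    have h1 := (child_frame (v := v) (e := 1)).2 a
    simp only [walkNum, wa_seq, wa_whl, wa_lod, wa_ite', wa_mov]
    tauto

theorem digits_length_le {a d : ℕ} (h : a < d) : (Nat.digits 2 a).length ≤ Nat.log 2 d + 1 := by
  rcases Nat.eq_zero_or_pos a with rfl | ha
  · simp
  · rw [Nat.length_digits 2 a (by norm_num) ha.ne']
    have := Nat.log_mono_right (b := 2) h.le
    omega

theorem run_walkNum {d v : ℕ} {s : State} (h : Good d s) (hz : s.r .z < d) :
    Run (walkNum v) s ((Nat.log 2 d + 1) * 11 + 1) fun s' => Good d s' ∧ Ext s.m s'.m ∧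
      Walks s'.m ((Nat.digits 2 (s.r .z)).map fun e => (v, e)) (s.r .nd) (s'.r .nd) := by
  refine Run.mono (run_whl (k := (Nat.digits 2 (s.r .z)).length) (c := 10)
    (fun k s' => Good d s' ∧ Ext s.m s'.m ∧ s'.r .z < d ∧ (Nat.digits 2 (s'.r .z)).length = k ∧
      ∃ done, Nat.digits 2 (s.r .z) = done ++ Nat.digits 2 (s'.r .z) ∧
        Walks s'.m (done.map fun e => (v, e)) (s.r .nd) (s'.r .nd)) ?_ ?_ ?_)
    (Nat.add_le_add_right (Nat.mul_le_mul_right _ (digits_length_le hz)) 1) ?_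
  · rintro k s' ⟨_, _, _, rfl, _⟩
    rw [List.length_eq_zero_iff, Nat.digits_eq_nil_iff_eq_zero]
  · rintro k s1 - ⟨hg, hext, hlt, hk, done, hd, hw⟩
    have hne : s1.r .z ≠ 0 := by rintro e; rw [e] at hk; simp at hk
    have hdig := Nat.digits_def' (b := 2) (by norm_num) (Nat.pos_of_ne_zero hne)
    obtain ⟨b1, b2⟩ := hg.bits _ hlt
    refine run_seq (T := 1) (T' := 9) (run_lod (run_seq (T := 1) (T' := 8) (run_lod
      (run_seq (T := 6) (T' := 2) ?_))))
    set s2 := (s1.setr .pb (s1.m .par (s1.r .z))).setr .zh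
      ((s1.setr .pb (s1.m .par (s1.r .z))).m .half ((s1.setr .pb (s1.m .par (s1.r .z))).r .z))
      with hs2
    have hr2 : ∀ a, s2.r a = if a = .zh then s1.r .z / 2 else if a = .pb then s1.r .z % 2 else
        s1.r a := by
      intro a
      simp only [hs2, State.r_setr, State.m_setr, reduceCtorEq, if_false, b1, b2]
    have hm2 : s2.m = s1.m := rfl
    have hg2 : Good d s2 := hg.of_eq rfl rfl (fun _ _ => rfl) (by simp [hr2])
    have key : ∀ e, s1.r .z % 2 = e → Run (child v e) s2 5 fun s' =>
        Run (mov .nd .ch ;; mov .z .zh) s' 2 fun s' => Good d s' ∧ Ext s.m s'.m ∧ s'.r .z < d ∧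
          (Nat.digits 2 (s'.r .z)).length = k ∧
      ∃ done, Nat.digits 2 (s.r .z) = done ++ Nat.digits 2 (s'.r .z) ∧
        Walks s'.m (done.map fun e => (v, e)) (s.r .nd) (s'.r .nd) := by
      intro e he
      refine (run_child hg2).frame.post ?_
      rintro s3 ⟨⟨g3, e3, c3, c3'⟩, f3⟩
      refine run_seq (T := 1) (T' := 1) (run_mov (run_mov ?_))
      have hzh : s3.r .zh = s1.r .z / 2 := by
        rw [f3.1 _ (fun h => by have := child_frame.1 _ h; simp [child] at h), hr2, if_pos rfl]
      refine ⟨g3.of_eq rfl rfl (fun _ _ => rfl) (by simp), hext.trans e3, ?_, ?_, done ++ [e], ?_,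
        ?_⟩
      · simp [hzh]; omega
      · rw [hdig] at hk
        simpa [hzh] using hk
      · simp only [State.r_setr, if_true, reduceCtorEq, if_false, hzh]
        rw [hd, hdig, he]; simp
      · simp only [State.r_setr, if_true, reduceCtorEq, if_false, State.m_setr, List.map_append,
          List.map_cons, List.map_nil]
        rw [walks_append]
        refine ⟨s1.r .nd, hw.ext e3, ?_⟩
        have : s2.r .nd = s1.r .nd := by simp [hr2]
        rw [this] at c3'
        exact ⟨by rw [c3']; exact c3, c3'.symm⟩
    refine run_ite (fun h0 => key 1 ?_) fun h0 => key 0 ?_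
    · simp only [hr2, reduceCtorEq, if_false, if_true] at h0; omega
    · simp only [hr2, reduceCtorEq, if_false, if_true] at h0; omega
  · exact ⟨h, Ext.refl _, hz, rfl, [], rfl, rfl⟩
  · rintro s' ⟨h1, h2, h3, h4, done, h5, h6⟩
    refine ⟨h1, h2, ?_⟩
    rw [List.length_eq_zero_iff] at h4
    rw [h4, List.append_nil] at h5
    rw [h5]
    exact h6

/-- Find the node `nd` of the vector in the registers `src`, restricted to the variables `X`. -/
def walk (n : ℕ) (src : ℕ → Rg) (X : Finset (Fin n)) : Prog :=
  cst .nd 0 ;; forV fun v : Fin n => (if v ∈ X then mov .z (src v) else cst .z 0) ;; walkNum v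

theorem walk_frame {src : ℕ → Rg} {X : Finset (Fin n)} : (∀ a, (walk n src X).wr a → a.aux) ∧
    ∀ a, (walk n src X).wa a → a.isChl := by
  constructor
  · intro a
    simp only [walk, wr_seq, wr_forV, wr_cst]
    rintro (rfl | rfl | ⟨v, h | h⟩)
    · simp [Rg.aux]
    · simp [Rg.aux]
    · split_ifs at h <;> simp only [wr_mov, wr_cst] at h <;> simp [Rg.aux, h]
    · exact walkNum_frame.1 a h
  · intro a
    simp only [walk, wa_seq, wa_forV, wa_cst]
    rintro (h | ⟨v, h | h⟩)
    · exact h.elim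
    · split_ifs at h <;> simp at h
    · exact walkNum_frame.2 a h

/-- The number of steps for looking up a vector with entries less than `d`. -/
def walkCost (n d : ℕ) : ℕ := n * ((Nat.log 2 d + 1) * 11 + 2) + 2

/-- Looking up a vector takes logarithmic time and finds its node, which identifies the vector. -/
theorem run_walk {d : ℕ} {src : ℕ → Rg} {X : Finset (Fin n)} {s : State} (h : Good d s)
    (hsrc : ∀ v, ¬ (src v).aux) (hx : ∀ v : Fin n, s.r (src v) < d) :
    Run (walk n src X) s (walkCost n d) fun s' => Good d s' ∧ Ext s.m s'.m ∧
      Key s'.m (mask X fun v : Fin n => s.r (src v)) (s'.r .nd) := by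
  set x : Vec n := mask X fun v : Fin n => s.r (src v) with hxdef
  refine (run_seq (T := 1) (T' := n * ((Nat.log 2 d + 1) * 11 + 2) + 1) (run_cst ?_)).mono
    (by rw [walkCost]; omega) (fun _ h => h)
  refine run_forV _ (fun k s' => Good d s' ∧ Ext s.m s'.m ∧
    Walks s'.m (((List.finRange n).take k).flatMap fun v =>
      (Nat.digits 2 (x v)).map fun e => (v.val, e)) 0 (s'.r .nd)) ?_ ?_ ?_
  · exact ⟨h.of_eq rfl rfl (fun _ _ => rfl) (by simp), Ext.refl _, by simp [Walks]⟩
  · rintro v s1 f1 ⟨g1, e1, w1⟩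
    have hs : s1.r (src v) = s.r (src v) := by
      rw [f1.1, State.r_setr, if_neg (fun e => hsrc v (by simp [Rg.aux, e]))]
      intro hw
      refine hsrc v (walk_frame (n := n) (src := src) (X := X) |>.1 _ ?_)
      rw [walk, wr_seq]
      exact Or.inr hw
    refine (run_seq (T := 1) (T' := (Nat.log 2 d + 1) * 11 + 1) (Q := fun s' => Good d s' ∧
      Ext s.m s'.m ∧ Walks s'.m (((List.finRange n).take (v + 1)).flatMap fun v =>
      (Nat.digits 2 (x v)).map fun e => (v.val, e)) 0 (s'.r .nd)) ?_).mono (by omega)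
      fun _ h => h
    have key : ∀ a, a = x v → Run (walkNum v) (s1.setr .z a) ((Nat.log 2 d + 1) * 11 + 1)
        fun s' => Good d s' ∧ Ext s.m s'.m ∧
          Walks s'.m (((List.finRange n).take (v + 1)).flatMap fun v =>
            (Nat.digits 2 (x v)).map fun e => (v.val, e)) 0 (s'.r .nd) := by
      rintro a rfl
      have hlt : x v < d := by
        rw [hxdef, mask]
        split_ifs
        · exact hx v
        · exact h.pos
      refine (run_walkNum (s := s1.setr .z (x v)) (g1.of_eq rfl rfl (fun _ _ => rfl) (by simp))
        (by simpa using hlt)).post ?_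
      rintro s2 ⟨g2, e2, w2⟩
      refine ⟨g2, e1.trans e2, ?_⟩
      have ht : (List.finRange n).take (v + 1) = (List.finRange n).take v ++ [v] := by
        rw [List.take_add_one]
        simp
      rw [ht, List.flatMap_append, walks_append]
      refine ⟨_, w1.ext e2, ?_⟩
      simpa using w2
    split_ifs with hv
    · exact run_mov (key _ (by rw [hs, hxdef, mask, if_pos hv]))
    · exact run_cst (key _ (by rw [hxdef, mask, if_neg hv]))
  · rintro s' ⟨g, e, w⟩
    refine ⟨g.of_eq rfl rfl (fun _ _ => rfl) (by simp), e, ?_⟩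
    have : (List.finRange n).take n = List.finRange n := by
      rw [List.take_of_length_le]; simp
    rw [this] at w
    simpa [Key, path] using w

end Dictionary

/-! ### Passes over the rows of a bank -/

section Passes

variable {n : ℕ}

/-- The registers that programs for operations on tables may change if the banks with numbers less
than `nb` are to be kept. -/
def Rg.free (nb : ℕ) : Rg → Prop
  | .len b | .pres b | .lo b | .hi b => nb ≤ b
  | .out | .bud | .fail | .ocnt | .go | .idn | .val | .ptr | .hlf | .ne => False
  | _ => True

/-- The arrays that programs for operations on tables may change if the banks with numbers less
than `nb` are to be kept. -/
def Ar.free (nb : ℕ) : Ar → Prop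
  | .col b _ => nb ≤ b
  | .inp | .out | .half | .par | .cmp | .dec => False
  | _ => True

/-- The program changes only free registers and arrays. -/
def Prog.Local (nb : ℕ) (P : Prog) : Prop :=
  (∀ a, P.wr a → a.free nb) ∧ ∀ a, P.wa a → a.free nb

/-- The states differ only in free registers and arrays. -/
def Kept (nb : ℕ) (s s' : State) : Prop :=
  (∀ a : Rg, ¬ a.free nb → s'.r a = s.r a) ∧ ∀ a : Ar, ¬ a.free nb → s'.m a = s.m a

theorem Kept.refl (nb : ℕ) (s : State) : Kept nb s s := ⟨fun _ _ => rfl, fun _ _ => rfl⟩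

theorem Kept.trans {nb : ℕ} {s s' s'' : State} (h : Kept nb s s') (h' : Kept nb s' s'') :
    Kept nb s s'' :=
  ⟨fun a ha => (h'.1 a ha).trans (h.1 a ha), fun a ha => (h'.2 a ha).trans (h.2 a ha)⟩

theorem Rg.free.mono {nb nb' : ℕ} (h : nb ≤ nb') {a : Rg} (ha : a.free nb') : a.free nb := by
  cases a <;> simp only [Rg.free] at ha ⊢
  all_goals omega

theorem Ar.free.mono {nb nb' : ℕ} (h : nb ≤ nb') {a : Ar} (ha : a.free nb') : a.free nb := by
  cases a <;> simp only [Ar.free] at ha ⊢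
  omega

theorem Kept.mono {nb nb' : ℕ} (h : nb ≤ nb') {s s' : State} (hk : Kept nb' s s') :
    Kept nb s s' :=
  ⟨fun a ha => hk.1 a fun e => ha (e.mono h), fun a ha => hk.2 a fun e => ha (e.mono h)⟩

theorem Frame.kept {nb : ℕ} {P : Prog} (hP : P.Local nb) {s s' : State} (h : Frame P s s') :
    Kept nb s s' :=
  ⟨fun a ha => h.1 a fun e => ha (hP.1 a e), fun a ha => h.2 a fun e => ha (hP.2 a e)⟩

theorem Run.kept {nb : ℕ} {P : Prog} (hP : P.Local nb) {s : State} {T : ℕ} {Q : State → Prop}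
    (h : Run P s T Q) : Run P s T fun s' => Q s' ∧ Kept nb s s' :=
  h.frame.post fun _ h => ⟨h.1, h.2.kept hP⟩

theorem Kept.setr {nb : ℕ} {s s' : State} (h : Kept nb s s') {a : Rg} (ha : a.free nb) (c : ℕ) :
    Kept nb s (s'.setr a c) := by
  refine ⟨fun b hb => ?_, h.2⟩
  rw [State.r_setr, if_neg (by rintro rfl; exact hb ha), h.1 b hb]

theorem rows_setr {s : State} {a : Rg} {c b : ℕ} (h : Rg.len b ≠ a) :
    rows n (s.setr a c) b = rows n s b :=
  rows_congr (by rw [State.r_setr, if_neg h]) fun _ => rfl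

theorem Kept.rows {nb : ℕ} {s s' : State} (h : Kept nb s s') {b : ℕ} (hb : b < nb) :
    rows n s' b = rows n s b :=
  rows_congr (h.1 _ (by simp [Rg.free, hb])) fun v => h.2 _ (by simp [Ar.free, hb])

section Local

variable {nb : ℕ}

@[simp] theorem local_cst {a : Rg} {c : ℕ} : (cst a c).Local nb ↔ a.free nb := by
  simp [Prog.Local]
@[simp] theorem local_mov {a c : Rg} : (mov a c).Local nb ↔ a.free nb := by
  simp [Prog.Local]
@[simp] theorem local_inc {a : Rg} : (inc a).Local nb ↔ a.free nb := by
  simp [Prog.Local]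
@[simp] theorem local_dif {a c e : Rg} : (dif a c e).Local nb ↔ a.free nb := by
  simp [Prog.Local]
@[simp] theorem local_lod {a i : Rg} {A : Ar} : (lod a A i).Local nb ↔ a.free nb := by
  simp [Prog.Local]
@[simp] theorem local_sto {a i : Rg} {A : Ar} : (sto A i a).Local nb ↔ A.free nb := by
  simp [Prog.Local]
@[simp] theorem local_skp : skp.Local nb ↔ True := by
  simp [Prog.Local, Rg.free]
@[simp] theorem local_seq {p q : Prog} : (p ;; q).Local nb ↔ p.Local nb ∧ q.Local nb := by
  simp only [Prog.Local, wr_seq, wa_seq, or_imp, forall_and]; tauto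
@[simp] theorem local_ite' {a : Rg} {p q : Prog} :
    (ite' a p q).Local nb ↔ p.Local nb ∧ q.Local nb := by
  simp only [Prog.Local, wr_ite', wa_ite', or_imp, forall_and]; tauto
@[simp] theorem local_whl {a : Rg} {p : Prog} : (whl a p).Local nb ↔ p.Local nb := Iff.rfl

@[simp] theorem local_forV {f : Fin n → Prog} : (forV f).Local nb ↔ ∀ v, (f v).Local nb := by
  constructor
  · rintro ⟨h1, h2⟩ v
    exact ⟨fun a ha => h1 a ((wr_forV f a).2 (Or.inr ⟨v, ha⟩)),
      fun a ha => h2 a ((wa_forV f a).2 ⟨v, ha⟩)⟩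
  · intro h
    refine ⟨fun a ha => ?_, fun a ha => ?_⟩
    · rcases (wr_forV f a).1 ha with rfl | ⟨v, hv⟩
      · simp [Rg.free]
      · exact (h v).1 a hv
    · obtain ⟨v, hv⟩ := (wa_forV f a).1 ha
      exact (h v).2 a hv

@[simp] theorem local_loadRow {dst : ℕ → Rg} {b : ℕ} {i : Rg} :
    (loadRow n dst b i).Local nb ↔ ∀ v : Fin n, (dst v).free nb := by simp [loadRow]

@[simp] theorem local_appendRow {src : ℕ → Rg} {b : ℕ} :
    (appendRow n src b).Local nb ↔ nb ≤ b := by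
  simp only [appendRow, local_seq, local_forV, local_sto, local_inc, Rg.free, Ar.free]
  tauto

@[simp] theorem local_forRows {b : ℕ} {body : Prog} :
    (forRows n b body).Local nb ↔ body.Local nb := by
  simp [forRows, Rg.free]

@[simp] theorem local_walk {src : ℕ → Rg} {X : Finset (Fin n)} : (walk n src X).Local nb := by
  refine ⟨fun a ha => ?_, fun a ha => ?_⟩
  · rcases walk_frame.1 a ha with rfl | rfl | rfl | rfl | rfl | rfl | rfl <;> trivial
  · obtain ⟨v, e, rfl⟩ := walk_frame.2 a ha
    trivial

end Local

/-- The registers used for iterating over the rows of a bank. -/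
def Rg.loopVar (a : Rg) : Prop := a.aux ∨ a = .idx ∨ a = .rem ∨ ∃ v, a = .x v

/-- The property does not depend on the memory that is used for iterating, and it is preserved when
the dictionary grows. -/
def Stable (J : State → Prop) : Prop :=
  ∀ s s', J s → Ext s.m s'.m → (∀ a : Ar, ¬ a.isChl → s'.m a = s.m a) →
    (∀ a : Rg, ¬ a.loopVar → s'.r a = s.r a) → J s'

theorem Stable.and {J J' : State → Prop} (h : Stable J) (h' : Stable J') :
    Stable fun s => J s ∧ J' s :=
  fun s s' hs e hm hr => ⟨h s s' hs.1 e hm hr, h' s s' hs.2 e hm hr⟩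

/-- The entries of a list of vectors are less than `d`. -/
def Below (d : ℕ) (l : List (Vec n)) : Prop := ∀ x ∈ l, ∀ v, x v < d

/-- Execute `body` for all rows of bank `b`, with the row in the registers `x` and the node of its
restriction to `X` in `nd`. -/
def pass (n b : ℕ) (X : Finset (Fin n)) (body : Prog) : Prog := forRows n b (walk n .x X ;; body)

@[simp] theorem local_pass {nb b : ℕ} {X : Finset (Fin n)} {body : Prog} :
    (pass n b X body).Local nb ↔ body.Local nb := by simp [pass]

/-- The program may be executed for the rows of bank `b`. -/
structure Body (n b : ℕ) (body : Prog) : Prop where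
  idx : ¬ body.wr .idx
  len : ¬ body.wr (.len b)
  ncnt : ¬ body.wr .ncnt
  col : ∀ v : Fin n, ¬ body.wa (.col b v)
  half : ¬ body.wa .half
  par : ¬ body.wa .par
  chl : ∀ v e, ¬ body.wa (.chl v e)

/-- The invariant `J done` speaks of the rows that have been treated. The body runs with the current
row in the registers `x`, its index in `idx`, and the node of its restriction to `X` in `nd`. -/
theorem run_pass {d b : ℕ} {X : Finset (Fin n)} {body : Prog} {s₀ : State} {l : List (Vec n)}
    (hl : rows n s₀ b = l) (hd : Below d l) (hg : Good d s₀) (cost : Vec n → ℕ)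
    (J : List (Vec n) → State → Prop) (hJ : ∀ l, Stable (J l)) (hB : Body n b body) (h0 : J [] s₀)
    (hbody : ∀ done x rest s, l = done ++ x :: rest → Frame (pass n b X body) s₀ s → Good d s →
      J done s → (∀ v : Fin n, s.r (.x v) = x v) → s.r .idx = done.length →
      Key s.m (mask X x) (s.r .nd) → Run body s (cost x) (J (done ++ [x]))) :
    Run (pass n b X body) s₀ ((l.map fun x => cost x + (walkCost n d + n + 4)).sum + 3) fun s' =>
      J l s' ∧ Good d s' ∧ Ext s₀.m s'.m := by
  refine (run_forRows hl (fun x => walkCost n d + cost x)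
    (fun l s => J l s ∧ Good d s ∧ Ext s₀.m s.m) ?_ ?_ ?_ ?_ ⟨h0, hg, Ext.refl _⟩ ?_).mono ?_ ?_
  · rw [wr_seq, not_or]
    exact ⟨fun h => by have := walk_frame.1 _ h; simp [Rg.aux] at this, hB.idx⟩
  · rw [wr_seq, not_or]
    exact ⟨fun h => by have := walk_frame.1 _ h; simp [Rg.aux] at this, hB.len⟩
  · intro v
    rw [wa_seq, not_or]
    exact ⟨fun h => by have := walk_frame.2 _ h; simp [Ar.isChl] at this, hB.col v⟩
  · rintro l s s' hm hr ⟨h1, h2, h3⟩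
    refine ⟨hJ l s s' h1 (by rw [hm]; exact Ext.refl _) (fun a _ => by rw [hm]) fun a ha => ?_,
      h2.of_eq (by rw [hm]) (by rw [hm]) (fun _ _ => by rw [hm]) ?_, by rw [hm]; exact h3⟩
    · simp only [Rg.loopVar, Rg.aux, not_or, not_exists] at ha
      exact hr a ha.2.1 ha.2.2.1 ha.2.2.2 ha.1.2.2.2.2.2.2
    · exact hr _ (by simp) (by simp) (by simp) (by simp)
  · rintro done x rest s hls hf ⟨h1, h2, h3⟩ hx hi
    have hxl : ∀ v : Fin n, s.r (.x v) < d := fun v => by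
      rw [hx v]; exact hd x (by rw [hls]; simp) v
    refine run_seq ((run_walk (X := X) h2 (by simp [Rg.aux]) hxl).frame.post ?_)
    rintro s1 ⟨⟨g1, e1, k1⟩, f1⟩
    have hxe : (fun v : Fin n => s.r (.x v)) = x := funext hx
    rw [hxe] at k1
    have hr1 : ∀ a : Rg, ¬ a.aux → s1.r a = s.r a := fun a ha =>
      f1.1 a fun h => ha (walk_frame.1 a h)
    have hm1 : ∀ a : Ar, ¬ a.isChl → s1.m a = s.m a := fun a ha =>
      f1.2 a fun h => ha (walk_frame.2 a h)
    refine (hbody done x rest s1 hls ?_ g1 ?_ (fun v => ?_) ?_ k1).frame.post ?_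
    · refine hf.trans (f1.mono (fun a ha => ?_) fun a ha => ?_)
      · simp [forRows, ha]
      · simp [forRows, ha]
    · exact hJ _ s s1 h1 e1 hm1 fun a ha => hr1 a fun h => ha (Or.inl h)
    · rw [hr1 _ (by simp [Rg.aux]), hx]
    · rw [hr1 _ (by simp [Rg.aux]), hi]
    · rintro s2 ⟨j2, f2⟩
      have e2 : ∀ v e, s2.m (.chl v e) = s1.m (.chl v e) := fun v e => f2.2 _ (hB.chl v e)
      exact ⟨j2, g1.of_eq (f2.2 _ hB.half) (f2.2 _ hB.par) e2 (f2.1 _ hB.ncnt),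
        h3.trans (e1.trans (Ext.of_eq e2))⟩
  · refine Nat.add_le_add_right (le_of_eq (congrArg List.sum (List.map_congr_left ?_))) 3
    intro x _
    ring
  · rintro s' ⟨⟨h1, h2, h3⟩, _⟩
    exact ⟨h1, h2, h3⟩

/-- The same with a constant cost. -/
theorem run_pass_const {d b : ℕ} {X : Finset (Fin n)} {body : Prog} {s₀ : State}
    {l : List (Vec n)} (hl : rows n s₀ b = l) (hd : Below d l) (hg : Good d s₀) (cost : ℕ)
    (J : List (Vec n) → State → Prop) (hJ : ∀ l, Stable (J l)) (hB : Body n b body) (h0 : J [] s₀)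
    (hbody : ∀ done x rest s, l = done ++ x :: rest → Frame (pass n b X body) s₀ s → Good d s →
      J done s → (∀ v : Fin n, s.r (.x v) = x v) → s.r .idx = done.length →
      Key s.m (mask X x) (s.r .nd) → Run body s cost (J (done ++ [x]))) :
    Run (pass n b X body) s₀ (l.length * (cost + (walkCost n d + n + 4)) + 3) fun s' =>
      J l s' ∧ Good d s' ∧ Ext s₀.m s'.m :=
  (run_pass hl hd hg (fun _ => cost) J hJ hB h0 hbody).mono (by simp) fun _ h => h

/-! ### Counting the rows of a group -/

/-- In array `a`, the cells of the vectors in `R` contain the values of `F`. -/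
def Holds (m : Ar → ℕ → ℕ) (a : Ar) (R : Set (Vec n)) (F : Vec n → ℕ) : Prop :=
  ∀ y ∈ R, ∃ k, Key m y k ∧ m a k = F y

theorem Holds.ext {m m' : Ar → ℕ → ℕ} {a : Ar} {R : Set (Vec n)} {F : Vec n → ℕ}
    (h : Holds m a R F) (he : Ext m m') (ha : m' a = m a) : Holds m' a R F := fun y hy => by
  obtain ⟨k, h1, h2⟩ := h y hy
  exact ⟨k, h1.ext he, by rw [ha, h2]⟩

theorem stable_holds {a : Ar} (ha : ¬ a.isChl) {R : Set (Vec n)} {F : Vec n → ℕ} :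
    Stable fun s => Holds s.m a R F := fun _ _ h he hm _ => h.ext he (hm a ha)

theorem stable_rows {b : ℕ} {l : List (Vec n)} : Stable fun s => rows n s b = l :=
  fun s s' h _ hm hr => by
    rw [← h]
    exact rows_congr (hr _ (by simp [Rg.loopVar, Rg.aux])) fun v => hm _ (by simp [Ar.isChl])

theorem stable_reg {a : Rg} (ha : ¬ a.loopVar) {p : ℕ → Prop} : Stable fun s => p (s.r a) :=
  fun s s' h _ _ hr => by
    show p (s'.r a)
    rw [hr a ha]
    exact h

theorem Holds.eq {m : Ar → ℕ → ℕ} {a : Ar} {R : Set (Vec n)} {F : Vec n → ℕ} (h : Holds m a R F)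
    {y : Vec n} (hy : y ∈ R) {k : ℕ} (hk : Key m y k) : m a k = F y := by
  obtain ⟨k', h1, h2⟩ := h y hy
  rw [hk.unique h1, h2]

theorem Holds.store {s : State} {c : ℕ} (ht : Trie s.m c) {a : Ar} (ha : ¬ a.isChl)
    {R : Set (Vec n)} {F F' : Vec n → ℕ} (h : Holds s.m a R F) {y : Vec n} {k : ℕ}
    (hk : Key s.m y k) {e : ℕ} (hy : F' y = e) (hF : ∀ z ∈ R, z ≠ y → F' z = F z) :
    Holds (s.setm a k e).m a (insert y R) F' := by
  have he : Ext s.m (s.setm a k e).m := Ext.of_eq fun v i => State.m_setm_ne _ _ _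
    fun h => ha ⟨v, i, h.symm⟩
  have h1 : ∃ k', Key (s.setm a k e).m y k' ∧ (s.setm a k e).m a k' = F' y :=
    ⟨k, hk.ext he, by rw [State.m_setm, if_pos ⟨rfl, rfl⟩, hy]⟩
  intro z hz
  by_cases hzy : z = y
  · rw [hzy]; exact h1
  · have hz' : z ∈ R := hz.resolve_left hzy
    obtain ⟨k', h2, h3⟩ := h z hz'
    refine ⟨k', h2.ext he, ?_⟩
    rw [State.m_setm, if_neg, h3, hF z hz' hzy]
    rintro ⟨_, rfl⟩
    exact hzy (h2.inj ht hk)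

/-- The restrictions to `X` of the vectors of a list. -/
def masks (X : Finset (Fin n)) (l : List (Vec n)) : Set (Vec n) := {y | ∃ x ∈ l, mask X x = y}

theorem mem_masks {X : Finset (Fin n)} {l : List (Vec n)} {x : Vec n} (hx : x ∈ l) :
    mask X x ∈ masks X l := ⟨x, hx, rfl⟩

/-- The cells of array `a` for the rows of bank `b` are set to zero. -/
def zeroPass (n b : ℕ) (X : Finset (Fin n)) (a : Ar) : Prog :=
  pass n b X (cst .t1 0 ;; sto a .nd .t1)

/-- Arrays that may contain data for the nodes of the dictionary. -/
def Ar.isData (a : Ar) : Prop := a = .cnt ∨ a = .head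

theorem Ar.isData.not_isChl {a : Ar} (h : a.isData) : ¬ a.isChl := by
  rintro ⟨v, e, rfl⟩
  simp [Ar.isData] at h

theorem run_zeroPass {d b : ℕ} {X : Finset (Fin n)} {a : Ar} (ha : a.isData) {s : State}
    {l : List (Vec n)} (hl : rows n s b = l) (hd : Below d l) (hg : Good d s) {R : Set (Vec n)}
    (hR : Holds s.m a R 0) :
    Run (zeroPass n b X a) s (l.length * (walkCost n d + n + 6) + 3) fun s' =>
      Holds s'.m a (R ∪ masks X l) 0 ∧ Good d s' ∧ Ext s.m s'.m := by
  refine (run_pass_const hl hd hg 2 (fun done s => Holds s.m a (R ∪ masks X done) 0)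
    (fun _ => stable_holds ha.not_isChl) ?_ (by simpa [masks] using hR) ?_).mono
    (le_of_eq (by ring)) fun _ h => h
  · rcases ha with rfl | rfl <;> constructor <;> simp
  · intro done x rest s' _ _ g h _ _ k
    refine run_seq (T := 1) (T' := 1) (run_cst (run_sto ?_))
    have h1 : Holds (s'.setr .t1 0).m a (R ∪ masks X done) 0 := h
    have h2 := h1.store (F' := 0) (e := 0) (s := s'.setr .t1 0) g.trie ha.not_isChl k rfl
      (fun _ _ _ => rfl)
    intro y hy
    simp only [State.r_setr, if_true, reduceCtorEq, if_false]
    refine h2 y ?_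
    rcases hy with hy | ⟨x', hx', rfl⟩
    · exact Or.inr (Or.inl hy)
    · rcases List.mem_append.1 hx' with hx' | hx'
      · exact Or.inr (Or.inr ⟨x', hx', rfl⟩)
      · simp only [List.mem_singleton] at hx'
        exact Or.inl (by rw [hx'])

@[simp] theorem local_zeroPass {nb b : ℕ} {X : Finset (Fin n)} {a : Ar} :
    (zeroPass n b X a).Local nb ↔ a.free nb := by simp [zeroPass, Rg.free]

/-- Count the rows of bank `b` in each group. -/
def countPass (n b : ℕ) (X : Finset (Fin n)) : Prog :=
  pass n b X (lod .ct .cnt .nd ;; inc .ct ;; sto .cnt .nd .ct)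

@[simp] theorem local_countPass {nb b : ℕ} {X : Finset (Fin n)} :
    (countPass n b X).Local nb := by simp [countPass, Rg.free, Ar.free]

/-- The number of vectors in the list whose restriction to `X` is `y`. -/
def groupSize (X : Finset (Fin n)) (l : List (Vec n)) (y : Vec n) : ℕ :=
  l.countP fun x => mask X x = y

theorem run_countPass {d b : ℕ} {X : Finset (Fin n)} {s : State}
    {l : List (Vec n)} (hl : rows n s b = l) (hd : Below d l) (hg : Good d s) {R : Set (Vec n)}
    (hR : Holds s.m .cnt R 0) (hs : masks X l ⊆ R) :
    Run (countPass n b X) s (l.length * (walkCost n d + n + 7) + 3) fun s' =>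
      Holds s'.m .cnt R (groupSize X l) ∧ Good d s' ∧ Ext s.m s'.m := by
  refine (run_pass_const hl hd hg 3 (fun done s => Holds s.m .cnt R (groupSize X done))
    (fun _ => stable_holds (by simp [Ar.isChl])) ?_ ?_ ?_).mono (le_of_eq (by ring))
    fun _ h => h
  · constructor <;> simp
  · intro y hy
    obtain ⟨k, h1, h2⟩ := hR y hy
    exact ⟨k, h1, by rw [h2]; rfl⟩
  · intro done x rest s' hls _ g h _ _ k
    refine run_seq (T := 1) (T' := 2) (run_lod (run_seq (T := 1) (T' := 1) (run_inc (run_sto ?_))))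
    set s1 := ((s'.setr .ct (s'.m .cnt (s'.r .nd))).setr .ct
      ((s'.setr .ct (s'.m .cnt (s'.r .nd))).r .ct + 1))
    have hx : mask X x ∈ R := hs (mem_masks (by rw [hls]; simp))
    have h1 : Holds s1.m .cnt R (groupSize X done) := h
    have h2 := h1.store (F' := groupSize X (done ++ [x])) (e := s'.m .cnt (s'.r .nd) + 1)
      (s := s1) g.trie (by simp [Ar.isChl]) k (by rw [h.eq hx k]; simp [groupSize])
      (fun z _ hz => by
        have : ¬ mask X x = z := fun e => hz e.symm
        simp [groupSize, this])
    rw [Set.insert_eq_of_mem hx] at h2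
    simpa [s1] using h2

/-- For the restrictions to `X` of the rows of the banks `a` and `b`, count the rows of bank `b`. -/
def groupCount (n a b : ℕ) (X : Finset (Fin n)) : Prog :=
  zeroPass n a X .cnt ;; zeroPass n b X .cnt ;; countPass n b X

@[simp] theorem local_groupCount {nb a b : ℕ} {X : Finset (Fin n)} :
    (groupCount n a b X).Local nb := by simp [groupCount, Ar.free]

theorem run_groupCount {d a b : ℕ} {X : Finset (Fin n)} {s : State}
    {la lb : List (Vec n)} (hla : rows n s a = la) (hlb : rows n s b = lb) (hda : Below d la)
    (hdb : Below d lb) (hg : Good d s) {E : ℕ} (hEa : la.length ≤ E) (hEb : lb.length ≤ E) :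
    Run (groupCount n a b X) s (3 * (E * (walkCost n d + n + 7) + 3)) fun s' =>
      Holds s'.m .cnt (masks X la ∪ masks X lb) (groupSize X lb) ∧ Good d s' := by
  have hk : ∀ {s' s'' : State}, Kept (max a b + 1) s' s'' →
      (rows n s'' a = rows n s' a) ∧ rows n s'' b = rows n s' b := fun h =>
    ⟨h.rows (by omega), h.rows (by omega)⟩
  have c1 : la.length * (walkCost n d + n + 6) + 3 ≤ E * (walkCost n d + n + 7) + 3 :=
    Nat.add_le_add_right (Nat.mul_le_mul hEa (by omega)) 3
  have c2 : lb.length * (walkCost n d + n + 6) + 3 ≤ E * (walkCost n d + n + 7) + 3 :=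
    Nat.add_le_add_right (Nat.mul_le_mul hEb (by omega)) 3
  have c3 : lb.length * (walkCost n d + n + 7) + 3 ≤ E * (walkCost n d + n + 7) + 3 :=
    Nat.add_le_add_right (Nat.mul_le_mul hEb (by omega)) 3
  refine (run_seq ((((run_zeroPass (Or.inl rfl) hla hda hg (R := ∅)
    (by intro y hy; simp at hy)).mono c1 fun _ h => h).kept
    (nb := max a b + 1) (by simp [Ar.free])).post ?_)).mono
    (T := (E * (walkCost n d + n + 7) + 3) + ((E * (walkCost n d + n + 7) + 3) +
      (E * (walkCost n d + n + 7) + 3))) (le_of_eq (by ring)) fun _ h => h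
  rintro s1 ⟨⟨h1, g1, e1⟩, k1⟩
  refine run_seq ((((run_zeroPass (Or.inl rfl) ((hk k1).2.trans hlb) hdb g1 h1).mono
    c2 fun _ h => h).kept (nb := max a b + 1) (by simp [Ar.free])).post ?_)
  rintro s2 ⟨⟨h2, g2, e2⟩, k2⟩
  refine (run_countPass ((hk (k1.trans k2)).2.trans hlb) hdb g2 h2 ?_).mono c3 ?_
  · exact Set.subset_union_right
  · rintro s3 ⟨h3, g3, e3⟩
    refine ⟨?_, g3⟩
    simpa using h3

/-! ### Filtering the rows of a bank -/

/-- Write to bank `nb` the rows of bank `a` for which the number of rows of bank `b` with the same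
restriction to `X` is greater than `lo0` and at most `hi0`. -/
def filterRows (n nb a b : ℕ) (X : Finset (Fin n)) : Prog :=
  groupCount n a b X ;; cst (.len nb) 0 ;;
    pass n a X (lod .ct .cnt .nd ;; dif .t1 .ct .lo0 ;;
      ite' .t1 (dif .t1 .ct .hi0 ;; ite' .t1 skp (appendRow n .x nb)) skp)

@[simp] theorem local_filterRows {nb nb' a b : ℕ} {X : Finset (Fin n)} :
    (filterRows n nb a b X).Local nb' ↔ nb' ≤ nb := by
  simp [filterRows, Rg.free]

@[simp] theorem wr_appendRow {src : ℕ → Rg} {b : ℕ} (a : Rg) :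
    (appendRow n src b).wr a ↔ a = .len b ∨ a = .junk := by
  simp [appendRow]; tauto

@[simp] theorem wa_appendRow {src : ℕ → Rg} {b : ℕ} (a : Ar) :
    (appendRow n src b).wa a ↔ ∃ v : Fin n, a = .col b v := by
  simp [appendRow]

theorem run_filterRows {d nb a b : ℕ} {X : Finset (Fin n)} {s : State}
    {la lb : List (Vec n)} (hla : rows n s a = la) (hlb : rows n s b = lb) (hda : Below d la)
    (hdb : Below d lb) (hg : Good d s) {E : ℕ} (hEa : la.length ≤ E) (hEb : lb.length ≤ E)
    (ha : a < nb) {lo hi : ℕ} (hlo : s.r .lo0 = lo) (hhi : s.r .hi0 = hi) :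
    Run (filterRows n nb a b X) s (6 * ((E + 1) * (walkCost n d + 6 * n + 20))) fun s' =>
      rows n s' nb = la.filter (fun x => lo < groupSize X lb (mask X x) ∧
        groupSize X lb (mask X x) ≤ hi) ∧ Good d s' := by
  have hB : Body n a (lod .ct .cnt .nd ;; dif .t1 .ct .lo0 ;;
      ite' .t1 (dif .t1 .ct .hi0 ;; ite' .t1 skp (appendRow n .x nb)) skp) := by
    constructor <;> simp <;> omega
  refine (run_seq ((run_groupCount hla hlb hda hdb hg hEa hEb).frame.post ?_)).mono
    (T := (3 * (E * (walkCost n d + n + 7) + 3)) +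
      (1 + (la.length * (n + 8 + (walkCost n d + n + 4)) + 3))) ?_ (fun _ h => h)
  · rintro s1 ⟨⟨h1, g1⟩, f1⟩
    refine run_seq (run_cst ?_)
    have k1 : Kept nb s s1 := f1.kept (by simp)
    have l1 : s1.r .lo0 = lo := by
      rw [← hlo]; refine f1.1 _ fun h => ?_
      simp [groupCount, zeroPass, countPass, pass, forRows, loadRow] at h
      exact absurd (walk_frame.1 _ h) (by simp [Rg.aux])
    have l2 : s1.r .hi0 = hi := by
      rw [← hhi]; refine f1.1 _ fun h => ?_
      simp [groupCount, zeroPass, countPass, pass, forRows, loadRow] at h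
      exact absurd (walk_frame.1 _ h) (by simp [Rg.aux])
    refine (run_pass_const (l := la) (d := d) ?_ hda ?_ _ (fun done s => (rows n s nb = done.filter
      (fun x => lo < groupSize X lb (mask X x) ∧ groupSize X lb (mask X x) ≤ hi)) ∧
      (Holds s.m .cnt (masks X la ∪ masks X lb) (groupSize X lb)) ∧ s.r .lo0 = lo ∧ s.r .hi0 = hi)
      (fun l => ?_) hB ?_ ?_).post ?_
    · rw [← hla, ← k1.rows (n := n) ha]
      refine rows_congr ?_ fun v => rfl
      rw [State.r_setr, if_neg (by simp; omega)]
    · exact g1.of_eq rfl rfl (fun _ _ => rfl) (by simp)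
    · exact stable_rows.and ((stable_holds (by simp [Ar.isChl])).and
        ((stable_reg (p := fun c => c = lo) (by simp [Rg.loopVar, Rg.aux])).and
        (stable_reg (p := fun c => c = hi) (by simp [Rg.loopVar, Rg.aux]))))
    · refine ⟨?_, h1, by simpa using l1, by simpa using l2⟩
      simp [rows]
    · rintro done x rest s2 hls - g2 ⟨j1, j2, j3, j4⟩ hx - k2
      have hc : s2.m .cnt (s2.r .nd) = groupSize X lb (mask X x) :=
        j2.eq (Or.inl (mem_masks (by rw [hls]; simp))) k2
      refine Run.mono (run_seq (T := 1) (T' := 1 + (1 + ((n + 2) + 1) + 1)) (run_lod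
        (run_seq (T := 1) (run_dif (run_ite (fun h1 => ?_) fun h1 => ?_))))) (T' := n + 8)
        (by omega) (fun _ h => h)
      · simp only [State.r_setr, if_true, reduceCtorEq, if_false, hc, j3] at h1
        refine run_seq (run_dif (run_ite (fun h2 => ?_) fun h2 => ?_))
        · simp only [State.r_setr, if_true, reduceCtorEq, if_false, hc, j4] at h2
          refine Run.mono (run_skp ?_) (show 1 ≤ n + 2 by omega) fun _ h => h
          refine ⟨?_, j2, by simpa using j3, by simpa using j4⟩
          simp only [rows_setr, ne_eq, reduceCtorEq, not_false_eq_true]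
          rw [j1, List.filter_append]
          have : ¬ groupSize X lb (mask X x) ≤ hi := by omega
          simp [this]
        · simp only [State.r_setr, if_true, reduceCtorEq, if_false, hc, j4] at h2
          refine (run_appendRow _).post ?_
          rintro s3 ⟨r3, m3, q3⟩
          refine ⟨?_, j2.ext (Ext.of_eq fun v e => ?_) ?_, ?_, ?_⟩
          · rw [r3, List.filter_append]
            simp only [rows_setr, ne_eq, reduceCtorEq, not_false_eq_true]
            rw [j1]
            congr 1
            have c1 : lo < groupSize X lb (mask X x) := by omega
            have c2 : groupSize X lb (mask X x) ≤ hi := by omega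
            simp only [List.filter_cons, c1, c2, and_self, decide_true, if_true, List.filter_nil]
            simpa using funext hx
          · rw [m3 _ (by simp)]; rfl
          · rw [m3 _ (by simp)]; rfl
          · rw [q3 _ (by simp) (by simp)]; simpa using j3
          · rw [q3 _ (by simp) (by simp)]; simpa using j4
      · simp only [State.r_setr, if_true, reduceCtorEq, if_false, hc, j3] at h1
        refine Run.mono (run_skp ?_) (show 1 ≤ 1 + (n + 2 + 1) by omega) fun _ h => h
        refine ⟨?_, j2, by simpa using j3, by simpa using j4⟩
        simp only [rows_setr, ne_eq, reduceCtorEq, not_false_eq_true]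
        rw [j1, List.filter_append]
        have : ¬ lo < groupSize X lb (mask X x) := by omega
        simp [this]
    · rintro s3 ⟨⟨h1, _⟩, h2, _⟩
      exact ⟨h1, h2⟩
  · have h1 : la.length * (n + 8 + (walkCost n d + n + 4)) ≤ E * (walkCost n d + 6 * n + 20) :=
      Nat.mul_le_mul hEa (by omega)
    have h2 : E * (walkCost n d + n + 7) ≤ E * (walkCost n d + 6 * n + 20) :=
      Nat.mul_le_mul_left _ (by omega)
    have h3 : (E + 1) * (walkCost n d + 6 * n + 20) = E * (walkCost n d + 6 * n + 20) +
      (walkCost n d + 6 * n + 20) := by ring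
    omega

end Passes

/-! ### Projections and joins of banks -/

section ProjectJoin

variable {n : ℕ}

theorem stable_rows' {b : ℕ} {p : List (Vec n) → Prop} : Stable fun s => p (rows n s b) :=
  fun s s' h e hm hr => by
    show p (rows n s' b)
    rw [stable_rows (n := n) (l := rows n s b) s s' rfl e hm hr]
    exact h

/-- Set the vector registers `x` to zero outside `X`. -/
def maskRow (n : ℕ) (X : Finset (Fin n)) : Prog :=
  forV fun v : Fin n => if v ∈ X then skp else cst (.x v) 0

@[simp] theorem wr_maskRow {X : Finset (Fin n)} (a : Rg) :
    (maskRow n X).wr a ↔ a = .junk ∨ ∃ v : Fin n, v ∉ X ∧ a = .x v := by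
  simp only [maskRow, wr_forV]
  constructor
  · rintro (h | ⟨v, h⟩)
    · exact Or.inl h
    · split_ifs at h with hv
      · exact Or.inl (by simpa using h)
      · exact Or.inr ⟨v, hv, by simpa using h⟩
  · rintro (h | ⟨v, hv, h⟩)
    · exact Or.inl h
    · exact Or.inr ⟨v, by simp [hv, h]⟩

@[simp] theorem wa_maskRow {X : Finset (Fin n)} (a : Ar) : (maskRow n X).wa a ↔ False := by
  simp only [maskRow, wa_forV, iff_false, not_exists]
  intro v h
  split_ifs at h <;> simp at h

theorem run_maskRow {X : Finset (Fin n)} {s : State} {x : Vec n}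
    (hx : ∀ v : Fin n, s.r (.x v) = x v) :
    Run (maskRow n X) s (n + 1) fun s' => ∀ v : Fin n, s'.r (.x v) = mask X x v := by
  refine (run_forV 1 (fun k s' => ∀ v : Fin n, s'.r (.x v) = if v.val < k then mask X x v else x v)
    (by simpa using hx) ?_ ?_).mono (by omega) fun _ h => h
  · intro v s' _ h
    have hu : ∀ u : Fin n, u ≠ v → ((u.val < v.val + 1) ↔ u.val < v.val) := fun u hu => by
      have : u.val ≠ v.val := fun e => hu (Fin.ext e)
      omega
    split_ifs with hv
    · refine run_skp fun u => ?_
      rw [State.r_setr, if_neg (by simp), h]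
      by_cases huv : u = v
      · subst huv; simp [mask, hv]
      · simp only [hu u huv]
    · refine run_cst fun u => ?_
      rw [State.r_setr]
      by_cases huv : u = v
      · subst huv; simp [mask, hv]
      · rw [if_neg (by simpa using fun e => huv (Fin.ext e)), h]
        simp only [hu u huv]
  · intro s' h v
    rw [State.r_setr, if_neg (by simp), h, if_pos v.2]

@[simp] theorem local_maskRow {nb : ℕ} {X : Finset (Fin n)} : (maskRow n X).Local nb := by
  constructor
  · intro a ha
    rcases (wr_maskRow a).1 ha with rfl | ⟨v, _, rfl⟩ <;> simp [Rg.free]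
  · intro a ha
    simp at ha

/-- Write to bank `nb` the restrictions to `X` of the rows of bank `a`. -/
def projRows (n nb a : ℕ) (X : Finset (Fin n)) : Prog :=
  zeroPass n a X .cnt ;; cst (.len nb) 0 ;;
    pass n a X (lod .ct .cnt .nd ;; ite' .ct skp
      (cst .t1 1 ;; sto .cnt .nd .t1 ;; maskRow n X ;; appendRow n .x nb))

@[simp] theorem local_projRows {nb nb' a : ℕ} {X : Finset (Fin n)} :
    (projRows n nb a X).Local nb' ↔ nb' ≤ nb := by
  simp [projRows, Rg.free, Ar.free]

open Classical in
theorem run_projRows {d nb a : ℕ} {X : Finset (Fin n)} {s : State}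
    {la : List (Vec n)} (hla : rows n s a = la) (hda : Below d la)
    (hg : Good d s) {E : ℕ} (hEa : la.length ≤ E) (ha : a < nb) :
    Run (projRows n nb a X) s (6 * ((E + 1) * (walkCost n d + 6 * n + 20))) fun s' =>
      ((rows n s' nb).Nodup ∧ ∀ y, y ∈ rows n s' nb ↔ y ∈ masks X la) ∧ Good d s' := by
  have hB : Body n a (lod .ct .cnt .nd ;; ite' .ct skp
      (cst .t1 1 ;; sto .cnt .nd .t1 ;; maskRow n X ;; appendRow n .x nb)) := by
    constructor <;> simp <;> omega
  refine (run_seq (((run_zeroPass (Or.inl rfl) hla hda hg (R := ∅)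
    (by intro y hy; simp at hy)).kept (nb := nb) (by simp [Ar.free])).post ?_)).mono
    (T := (la.length * (walkCost n d + n + 6) + 3) +
      (1 + (la.length * (2 * n + 7 + (walkCost n d + n + 4)) + 3))) ?_ (fun _ h => h)
  · rintro s1 ⟨⟨h1, g1, _⟩, k1⟩
    refine run_seq (run_cst ?_)
    refine (run_pass_const (l := la) (d := d) ?_ hda ?_ _ (fun done s =>
      ((rows n s nb).Nodup ∧ ∀ y, y ∈ rows n s nb ↔ y ∈ masks X done) ∧
      Holds s.m .cnt (masks X la) (fun y => if y ∈ masks X done then 1 else 0))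
      (fun l => ?_) hB ?_ ?_).post ?_
    · rw [rows_setr (by simp; omega), k1.rows ha, hla]
    · exact g1.of_eq rfl rfl (fun _ _ => rfl) (by simp)
    · exact (stable_rows' (p := fun l' => l'.Nodup ∧ ∀ y, y ∈ l' ↔ y ∈ masks X l)).and
        (stable_holds (by simp [Ar.isChl]))
    · refine ⟨by simp [rows, masks], ?_⟩
      have : (fun y => if y ∈ masks X ([] : List (Vec n)) then 1 else 0) = (0 : Vec n → ℕ) := by
        funext y; simp [masks]
      rw [this]
      simpa using h1
    · rintro done x rest s2 hls - g2 ⟨⟨j1, j2⟩, j3⟩ hx - k2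
      have hxa : mask X x ∈ masks X la := mem_masks (by rw [hls]; simp)
      have hc := j3.eq hxa k2
      have hmem : ∀ y, y ∈ masks X (done ++ [x]) ↔ y ∈ masks X done ∨ y = mask X x := by
        intro y
        simp only [masks, List.mem_append, List.mem_singleton, Set.mem_ofPred_eq, or_and_right,
          exists_or, exists_eq_left]
        rw [eq_comm (a := y)]
      refine Run.mono (run_seq (T := 1) (T' := (1 + (1 + ((n + 1) + (n + 2)))) + 1)
        (run_lod (run_ite (fun h1 => ?_) fun h1 => ?_))) (T' := 2 * n + 7) (by omega) (fun _ h => h)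
      · simp only [State.r_setr, if_true, hc] at h1
        have hd : mask X x ∈ masks X done := by
          by_contra hne
          simp [hne] at h1
        refine Run.mono (run_skp ?_) (show 1 ≤ 1 + (1 + ((n + 1) + (n + 2))) by omega) fun _ h => h
        have e : ∀ y, y ∈ masks X (done ++ [x]) ↔ y ∈ masks X done := fun y => by
          rw [hmem]
          exact ⟨fun h => h.elim id fun e => e ▸ hd, Or.inl⟩
        simp only [rows_setr, ne_eq, reduceCtorEq, not_false_eq_true, e]
        exact ⟨⟨j1, j2⟩, j3⟩
      · simp only [State.r_setr, if_true, hc] at h1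
        have hd : mask X x ∉ masks X done := by
          intro hne
          simp [hne] at h1
        refine run_seq (run_cst (run_seq (run_sto ?_)))
        have j4 : Holds ((s2.setr .ct (s2.m .cnt (s2.r .nd))).setr .t1 1).m .cnt (masks X la)
          (fun y => if y ∈ masks X done then 1 else 0) := j3
        have j5 := j4.store (F' := fun y => if y ∈ masks X (done ++ [x]) then 1 else 0) (e := 1)
          g2.trie (by simp [Ar.isChl]) k2 (by simp [hmem])
          (fun z _ hz => by simp [hmem, hz])
        rw [Set.insert_eq_of_mem hxa] at j5
        simp only [State.r_setr, if_true, reduceCtorEq, if_false]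
        set s3 := (((s2.setr Rg.ct (s2.m Ar.cnt (s2.r Rg.nd))).setr Rg.t1 1).setm Ar.cnt
          (s2.r Rg.nd) 1) with hs3
        have e3 : rows n s3 nb = rows n s2 nb :=
          rows_congr (by simp [hs3]) fun v => State.m_setm_ne _ _ _ (by simp)
        refine run_seq ((run_maskRow (x := x) (fun v => by simp [hs3, hx])).frame.post ?_)
        rintro s4 ⟨hx4, f4⟩
        have m4 : s4.m = s3.m := funext fun a => f4.2 a (by simp)
        have e4 : rows n s4 nb = rows n s2 nb := by
          rw [← e3]
          exact rows_congr (f4.1 _ (by simp)) fun v => by rw [m4]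
        refine (run_appendRow s4).post ?_
        rintro s5 ⟨r5, m5, q5⟩
        refine ⟨?_, j5.ext (Ext.of_eq fun v e => by rw [m5 _ (by simp), m4]; rfl)
          (by rw [m5 _ (by simp), m4]; rfl)⟩
        have hv : (fun v : Fin n => s4.r (.x v)) = mask X x := funext hx4
        rw [r5, e4, hv]
        refine ⟨?_, fun y => ?_⟩
        · rw [List.nodup_append]
          refine ⟨j1, by simp, ?_⟩
          intro y hy z hz
          rw [List.mem_singleton] at hz
          rintro rfl
          rw [hz, j2] at hy
          exact hd hy
        · rw [hmem, List.mem_append, j2, List.mem_singleton]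
    · rintro s3 ⟨⟨h1, _⟩, h2, _⟩
      exact ⟨h1, h2⟩
  · have h1 : la.length * (2 * n + 7 + (walkCost n d + n + 4)) ≤
        E * (walkCost n d + 6 * n + 20) := Nat.mul_le_mul hEa (by omega)
    have h2 : la.length * (walkCost n d + n + 6) ≤ E * (walkCost n d + 6 * n + 20) :=
      Nat.mul_le_mul hEa (by omega)
    have h3 : (E + 1) * (walkCost n d + 6 * n + 20) = E * (walkCost n d + 6 * n + 20) +
      (walkCost n d + 6 * n + 20) := by ring
    omega

/-- The number `j` is the head of a linked list of the given rows of bank `q`, which are among the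
first `N` rows. The number `0` stands for the empty list and `i + 1` for a list that starts with
row `i`. -/
def Chain (m : Ar → ℕ → ℕ) (q N : ℕ) : ℕ → List (Vec n) → Prop
  | j, [] => j = 0
  | j, x :: L => ∃ i < N, j = i + 1 ∧ rowAt n m q i = x ∧ Chain m q N (m .nxt i) L

theorem Chain.congr {m m' : Ar → ℕ → ℕ} {q N N' : ℕ} (hN : N ≤ N')
    (h1 : ∀ i < N, m' .nxt i = m .nxt i) (h2 : ∀ v : Fin n, m' (.col q v) = m (.col q v)) {j : ℕ}
    {L : List (Vec n)} (h : Chain m q N j L) : Chain m' q N' j L := by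
  induction L generalizing j with
  | nil => exact h
  | cons x L ih =>
    obtain ⟨i, hi, rfl, hx, hL⟩ := h
    refine ⟨i, by omega, rfl, ?_, ?_⟩
    · rw [← hx]
      funext v
      exact congrFun (h2 v) i
    · rw [h1 i hi]
      exact ih hL

/-- For the vectors in `R`, the lists `G` of rows of bank `q` are stored. -/
def Chains (m : Ar → ℕ → ℕ) (q N : ℕ) (R : Set (Vec n)) (G : Vec n → List (Vec n)) : Prop :=
  ∀ y ∈ R, ∃ k, Key m y k ∧ Chain m q N (m .head k) (G y)

theorem stable_chains {q N : ℕ} {R : Set (Vec n)} {G : Vec n → List (Vec n)} :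
    Stable fun s => Chains s.m q N R G := fun s s' h e hm _ y hy => by
  obtain ⟨k, h1, h2⟩ := h y hy
  refine ⟨k, h1.ext e, ?_⟩
  rw [hm .head (by simp [Ar.isChl])]
  exact h2.congr le_rfl (fun i _ => by rw [hm .nxt (by simp [Ar.isChl])])
    fun v => hm _ (by simp [Ar.isChl])

/-- The rows with restriction `y` to `X`, in reverse order. -/
def group (X : Finset (Fin n)) (l : List (Vec n)) (y : Vec n) : List (Vec n) :=
  (l.filter fun x => mask X x = y).reverse

theorem length_group {X : Finset (Fin n)} {l : List (Vec n)} {y : Vec n} :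
    (group X l y).length = groupSize X l y := by
  simp [group, groupSize, List.countP_eq_length_filter]

/-- Build the linked lists of the groups of rows of bank `q`. -/
def linkPass (n q : ℕ) (X : Finset (Fin n)) : Prog :=
  pass n q X (lod .jj .head .nd ;; sto .nxt .idx .jj ;; mov .jj .idx ;; inc .jj ;;
    sto .head .nd .jj)

@[simp] theorem local_linkPass {nb q : ℕ} {X : Finset (Fin n)} : (linkPass n q X).Local nb := by
  simp [linkPass, Rg.free, Ar.free]

theorem run_linkPass {d q : ℕ} {X : Finset (Fin n)} {s : State} {l : List (Vec n)}
    (hl : rows n s q = l) (hd : Below d l) (hg : Good d s) {R : Set (Vec n)}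
    (hR : Holds s.m .head R 0) :
    Run (linkPass n q X) s (l.length * (walkCost n d + n + 9) + 3) fun s' =>
      Chains s'.m q l.length R (group X l) ∧ Good d s' := by
  refine (run_pass_const hl hd hg 5 (fun done s => rows n s q = l ∧
    Chains s.m q done.length R (group X done)) (fun _ => stable_rows.and stable_chains)
    ?_ ?_ ?_).mono (le_of_eq (by ring)) fun _ h => ⟨h.1.2, h.2.1⟩
  · constructor <;> simp
  · refine ⟨hl, fun y hy => ?_⟩
    obtain ⟨k, h1, h2⟩ := hR y hy
    exact ⟨k, h1, h2⟩
  · rintro done x rest s1 hls - g ⟨j0, j1⟩ _ hi k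
    have hrow : rowAt n s1.m q done.length = x := by
      have h1 : (rows n s1 q)[done.length]? = some x := by rw [j0, hls]; simp
      have h2 : s1.r (.len q) = l.length := by rw [← length_rows (n := n), j0]
      rw [rows, List.getElem?_map, List.getElem?_range (by rw [h2, hls]; simp)] at h1
      simpa using h1
    refine run_seq (T := 1) (T' := 4) (run_lod (run_seq (T := 1) (T' := 3) (run_sto
      (run_seq (T := 1) (T' := 2) (run_mov (run_seq (T := 1) (T' := 1) (run_inc (run_sto ?_))))))))
    simp only [State.r_setr, State.r_setm, if_true, reduceCtorEq, if_false, hi]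
    generalize hs' : State.setm _ Ar.head (s1.r .nd) (done.length + 1) = s'
    have hm : ∀ a j, s'.m a j = if a = .head ∧ j = s1.r .nd then done.length + 1 else
        if a = .nxt ∧ j = done.length then s1.m .head (s1.r .nd) else s1.m a j := by
      intro a j
      rw [← hs', State.m_setm]
      simp only [State.m_setr]
      rw [State.m_setm]
      rfl
    have hr : s'.r (.len q) = s1.r (.len q) := by rw [← hs']; simp
    have he : Ext s1.m s'.m := Ext.of_eq fun v e => funext fun j => by
      rw [hm, if_neg (by simp), if_neg (by simp)]
    have hcol : ∀ v : Fin n, s'.m (.col q v) = s1.m (.col q v) := fun v => funext fun j => by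
      rw [hm, if_neg (by simp), if_neg (by simp)]
    have hnxt : ∀ i < done.length, s'.m .nxt i = s1.m .nxt i := fun i hi => by
      rw [hm, if_neg (by simp), if_neg (fun h => by omega)]
    refine ⟨(rows_congr hr hcol).trans j0, fun y hy => ?_⟩
    rw [List.length_append, List.length_singleton]
    obtain ⟨k', k1, k2⟩ := j1 y hy
    refine ⟨k', k1.ext he, ?_⟩
    have k3 : Chain s'.m q (done.length + 1) (s1.m .head k') (group X done y) :=
      k2.congr (Nat.le_succ _) hnxt hcol
    by_cases hyx : mask X x = y
    · subst hyx
      obtain rfl := k.unique k1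
      have hgr : group X (done ++ [x]) (mask X x) = x :: group X done (mask X x) := by simp [group]
      rw [hgr, hm, if_pos ⟨rfl, rfl⟩]
      refine ⟨done.length, Nat.lt_succ_self _, rfl, ?_, ?_⟩
      · rw [← hrow]
        funext v
        exact congrFun (hcol v) _
      · rw [hm .nxt, if_neg (by simp), if_pos ⟨rfl, rfl⟩]
        exact k3
    · have hgr : group X (done ++ [x]) y = group X done y := by simp [group, hyx]
      rw [hgr, hm, if_neg, if_neg (by simp)]
      · exact k3
      · rintro ⟨-, rfl⟩
        exact hyx (k.inj g.trie k1)

/-- Append to bank `nb` the vector in the registers `x`, combined with the rows of bank `q` in the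
linked list that starts at `jj`. -/
def mergeLoop (n q nb : ℕ) (W : Finset (Fin n)) : Prog :=
  whl .jj (cst .t1 1 ;; dif .t1 .jj .t1 ;; loadRow n .y q .t1 ;;
    (forV fun v : Fin n => if v ∈ W then mov (.y v) (.x v) else skp) ;; appendRow n .y nb ;;
    lod .jj .nxt .t1)

theorem wr_mergeRow {W : Finset (Fin n)} (a : Rg) :
    (forV fun v : Fin n => if v ∈ W then mov (.y v) (.x v) else skp).wr a →
      a = .junk ∨ ∃ v : Fin n, a = .y v := by
  rw [wr_forV]
  rintro (h | ⟨v, h⟩)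
  · exact Or.inl h
  · split_ifs at h
    · exact Or.inr ⟨v, by simpa using h⟩
    · exact Or.inl (by simpa using h)

theorem wa_mergeRow {W : Finset (Fin n)} (a : Ar) :
    ¬ (forV fun v : Fin n => if v ∈ W then mov (.y v) (.x v) else skp).wa a := by
  rw [wa_forV]
  rintro ⟨v, h⟩
  split_ifs at h <;> simp at h

theorem wr_mergeLoop {q nb : ℕ} {W : Finset (Fin n)} (a : Rg)
    (h : (mergeLoop n q nb W).wr a) :
    a = .jj ∨ a = .t1 ∨ a = .junk ∨ a = .len nb ∨ ∃ v : Fin n, a = .y v := by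
  simp only [mergeLoop, wr_whl, wr_seq, wr_cst, wr_dif, wr_lod, loadRow, wr_appendRow,
    wr_forV (f := fun v : Fin n => lod (.y v) (.col q v) .t1)] at h
  have := wr_mergeRow (W := W) a
  tauto

theorem wa_mergeLoop {q nb : ℕ} {W : Finset (Fin n)} (a : Ar)
    (h : (mergeLoop n q nb W).wa a) : ∃ v : Fin n, a = .col nb v := by
  have := wa_mergeRow (W := W) a
  simp only [mergeLoop, wa_whl, wa_seq, wa_cst, wa_dif, wa_lod, loadRow, wa_appendRow,
    wa_forV (f := fun v : Fin n => lod (.y v) (.col q v) .t1), exists_false] at h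
  tauto

@[simp] theorem local_mergeLoop {nb nb' q : ℕ} {W : Finset (Fin n)} (h : nb' ≤ nb) :
    (mergeLoop n q nb W).Local nb' := by
  constructor
  · intro a ha
    rcases wr_mergeLoop a ha with rfl | rfl | rfl | rfl | ⟨v, rfl⟩ <;> simp [Rg.free, h]
  · intro a ha
    obtain ⟨v, rfl⟩ := wa_mergeLoop a ha
    simp [Ar.free, h]

theorem run_mergeRow {W : Finset (Fin n)} {s : State} {x y : Vec n}
    (hx : ∀ v : Fin n, s.r (.x v) = x v) (hy : ∀ v : Fin n, s.r (.y v) = y v) :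
    Run (forV fun v : Fin n => if v ∈ W then mov (.y v) (.x v) else skp) s (n + 1) fun s' =>
      ∀ v : Fin n, s'.r (.y v) = merge W x y v := by
  refine (run_forV 1 (fun k s' => (∀ v : Fin n, s'.r (.x v) = x v) ∧ ∀ v : Fin n, s'.r (.y v) =
    if v.val < k then merge W x y v else y v) ⟨hx, by simpa using hy⟩ ?_ ?_).mono (by omega)
    fun _ h => h
  · rintro v s' _ ⟨h0, h⟩
    have hu : ∀ u : Fin n, u ≠ v → ((u.val < v.val + 1) ↔ u.val < v.val) := fun u hu => by
      have : u.val ≠ v.val := fun e => hu (Fin.ext e)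
      omega
    split_ifs with hv
    · refine run_mov ⟨fun u => by rw [State.r_setr, if_neg (by simp), h0], fun u => ?_⟩
      rw [State.r_setr]
      by_cases huv : u = v
      · subst huv; simp [merge, hv, h0]
      · rw [if_neg (by simpa using fun e => huv (Fin.ext e)), h]
        simp only [hu u huv]
    · refine run_skp ⟨fun u => by rw [State.r_setr, if_neg (by simp), h0], fun u => ?_⟩
      rw [State.r_setr, if_neg (by simp), h]
      by_cases huv : u = v
      · subst huv; simp [merge, hv]
      · simp only [hu u huv]
  · rintro s' ⟨_, h⟩ v
    rw [State.r_setr, if_neg (by simp), h, if_pos v.2]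

theorem run_mergeLoop {q nb N : ℕ} (hq : q ≠ nb) {W : Finset (Fin n)} {s : State} {x : Vec n}
    {L : List (Vec n)} (hL : Chain s.m q N (s.r .jj) L) (hx : ∀ v : Fin n, s.r (.x v) = x v) :
    Run (mergeLoop n q nb W) s (L.length * (3 * n + 8) + 1) fun s' =>
      rows n s' nb = rows n s nb ++ L.map (merge W x) := by
  refine (run_whl (k := L.length) (c := 3 * n + 7) (fun k s' => ∃ L₁ L₂, L = L₁ ++ L₂ ∧
    L₂.length = k ∧ Chain s'.m q N (s'.r .jj) L₂ ∧ rows n s' nb = rows n s nb ++ L₁.map (merge W x))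
    ?_ ?_ ⟨[], L, rfl, rfl, hL, by simp⟩).mono (le_refl _) ?_
  · rintro k s' ⟨L₁, L₂, -, hk, hc, -⟩
    rcases L₂ with _ | ⟨y, L₂⟩
    · have : s'.r .jj = 0 := hc
      simp [this, ← hk]
    · obtain ⟨i, -, e, -⟩ := hc
      rw [e, ← hk]; simp
  · rintro k s1 f1 ⟨L₁, L₂, hLL, hk, hc, hrows⟩
    rcases L₂ with _ | ⟨y, L₂⟩
    · simp at hk
    obtain ⟨i, hi, e, hy, hc⟩ := hc
    have fx : ∀ v : Fin n, s1.r (.x v) = x v := fun v => by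
      rw [f1.1, hx]
      intro h
      have := wr_mergeLoop (n := n) (q := q) (nb := nb) (W := W) _ h
      simp at this
    refine (run_seq (T := 1) (T' := 1 + ((n + 1) + ((n + 1) + ((n + 2) + 1)))) (run_cst
      (run_seq (run_dif ?_)))).mono (by omega) fun _ h => h
    set s2 := (s1.setr .t1 1).setr .t1 ((s1.setr .t1 1).r .jj - (s1.setr .t1 1).r .t1) with hs2
    have ht : s2.r .t1 = i := by simp [hs2, e]
    have r2 : rows n s2 nb = rows n s1 nb := by rw [hs2, rows_setr (by simp), rows_setr (by simp)]
    refine run_seq ((run_loadRow (fun a b h => by simpa using h) (by simp) (by simp) (by simp)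
      s2).post ?_)
    rintro s3 ⟨y3, m3, q3⟩
    have r3 : rows n s3 nb = rows n s2 nb :=
      rows_congr (q3 _ (by simp) (by simp)) fun v => by rw [m3]
    refine run_seq ((run_mergeRow (x := x) (y := y) (fun v => ?_) (fun v => ?_)).frame.post ?_)
    · rw [q3 _ (by simp) (by simp), ← fx v]; simp [hs2]
    · rw [y3 v, ht]; exact congrFun hy v
    rintro s4 ⟨y4, f4⟩
    have m4 : s4.m = s3.m := funext fun a => f4.2 a (wa_mergeRow a)
    have q4 : ∀ a : Rg, a ≠ .junk → (∀ v, a ≠ .y v) → s4.r a = s3.r a := fun a h1 h2 =>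
      f4.1 a fun h => by
        rcases wr_mergeRow a h with h | ⟨v, h⟩
        · exact h1 h
        · exact h2 v h
    have r4 : rows n s4 nb = rows n s3 nb :=
      rows_congr (q4 _ (by simp) (by simp)) fun v => by rw [m4]
    refine run_seq ((run_appendRow s4).post ?_)
    rintro s5 ⟨r5, m5, q5⟩
    refine run_lod ⟨L₁ ++ [y], L₂, by simp [hLL], by simpa using hk, ?_, ?_⟩
    · have t5 : s5.r .t1 = i := by
        rw [q5 _ (by simp) (by simp), q4 _ (by simp) (by simp), q3 _ (by simp) (by simp), ht]
      have n5 : s5.m .nxt = s1.m .nxt := by rw [m5 _ (by simp), m4, m3]; rfl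
      simp only [State.r_setr, if_true, State.m_setr, t5, n5]
      refine hc.congr le_rfl (fun i _ => by rw [n5]) fun v => ?_
      rw [m5 _ (by simp [hq]), m4, m3]; rfl
    · have hv : (fun v : Fin n => s4.r (.y v)) = merge W x y := funext y4
      rw [rows_setr (by simp), r5, r4, r3, r2, hrows, hv]
      simp
  · rintro s' ⟨L₁, L₂, hLL, hk, -, hrows⟩
    rw [List.length_eq_zero_iff] at hk
    rw [hrows, hLL, hk]
    simp

/-- The join of two lists of rows. -/
def joinList (W X : Finset (Fin n)) (lp lq : List (Vec n)) : List (Vec n) :=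
  lp.flatMap fun x => (group X lq (mask X x)).map (merge W x)

theorem length_joinList {W X : Finset (Fin n)} {lp lq : List (Vec n)} :
    (joinList W X lp lq).length = (lp.map fun x => groupSize X lq (mask X x)).sum := by
  simp [joinList, List.length_flatMap, length_group]

/-- Write to bank `nb` the join of the banks `p` and `q`, if it has at most `bud` rows. -/
def joinRows (n nb p q : ℕ) (W X : Finset (Fin n)) : Prog :=
  groupCount n p q X ;; mov .left .bud ;; cst .ok 1 ;;
    pass n p X (lod .ct .cnt .nd ;; dif .t1 .ct .left ;;
      ite' .t1 (cst .ok 0) (dif .left .left .ct)) ;;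
    cst (.len nb) 0 ;; mov (.pres nb) .ok ;;
    ite' .ok (zeroPass n p X .head ;; zeroPass n q X .head ;; linkPass n q X ;;
      pass n p X (lod .jj .head .nd ;; mergeLoop n q nb W)) skp

@[simp] theorem local_joinRows {nb nb' p q : ℕ} {W X : Finset (Fin n)} (h : nb' ≤ nb) :
    (joinRows n nb p q W X).Local nb' := by
  simp [joinRows, Rg.free, Ar.free, h]

/-- First the size of the join is computed from the group sizes, by subtracting them from the size
limit; only if the limit is respected are the rows written. -/
theorem run_joinRows {d nb p q : ℕ} {W X : Finset (Fin n)} {s : State}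
    {lp lq : List (Vec n)} (hlp : rows n s p = lp) (hlq : rows n s q = lq) (hdp : Below d lp)
    (hdq : Below d lq) (hg : Good d s) {E : ℕ} (hEp : lp.length ≤ E) (hEq : lq.length ≤ E)
    (hp : p < nb) (hq : q < nb) {M : ℕ} (hM : s.r .bud = M) (hME : M ≤ E) :
    Run (joinRows n nb p q W X) s (9 * ((E + 1) * (walkCost n d + 6 * n + 20))) fun s' =>
      ((s'.r (.pres nb) = if (joinList W X lp lq).length ≤ M then 1 else 0) ∧
      rows n s' nb = if (joinList W X lp lq).length ≤ M then joinList W X lp lq else []) ∧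
      Good d s' := by
  set G := E * (walkCost n d + 6 * n + 20) + 3 with hG
  have hc : ∀ {L c : ℕ}, L ≤ E → c ≤ walkCost n d + 6 * n + 20 → L * c + 3 ≤ G := fun h1 h2 =>
    Nat.add_le_add_right (Nat.mul_le_mul h1 h2) 3
  have hB1 : Body n p (lod .ct .cnt .nd ;; dif .t1 .ct .left ;;
      ite' .t1 (cst .ok 0) (dif .left .left .ct)) := by constructor <;> simp
  have hB2 : Body n p (lod .jj .head .nd ;; mergeLoop n q nb W) := by
    constructor
    all_goals
      simp only [wr_seq, wa_seq, wr_lod, wa_lod]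
      intros
      intro h
      rcases h with h | h
      · simp at h
      · first
        | have := wr_mergeLoop _ h
          simp at this
          try omega
        | obtain ⟨v, h⟩ := wa_mergeLoop _ h
          simp at h
          try omega
  refine (run_seq (T := 3 * G) (T' := 1 + (1 + (G + (1 + (1 + ((G + (G + (G + G))) + 1))))))
    (((run_groupCount hlp hlq hdp hdq hg hEp hEq).mono
      (Nat.mul_le_mul_left 3 (hc le_rfl (by omega))) fun _ h => h).kept
        (nb := nb) (by simp) |>.post ?_)).mono ?_ fun _ h => h
  swap
  · have h3 : (E + 1) * (walkCost n d + 6 * n + 20) = E * (walkCost n d + 6 * n + 20) +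
      (walkCost n d + 6 * n + 20) := by ring
    omega
  rintro s1 ⟨⟨h1, g1⟩, k1⟩
  have hb1 : s1.r .bud = M := by rw [← hM]; exact k1.1 _ (by simp [Rg.free])
  refine run_seq (run_mov (run_seq (run_cst ?_)))
  set s2 := (s1.setr .left (s1.r .bud)).setr .ok 1 with hs2
  have k2 : Kept nb s s2 := (k1.setr (by trivial) _).setr (by trivial) _
  have g2 : Good d s2 := g1.of_eq rfl rfl (fun _ _ => rfl) (by simp [hs2])
  set size : List (Vec n) → ℕ := fun l => (l.map fun x => groupSize X lq (mask X x)).sum with hsize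
  refine run_seq ((((run_pass_const (l := lp) ((k2.rows hp).trans hlp) hdp g2 5 (fun done s =>
    Holds s.m .cnt (masks X lp ∪ masks X lq) (groupSize X lq) ∧
    (fun o => ∃ u, (o = 1 ∧ u + size done = M ∨ o = 0 ∧ M < size done) ∧ u = s.r .left)
      (s.r .ok)) ?_ hB1 ?_ ?_).mono (hc hEp (by omega)) fun _ h => h).kept (nb := nb)
      (by simp [Rg.free])).post ?_)
  · intro l s s' ⟨i1, u, i2, i3⟩ e hm hr
    refine ⟨i1.ext e (hm _ (by simp [Ar.isChl])), u, ?_, ?_⟩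
    · rw [hr .ok (by simp [Rg.loopVar, Rg.aux])]; exact i2
    · rw [hr .left (by simp [Rg.loopVar, Rg.aux])]; exact i3
  · exact ⟨h1, M, Or.inl ⟨by simp [hs2], by simp [hsize]⟩, by simp [hs2, hb1]⟩
  · rintro done x rest s3 hls - g3 ⟨j1, u, j2, j3⟩ - - k3
    have hcx := j1.eq (Or.inl (mem_masks (by rw [hls]; simp))) k3
    have hsz : size (done ++ [x]) = size done + groupSize X lq (mask X x) := by simp [hsize]
    refine run_seq (T := 1) (T' := 4) (run_lod (run_seq (T := 1) (T' := 3) (run_dif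
      (run_ite (T := 2) (fun c => ?_) fun c => ?_))))
    · simp only [State.r_setr, if_true, reduceCtorEq, if_false, hcx, ← j3] at c
      refine Run.mono (run_cst ?_) (show 1 ≤ 2 by omega) fun _ h => h
      refine ⟨j1, u, Or.inr ⟨by simp, ?_⟩, by simp [← j3]⟩
      rw [hsz]
      rcases j2 with ⟨-, j2⟩ | ⟨-, j2⟩ <;> omega
    · simp only [State.r_setr, if_true, reduceCtorEq, if_false, hcx, ← j3] at c
      refine Run.mono (run_dif ?_) (show 1 ≤ 2 by omega) fun _ h => h
      refine ⟨j1, u - groupSize X lq (mask X x), ?_, by simp [← j3, hcx]⟩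
      simp only [State.r_setr, if_true, reduceCtorEq, if_false, hsz]
      rcases j2 with ⟨j4, j2⟩ | ⟨j4, j2⟩
      · exact Or.inl ⟨j4, by omega⟩
      · exact Or.inr ⟨j4, by omega⟩
  rintro s3 ⟨⟨⟨-, u, j2, -⟩, g3, -⟩, k3⟩
  have hJ : (joinList W X lp lq).length = size lp := length_joinList
  refine run_seq (run_cst (run_seq (run_mov ?_)))
  set s4 := (s3.setr (.len nb) 0).setr (.pres nb) ((s3.setr (.len nb) 0).r .ok) with hs4
  have k4 : Kept nb s s4 := ((k2.trans k3).setr (by simp [Rg.free]) _).setr (by simp [Rg.free]) _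
  have g4 : Good d s4 := g3.of_eq rfl rfl (fun _ _ => rfl) (by simp [hs4])
  have r4 : rows n s4 nb = [] := by simp [rows, hs4]
  have o4 : s4.r .ok = s3.r .ok := by simp [hs4]
  have p4 : s4.r (.pres nb) = s3.r .ok := by simp [hs4]
  refine run_ite (fun c => ?_) fun c => ?_
  · rw [o4] at c
    obtain ⟨ho, hle⟩ : s3.r .ok = 1 ∧ size lp ≤ M := by
      rcases j2 with ⟨j4, j2⟩ | ⟨j4, j2⟩
      · exact ⟨j4, by omega⟩
      · exact absurd j4 c
    simp only [hJ, hle, if_true]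
    refine run_seq ((((run_zeroPass (X := X) (Or.inr rfl) ((k4.rows hp).trans hlp) hdp g4 (R := ∅)
      (by intro y hy; simp at hy)).mono (hc hEp (by omega)) fun _ h => h).frame).post ?_)
    rintro s5 ⟨⟨h5, g5, -⟩, f5⟩
    have k5 : Kept nb s s5 := k4.trans (f5.kept (by simp [Ar.free]))
    refine run_seq ((((run_zeroPass (X := X) (Or.inr rfl) ((k5.rows hq).trans hlq) hdq g5
      h5).mono (hc hEq (by omega)) fun _ h => h).frame).post ?_)
    rintro s6 ⟨⟨h6, g6, -⟩, f6⟩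
    have k6 : Kept nb s s6 := k5.trans (f6.kept (by simp [Ar.free]))
    refine run_seq ((((run_linkPass (X := X) ((k6.rows hq).trans hlq) hdq g6
      h6).mono (hc hEq (by omega)) fun _ h => h).frame).post ?_)
    rintro s7 ⟨⟨h7, g7⟩, f7⟩
    have k7 : Kept nb s s7 := k6.trans (f7.kept (by simp))
    have nw : ∀ a : Rg, a = .len nb ∨ a = .pres nb → s7.r a = s4.r a := by
      intro a ha
      have e1 : ¬ (zeroPass n p X .head).wr a := fun h => by
        simp only [zeroPass, pass, forRows, loadRow, wr_seq, wr_cst, wr_mov, wr_whl, wr_forV,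
          wr_lod, wr_sto, wr_inc, wr_dif] at h
        have := walk_frame (src := .x) (X := X) |>.1 a
        rcases ha with rfl | rfl <;> simp [Rg.aux] at h this <;> exact this h
      have e2 : ¬ (zeroPass n q X .head).wr a := fun h => by
        simp only [zeroPass, pass, forRows, loadRow, wr_seq, wr_cst, wr_mov, wr_whl, wr_forV,
          wr_lod, wr_sto, wr_inc, wr_dif] at h
        have := walk_frame (src := .x) (X := X) |>.1 a
        rcases ha with rfl | rfl <;> simp [Rg.aux] at h this <;> exact this h
      have e3 : ¬ (linkPass n q X).wr a := fun h => by
        simp only [linkPass, pass, forRows, loadRow, wr_seq, wr_cst, wr_mov, wr_whl, wr_forV,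
          wr_lod, wr_sto, wr_inc, wr_dif] at h
        have := walk_frame (src := .x) (X := X) |>.1 a
        rcases ha with rfl | rfl <;> simp [Rg.aux] at h this <;> exact this h
      rw [f7.1 a e3, f6.1 a e2, f5.1 a e1]
    have r7 : rows n s7 nb = [] := by
      have : s7.r (.len nb) = 0 := by rw [nw _ (Or.inl rfl)]; simp [hs4]
      simp [rows, this]
    have p7 : s7.r (.pres nb) = 1 := by rw [nw _ (Or.inr rfl), p4, ho]
    refine (run_pass ((k7.rows hp).trans hlp) hdp g7
      (fun x => 2 + groupSize X lq (mask X x) * (3 * n + 8)) (fun done s =>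
      Chains s.m q lq.length (∅ ∪ masks X lp ∪ masks X lq) (group X lq) ∧
      rows n s nb = joinList W X done lq ∧ s.r (.pres nb) = 1) ?_ hB2 ?_ ?_).mono ?_ ?_
    · exact fun l => stable_chains.and (stable_rows.and
        (stable_reg (p := fun c => c = 1) (by simp [Rg.loopVar, Rg.aux])))
    · exact ⟨h7, by rw [r7]; rfl, p7⟩
    · rintro done x rest s8 hls - g8 ⟨j1, j2, j3⟩ hx - k8
      obtain ⟨k, i1, i2⟩ := j1 _ (Or.inl (Or.inr (mem_masks (x := x) (by rw [hls]; simp))))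
      obtain rfl := k8.unique i1
      refine (run_seq (T := 1) (T' := groupSize X lq (mask X x) * (3 * n + 8) + 1)
        (run_lod ?_)).mono (by omega) fun _ h => h
      have hm9 : (s8.setr .jj (s8.m .head (s8.r .nd))).m = s8.m := rfl
      have := run_mergeLoop (q := q) (nb := nb) (N := lq.length) (W := W) (by omega) (x := x)
        (L := group X lq (mask X x)) (s := s8.setr .jj (s8.m .head (s8.r .nd)))
        (by simpa using i2) (fun v => by simp [hx])
      rw [length_group] at this
      refine this.frame.post ?_
      rintro s9 ⟨r9, f9⟩
      have m9 : ∀ a : Ar, (∀ v, a ≠ .col nb v) → s9.m a = s8.m a := fun a ha =>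
        f9.2 a fun h => by obtain ⟨v, rfl⟩ := wa_mergeLoop a h; exact ha v rfl
      refine ⟨fun y hy => ?_, ?_, ?_⟩
      · obtain ⟨k, i1, i2⟩ := j1 y hy
        refine ⟨k, i1.ext (Ext.of_eq fun v e => m9 _ (by simp)), ?_⟩
        rw [m9 _ (by simp)]
        exact i2.congr le_rfl (fun i _ => by rw [m9 _ (by simp)])
          fun v => m9 _ (by simp; omega)
      · rw [r9, rows_setr (by simp), j2]
        simp [joinList]
      · rw [f9.1 _ fun h => by have := wr_mergeLoop _ h; simp at this]
        simpa using j3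
    · have e : (lp.map fun x => 2 + groupSize X lq (mask X x) * (3 * n + 8) +
          (walkCost n d + n + 4)).sum = lp.length * (walkCost n d + n + 6) +
          size lp * (3 * n + 8) := by
        simp only [hsize, List.sum_map_add, List.sum_map_mul_right]
        simp
        ring
      rw [e]
      have e1 : lp.length * (walkCost n d + n + 6) ≤ E * (walkCost n d + n + 6) :=
        Nat.mul_le_mul_right _ hEp
      have e2 : size lp * (3 * n + 8) ≤ E * (3 * n + 8) := Nat.mul_le_mul_right _ (hle.trans hME)
      have e3 : E * (walkCost n d + n + 6) + E * (3 * n + 8) ≤ E * (walkCost n d + 6 * n + 20) := by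
        rw [← mul_add]
        exact Nat.mul_le_mul_left _ (by omega)
      omega
    · rintro s' ⟨⟨-, h2, h3⟩, h4, -⟩
      exact ⟨⟨h3, h2⟩, h4⟩
  · rw [o4] at c
    have hlt : ¬ size lp ≤ M := by
      rcases j2 with ⟨j4, j2⟩ | ⟨j4, j2⟩ <;> omega
    simp only [hJ, hlt, if_false]
    refine Run.mono (run_skp ?_) (show 1 ≤ G + (G + (G + G)) by omega) fun _ h => h
    exact ⟨⟨by simp [p4, c], by rw [rows_setr (by simp), r4]⟩,
      g4.of_eq rfl rfl (fun _ _ => rfl) (by simp)⟩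

end ProjectJoin

/-! ### Operations on tables in memory -/

section TableOps

variable {n : ℕ}

/-- Bank `b` contains the table `o`; for an absent table the bank is empty. -/
structure Rep (s : State) (b : ℕ) (o : Option (Finset (Vec n))) : Prop where
  pres : s.r (.pres b) = if o.isSome then 1 else 0
  nodup : (rows n s b).Nodup
  mem : ∀ x, x ∈ rows n s b ↔ ∃ S, o = some S ∧ x ∈ S

/-- The table has at most `E` rows, with entries less than `d`. -/
def Small (d E : ℕ) (o : Option (Finset (Vec n))) : Prop :=
  ∀ S, o = some S → (∀ x ∈ S, ∀ v, x v < d) ∧ S.card ≤ E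

theorem Rep.toFinset {s : State} {b : ℕ} {S : Finset (Vec n)} (h : Rep s b (some S)) :
    (rows n s b).toFinset = S := by
  ext x
  rw [List.mem_toFinset, h.mem]
  simp

theorem Rep.length {s : State} {b : ℕ} {S : Finset (Vec n)} (h : Rep s b (some S)) :
    (rows n s b).length = S.card := by
  rw [← List.toFinset_card_of_nodup h.nodup, h.toFinset]

theorem Rep.of_none {s : State} {b : ℕ} (h : Rep (n := n) s b none) : rows n s b = [] := by
  rw [List.eq_nil_iff_forall_not_mem]
  intro x hx
  obtain ⟨S, h, _⟩ := (h.mem x).1 hx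
  cases h

theorem Rep.below {s : State} {b d E : ℕ} {o : Option (Finset (Vec n))} (h : Rep s b o)
    (ho : Small d E o) : Below d (rows n s b) := fun x hx => by
  obtain ⟨S, h1, h2⟩ := (h.mem x).1 hx
  exact (ho S h1).1 x h2

theorem Rep.length_le {s : State} {b d E : ℕ} {o : Option (Finset (Vec n))} (h : Rep s b o)
    (ho : Small d E o) : (rows n s b).length ≤ E := by
  cases o with
  | none => rw [h.of_none]; simp
  | some S => rw [h.length]; exact (ho S rfl).2

theorem Rep.kept {s s' : State} {b nb : ℕ} {o : Option (Finset (Vec n))} (h : Rep s b o)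
    (hk : Kept nb s s') (hb : b < nb) : Rep s' b o := by
  have := hk.rows (n := n) hb
  exact ⟨by rw [hk.1 _ (by simp [Rg.free, hb])]; exact h.pres, by rw [this]; exact h.nodup,
    fun x => by rw [this]; exact h.mem x⟩

theorem Rep.ofList {s : State} {b : ℕ} {l : List (Vec n)} {S : Finset (Vec n)}
    (h : rows n s b = l) (hl : l.Nodup) (hp : s.r (.pres b) = 1) (hm : ∀ x, x ∈ l ↔ x ∈ S) :
    Rep s b (some S) :=
  ⟨by simpa using hp, by rw [h]; exact hl, fun x => by rw [h, hm]; simp⟩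

theorem groupSize_eq {s : State} {b : ℕ} {S : Finset (Vec n)} (h : Rep s b (some S))
    (X : Finset (Fin n)) (y : Vec n) :
    groupSize X (rows n s b) y = (S.filter fun g => mask X g = y).card := by
  rw [groupSize, List.countP_eq_length_filter,
    ← List.toFinset_card_of_nodup (h.nodup.filter _), List.toFinset_filter, h.toFinset]
  simp

/-- Copy bank `a` to bank `nb`, without its presence flag. -/
def copyRows (n nb a : ℕ) : Prog :=
  cst .lo0 0 ;; mov .hi0 (.len a) ;; filterRows n nb a a ∅

theorem run_copyRows {d nb a : ℕ} {s : State} {la : List (Vec n)} (hla : rows n s a = la)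
    (hda : Below d la) (hg : Good d s) {E : ℕ} (hEa : la.length ≤ E) (ha : a < nb) :
    Run (copyRows n nb a) s (7 * ((E + 1) * (walkCost n d + 6 * n + 20))) fun s' =>
      rows n s' nb = la ∧ Good d s' := by
  have hlen : s.r (.len a) = la.length := by rw [← hla, length_rows]
  have hE : 20 ≤ (E + 1) * (walkCost n d + 6 * n + 20) := by nlinarith
  refine (run_seq (T := 1) (T' := 1 + 6 * ((E + 1) * (walkCost n d + 6 * n + 20)))
    (run_cst (run_seq (run_mov ?_)))).mono (by omega) fun _ h => h
  have hr : ∀ s' : State, s'.m = s.m → s'.r (.len a) = s.r (.len a) → rows n s' a = la :=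
    fun s' h h' => by rw [← hla]; exact rows_congr h' fun v => by rw [h]
  set s1 := (s.setr .lo0 0).setr .hi0 ((s.setr .lo0 0).r (.len a)) with hs1
  refine (run_filterRows (s := s1) (E := E) (lo := 0) (hi := la.length) (hr _ rfl (by simp [hs1]))
    (hr _ rfl (by simp [hs1])) hda hda (hg.of_eq rfl rfl (fun _ _ => rfl) (by simp [hs1])) hEa hEa
    ha (by simp [hs1]) (by simp [hs1, hlen])).post ?_
  rintro s' ⟨h1, h2⟩
  refine ⟨?_, h2⟩
  rw [h1, List.filter_eq_self]
  intro x hx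
  refine decide_eq_true ⟨?_, List.countP_le_length⟩
  rw [groupSize, List.countP_pos_iff]
  exact ⟨x, hx, by simp⟩

@[simp] theorem local_copyRows {nb nb' a : ℕ} : (copyRows n nb a).Local nb' ↔ nb' ≤ nb := by
  simp [copyRows, Rg.free]

/-- Write table `a` to bank `nb`. -/
def copyOp (n nb a : ℕ) : Prog := copyRows n nb a ;; mov (.pres nb) (.pres a)

@[simp] theorem local_copyOp {nb nb' a : ℕ} : (copyOp n nb a).Local nb' ↔ nb' ≤ nb := by
  simp [copyOp, Rg.free]

theorem run_copyOp {d nb a E : ℕ} {s : State} {o : Option (Finset (Vec n))} (hr : Rep s a o)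
    (ho : Small d E o) (hg : Good d s) (ha : a < nb) :
    Run (copyOp n nb a) s (8 * ((E + 1) * (walkCost n d + 6 * n + 20))) fun s' =>
      Rep s' nb o ∧ Good d s' := by
  have hE : 20 ≤ (E + 1) * (walkCost n d + 6 * n + 20) := by nlinarith
  refine (run_seq (T' := 1) (((run_copyRows rfl (hr.below ho) hg (hr.length_le ho) ha).kept
    (nb := nb) (by simp)).post ?_)).mono (by omega) fun _ h => h
  rintro s1 ⟨⟨h1, g1⟩, k1⟩
  refine run_mov ⟨⟨?_, ?_, fun x => ?_⟩, g1.of_eq rfl rfl (fun _ _ => rfl) (by simp)⟩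
  · rw [State.r_setr, if_pos rfl, k1.1 _ (by simp [Rg.free, ha]), hr.pres]
  · rw [rows_setr (by simp), h1]; exact hr.nodup
  · rw [rows_setr (by simp), h1, hr.mem]

/-- Restrict table `a` to the rows that agree on `X` with some row of table `b`. -/
def semiOp (n nb a b : ℕ) (X : Finset (Fin n)) : Prog :=
  ite' (.pres b) (cst .lo0 0 ;; mov .hi0 (.len b) ;; filterRows n nb a b X ;;
    mov (.pres nb) (.pres a)) (copyOp n nb a)

@[simp] theorem local_semiOp {nb nb' a b : ℕ} {X : Finset (Fin n)} :
    (semiOp n nb a b X).Local nb' ↔ nb' ≤ nb := by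
  simp [semiOp, Rg.free]

theorem run_semiOp {d nb a b E : ℕ} {X : Finset (Fin n)} {s : State}
    {oa ob : Option (Finset (Vec n))} (hra : Rep s a oa) (hrb : Rep s b ob) (hoa : Small d E oa)
    (hob : Small d E ob) (hg : Good d s) (ha : a < nb) :
    Run (semiOp n nb a b X) s (9 * ((E + 1) * (walkCost n d + 6 * n + 20))) fun s' =>
      Rep s' nb (semiRes X oa ob) ∧ Good d s' := by
  have hE : 20 ≤ (E + 1) * (walkCost n d + 6 * n + 20) := by nlinarith
  set U := (E + 1) * (walkCost n d + 6 * n + 20)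
  refine (run_ite (T := 8 * U) (fun h => ?_) fun h => ?_).mono (by omega) fun _ h => h
  · obtain ⟨R, rfl⟩ : ∃ R, ob = some R := by
      cases ob with
      | none => rw [hrb.pres] at h; simp at h
      | some R => exact ⟨R, rfl⟩
    refine (run_seq (T := 1) (T' := 1 + (6 * U + 1)) (run_cst (run_seq (run_mov ?_)))).mono
      (by omega) fun _ h => h
    have hr : ∀ (c : ℕ) (s' : State), s'.m = s.m → s'.r (.len c) = s.r (.len c) →
      rows n s' c = rows n s c := fun c s' h h' => rows_congr h' fun v => by rw [h]
    set s1 := (s.setr .lo0 0).setr .hi0 ((s.setr .lo0 0).r (.len b)) with hs1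
    refine run_seq (((run_filterRows (s := s1) (E := E) (lo := 0) (hi := s.r (.len b))
      (hr a _ rfl (by simp [hs1])) (hr b _ rfl (by simp [hs1])) (hra.below hoa)
      (hrb.below hob) (hg.of_eq rfl rfl (fun _ _ => rfl) (by simp [hs1])) (hra.length_le hoa)
      (hrb.length_le hob) ha (by simp [hs1]) (by simp [hs1])).kept (nb := nb) (by simp)).post ?_)
    rintro s2 ⟨⟨h2, g2⟩, k2⟩
    have hp2 : s2.r (.pres a) = s.r (.pres a) := by
      rw [k2.1 _ (by simp [Rg.free, ha])]; simp [hs1]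
    refine run_mov ⟨⟨?_, ?_, fun x => ?_⟩, g2.of_eq rfl rfl (fun _ _ => rfl) (by simp)⟩
    · rw [State.r_setr, if_pos rfl, hp2, hra.pres]
      cases oa <;> simp [semiRes]
    · rw [rows_setr (by simp), h2]; exact hra.nodup.filter _
    · rw [rows_setr (by simp), h2, List.mem_filter, hra.mem]
      cases oa with
      | none => simp [semiRes]
      | some S =>
        have hle : groupSize X (rows n s b) (mask X x) ≤ s.r (.len b) := by
          rw [← length_rows (n := n)]; exact List.countP_le_length
        have e1 : (0 < groupSize X (rows n s b) (mask X x)) ↔ ∃ g ∈ R, mask X g = mask X x := by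
          rw [groupSize_eq hrb, Finset.card_pos]
          exact ⟨fun ⟨g, hg⟩ => ⟨g, Finset.mem_filter.1 hg⟩,
            fun ⟨g, hg⟩ => ⟨g, Finset.mem_filter.2 hg⟩⟩
        simp [semiRes, semiSet, hle, e1]
  · obtain rfl : ob = none := by
      cases ob with
      | none => rfl
      | some R => rw [hrb.pres] at h; simp at h
    refine (run_copyOp hra hoa hg ha).post ?_
    rintro s' ⟨h1, h2⟩
    refine ⟨?_, h2⟩
    cases oa <;> exact h1

/-- The projection of table `a` to `X`, unless table `b` is present. -/
def projOp (n nb a b : ℕ) (X : Finset (Fin n)) : Prog :=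
  ite' (.pres b) (copyOp n nb b) (projRows n nb a X ;; mov (.pres nb) (.pres a))

@[simp] theorem local_projOp {nb nb' a b : ℕ} {X : Finset (Fin n)} :
    (projOp n nb a b X).Local nb' ↔ nb' ≤ nb := by
  simp [projOp, Rg.free]

theorem run_projOp {d nb a b E : ℕ} {X : Finset (Fin n)} {s : State}
    {oa ob : Option (Finset (Vec n))} (hra : Rep s a oa) (hrb : Rep s b ob) (hoa : Small d E oa)
    (hob : Small d E ob) (hg : Good d s) (ha : a < nb) (hb : b < nb) :
    Run (projOp n nb a b X) s (9 * ((E + 1) * (walkCost n d + 6 * n + 20))) fun s' =>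
      Rep s' nb (projRes X oa ob) ∧ Good d s' := by
  have hE : 20 ≤ (E + 1) * (walkCost n d + 6 * n + 20) := by nlinarith
  set U := (E + 1) * (walkCost n d + 6 * n + 20)
  refine (run_ite (T := 8 * U) (fun h => ?_) fun h => ?_).mono (by omega) fun _ h => h
  · obtain ⟨R, rfl⟩ : ∃ R, ob = some R := by
      cases ob with
      | none => rw [hrb.pres] at h; simp at h
      | some R => exact ⟨R, rfl⟩
    refine (run_copyOp hrb hob hg hb).post ?_
    rintro s' ⟨h1, h2⟩
    refine ⟨?_, h2⟩
    cases oa <;> exact h1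
  · obtain rfl : ob = none := by
      cases ob with
      | none => rfl
      | some R => rw [hrb.pres] at h; simp at h
    refine (run_seq (T' := 1) (((run_projRows rfl (hra.below hoa) hg (hra.length_le hoa) ha).kept
      (nb := nb) (by simp)).post ?_)).mono (by omega) fun _ h => h
    rintro s1 ⟨⟨⟨h1, h2⟩, g1⟩, k1⟩
    refine run_mov ⟨⟨?_, ?_, fun x => ?_⟩, g1.of_eq rfl rfl (fun _ _ => rfl) (by simp)⟩
    · rw [State.r_setr, if_pos rfl, k1.1 _ (by simp [Rg.free, ha]), hra.pres]
      cases oa <;> simp [projRes]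
    · rw [rows_setr (by simp)]; exact h1
    · rw [rows_setr (by simp), h2]
      cases oa with
      | none => simp [projRes, masks, hra.of_none]
      | some S => simp [projRes, masks, hra.mem]

/-- Mark the table in bank `nb` as absent. -/
def absentOp (nb : ℕ) : Prog := cst (.len nb) 0 ;; cst (.pres nb) 0

theorem run_absentOp {d nb : ℕ} {s : State} (hg : Good d s) :
    Run (absentOp nb) s 2 fun s' => Rep (n := n) s' nb none ∧ Good d s' := by
  refine run_seq (T := 1) (T' := 1) (run_cst (run_cst ?_))
  have e : rows n ((s.setr (.len nb) 0).setr (.pres nb) 0) nb = [] := by simp [rows]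
  exact ⟨⟨by simp, by rw [e]; simp, fun x => by rw [e]; simp⟩,
    hg.of_eq rfl rfl (fun _ _ => rfl) (by simp)⟩

/-- The join of the tables `p` and `q`, unless table `z` is present. -/
def joinOp (n nb p q z : ℕ) (W X : Finset (Fin n)) : Prog :=
  ite' (.pres z) (copyOp n nb z) (ite' (.pres p) (ite' (.pres q) (joinRows n nb p q W X)
    (absentOp nb)) (absentOp nb))

theorem local_joinOp {nb nb' p q z : ℕ} {W X : Finset (Fin n)} (h : nb' ≤ nb) :
    (joinOp n nb p q z W X).Local nb' := by
  simp [joinOp, absentOp, Rg.free, h]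

theorem mem_joinList {W X : Finset (Fin n)} {lp lq : List (Vec n)} {S R : Finset (Vec n)}
    (hp : ∀ x, x ∈ lp ↔ x ∈ S) (hq : ∀ x, x ∈ lq ↔ x ∈ R) (x : Vec n) :
    x ∈ joinList W X lp lq ↔ x ∈ joinSet W X S R := by
  simp only [joinList, group, List.mem_flatMap, List.mem_map, List.mem_reverse, List.mem_filter,
    decide_eq_true_eq, joinSet, Finset.mem_image, Finset.mem_filter, Finset.mem_product,
    Prod.exists, hp, hq]
  constructor
  · rintro ⟨f, hf, g, ⟨hg, e⟩, rfl⟩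
    exact ⟨f, g, ⟨⟨hf, hg⟩, e.symm⟩, rfl⟩
  · rintro ⟨f, g, ⟨⟨hf, hg⟩, e⟩, rfl⟩
    exact ⟨f, hf, g, ⟨hg, e.symm⟩, rfl⟩

theorem nodup_joinList {W W' X : Finset (Fin n)} {lp lq : List (Vec n)} (hX : X = W ∩ W')
    (hp : lp.Nodup) (hq : lq.Nodup) (hp' : ∀ x ∈ lp, mask W x = x)
    (hq' : ∀ x ∈ lq, mask W' x = x) : (joinList W X lp lq).Nodup := by
  have e1 : ∀ f g, mask W (merge W f g) = mask W f := fun f g => mask_eq_iff.2 fun v hv => by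
    simp [merge, hv]
  rw [joinList, List.nodup_flatMap]
  refine ⟨fun f hf => ?_, hp.imp_of_mem ?_⟩
  · refine List.Nodup.map_on ?_ (List.nodup_reverse.2 (hq.filter _))
    intro g hg g' hg' e
    simp only [group, List.mem_reverse, List.mem_filter, decide_eq_true_eq] at hg hg'
    rw [← hq' g hg.1, ← hq' g' hg'.1, mask_eq_iff]
    intro v hv
    by_cases hvW : v ∈ W
    · have := mask_eq_iff.1 (hg.2.trans hg'.2.symm) v (by rw [hX]; simp [hv, hvW])
      exact this
    · simpa [merge, hvW] using congrFun e v
  · intro f f' hf hf' hne x hx hx'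
    obtain ⟨g, _, rfl⟩ := List.mem_map.1 hx
    obtain ⟨g', _, e⟩ := List.mem_map.1 hx'
    apply hne
    rw [← hp' f hf, ← hp' f' hf', ← e1 f g, ← e1 f' g', e]

theorem run_joinOp {d nb p q z E M : ℕ} {W W' X : Finset (Fin n)} {s : State}
    {op oq oz : Option (Finset (Vec n))} (hrp : Rep s p op) (hrq : Rep s q oq) (hrz : Rep s z oz)
    (hop : Small d E op) (hoq : Small d E oq) (hoz : Small d E oz) (hg : Good d s) (hp : p < nb)
    (hq : q < nb) (hz : z < nb) (hM : s.r .bud = M) (hME : M ≤ E) (hX : X = W ∩ W')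
    (hp' : ∀ S, op = some S → ∀ x ∈ S, mask W x = x)
    (hq' : ∀ S, oq = some S → ∀ x ∈ S, mask W' x = x) :
    Run (joinOp n nb p q z W X) s (10 * ((E + 1) * (walkCost n d + 6 * n + 20))) fun s' =>
      Rep s' nb (joinRes M W X op oq oz) ∧ Good d s' := by
  have hE : 20 ≤ (E + 1) * (walkCost n d + 6 * n + 20) := by nlinarith
  set U := (E + 1) * (walkCost n d + 6 * n + 20)
  have hcase : ∀ {b : ℕ} {o : Option (Finset (Vec n))}, Rep s b o →
      (s.r (.pres b) ≠ 0 → ∃ R, o = some R) ∧ (s.r (.pres b) = 0 → o = none) := by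
    intro b o h
    rw [h.pres]
    cases o <;> simp
  refine (run_ite (T := 9 * U + 2) (fun h => ?_) fun h => ?_).mono (by omega) fun _ h => h
  · obtain ⟨R, rfl⟩ := (hcase hrz).1 h
    refine (run_copyOp hrz hoz hg hz).mono (by omega) ?_
    rintro s' ⟨h1, h2⟩
    refine ⟨?_, h2⟩
    cases op <;> cases oq <;> exact h1
  obtain rfl := (hcase hrz).2 h
  refine (run_ite (T := 9 * U + 1) (fun h => ?_) fun h => ?_).mono (by omega) fun _ h => h
  swap
  · obtain rfl := (hcase hrp).2 h
    refine (run_absentOp (n := n) hg).mono (by omega) ?_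
    intro s' h
    cases oq <;> exact h
  obtain ⟨S, rfl⟩ := (hcase hrp).1 h
  refine (run_ite (T := 9 * U) (fun h => ?_) fun h => ?_).mono (by omega) fun _ h => h
  swap
  · obtain rfl := (hcase hrq).2 h
    exact (run_absentOp hg).mono (by omega) fun s' h => h
  obtain ⟨R, rfl⟩ := (hcase hrq).1 h
  refine (run_joinRows rfl rfl (hrp.below hop) (hrq.below hoq) hg (hrp.length_le hop)
    (hrq.length_le hoq) hp hq hM hME).post ?_
  rintro s' ⟨⟨h1, h2⟩, g'⟩
  refine ⟨?_, g'⟩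
  have hmem := mem_joinList (W := W) (X := X) (lp := rows n s p) (lq := rows n s q) (S := S)
    (R := R) (fun x => by rw [hrp.mem]; simp) (fun x => by rw [hrq.mem]; simp)
  have hnd : (joinList W X (rows n s p) (rows n s q)).Nodup :=
    nodup_joinList hX hrp.nodup hrq.nodup (fun x hx => hp' S rfl x (by simpa [hrp.mem] using hx))
      (fun x hx => hq' R rfl x (by simpa [hrq.mem] using hx))
  have hcard : (joinList W X (rows n s p) (rows n s q)).length = (joinSet W X S R).card := by
    rw [← List.toFinset_card_of_nodup hnd]
    congr 1
    ext x
    rw [List.mem_toFinset, hmem]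
  rw [hcard] at h1 h2
  simp only [joinRes]
  split_ifs at h1 h2 ⊢
  · exact Rep.ofList h2 hnd h1 hmem
  · exact ⟨by simpa using h1, by rw [h2]; simp, fun x => by rw [h2]; simp⟩

/-- The rows of table `a` whose degree over `X` lies in the bucket with the limits of bank `nb`. -/
def bucketOp (n nb a : ℕ) (X : Finset (Fin n)) : Prog :=
  mov .lo0 (.lo nb) ;; mov .hi0 (.hi nb) ;; filterRows n nb a a X ;; cst (.pres nb) 1

theorem run_bucketOp {d nb a E i : ℕ} {X : Finset (Fin n)} {s : State} {S : Finset (Vec n)}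
    (hra : Rep s a (some S)) (hoa : Small d E (some S)) (hg : Good d s) (ha : a < nb)
    (hlo : s.r (.lo nb) = 2 ^ i / 2) (hhi : s.r (.hi nb) = 2 ^ i) :
    Run (bucketOp n nb a X) s (7 * ((E + 1) * (walkCost n d + 6 * n + 20))) fun s' =>
      Rep s' nb (some (splitSet X S i)) ∧ Good d s' ∧ Kept nb s s' ∧
        s'.r (.lo nb) = s.r (.lo nb) ∧ s'.r (.hi nb) = s.r (.hi nb) := by
  have hE : 20 ≤ (E + 1) * (walkCost n d + 6 * n + 20) := by nlinarith
  set U := (E + 1) * (walkCost n d + 6 * n + 20)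
  have hloc : (bucketOp n nb a X).Local nb := by simp [bucketOp, Rg.free]
  have hf : ∀ b : Rg, b = .lo nb ∨ b = .hi nb → ¬ (bucketOp n nb a X).wr b := by
    intro b hb h
    simp only [bucketOp, filterRows, groupCount, zeroPass, countPass, pass, forRows, loadRow,
      wr_seq, wr_cst, wr_mov, wr_whl, wr_forV, wr_lod, wr_sto, wr_inc, wr_dif, wr_ite', wr_skp,
      wr_appendRow] at h
    have := walk_frame (src := .x) (X := X) |>.1 b
    rcases hb with rfl | rfl <;> simp [Rg.aux] at h this <;> exact this h
  refine Run.post (Run.frame (Q := fun s' => Rep s' nb (some (splitSet X S i)) ∧ Good d s') ?_)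
    fun s' h => ⟨h.1.1, h.1.2, h.2.kept hloc, h.2.1 _ (hf _ (Or.inl rfl)),
      h.2.1 _ (hf _ (Or.inr rfl))⟩
  refine (run_seq (T := 1) (T' := 1 + (6 * U + 1)) (run_mov (run_seq (run_mov ?_)))).mono
    (by omega) fun _ h => h
  have hr : ∀ (c : ℕ) (s' : State), s'.m = s.m → s'.r (.len c) = s.r (.len c) →
    rows n s' c = rows n s c := fun c s' h h' => rows_congr h' fun v => by rw [h]
  set s1 := (s.setr .lo0 (s.r (.lo nb))).setr .hi0 ((s.setr .lo0 (s.r (.lo nb))).r (.hi nb))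
    with hs1
  refine run_seq ((run_filterRows (s := s1) (E := E) (lo := 2 ^ i / 2) (hi := 2 ^ i)
    (hr a _ rfl (by simp [hs1])) (hr a _ rfl (by simp [hs1])) (hra.below hoa)
    (hra.below hoa) (hg.of_eq rfl rfl (fun _ _ => rfl) (by simp [hs1])) (hra.length_le hoa)
    (hra.length_le hoa) ha (by simp [hs1, hlo]) (by simp [hs1, hhi])).post ?_)
  rintro s2 ⟨h2, g2⟩
  refine run_cst ⟨Rep.ofList (l := _) (by rw [rows_setr (by simp), h2]) (hra.nodup.filter _)
    (by simp) fun x => ?_, g2.of_eq rfl rfl (fun _ _ => rfl) (by simp)⟩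
  rw [List.mem_filter, hra.mem]
  simp only [Option.some.injEq, exists_eq_left', groupSize_eq hra, decide_eq_true_eq]
  rw [splitSet, Finset.mem_filter]
  rfl

end TableOps

/-! ### Programs for lists of operations -/

section Compile

variable {n : ℕ}

theorem Small.of_subset {d E : ℕ} {S S' : Finset (Vec n)} (h : Small d E (some S)) (hS : S' ⊆ S) :
    Small d E (some S') := by
  rintro _ ⟨⟩
  exact ⟨fun x hx => (h S rfl).1 x (hS hx), (Finset.card_le_card hS).trans (h S rfl).2⟩

theorem small_semiRes {d E : ℕ} {X : Finset (Fin n)} {oa ob : Option (Finset (Vec n))}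
    (ha : Small d E oa) : Small d E (semiRes X oa ob) := by
  cases oa <;> cases ob <;> first | exact ha | exact ha.of_subset (Finset.filter_subset _ _)

theorem small_projRes {d E : ℕ} (hd : 0 < d) {X : Finset (Fin n)}
    {oa ob : Option (Finset (Vec n))} (ha : Small d E oa) (hb : Small d E ob) :
    Small d E (projRes X oa ob) := by
  cases ob with
  | some S => cases oa <;> exact hb
  | none =>
    cases oa with
    | none => exact ha
    | some R =>
      rintro _ ⟨⟩
      refine ⟨fun x hx v => ?_, Finset.card_image_le.trans (ha R rfl).2⟩
      obtain ⟨y, hy, rfl⟩ := Finset.mem_image.1 hx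
      rw [mask]
      split_ifs
      · exact (ha R rfl).1 y hy v
      · exact hd

theorem small_joinRes {d E M : ℕ} (hM : M ≤ E) {W X : Finset (Fin n)}
    {op oq oz : Option (Finset (Vec n))} (hp : Small d E op) (hq : Small d E oq)
    (hz : Small d E oz) : Small d E (joinRes M W X op oq oz) := by
  cases oz with
  | some S => cases op <;> cases oq <;> exact hz
  | none =>
    cases op with
    | none => cases oq <;> exact hz
    | some R =>
      cases oq with
      | none => exact hz
      | some R' =>
        simp only [joinRes]
        split_ifs with h
        · rintro _ ⟨⟩
          refine ⟨fun x hx v => ?_, h.trans hM⟩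
          obtain ⟨⟨f, g⟩, hfg, rfl⟩ := Finset.mem_image.1 hx
          obtain ⟨hf, hg⟩ := Finset.mem_product.1 (Finset.mem_filter.1 hfg).1
          simp only [merge]
          split_ifs
          · exact (hp R rfl).1 f hf v
          · exact (hq R' rfl).1 g hg v
        · exact hz

/-- The output that has been written. -/
def outList (s : State) : List ℕ := (List.range (s.r .out)).map (s.m .out)

theorem outList_congr {s s' : State} (h : s'.r .out = s.r .out) (h' : s'.m .out = s.m .out) :
    outList s' = outList s := by rw [outList, outList, h, h']

/-- The tuple of a vector, in the original values. -/
def decode (dec : ℕ → ℕ) (x : Vec n) : List ℕ := List.ofFn fun v => dec (x v)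

/-- Write the tuple of the vector in the registers `x` to the output. -/
def emit (n : ℕ) : Prog :=
  (forV fun v : Fin n => lod .t1 .dec (.x v) ;; sto .out .out .t1 ;; inc .out) ;; inc .ocnt

theorem run_emit {s : State} {x : Vec n} (hx : ∀ v : Fin n, s.r (.x v) = x v) :
    Run (emit n) s (3 * n + 2) fun s' => outList s' = outList s ++ decode (s.m .dec) x ∧
      s'.r .ocnt = s.r .ocnt + 1 := by
  refine (run_seq (T := n * 3 + 1) (T' := 1) (run_forV 3 (fun k s' =>
    (outList s' = outList s ++ (decode (s.m .dec) x).take k ∧ s'.r .ocnt = s.r .ocnt) ∧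
    s'.m .dec = s.m .dec ∧ ∀ v : Fin n, s'.r (.x v) = x v) ?_ ?_ ?_)).mono (by omega) fun _ h => h
  · exact ⟨⟨by simp, rfl⟩, rfl, hx⟩
  · rintro v s1 - ⟨⟨h1, h2⟩, h3, h4⟩
    refine run_seq (T := 1) (T' := 2) (run_lod (run_seq (T := 1) (T' := 1) (run_sto (run_inc
      ⟨⟨?_, ?_⟩, ?_, ?_⟩))))
    · rw [List.take_add_one, ← List.append_assoc, ← h1]
      have e1 : (decode (s.m .dec) x)[v.val]?.toList = [s.m .dec (x v)] := by
        simp [decode]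
      rw [e1]
      simp only [outList, State.r_setr, State.r_setm, reduceCtorEq, if_false, if_true,
        State.m_setr, List.range_succ, List.map_append, List.map_cons, List.map_nil]
      congr 1
      · refine List.map_congr_left fun j hj => ?_
        rw [List.mem_range] at hj
        rw [State.m_setm, if_neg (by omega)]
        rfl
      · rw [State.m_setm, if_pos ⟨rfl, rfl⟩, h3, h4]
    · simpa using h2
    · simp only [State.m_setr]
      rw [State.m_setm_ne _ _ _ (by simp)]
      exact h3
    · intro u
      simp [h4]
  · rintro s' ⟨⟨h1, h2⟩, -⟩
    refine run_inc ⟨?_, by simp [h2]⟩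
    have : (decode (s.m .dec) x).take n = decode (s.m .dec) x := by
      rw [List.take_of_length_le]; simp [decode]
    rw [this] at h1
    rw [← h1]
    exact outList_congr (by simp) rfl

/-- Output the rows of bank `b` if the table is present, and report a failure otherwise. -/
def leaf (n b : ℕ) : Prog := ite' (.pres b) (forRows n b (emit n)) (cst .fail 1)

/-- The states differ only in free registers and arrays and in the output. -/
def KeptOut (nb : ℕ) (s s' : State) : Prop :=
  (∀ a : Rg, ¬ a.free nb → a ≠ .out → a ≠ .ocnt → a ≠ .fail → s'.r a = s.r a) ∧
    ∀ a : Ar, ¬ a.free nb → a ≠ .out → s'.m a = s.m a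

theorem KeptOut.trans {nb : ℕ} {s s' s'' : State} (h : KeptOut nb s s') (h' : KeptOut nb s' s'') :
    KeptOut nb s s'' :=
  ⟨fun a h1 h2 h3 h4 => (h'.1 a h1 h2 h3 h4).trans (h.1 a h1 h2 h3 h4),
    fun a h1 h2 => (h'.2 a h1 h2).trans (h.2 a h1 h2)⟩

theorem KeptOut.mono {nb nb' : ℕ} (h : nb ≤ nb') {s s' : State} (hk : KeptOut nb' s s') :
    KeptOut nb s s' :=
  ⟨fun a ha => hk.1 a fun e => ha (e.mono h), fun a ha => hk.2 a fun e => ha (e.mono h)⟩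

theorem Kept.keptOut {nb : ℕ} {s s' : State} (hk : Kept nb s s') : KeptOut nb s s' :=
  ⟨fun a ha _ _ _ => hk.1 a ha, fun a ha _ => hk.2 a ha⟩

theorem KeptOut.rows {nb : ℕ} {s s' : State} (h : KeptOut nb s s') {b : ℕ} (hb : b < nb) :
    rows n s' b = rows n s b :=
  rows_congr (h.1 _ (by simp [Rg.free, hb]) (by simp) (by simp) (by simp))
    fun v => h.2 _ (by simp [Ar.free, hb]) (by simp)

theorem Rep.keptOut {s s' : State} {b nb : ℕ} {o : Option (Finset (Vec n))} (h : Rep s b o)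
    (hk : KeptOut nb s s') (hb : b < nb) : Rep s' b o := by
  have := hk.rows (n := n) hb
  exact ⟨by rw [hk.1 _ (by simp [Rg.free, hb]) (by simp) (by simp) (by simp)]; exact h.pres,
    by rw [this]; exact h.nodup, fun x => by rw [this]; exact h.mem x⟩

/-- The program has appended the tuples of `l` to the output, and it has reported a failure unless
`ok` holds. -/
structure Emits (s s' : State) (l : List (Vec n)) (ok : Prop) : Prop where
  out : outList s' = outList s ++ l.flatMap (decode (s.m .dec))
  ocnt : s'.r .ocnt = s.r .ocnt + l.length
  fail : s'.r .fail = 0 ↔ s.r .fail = 0 ∧ ok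

theorem Emits.trans {s s' s'' : State} {l l' : List (Vec n)} {ok ok' : Prop}
    (h : Emits s s' l ok) (hd : s'.m .dec = s.m .dec) (h' : Emits s' s'' l' ok') :
    Emits s s'' (l ++ l') (ok ∧ ok') :=
  ⟨by rw [h'.out, h.out, hd]; simp, by rw [h'.ocnt, h.ocnt]; simp [add_assoc],
    by rw [h'.fail, h.fail, and_assoc]⟩

theorem Emits.congr_ok {s s' : State} {l : List (Vec n)} {ok ok' : Prop} (h : Emits s s' l ok)
    (e : ok ↔ ok') : Emits s s' l ok' :=
  ⟨h.out, h.ocnt, by rw [h.fail, e]⟩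

theorem Emits.of_left {s₀ s s' : State} {l : List (Vec n)} {ok : Prop} (h : Emits s s' l ok)
    (hk : Kept 0 s₀ s) : Emits s₀ s' l ok := by
  have e1 : s.m .dec = s₀.m .dec := hk.2 _ (by simp [Ar.free])
  have e2 : outList s = outList s₀ :=
    outList_congr (hk.1 _ (by simp [Rg.free])) (hk.2 _ (by simp [Ar.free]))
  refine ⟨by rw [← e1, ← e2]; exact h.out, ?_, ?_⟩
  · rw [← hk.1 .ocnt (by simp [Rg.free])]; exact h.ocnt
  · rw [← hk.1 .fail (by simp [Rg.free])]; exact h.fail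

theorem Emits.of_right {s s' s'' : State} {l : List (Vec n)} {ok : Prop} (h : Emits s s' l ok)
    (hk : Kept 0 s' s'') : Emits s s'' l ok := by
  have e2 : outList s'' = outList s' :=
    outList_congr (hk.1 _ (by simp [Rg.free])) (hk.2 _ (by simp [Ar.free]))
  refine ⟨by rw [e2]; exact h.out, ?_, ?_⟩
  · rw [hk.1 .ocnt (by simp [Rg.free])]; exact h.ocnt
  · rw [hk.1 .fail (by simp [Rg.free])]; exact h.fail

/-- A bound for the number of steps of an operation. -/
def stepCost (n d E : ℕ) : ℕ := 12 * ((E + 1) * (walkCost n d + 6 * n + 20))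

theorem run_leaf {d b nb E : ℕ} {s : State} {o : Option (Finset (Vec n))} (hr : Rep s b o)
    (ho : Small d E o) (hg : Good d s) :
    Run (leaf n b) s (stepCost n d E) fun s' => Good d s' ∧ KeptOut nb s s' ∧
      ∃ l, ((o = none ∧ l = []) ∨ ∃ S, o = some S ∧ l.Nodup ∧ l.toFinset = S) ∧
        Emits s s' l o.isSome := by
  have hlen := hr.length_le ho
  have hcost : 1 + (E * ((3 * n + 2) + n + 4) + 3) ≤ stepCost n d E := by
    have h1 : E * ((3 * n + 2) + n + 4) ≤ E * (walkCost n d + 6 * n + 20) :=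
      Nat.mul_le_mul_left _ (by omega)
    have h3 : (E + 1) * (walkCost n d + 6 * n + 20) = E * (walkCost n d + 6 * n + 20) +
      (walkCost n d + 6 * n + 20) := by ring
    rw [stepCost]
    omega
  have hfr : ∀ s', Frame (leaf n b) s s' → Good d s' ∧ KeptOut nb s s' := by
    intro s' f
    refine ⟨hg.of_eq (f.2 _ ?_) (f.2 _ ?_) (fun v e => f.2 _ ?_) (f.1 _ ?_),
      fun a h1 h2 h3 h4 => f.1 a fun h => ?_, fun a h1 h2 => f.2 a fun h => ?_⟩
    · simp [leaf, emit, forRows, loadRow]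
    · simp [leaf, emit, forRows, loadRow]
    · simp [leaf, emit, forRows, loadRow]
    · simp [leaf, emit, forRows, loadRow]
    · simp only [leaf, emit, forRows, loadRow, wr_ite', wr_seq, wr_cst, wr_mov, wr_whl, wr_forV,
        wr_lod, wr_sto, wr_inc, wr_dif] at h
      rcases h with (rfl | rfl | (rfl | ⟨v, rfl⟩) | ((rfl | ⟨v, rfl | h | rfl⟩) | rfl) | rfl |
        rfl) | rfl
      all_goals first | exact h1 trivial | contradiction
    · simp only [leaf, emit, forRows, loadRow, wa_ite', wa_seq, wa_cst, wa_mov, wa_whl, wa_forV,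
        wa_lod, wa_sto, wa_inc, wa_dif] at h
      simp at h
      exact h2 h.2
  suffices Run (leaf n b) s (stepCost n d E) fun s' => ∃ l, ((o = none ∧ l = []) ∨
      ∃ S, o = some S ∧ l.Nodup ∧ l.toFinset = S) ∧ Emits s s' l o.isSome from
    this.frame.post fun s' h => ⟨(hfr s' h.2).1, (hfr s' h.2).2, h.1⟩
  refine (run_ite (T := E * ((3 * n + 2) + n + 4) + 3) (fun h => ?_) fun h => ?_).mono (by omega)
    fun _ h => h
  · obtain ⟨S, rfl⟩ : ∃ S, o = some S := by
      cases o with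
      | none => rw [hr.pres] at h; simp at h
      | some R => exact ⟨R, rfl⟩
    refine (run_forRows (l := rows n s b) rfl (fun _ => 3 * n + 2) (fun done s' =>
      outList s' = outList s ++ done.flatMap (decode (s.m .dec)) ∧
      s'.r .ocnt = s.r .ocnt + done.length ∧ s'.r .fail = s.r .fail ∧ s'.m .dec = s.m .dec)
      ?_ ?_ ?_ ?_ ?_ ?_).mono ?_ ?_
    · simp [emit]
    · simp [emit]
    · simp [emit]
    · rintro l s1 s2 hm hr' ⟨h1, h2, h3, h4⟩
      refine ⟨?_, ?_, ?_, by rw [hm, h4]⟩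
      · rw [← h1]
        exact outList_congr (hr' _ (by simp) (by simp) (by simp) (by simp)) (by rw [hm])
      · rw [hr' _ (by simp) (by simp) (by simp) (by simp), h2]
      · rw [hr' _ (by simp) (by simp) (by simp) (by simp), h3]
    · simp
    · rintro done x rest s1 - - ⟨h1, h2, h3, h4⟩ hx -
      refine (run_emit hx).frame.post ?_
      rintro s2 ⟨⟨h5, h6⟩, f⟩
      refine ⟨?_, ?_, ?_, ?_⟩
      · rw [h5, h1, h4]; simp
      · rw [h6, h2]; simp [add_assoc]
      · rw [f.1 _ (by simp [emit]), h3]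
      · rw [f.2 _ (by simp [emit]), h4]
    · have : ((rows n s b).map fun _ => 3 * n + 2 + n + 4).sum =
          (rows n s b).length * (3 * n + 2 + n + 4) := by simp
      rw [this]
      exact Nat.add_le_add_right (Nat.mul_le_mul_right _ hlen) 3
    · rintro s' ⟨⟨h1, h2, h3, -⟩, -⟩
      exact ⟨_, Or.inr ⟨S, rfl, hr.nodup, hr.toFinset⟩, h1, h2, by rw [h3]; simp⟩
  · obtain rfl : o = none := by
      cases o with
      | none => rfl
      | some R => rw [hr.pres] at h; simp at h
    refine Run.mono (run_cst ?_) (show 1 ≤ _ by omega) fun _ h => h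
    refine ⟨[], Or.inl ⟨rfl, rfl⟩, ?_, by simp, by simp⟩
    rw [List.flatMap_nil, List.append_nil]
    exact outList_congr (by simp) rfl

variable {ι : Type*} [DecidableEq ι]

/-- The tables are stored in the banks given by `loc`, all of which are less than `nb`. -/
def Stored (s : State) (loc : ι → ℕ) (nb : ℕ) (T : Tabs ι n) : Prop :=
  ∀ i, loc i < nb ∧ Rep s (loc i) (T i)

theorem Stored.update {s s' : State} {loc : ι → ℕ} {nb : ℕ} {T : Tabs ι n}
    (h : Stored s loc nb T) (hk : Kept nb s s') {a : ι} {o : Option (Finset (Vec n))}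
    (ho : Rep s' nb o) :
    Stored s' (Function.update loc a nb) (nb + 1) (Function.update T a o) := by
  intro i
  by_cases hi : i = a
  · subst hi
    simpa using ho
  · rw [Function.update_of_ne hi, Function.update_of_ne hi]
    exact ⟨(h i).1.trans (Nat.lt_succ_self _), (h i).2.kept hk (h i).1⟩

omit [DecidableEq ι] in
theorem Stored.keptOut {s s' : State} {loc : ι → ℕ} {nb : ℕ} {T : Tabs ι n}
    (h : Stored s loc nb T) (hk : KeptOut nb s s') : Stored s' loc nb T :=
  fun i => ⟨(h i).1, (h i).2.keptOut hk (h i).1⟩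

theorem small_update {d E : ℕ} {T : Tabs ι n} (hT : ∀ i, Small d E (T i)) {a : ι}
    {o : Option (Finset (Vec n))} (ho : Small d E o) (i : ι) :
    Small d E (Function.update T a o i) := by
  by_cases hi : i = a
  · subst hi
    simpa using ho
  · rw [Function.update_of_ne hi]
    exact hT i

/-- Double the number in a register. -/
def double (a : Rg) : Prog :=
  mov .t2 a ;; whl .t2 (inc a ;; cst .t1 1 ;; dif .t2 .t2 .t1)

theorem run_double {a : Rg} (h1 : a ≠ .t1) (h2 : a ≠ .t2) {s : State} :
    Run (double a) s (s.r a * 4 + 2) fun s' => s'.r a = 2 * s.r a := by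
  have h3 : Rg.t1 ≠ a := h1.symm
  have h4 : Rg.t2 ≠ a := h2.symm
  refine (run_seq (T := 1) (T' := s.r a * (3 + 1) + 1) (run_mov ?_)).mono (by omega)
    fun _ h => h
  refine (run_whl (k := s.r a) (c := 3) (fun k s' => s'.r .t2 = k ∧
    s'.r a + k = 2 * s.r a) ?_ ?_ ?_).post fun s' h => by simpa using h.2
  · rintro k s' ⟨rfl, -⟩
    rfl
  · rintro k s' - ⟨e1, e2⟩
    refine run_seq (T := 1) (T' := 2) (run_inc (run_seq (T := 1) (T' := 1) (run_cst (run_dif ?_))))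
    constructor
    · simp [e1, h4]
    · simp [h1, h2]; omega
  · constructor
    · simp
    · simp [h2]; omega

/-- The program for a list of operations, where table `i` is in bank `loc i`, and the results are
written to the banks from `nb` on. In the end table `v₀` is output. -/
def compile (v₀ : ι) : List (Op ι n) → (ι → ℕ) → ℕ → Prog
  | [], loc, _ => leaf n (loc v₀)
  | .split a X :: ops, loc, nb =>
    ite' (.pres (loc a))
      (cst (.lo nb) 0 ;; cst (.hi nb) 1 ;; mov .t1 (.len (loc a)) ;;
        whl .t1 (bucketOp n nb (loc a) X ;; compile v₀ ops (Function.update loc a nb) (nb + 1) ;;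
          mov (.lo nb) (.hi nb) ;; double (.hi nb) ;; dif .t1 (.len (loc a)) (.lo nb)))
      (compile v₀ ops loc nb)
  | .proj a b X :: ops, loc, nb =>
    projOp n nb (loc a) (loc b) X ;; compile v₀ ops (Function.update loc b nb) (nb + 1)
  | .join p q z W X :: ops, loc, nb =>
    joinOp n nb (loc p) (loc q) (loc z) W X ;; compile v₀ ops (Function.update loc z nb) (nb + 1)
  | .semi a b X :: ops, loc, nb =>
    semiOp n nb (loc a) (loc b) X ;; compile v₀ ops (Function.update loc a nb) (nb + 1)

/-- A bound for the number of steps of a program with `k` operations. -/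
def compileCost (n d E : ℕ) : ℕ → ℕ
  | 0 => stepCost n d E
  | k + 1 => (Nat.log 2 E + 3) * (stepCost n d E + compileCost n d E k)

/-- The compiled program outputs the concatenation of the tables `v₀` over all branches, and reports
a failure if table `v₀` is absent in some branch. -/
theorem run_compile {d E M : ℕ} {att : ι → Finset (Fin n)} {v₀ : ι} (hME : M ≤ E)
    (ops : List (Op ι n)) (hops : ∀ op ∈ ops, op.WF att) (loc : ι → ℕ) (nb : ℕ) (T : Tabs ι n)
    (hT : Supp att T) (hsm : ∀ i, Small d E (T i)) (s : State) (hg : Good d s)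
    (hst : Stored s loc nb T) (hM : s.r .bud = M) :
    Run (compile v₀ ops loc nb) s (compileCost n d E ops.length) fun s' =>
      Good d s' ∧ KeptOut nb s s' ∧ ∃ l, OutList M v₀ ops T l ∧
        Emits s s' l (Success M v₀ ops T) := by
  have hd := hg.pos
  induction ops generalizing loc nb T s with
  | nil =>
    refine (run_leaf (nb := nb) (hst v₀).2 (hsm v₀) hg).post ?_
    rintro s' ⟨h1, h2, l, h3, h4⟩
    exact ⟨h1, h2, l, h3, h4.congr_ok (by simp [Success, Leaf])⟩
  | cons op ops ih =>
    have hops' : ∀ o ∈ ops, o.WF att := fun o ho => hops o (by simp [ho])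
    have hop := hops op (by simp)
    have hU : 20 ≤ (E + 1) * (walkCost n d + 6 * n + 20) := by nlinarith
    have hEU : (E + 1) * 20 ≤ (E + 1) * (walkCost n d + 6 * n + 20) :=
      Nat.mul_le_mul_left _ (by omega)
    have hsc : stepCost n d E = 12 * ((E + 1) * (walkCost n d + 6 * n + 20)) := rfl
    set U := (E + 1) * (walkCost n d + 6 * n + 20)
    set F := compileCost n d E ops.length with hF
    have hlen : compileCost n d E (op :: ops).length = (Nat.log 2 E + 3) * (stepCost n d E + F) :=
      rfl
    have hle : stepCost n d E + F ≤ compileCost n d E (op :: ops).length := by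
      rw [hlen]; exact Nat.le_mul_of_pos_left _ (by omega)
    -- the operations without branches
    have key : ∀ (P : Prog) (z : ι) (res : Option (Finset (Vec n))),
        Run P s (stepCost n d E) (fun s' => Rep s' nb res ∧ Good d s') → P.Local nb →
        Small d E res → Supp att (Function.update T z res) →
        Run (P ;; compile v₀ ops (Function.update loc z nb) (nb + 1)) s
          (compileCost n d E (op :: ops).length) fun s' => Good d s' ∧ KeptOut nb s s' ∧
            ∃ l, OutList M v₀ ops (Function.update T z res) l ∧
              Emits s s' l (Success M v₀ ops (Function.update T z res)) := by
      intro P z res hP hloc hres hsupp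
      refine (run_seq ((hP.kept hloc).post ?_)).mono hle fun _ h => h
      rintro s1 ⟨⟨h1, g1⟩, k1⟩
      refine (ih hops' _ _ _ hsupp (small_update hsm hres) s1 g1 (hst.update k1 h1) ?_).post ?_
      · rw [k1.1 _ (by simp [Rg.free]), hM]
      · rintro s2 ⟨g2, k2, l, hl, he⟩
        exact ⟨g2, k1.keptOut.trans (k2.mono (Nat.le_succ _)), l, hl,
          he.of_left (k1.mono (Nat.zero_le _))⟩
    cases op with
    | proj a b X =>
      refine (key _ b (projRes X (T a) (T b)) ((run_projOp (hst a).2 (hst b).2 (hsm a) (hsm b) hg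
        (hst a).1 (hst b).1).mono (by omega) fun _ h => h) (by simp)
        (small_projRes hd (hsm a) (hsm b)) (hT.step (M := M) (op := .proj a b X) hop rfl)).post ?_
      rintro s' ⟨h1, h2, l, h3, h4⟩
      exact ⟨h1, h2, l, h3, h4.congr_ok (by simp [Success, Leaf, Step])⟩
    | join p q z W X =>
      obtain ⟨-, hW, hX⟩ := hop
      refine (key _ z (joinRes M W X (T p) (T q) (T z)) ((run_joinOp (W' := att q) (hst p).2
        (hst q).2 (hst z).2 (hsm p) (hsm q) (hsm z) hg (hst p).1 (hst q).1 (hst z).1 hM hME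
        (by rw [hW, hX]) (fun S hS x hx => by rw [hW]; exact hT p S hS x hx) (hT q)).mono
        (by omega) fun _ h => h) (local_joinOp le_rfl)
        (small_joinRes hME (hsm p) (hsm q) (hsm z))
        (hT.step (M := M) (op := .join p q z W X) (hops _ (by simp)) rfl)).post ?_
      rintro s' ⟨h1, h2, l, h3, h4⟩
      exact ⟨h1, h2, l, h3, h4.congr_ok (by simp [Success, Leaf, Step])⟩
    | semi a b X =>
      refine (key _ a (semiRes X (T a) (T b)) ((run_semiOp (hst a).2 (hst b).2 (hsm a) (hsm b) hg
        (hst a).1).mono (by omega) fun _ h => h) (by simp)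
        (small_semiRes (hsm a)) (hT.step (M := M) (op := .semi a b X) hop rfl)).post ?_
      rintro s' ⟨h1, h2, l, h3, h4⟩
      exact ⟨h1, h2, l, h3, h4.congr_ok (by simp [Success, Leaf, Step])⟩
    | split a X =>
      rw [hlen]
      have hpa := (hst a).2.pres
      refine (run_ite (T := (Nat.log 2 E + 2) * (stepCost n d E + F) + 6) (fun h => ?_)
        fun h => ?_).mono ?_ fun _ h => h
      rotate_left
      · have hTa : T a = none := by
          cases hTa : T a with
          | none => rfl
          | some R => rw [hTa] at hpa; rw [hpa] at h; simp at h
        refine (ih hops' loc nb T hT hsm s hg hst hM).mono ?_ ?_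
        · have : F ≤ (Nat.log 2 E + 2) * (stepCost n d E + F) :=
            (Nat.le_add_left _ _).trans (Nat.le_mul_of_pos_left _ (by omega))
          omega
        · rintro s' ⟨h1, h2, l, h3, h4⟩
          exact ⟨h1, h2, l, Or.inl ⟨hTa, h3⟩, h4.congr_ok (by simp [Success, Leaf, Step, hTa])⟩
      · have : (Nat.log 2 E + 3) * (stepCost n d E + F) =
          (Nat.log 2 E + 2) * (stepCost n d E + F) + (stepCost n d E + F) := by ring
        omega
      obtain ⟨S, hTa⟩ : ∃ S, T a = some S := by
        cases hTa : T a with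
        | none => rw [hTa] at hpa; rw [hpa] at h; simp at h
        | some R => exact ⟨R, rfl⟩
      have hSa : Small d E (some S) := hTa ▸ hsm a
      have hSE : S.card ≤ E := (hSa S rfl).2
      -- the number of nonempty buckets
      obtain ⟨r, hr⟩ : ∃ r, ∀ i, i < r ↔ 2 ^ i / 2 < S.card := by
        have hex : ∃ i, S.card ≤ 2 ^ i / 2 := ⟨S.card + 1, by
          rw [pow_succ, Nat.mul_div_cancel _ (by norm_num)]
          exact Nat.lt_two_pow_self.le⟩
        classical
        refine ⟨Nat.find hex, fun i => ⟨fun hi => not_le.1 (Nat.find_min hex hi), fun hi => ?_⟩⟩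
        by_contra hlt
        have h1 := Nat.find_spec hex
        have h2 : 2 ^ Nat.find hex / 2 ≤ 2 ^ i / 2 :=
          Nat.div_le_div_right (Nat.pow_le_pow_right (by norm_num) (not_lt.1 hlt))
        omega
      have hrE : r ≤ Nat.log 2 E + 2 := by
        by_contra hlt
        have h1 := (hr (Nat.log 2 E + 2)).1 (by omega)
        rw [pow_succ, Nat.mul_div_cancel _ (by norm_num)] at h1
        have h2 := Nat.lt_pow_succ_log_self (b := 2) (by norm_num) E
        have h3 : 2 ^ (Nat.log 2 E + 1) < E := h1.trans_le hSE
        exact absurd h2 (by simp only [Nat.succ_eq_add_one]; omega)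
      have hstep : ∀ i < r, Supp att (Function.update T a (some (splitSet X S i))) := fun i hi =>
        hT.step (M := M) (op := .split a X) hop (Or.inr ⟨S, i, hTa, (hr i).1 hi, rfl⟩)
      have hra : Rep s (loc a) (some S) := hTa ▸ (hst a).2
      have hlenS : s.r (.len (loc a)) = S.card := by rw [← length_rows (n := n), hra.length]
      have hla := (hst a).1
      refine (run_seq (T := 1) (T' := 1 + (1 + (r * ((stepCost n d E + F - 1) + 1) + 1)))
        (run_cst (run_seq (run_cst (run_seq (run_mov ?_)))))).mono ?_ fun _ h => h
      swap
      · have e1 : stepCost n d E + F - 1 + 1 = stepCost n d E + F := by omega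
        have e2 : r * (stepCost n d E + F) ≤ (Nat.log 2 E + 2) * (stepCost n d E + F) :=
          Nat.mul_le_mul_right _ hrE
        rw [e1]
        omega
      set s1 := ((s.setr (.lo nb) 0).setr (.hi nb) 1).setr .t1
        (((s.setr (.lo nb) 0).setr (.hi nb) 1).r (.len (loc a))) with hs1
      have k1 : Kept nb s s1 := (((Kept.refl nb s).setr (by simp [Rg.free]) _).setr
        (by simp [Rg.free]) _).setr (by simp [Rg.free]) _
      refine (run_whl (k := r) (c := stepCost n d E + F - 1) (fun k s' => k ≤ r ∧
        s'.r .t1 = S.card - 2 ^ (r - k) / 2 ∧ s'.r (.lo nb) = 2 ^ (r - k) / 2 ∧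
        s'.r (.hi nb) = 2 ^ (r - k) ∧ Good d s' ∧ KeptOut nb s s' ∧ ∃ ls : ℕ → List (Vec n),
          (∀ i < r - k, OutList M v₀ ops (Function.update T a (some (splitSet X S i))) (ls i)) ∧
          Emits s s' ((List.range (r - k)).flatMap ls)
            (∀ i < r - k, Success M v₀ ops (Function.update T a (some (splitSet X S i)))))
        ?_ ?_ ?_).post ?_
      · rintro k s' ⟨hk, ht, -⟩
        rw [ht]
        have := hr (r - k)
        omega
      · rintro k s2 - ⟨hk, ht, hlo, hhi, g2, ko2, ls, hls, hem⟩
        set i := r - (k + 1) with hi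
        have hir : i < r := by omega
        have hik : r - k = i + 1 := by omega
        have hi2 : 2 ^ i ≤ 2 * S.card := by
          have h1 := (hr i).1 hir
          omega
        have hb : 7 * U + (F + (1 + ((2 ^ i * 4 + 2) + 1))) ≤ stepCost n d E + F - 1 := by
          omega
        refine (run_seq ((run_bucketOp (hra.keptOut ko2 hla) hSa g2 hla hlo hhi).post ?_)).mono hb
          fun _ h => h
        rintro s3 ⟨r3, g3, k3, lo3, hi3⟩
        have st3 := (hst.keptOut ko2).update k3 r3 (a := a)
        have hM3 : s3.r .bud = M := by
          rw [k3.1 _ (by simp [Rg.free]), ko2.1 _ (by simp [Rg.free]) (by simp) (by simp)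
            (by simp), hM]
        refine run_seq ((ih hops' _ _ _ (hstep i hir) (small_update hsm
          (hSa.of_subset (Finset.filter_subset _ _))) s3 g3 st3 hM3).post ?_)
        rintro s4 ⟨g4, k4, l, hl, he⟩
        have lo4 : s4.r (.lo nb) = 2 ^ i / 2 := by
          rw [k4.1 _ (by simp [Rg.free]) (by simp) (by simp) (by simp), lo3, hlo]
        have hi4 : s4.r (.hi nb) = 2 ^ i := by
          rw [k4.1 _ (by simp [Rg.free]) (by simp) (by simp) (by simp), hi3, hhi]
        have he4 := (hem.trans (ko2.2 _ (by simp [Ar.free]) (by simp))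
          (he.of_left (k3.mono (Nat.zero_le _))))
        have k4' : KeptOut nb s s4 := ko2.trans (k3.keptOut.trans (k4.mono (Nat.le_succ _)))
        refine run_seq (run_mov ?_)
        set s5 := s4.setr (.lo nb) (s4.r (.hi nb)) with hs5
        have hi5 : s5.r (.hi nb) = 2 ^ i := by simp [hs5, hi4]
        have lo5 : s5.r (.lo nb) = 2 ^ i := by simp [hs5, hi4]
        have := run_double (a := .hi nb) (by simp) (by simp) (s := s5)
        rw [hi5] at this
        refine run_seq (this.frame.post ?_)
        rintro s6 ⟨hi6, f6⟩
        have hw : ∀ b : Rg, b ≠ .t1 → b ≠ .t2 → b ≠ .hi nb → s6.r b = s5.r b := fun b b1 b2 b3 =>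
          f6.1 b (by simp [double, b1, b2, b3])
        have k5 : Kept nb s4 s5 := (Kept.refl nb s4).setr (by simp [Rg.free]) _
        have k6 : Kept nb s4 s6 := k5.trans (f6.kept (by simp [double, Rg.free]))
        have len6 : s6.r (.len (loc a)) = S.card := by
          rw [hw _ (by simp) (by simp) (by simp)]
          simp only [hs5, State.r_setr, reduceCtorEq, if_false]
          rw [k4'.1 _ (by simp [Rg.free, hla]) (by simp) (by simp) (by simp), hlenS]
        have lo6 : s6.r (.lo nb) = 2 ^ i := by
          rw [hw _ (by simp) (by simp) (by simp), lo5]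
        have m6 : s6.m = s4.m := funext fun b => f6.2 b (by simp [double])
        have e2 : 2 ^ (i + 1) / 2 = 2 ^ i := by
          rw [pow_succ, Nat.mul_div_cancel _ (by norm_num)]
        have k7 : Kept nb s4 (s6.setr .t1 (s6.r (.len (loc a)) - s6.r (.lo nb))) :=
          k6.setr (by simp [Rg.free]) _
        refine run_dif ⟨by omega, ?_, ?_, ?_, ?_, k4'.trans k7.keptOut,
          Function.update ls i l, ?_, ?_⟩
        · rw [hik, e2]; simp [len6, lo6]
        · rw [hik, e2]; simp [lo6]
        · rw [hik]; simp [hi6, pow_succ, mul_comm]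
        · refine g4.of_eq (by simp [m6]) (by simp [m6]) (fun v e => by simp [m6]) ?_
          simp only [State.r_setr, reduceCtorEq, if_false]
          rw [hw _ (by simp) (by simp) (by simp)]
          simp [hs5]
        · intro i' hi'
          rw [hik] at hi'
          by_cases hii : i' = i
          · subst hii
            rw [Function.update_self]
            exact hl
          · rw [Function.update_of_ne hii]
            exact hls i' (by omega)
        · have e1 : (List.range (i + 1)).flatMap (Function.update ls i l) =
              (List.range i).flatMap ls ++ l := by
            rw [List.range_succ, List.flatMap_append]
            congr 1
            · refine List.flatMap_congr fun j hj => ?_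
              rw [Function.update_of_ne (by rw [List.mem_range] at hj; omega)]
            · simp
          rw [hik, e1]
          refine (he4.of_right (k7.mono (Nat.zero_le _))).congr_ok ?_
          constructor
          · rintro ⟨h1, h2⟩ i' hi'
            rcases Nat.lt_succ_iff_lt_or_eq.1 hi' with hi' | rfl
            · exact h1 i' hi'
            · exact h2
          · exact fun h => ⟨fun i' hi' => h i' (by omega), h i (by omega)⟩
      · have r0 : r - r = 0 := Nat.sub_self r
        refine ⟨le_rfl, ?_, ?_, ?_, hg.of_eq rfl rfl (fun _ _ => rfl) (by simp [hs1]),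
          k1.keptOut, fun _ => [], ?_, ?_⟩
        · simp [hs1, hlenS]
        · simp [hs1]
        · simp [hs1]
        · simp
        · have : Emits (n := n) s s [] True := ⟨by simp, by simp, by simp⟩
          rw [r0]
          exact (this.of_right (k1.mono (Nat.zero_le _))).congr_ok (by simp)
      · rintro s' ⟨-, -, -, -, g', k', ls, hls, hem⟩
        refine ⟨g', k', _, Or.inr ⟨S, hTa, r, ls, hr, rfl, fun i hi => hls i (by simpa using hi)⟩,
          ?_⟩
        rw [Nat.sub_zero] at hem
        refine hem.congr_ok ⟨fun hs T' hT' => ?_, fun hs i hi T' hT' => ?_⟩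
        · obtain ⟨T₁, h1 | ⟨S', i, h1, h2, rfl⟩, h3⟩ := hT'
          · rw [hTa] at h1; cases h1.1
          · rw [hTa] at h1; cases h1
            exact hs i ((hr i).2 h2) T' h3
        · exact hs T' ⟨_, Or.inr ⟨S, i, hTa, (hr i).1 hi, rfl⟩, hT'⟩

/-- Each operation contributes at most a logarithmic factor, the number of degree buckets. -/
theorem compileCost_le (n d E k : ℕ) :
    compileCost n d E k ≤ (2 * (Nat.log 2 E + 3)) ^ k * stepCost n d E := by
  have h1 : ∀ k, stepCost n d E ≤ compileCost n d E k := by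
    intro k
    cases k with
    | zero => exact le_rfl
    | succ k =>
      exact (Nat.le_add_right _ _).trans (Nat.le_mul_of_pos_left _ (by omega))
  induction k with
  | zero => simp [compileCost]
  | succ k ih =>
    calc compileCost n d E (k + 1) ≤ (Nat.log 2 E + 3) * (2 * compileCost n d E k) :=
          Nat.mul_le_mul_left _ (by have := h1 k; omega)
      _ ≤ (Nat.log 2 E + 3) * (2 * ((2 * (Nat.log 2 E + 3)) ^ k * stepCost n d E)) := by gcongr
      _ = _ := by ring

end Compile

/-! ### Reading the input -/

section Parse

variable {n m : ℕ}

/-- The part of the input that has not been read yet starts with `w`. -/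
def Rest (s : State) (w : List ℕ) : Prop :=
  ∀ i (h : i < w.length), s.m .inp (s.r .ptr + i) = w[i]

theorem Rest.head {s : State} {a : ℕ} {w : List ℕ} (h : Rest s (a :: w)) :
    s.m .inp (s.r .ptr) = a := by
  exact h 0 (by simp)

theorem Rest.tail {s s' : State} {a : ℕ} {w : List ℕ} (h : Rest s (a :: w))
    (hm : s'.m .inp = s.m .inp) (hr : s'.r .ptr = s.r .ptr + 1) : Rest s' w := fun i hi => by
  rw [hm, hr]
  have := h (i + 1) (by simpa using hi)
  simpa [add_assoc, add_comm 1 i] using this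

theorem Rest.congr {s s' : State} {w : List ℕ} (h : Rest s w) (hm : s'.m .inp = s.m .inp)
    (hr : s'.r .ptr = s.r .ptr) : Rest s' w := fun i hi => by
  rw [hm, hr]
  exact h i hi

/-- The values that have been read are renamed by positive numbers less than `idn`; the new name
of `a` is `cmp a`, where `0` means that `a` has no name yet. -/
structure Renaming (s : State) : Prop where
  pos : 1 ≤ s.r .idn
  lt : ∀ a, s.m .cmp a ≠ 0 → s.m .cmp a < s.r .idn
  dec : ∀ a, s.m .cmp a ≠ 0 → s.m .dec (s.m .cmp a) = a

theorem Renaming.congr {s s' : State} (h : Renaming s) (h1 : s'.r .idn = s.r .idn)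
    (h2 : s'.m .cmp = s.m .cmp) (h3 : s'.m .dec = s.m .dec) : Renaming s' :=
  ⟨by rw [h1]; exact h.pos, fun a => by rw [h1, h2]; exact h.lt a,
    fun a => by rw [h2, h3]; exact h.dec a⟩

/-- The values that had names in `s` have the same names in `s'`. -/
def SameNames (s s' : State) : Prop := ∀ a, s.m .cmp a ≠ 0 → s'.m .cmp a = s.m .cmp a

theorem SameNames.refl (s : State) : SameNames s s := fun _ _ => rfl

theorem SameNames.of_eq {s s' : State} (h : s'.m .cmp = s.m .cmp) : SameNames s s' :=
  fun _ _ => by rw [h]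

theorem SameNames.trans {s s' s'' : State} (h : SameNames s s') (h' : SameNames s' s'') :
    SameNames s s'' := fun a ha => by
  have := h a ha
  rw [h' a (by rw [this]; exact ha), this]

/-- The values of the tuple have names. -/
def Named (s : State) {X : Finset (Fin n)} (t : Tuple X) : Prop := ∀ v, s.m .cmp (t v) ≠ 0

theorem Named.mono {s s' : State} (h : SameNames s s') {X : Finset (Fin n)} {t : Tuple X}
    (ht : Named s t) : Named s' t := fun v => by rw [h _ (ht v)]; exact ht v

theorem encVec_eq {s s' : State} (h : SameNames s s') {X : Finset (Fin n)} {t : Tuple X}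
    (ht : Named s t) : encVec (s'.m .cmp) t = encVec (s.m .cmp) t := by
  funext v
  by_cases hv : v ∈ X
  · simp only [encVec, hv, dif_pos]
    exact h _ (ht _)
  · simp [encVec, hv]

theorem map_encVec_eq {s s' : State} (h : SameNames s s') {X : Finset (Fin n)}
    {l : List (Tuple X)} (hl : ∀ t ∈ l, Named s t) :
    l.map (encVec (s'.m .cmp)) = l.map (encVec (s.m .cmp)) :=
  List.map_congr_left fun t ht => encVec_eq h (hl t ht)

/-- Read a value, and store its name in the register `x v`. -/
def readVal (v : ℕ) : Prog :=
  lod .val .inp .ptr ;; inc .ptr ;; lod .t1 .cmp .val ;;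
    ite' .t1 skp (mov .t1 .idn ;; sto .cmp .val .t1 ;; sto .dec .t1 .val ;; inc .idn) ;;
    mov (.x v) .t1

theorem run_readVal {v a : ℕ} {w : List ℕ} {s : State} (h : Rest s (a :: w)) (hn : Renaming s) :
    Run (readVal v) s 9 fun s' => Rest s' w ∧ Renaming s' ∧ SameNames s s' ∧ s'.m .cmp a ≠ 0 ∧
      s'.r (.x v) = s'.m .cmp a ∧ s'.r .idn ≤ s.r .idn + 1 := by
  have hp := hn.pos
  refine run_seq (T := 1) (T' := 8) (run_lod (run_seq (T := 1) (T' := 7) (run_inc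
    (run_seq (T := 1) (T' := 6) (run_lod (run_seq (T := 5) (T' := 1) ?_))))))
  simp only [State.r_setr, reduceCtorEq, if_false, if_true, State.m_setr, h.head]
  set s1 := ((s.setr .val a).setr .ptr (s.r .ptr + 1)).setr .t1 (s.m .cmp a) with hs1
  refine run_ite (fun h0 => ?_) fun h0 => ?_
  · have h0' : s.m .cmp a ≠ 0 := by simpa [hs1] using h0
    refine Run.mono (run_skp (run_mov ?_)) (show 1 ≤ 4 by omega) fun _ h => h
    refine ⟨h.tail rfl (by simp [hs1]), hn.congr (by simp [hs1]) rfl rfl, SameNames.of_eq rfl,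
      h0', ?_, by simp [hs1]⟩
    simp [hs1]
  · have h0' : s.m .cmp a = 0 := by simpa [hs1] using h0
    refine run_seq (T := 1) (T' := 3) (run_mov (run_seq (T := 1) (T' := 2) (run_sto
      (run_seq (T := 1) (T' := 1) (run_sto (run_inc (run_mov ?_)))))))
    simp only [State.r_setr, State.r_setm, reduceCtorEq, if_false, if_true, hs1]
    generalize hs' : State.setr _ (.x v) (s.r .idn) = s'
    have hm : ∀ b j, s'.m b j = if b = .dec ∧ j = s.r .idn then a else
        if b = .cmp ∧ j = a then s.r .idn else s.m b j := by
      intro b j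
      rw [← hs']
      simp only [State.m_setr]
      rw [State.m_setm, State.m_setm]
      rfl
    have hr : ∀ b, s'.r b = if b = .x v then s.r .idn else if b = .idn then s.r .idn + 1 else
        if b = .t1 then s.r .idn else if b = .ptr then s.r .ptr + 1 else if b = .val then a else
        s.r b := by
      intro b
      rw [← hs']
      simp only [State.r_setr, State.r_setm]
      split_ifs <;> rfl
    refine ⟨h.tail (funext fun j => ?_) (by simp [hr]), ⟨by simp [hr], fun b => ?_, fun b => ?_⟩,
      fun b hb => ?_, ?_, ?_, by simp⟩
    · simp [hm]
    · have := hn.lt b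
      simp only [hm, hr, reduceCtorEq, false_and, if_false, true_and, if_true]
      split_ifs
      · omega
      · intro hb; have := this hb; omega
    · have h1 := hn.lt b
      have h2 := hn.dec b
      simp only [hm, reduceCtorEq, false_and, if_false, true_and]
      split_ifs with h3 h4 h5
      · exact fun _ => h3.symm
      · omega
      · intro hb; have := h1 hb; omega
      · exact h2
    · simp only [hm, reduceCtorEq, false_and, if_false, true_and]
      rw [if_neg]
      rintro rfl
      exact hb h0'
    · simp [hm]; omega
    · simp [hm]

/-- Read a tuple with attributes `X` into the registers `x`. -/
def readTuple (X : Finset (Fin n)) : Prog :=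
  forV fun v : Fin n => if v ∈ X then readVal v else cst (.x v) 0

theorem readTuple_frame {X : Finset (Fin n)} :
    (∀ a, (readTuple X).wr a → a = .junk ∨ a = .val ∨ a = .ptr ∨ a = .t1 ∨ a = .idn ∨
      ∃ v : Fin n, a = .x v) ∧
    ∀ a, (readTuple X).wa a → a = .cmp ∨ a = .dec := by
  constructor
  · intro a ha
    rw [readTuple, wr_forV] at ha
    rcases ha with rfl | ⟨v, h⟩
    · simp
    · split_ifs at h
      · simp only [readVal, wr_seq, wr_lod, wr_inc, wr_ite', wr_skp, wr_mov, wr_sto] at h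
        have : a = .x v → ∃ v : Fin n, a = .x v := fun h => ⟨v, h⟩
        tauto
      · exact Or.inr (Or.inr (Or.inr (Or.inr (Or.inr ⟨v, by simpa using h⟩))))
  · intro a ha
    rw [readTuple, wa_forV] at ha
    obtain ⟨v, h⟩ := ha
    split_ifs at h
    · simp only [readVal, wa_seq, wa_lod, wa_inc, wa_ite', wa_skp, wa_mov, wa_sto] at h
      tauto
    · simp at h

theorem run_readTuple {X : Finset (Fin n)} {t : Tuple X} {w : List ℕ} {s : State}
    (h : Rest s (encodeTuple t ++ w)) (hn : Renaming s) :
    Run (readTuple X) s (9 * n + 1) fun s' => Rest s' w ∧ Renaming s' ∧ SameNames s s' ∧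
      Named s' t ∧ (∀ v : Fin n, s'.r (.x v) = encVec (s'.m .cmp) t v) ∧
      s'.r .idn ≤ s.r .idn + n := by
  set f : Fin n → Option ℕ := fun v => if h : v ∈ X then some (t ⟨v, h⟩) else none with hf
  refine (run_forV 9 (fun k s' => Rest s' (((List.finRange n).drop k).filterMap f ++ w) ∧
    Renaming s' ∧ SameNames s s' ∧ (∀ v (hv : v ∈ X), v.val < k → s'.m .cmp (t ⟨v, hv⟩) ≠ 0) ∧
    (∀ v : Fin n, v.val < k → s'.r (.x v) = encVec (s'.m .cmp) t v) ∧
    s'.r .idn ≤ s.r .idn + k) ?_ ?_ ?_).mono (by omega) fun _ h => h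
  · exact ⟨by rw [List.drop_zero]; exact h, hn, SameNames.refl s, fun v _ hv => by omega,
      fun v hv => by omega, by simp⟩
  · rintro v s1 - ⟨h1, h2, h3, h4, h5, h6⟩
    have hdrop : (List.finRange n).drop v = v :: (List.finRange n).drop (v + 1) := by
      rw [List.drop_eq_getElem_cons (by simp)]
      simp
    rw [hdrop] at h1
    have hlt : ∀ u : Fin n, u.val < v.val + 1 → u ≠ v → u.val < v.val := fun u hu huv => by
      have : u.val ≠ v.val := fun e => huv (Fin.ext e)
      omega
    split_ifs with hv
    · have hfv : f v = some (t ⟨v, hv⟩) := by simp [hf, hv]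
      rw [List.filterMap_cons_some hfv] at h1
      refine (run_readVal h1 h2).frame.post ?_
      rintro s2 ⟨⟨r1, r2, r3, r4, r5, r6⟩, f2⟩
      have hx : ∀ u : Fin n, u ≠ v → s2.r (.x u) = s1.r (.x u) := fun u huv => by
        refine f2.1 _ fun h => ?_
        simp [readVal] at h
        exact huv (Fin.ext h)
      refine ⟨r1, r2, h3.trans r3, fun u hu hlt' => ?_, fun u hu => ?_, by omega⟩
      · by_cases huv : u = v
        · subst huv; exact r4
        · have := h4 u hu (hlt u hlt' huv)
          rw [r3 _ this]; exact this
      · by_cases huv : u = v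
        · subst huv; simp [encVec, hv, r5]
        · rw [hx u huv, h5 u (hlt u hu huv)]
          by_cases huX : u ∈ X
          · simp only [encVec, huX, dif_pos]
            exact (r3 _ (h4 u huX (hlt u hu huv))).symm
          · simp [encVec, huX]
    · have hfv : f v = none := by simp [hf, hv]
      rw [List.filterMap_cons_none hfv] at h1
      refine Run.mono (run_cst ?_) (show 1 ≤ 9 by omega) fun _ h => h
      refine ⟨h1.congr rfl (by simp), h2.congr (by simp) rfl rfl, h3, fun u hu hlt' => ?_,
        fun u hu => ?_, ?_⟩
      · exact h4 u hu (hlt u hlt' (fun e => hv (e ▸ hu)))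
      · by_cases huv : u = v
        · subst huv; simp [encVec, hv]
        · have : (Rg.x u) ≠ .x v := by simpa using fun e => huv (Fin.ext e)
          rw [State.r_setr, if_neg this, h5 u (hlt u hu huv)]
          rfl
      · rw [State.r_setr, if_neg (by simp)]; omega
  · rintro s' ⟨h1, h2, h3, h4, h5, h6⟩
    refine ⟨?_, h2.congr (by simp) rfl rfl, h3, fun v => h4 v v.2 v.1.2, fun v => ?_, ?_⟩
    · have : (List.finRange n).drop n = [] := by simp
      rw [this] at h1
      exact Rest.congr h1 rfl (by simp)
    · rw [State.r_setr, if_neg (by simp), h5 v v.2]; rfl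
    · rw [State.r_setr, if_neg (by simp)]; exact h6

/-- Read a relation with attributes `X` into bank `b`; if it is empty, set `ne` to zero. -/
def readRel (X : Finset (Fin n)) (b : ℕ) : Prog :=
  lod .rem .inp .ptr ;; inc .ptr ;; ite' .rem skp (cst .ne 0) ;;
    whl .rem (readTuple X ;; appendRow n .x b ;; cst .t1 1 ;; dif .rem .rem .t1) ;;
    cst (.pres b) 1

theorem readRel_frame {X : Finset (Fin n)} {b : ℕ} :
    (∀ a, (readRel X b).wr a → a = .rem ∨ a = .ptr ∨ a = .junk ∨ a = .ne ∨ a = .val ∨ a = .t1 ∨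
      a = .idn ∨ (∃ v : Fin n, a = .x v) ∨ a = .len b ∨ a = .pres b) ∧
    ∀ a, (readRel X b).wa a → a = .cmp ∨ a = .dec ∨ ∃ v : Fin n, a = .col b v := by
  constructor
  · intro a
    have := (readTuple_frame (X := X)).1 a
    simp only [readRel, wr_seq, wr_lod, wr_inc, wr_ite', wr_skp, wr_cst, wr_whl, wr_appendRow,
      wr_dif]
    tauto
  · intro a
    have := (readTuple_frame (X := X)).2 a
    simp only [readRel, wa_seq, wa_lod, wa_inc, wa_ite', wa_skp, wa_cst, wa_whl, wa_appendRow,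
      wa_dif]
    tauto

theorem run_readRel {X : Finset (Fin n)} {b : ℕ} {l : List (Tuple X)} {w : List ℕ} {s : State}
    (h : Rest s (encodeRel l ++ w)) (hn : Renaming s) (hb : rows n s b = []) :
    Run (readRel X b) s (l.length * (10 * n + 6) + 7) fun s' => Rest s' w ∧ Renaming s' ∧
      SameNames s s' ∧ (∀ t ∈ l, Named s' t) ∧ rows n s' b = l.map (encVec (s'.m .cmp)) ∧
      s'.r (.pres b) = 1 ∧ (s'.r .ne = if l = [] then 0 else s.r .ne) ∧
      s'.r .idn ≤ s.r .idn + l.length * n := by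
  refine (run_seq (T := 1) (T' := 1 + (2 + ((l.length * ((10 * n + 5) + 1) + 1) + 1))) (run_lod
    (run_seq (run_inc (run_seq (Run.post (run_ite (T := 1) (Q := fun s' =>
      Rest s' (l.flatMap encodeTuple ++ w) ∧ Renaming s' ∧ s'.m .cmp = s.m .cmp ∧
      rows n s' b = [] ∧ s'.r .rem = l.length ∧ (s'.r .ne = if l = [] then 0 else s.r .ne) ∧
      s'.r .idn = s.r .idn) (fun h0 => ?_) fun h0 => ?_) ?_)))))).mono ?_
      fun _ h => h
  rotate_right
  · have : l.length * (10 * n + 5 + 1) = l.length * (10 * n + 6) := rfl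
    omega
  · simp only [State.r_setr, reduceCtorEq, if_true, if_false, Rest.head h] at h0
    refine run_skp ⟨h.tail rfl (by simp), hn.congr (by simp) rfl rfl, rfl, ?_, ?_, ?_, by simp⟩
    · simp only [rows_setr, ne_eq, reduceCtorEq, not_false_eq_true, hb]
    · simp [Rest.head h]
    · have : l ≠ [] := fun e => h0 (by simp [e])
      simp [this]
  · simp only [State.r_setr, reduceCtorEq, if_true, if_false, Rest.head h] at h0
    have hl : l = [] := List.length_eq_zero_iff.1 h0
    refine run_cst ⟨h.tail rfl (by simp), hn.congr (by simp) rfl rfl, rfl, ?_, ?_, ?_, by simp⟩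
    · simp only [rows_setr, ne_eq, reduceCtorEq, not_false_eq_true, hb]
    · simp [Rest.head h]
    · simp [hl]
  rintro s1 ⟨a1, a2, a3, a4, a5, a6, a7⟩
  refine run_seq ((run_whl (k := l.length) (c := 10 * n + 5) (fun k s' => s'.r .rem = k ∧
    ∃ l₁ l₂, l = l₁ ++ l₂ ∧ l₂.length = k ∧ Rest s' (l₂.flatMap encodeTuple ++ w) ∧ Renaming s' ∧
    SameNames s s' ∧ (∀ t ∈ l₁, Named s' t) ∧ rows n s' b = l₁.map (encVec (s'.m .cmp)) ∧
    (s'.r .ne = if l = [] then 0 else s.r .ne) ∧ s'.r .idn ≤ s.r .idn + l₁.length * n)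
    ?_ ?_ ?_).post ?_)
  · rintro k s' ⟨rfl, -⟩
    rfl
  · rintro k s2 - ⟨b1, l₁, l₂, b2, b3, b4, b5, b6, b7, b8, b9, b10⟩
    rcases l₂ with _ | ⟨t, l₂⟩
    · simp at b3
    rw [List.flatMap_cons, List.append_assoc] at b4
    refine (run_seq (T := 9 * n + 1) (T' := (n + 2) + (1 + 1))
      ((run_readTuple b4 b5).frame.post ?_)).mono (by omega) fun _ h => h
    rintro s3 ⟨⟨c1, c2, c3, c4, c5, c6⟩, f3⟩
    have rows3 : rows n s3 b = rows n s2 b :=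
      rows_congr (f3.1 _ fun h => by have := readTuple_frame.1 _ h; simp at this)
        fun v => f3.2 _ fun h => by have := readTuple_frame.2 _ h; simp at this
    have rem3 : s3.r .rem = k + 1 := by
      rw [f3.1 _ fun h => by have := readTuple_frame.1 _ h; simp at this, b1]
    have ne3 : s3.r .ne = s2.r .ne :=
      f3.1 _ fun h => by have := readTuple_frame.1 _ h; simp at this
    refine run_seq ((run_appendRow s3).post ?_)
    rintro s4 ⟨d1, d2, d3⟩
    have cmp4 : s4.m .cmp = s3.m .cmp := d2 _ (by simp)
    refine run_seq (run_cst (run_dif ⟨?_, l₁ ++ [t], l₂, by simp [b2], by simpa using b3,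
      ?_, ?_, ?_, ?_, ?_, ?_, ?_⟩))
    · simp [d3, rem3]
    · refine c1.congr ?_ ?_
      · simp [d2]
      · simp [d3]
    · exact c2.congr (by simp [d3]) (by simp [d2]) (by simp [d2])
    · exact b6.trans (c3.trans (SameNames.of_eq (by simp [d2])))
    · intro t' ht'
      have e : SameNames s3 ((s4.setr .t1 1).setr .rem ((s4.setr .t1 1).r .rem -
        (s4.setr .t1 1).r .t1)) := SameNames.of_eq (by simp [d2])
      rcases List.mem_append.1 ht' with ht' | ht'
      · exact ((b7 t' ht').mono c3).mono e
      · rw [List.mem_singleton.1 ht']; exact c4.mono e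
    · rw [rows_setr (by simp), rows_setr (by simp), d1, rows3, b8]
      simp only [State.m_setr, cmp4, List.map_append, List.map_cons, List.map_nil]
      rw [map_encVec_eq c3 b7]
      congr 2
      exact funext c5
    · simp only [State.r_setr, reduceCtorEq, if_false]
      rw [d3 _ (by simp) (by simp), ne3, b9]
    · simp only [State.r_setr, reduceCtorEq, if_false]
      rw [d3 _ (by simp) (by simp), List.length_append, List.length_singleton, add_mul]
      omega
  · refine ⟨a5, [], l, rfl, rfl, a1, a2, SameNames.of_eq a3, by simp, by simp [a4], a6, ?_⟩
    simp [a7]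
  · rintro s2 ⟨b1, l₁, l₂, b2, b3, b4, b5, b6, b7, b8, b9, b10⟩
    obtain rfl : l₂ = [] := List.length_eq_zero_iff.1 b3
    rw [List.append_nil] at b2
    subst b2
    refine run_cst ⟨b4.congr rfl (by simp), b5.congr (by simp) rfl rfl, b6, b7, ?_, by simp,
      by simpa using b9, by simpa using b10⟩
    rw [rows_setr (by simp), b8]
    rfl

/-- Read the instance; relation `j` is stored in bank `j`. -/
def readInst (S : Schema n m) : Prog := forV fun j : Fin m => readRel (S.vars j) j

theorem readInst_frame {S : Schema n m} :
    (∀ a, (readInst S).wr a → a = .rem ∨ a = .ptr ∨ a = .junk ∨ a = .ne ∨ a = .val ∨ a = .t1 ∨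
      a = .idn ∨ (∃ v : Fin n, a = .x v) ∨ ∃ j : Fin m, a = .len j ∨ a = .pres j) ∧
    ∀ a, (readInst S).wa a → a = .cmp ∨ a = .dec ∨ ∃ (j : Fin m) (v : Fin n), a = .col j v := by
  constructor
  · intro a ha
    rw [readInst, wr_forV] at ha
    rcases ha with rfl | ⟨j, h⟩
    · simp
    · have := readRel_frame.1 _ h
      have h1 : a = .len j → ∃ j : Fin m, a = .len j ∨ a = .pres j := fun h => ⟨j, Or.inl h⟩
      have h2 : a = .pres j → ∃ j : Fin m, a = .len j ∨ a = .pres j := fun h => ⟨j, Or.inr h⟩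
      rcases this with h | h | h | h | h | h | h | h | h | h
      all_goals simp only [h, true_or, or_true]
      · exact Or.inr (Or.inr (Or.inr (Or.inr (Or.inr (Or.inr (Or.inr (Or.inr (h ▸ h1 h))))))))
      · exact Or.inr (Or.inr (Or.inr (Or.inr (Or.inr (Or.inr (Or.inr (Or.inr (h ▸ h2 h))))))))
  · intro a ha
    rw [readInst, wa_forV] at ha
    obtain ⟨j, h⟩ := ha
    rcases readRel_frame.2 _ h with h | h | ⟨v, h⟩
    · exact Or.inl h
    · exact Or.inr (Or.inl h)
    · exact Or.inr (Or.inr ⟨j, v, h⟩)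

theorem run_readInst {S : Schema n m} {L : (j : Fin m) → List (Tuple (S.vars j))} {E : ℕ}
    (hE : ∀ j, (L j).length ≤ E) {s : State} (h : Rest s (encodeInst L)) (hn : Renaming s)
    (hid : s.r .idn = 1) (hne : s.r .ne = 1) (hb : ∀ j : Fin m, rows n s j = []) :
    Run (readInst S) s (m * (E * (10 * n + 6) + 7) + 1) fun s' => Renaming s' ∧
      (∀ j, ∀ t ∈ L j, Named s' t) ∧ (∀ j : Fin m, rows n s' j = (L j).map (encVec (s'.m .cmp)) ∧
      s'.r (.pres j) = 1) ∧ (s'.r .ne = 0 ↔ ∃ j, L j = []) ∧ s'.r .idn ≤ 1 + m * (E * n) := by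
  refine run_forV _ (fun k s' =>
    Rest s' (((List.finRange m).drop k).flatMap fun j => encodeRel (L j)) ∧ Renaming s' ∧
    (∀ j : Fin m, j.val < k → (∀ t ∈ L j, Named s' t) ∧
      rows n s' j = (L j).map (encVec (s'.m .cmp)) ∧ s'.r (.pres j) = 1) ∧
    (∀ j : Fin m, k ≤ j.val → rows n s' j = []) ∧
    (s'.r .ne = 0 ↔ ∃ j : Fin m, j.val < k ∧ L j = []) ∧ s'.r .idn ≤ 1 + k * (E * n)) ?_ ?_ ?_
  · exact ⟨by simpa [encodeInst] using h, hn, fun j hj => by omega, fun j _ => hb j,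
      by simp [hne], by simp [hid]⟩
  · rintro j s1 - ⟨h1, h2, h3, h4, h5, h6⟩
    have hdrop : (List.finRange m).drop j = j :: (List.finRange m).drop (j + 1) := by
      rw [List.drop_eq_getElem_cons (by simp)]
      simp
    rw [hdrop, List.flatMap_cons] at h1
    refine (run_readRel h1 h2 (h4 j le_rfl)).frame.mono
      (Nat.add_le_add_right (Nat.mul_le_mul_right _ (hE j)) 7) ?_
    rintro s2 ⟨⟨r1, r2, r3, r4, r5, r6, r7, r8⟩, f2⟩
    have hne' : ∀ i : Fin m, i ≠ j → i.val ≠ j.val := fun i hij e => hij (Fin.ext e)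
    have hrow : ∀ i : Fin m, i ≠ j → rows n s2 i = rows n s1 i ∧
        s2.r (.pres i) = s1.r (.pres i) := fun i hij => by
      refine ⟨rows_congr (f2.1 _ fun h => ?_) fun v => f2.2 _ fun h => ?_, f2.1 _ fun h => ?_⟩
      · have := readRel_frame.1 _ h
        simp at this
        exact hne' i hij this
      · have := readRel_frame.2 _ h
        simp at this
        exact hne' i hij this
      · have := readRel_frame.1 _ h
        simp at this
        exact hne' i hij this
    refine ⟨r1, r2, fun i hi => ?_, fun i hi => ?_, ?_, ?_⟩
    · by_cases hij : i = j
      · subst hij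
        exact ⟨r4, r5, r6⟩
      · obtain ⟨g1, g2, g3⟩ := h3 i (by have := hne' i hij; omega)
        exact ⟨fun t ht => (g1 t ht).mono r3, by rw [(hrow i hij).1, g2, map_encVec_eq r3 g1],
          by rw [(hrow i hij).2, g3]⟩
    · have hij : i ≠ j := by rintro rfl; omega
      rw [(hrow i hij).1, h4 i (by omega)]
    · rw [r7]
      constructor
      · split_ifs with hL
        · exact fun _ => ⟨j, by omega, hL⟩
        · intro h0
          obtain ⟨i, hi, hL'⟩ := h5.1 h0
          exact ⟨i, by omega, hL'⟩
      · rintro ⟨i, hi, hL⟩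
        by_cases hij : i = j
        · subst hij
          rw [if_pos hL]
        · split_ifs
          · rfl
          · exact h5.2 ⟨i, by have := hne' i hij; omega, hL⟩
    · have : (L j).length * n ≤ E * n := Nat.mul_le_mul_right _ (hE j)
      have e : (j.val + 1) * (E * n) = j * (E * n) + E * n := by ring
      omega
  · rintro s' ⟨-, h2, h3, -, h5, h6⟩
    refine ⟨h2.congr (by simp) rfl rfl, fun j => (h3 j j.2).1, fun j => ⟨?_, ?_⟩, ?_, ?_⟩
    · rw [rows_setr (by simp), (h3 j j.2).2.1]; rfl
    · rw [State.r_setr, if_neg (by simp), (h3 j j.2).2.2]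
    · rw [State.r_setr, if_neg (by simp), h5]
      exact ⟨fun ⟨j, _, h⟩ => ⟨j, h⟩, fun ⟨j, h⟩ => ⟨j, j.2, h⟩⟩
    · rw [State.r_setr, if_neg (by simp)]; exact h6

/-- Fill the arrays of quotients and remainders modulo two for numbers less than `idn`. -/
def halves : Prog :=
  mov .rem .idn ;; cst .t1 0 ;; cst .hlf 0 ;; cst .t2 0 ;;
    whl .rem (sto .half .t1 .hlf ;; sto .par .t1 .t2 ;; inc .t1 ;;
      ite' .t2 (inc .hlf ;; cst .t2 0) (cst .t2 1) ;; dif .rem .idn .t1)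

theorem run_halves {s : State} :
    Run halves s (s.r .idn * 8 + 5) fun s' => ∀ j < s.r .idn,
      s'.m .half j = j / 2 ∧ s'.m .par j = j % 2 := by
  refine (run_seq (T := 1) (T' := 1 + (1 + (1 + (s.r .idn * (7 + 1) + 1)))) (run_mov (run_seq
    (run_cst (run_seq (run_cst (run_seq (run_cst ?_)))))))).mono (by omega) fun _ h => h
  refine (run_whl (k := s.r .idn) (c := 7) (fun k s' => k ≤ s.r .idn ∧ s'.r .rem = k ∧
    s'.r .idn = s.r .idn ∧ s'.r .t1 = s.r .idn - k ∧ s'.r .hlf = (s.r .idn - k) / 2 ∧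
    s'.r .t2 = (s.r .idn - k) % 2 ∧ ∀ j < s.r .idn - k, s'.m .half j = j / 2 ∧
    s'.m .par j = j % 2) ?_ ?_ ?_).post ?_
  · rintro k s' ⟨-, rfl, -⟩
    rfl
  · rintro k s1 - ⟨h0, h1, h2, h3, h4, h5, h6⟩
    set i := s.r .idn - (k + 1) with hi
    have hik : s.r .idn - k = i + 1 := by omega
    rw [hik]
    refine run_seq (T := 1) (T' := 6) (run_sto (run_seq (T := 1) (T' := 5) (run_sto
      (run_seq (T := 1) (T' := 4) (run_inc (run_seq (T := 3) (T' := 1) ?_))))))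
    have hm : ∀ j < i + 1, ((s1.setm .half (s1.r .t1) (s1.r .hlf)).setm .par
        ((s1.setm .half (s1.r .t1) (s1.r .hlf)).r .t1)
        ((s1.setm .half (s1.r .t1) (s1.r .hlf)).r .t2)).m .half j = j / 2 ∧
        ((s1.setm .half (s1.r .t1) (s1.r .hlf)).setm .par
        ((s1.setm .half (s1.r .t1) (s1.r .hlf)).r .t1)
        ((s1.setm .half (s1.r .t1) (s1.r .hlf)).r .t2)).m .par j = j % 2 := by
      intro j hj
      simp only [State.m_setm, State.r_setm, h3, h4, h5, reduceCtorEq, false_and, if_false,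
        true_and]
      by_cases hji : j = i
      · simp [hji]
      · simp only [hji, if_false]
        exact h6 j (by omega)
    refine run_ite (fun h => ?_) fun h => ?_
    · simp only [State.r_setr, State.r_setm, reduceCtorEq, if_false, h5] at h
      refine run_seq (T := 1) (T' := 1) (run_inc (run_cst (run_dif ⟨by omega, ?_, ?_, ?_, ?_, ?_,
        fun j hj => hm j hj⟩)))
      · simp [h2, h3]; omega
      · simp [h2]
      · simp [h3]
      · simp [h4]; omega
      · simp; omega
    · simp only [State.r_setr, State.r_setm, reduceCtorEq, if_false, h5] at h
      refine Run.mono (run_cst (run_dif ⟨by omega, ?_, ?_, ?_, ?_, ?_,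
        fun j hj => hm j hj⟩)) (show 1 ≤ 2 by omega) fun _ h => h
      · simp [h2, h3]; omega
      · simp [h2]
      · simp [h3]
      · simp [h4]; omega
      · simp; omega
  · simp
  · rintro s' ⟨-, -, -, -, -, -, h⟩
    simpa using h

end Parse

/-! ### The whole program -/

section Main

variable {n m : ℕ} {S : Schema n m}

theorem Rg.code_ne_zero (a : Rg) : a.code ≠ 0 := by
  cases a <;> simp [Rg.code]

theorem startState_r (w : List ℕ) (a : Rg) : (startState w).r a = 0 := by
  simp [State.r, startState, a.code_ne_zero]

theorem startState_m (w : List ℕ) {a : Ar} (ha : a ≠ .inp) : (startState w).m a = 0 := by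
  funext i
  have : a.code ≠ 0 := fun h => ha (Ar.code_injective (h.trans rfl))
  simp [State.m, startState, this]

theorem startState_rest (w : List ℕ) : Rest (startState w) w := by
  intro i hi
  have : (startState w).r .ptr = 0 := startState_r w _
  rw [this, zero_add]
  simp [State.m, startState, Ar.code, hi]

/-- The banks of the initial tables: bank `m` contains the table over the empty set of variables,
and bank `m + 1` serves for all absent tables. -/
def initLoc (n m : ℕ) : Finset (Fin n) ⊕ Fin m → ℕ
  | .inl U => if U = ∅ then m else m + 1
  | .inr j => j

/-- Read the instance and prepare the memory. -/
def setup (S : Schema n m) : Prog :=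
  cst .ncnt 1 ;; cst .idn 1 ;; cst .ne 1 ;; readInst S ;; halves ;; cst (.len m) 1 ;;
    cst (.pres m) 1

/-- A bound for the number of steps for reading an instance of size `E`. -/
def setupCost (n m E : ℕ) : ℕ := m * (E * (10 * n + 6) + 7) + (1 + m * (E * n)) * 8 + 11

/-- The memory after reading the instance `D`: the dictionary and the tables of halves are correct,
the banks contain the initial tables, with values renamed by `cmp`, and `ne` is zero if and only if
some relation is empty. There are at most `1 + m n ‖D‖` names. -/
structure Ready (D : Inst S) (s : State) : Prop where
  good : Good (s.r .idn) s
  stored : Stored s (initLoc n m) (m + 2) (initTabs D (s.m .cmp))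
  names : Renaming s
  named : ∀ j, ∀ t ∈ D j, Named s t
  ne : s.r .ne = 0 ↔ ∃ j, D j = ∅
  idn : s.r .idn ≤ 1 + m * (D.size * n)
  out : s.m .out = 0

theorem Enumerates.card {α : Type*} {l : List α} {R : Finset α}
    (h : Enumerates l (R : Set α)) : l.length = R.card := by
  classical
  rw [← List.toFinset_card_of_nodup h.1]
  congr 1
  ext x
  rw [List.mem_toFinset, h.2, Finset.mem_coe]

theorem Inst.card_le_size (D : Inst S) (j : Fin m) : (D j).card ≤ D.size :=
  Finset.single_le_sum (f := fun j => (D j).card) (fun _ _ => Nat.zero_le _) (Finset.mem_univ j)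

theorem Renaming.injOn {s : State} (h : Renaming s) {D : Inst S}
    (hD : ∀ j, ∀ t ∈ D j, Named s t) : Set.InjOn (s.m .cmp) D.vals := by
  rintro _ ⟨j, t, ht, v, rfl⟩ _ ⟨j', t', ht', v', rfl⟩ e
  rw [← h.dec _ (hD j t ht v), e, h.dec _ (hD j' t' ht' v')]

theorem encVec_injOn {κ : ℕ → ℕ} {D : Inst S} (hκ : Set.InjOn κ D.vals) (j : Fin m) :
    Set.InjOn (encVec (n := n) κ) (D j : Set (Tuple (S.vars j))) := by
  intro t ht t' ht' e
  funext v
  have := congrFun e v.1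
  simp only [encVec, v.2, dif_pos] at this
  exact hκ ⟨j, t, ht, v, rfl⟩ ⟨j, t', ht', v, rfl⟩ this

theorem run_setup {D : Inst S} {L : (j : Fin m) → List (Tuple (S.vars j))}
    (hL : ∀ j, Enumerates (L j) (D j : Set (Tuple (S.vars j)))) :
    Run (setup S) (startState (encodeInst L)) (setupCost n m D.size) (Ready D) := by
  have hlen : ∀ j, (L j).length ≤ D.size := fun j => (hL j).card.le.trans (D.card_le_size j)
  refine (run_seq (T := 1) (T' := 1 + (1 + ((m * (D.size * (10 * n + 6) + 7) + 1) +
    (((1 + m * (D.size * n)) * 8 + 5) + (1 + 1))))) (run_cst (run_seq (run_cst (run_seq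
    (run_cst ?_)))))).mono (by rw [setupCost]; omega) fun _ h => h
  set s0 := ((((startState (encodeInst L)).setr .ncnt 1).setr .idn 1).setr .ne 1) with hs0
  have hr0 : ∀ a : Rg, a ≠ .ncnt → a ≠ .idn → a ≠ .ne → s0.r a = 0 := fun a h1 h2 h3 => by
    simp [hs0, h1, h2, h3, startState_r]
  have hm0 : ∀ a : Ar, a ≠ .inp → s0.m a = 0 := fun a ha => startState_m _ ha
  have hrows0 : ∀ b, rows n s0 b = [] := fun b => by simp [rows, hr0]
  refine run_seq ((run_readInst (s := s0) (L := L) hlen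
    ((startState_rest _).congr rfl (by simp [hs0]))
    ⟨by simp [hs0], fun a h => absurd ?_ h, fun a h => absurd ?_ h⟩ (by simp [hs0])
    (by simp [hs0]) (fun j => hrows0 j)).frame.post ?_)
  · rw [hm0 _ (by simp)]; rfl
  · rw [hm0 _ (by simp)]; rfl
  rintro s1 ⟨⟨a1, a2, a3, a4, a5⟩, f1⟩
  have fr1 : ∀ a : Rg, a = .ncnt ∨ a = .len m ∨ a = .pres m ∨ a = .len (m + 1) ∨
      a = .pres (m + 1) → s1.r a = s0.r a := fun a ha => f1.1 a fun h => by
    have := readInst_frame.1 _ h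
    rcases ha with rfl | rfl | rfl | rfl | rfl <;> simp at this <;>
      (obtain ⟨j, hj⟩ := this; have := j.2; omega)
  have fm1 : ∀ a : Ar, a = .out ∨ (∃ v e, a = .chl v e) ∨ (∃ v, a = .col m v) → s1.m a = 0 :=
    fun a ha => by
      have h0 : s0.m a = 0 := hm0 a (by rcases ha with rfl | ⟨v, e, rfl⟩ | ⟨v, rfl⟩ <;> simp)
      rw [← h0]
      refine f1.2 a fun h => ?_
      have := readInst_frame.2 _ h
      rcases ha with rfl | ⟨v, e, rfl⟩ | ⟨v, rfl⟩ <;> simp at this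
      obtain ⟨⟨j, hj⟩, -⟩ := this
      have := j.2
      omega
  refine run_seq ((run_halves (s := s1)).frame.mono (by omega) ?_)
  rintro s2 ⟨h2, f2⟩
  have fr2 : ∀ a : Rg, a ≠ .rem → a ≠ .t1 → a ≠ .hlf → a ≠ .t2 → s2.r a = s1.r a :=
    fun a b1 b2 b3 b4 => f2.1 a (by simp [halves, b1, b2, b3, b4])
  have fm2 : ∀ a : Ar, a ≠ .half → a ≠ .par → s2.m a = s1.m a :=
    fun a b1 b2 => f2.2 a (by simp [halves, b1, b2])
  have hn2 : Renaming s2 := a1.congr (fr2 _ (by simp) (by simp) (by simp) (by simp))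
    (fm2 _ (by simp) (by simp)) (fm2 _ (by simp) (by simp))
  have nm2 : ∀ j, ∀ t ∈ D j, Named s2 t := fun j t ht =>
    (a2 j t (((hL j).2 t).2 ht)).mono (SameNames.of_eq (fm2 _ (by simp) (by simp)))
  have idn2 : s2.r .idn = s1.r .idn := fr2 _ (by simp) (by simp) (by simp) (by simp)
  have chl2 : ∀ v e p, s2.m (.chl v e) p = 0 := fun v e p => by
    rw [fm2 _ (by simp) (by simp), fm1 _ (Or.inr (Or.inl ⟨v, e, rfl⟩))]; rfl
  have ncnt2 : s2.r .ncnt = 1 := by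
    rw [fr2 _ (by simp) (by simp) (by simp) (by simp), fr1 _ (Or.inl rfl)]; simp [hs0]
  refine run_seq (run_cst (run_cst ?_))
  set s3 := (s2.setr (.len m) 1).setr (.pres m) 1 with hs3
  have m3 : s3.m = s2.m := rfl
  refine ⟨⟨?_, ?_, ?_⟩, ?_, hn2.congr (by simp [hs3]) rfl rfl, nm2, ?_, ?_, ?_⟩
  · simp only [hs3, State.r_setr, reduceCtorEq, if_false]; exact hn2.pos
  · simp only [hs3, State.r_setr, reduceCtorEq, if_false, idn2]; exact h2
  · have nc3 : s3.r .ncnt = 1 := by simp [hs3, ncnt2]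
    refine ⟨by rw [nc3]; exact one_pos, fun v e p => ?_, fun v e p v' e' p' h => ?_⟩
    · rw [m3, chl2, nc3]; exact one_pos
    · rw [m3, chl2] at h; exact absurd rfl h
  · rintro (U | j)
    · by_cases hU : U = ∅
      · subst hU
        have hr : rows n s3 m = [0] := by
          have : s3.r (.len m) = 1 := by simp [hs3]
          rw [rows, this]
          simp only [List.range_one, List.map_cons, List.map_nil]
          congr 1
          funext v
          rw [rowAt, m3, fm2 _ (by simp) (by simp), fm1 _ (Or.inr (Or.inr ⟨v, rfl⟩))]
          rfl
        have e1 : initLoc n m (.inl ∅) = m := by simp [initLoc]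
        have e2 : initTabs D (s3.m .cmp) (.inl ∅) = some {0} := by simp [initTabs]
        rw [e1, e2]
        exact ⟨by omega, Rep.ofList hr (by simp) (by simp [hs3]) (by simp)⟩
      · have e1 : initLoc n m (.inl U) = m + 1 := by simp [initLoc, hU]
        have e2 : initTabs D (s3.m .cmp) (.inl U) = none := by simp [initTabs, hU]
        have hl : s3.r (.len (m + 1)) = 0 := by
          have : s3.r (.len (m + 1)) = s2.r (.len (m + 1)) := by simp [hs3]
          rw [this, fr2 _ (by simp) (by simp) (by simp) (by simp), fr1 _ (by simp),
            hr0 _ (by simp) (by simp) (by simp)]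
        have hp : s3.r (.pres (m + 1)) = 0 := by
          have : s3.r (.pres (m + 1)) = s2.r (.pres (m + 1)) := by simp [hs3]
          rw [this, fr2 _ (by simp) (by simp) (by simp) (by simp), fr1 _ (by simp),
            hr0 _ (by simp) (by simp) (by simp)]
        have hr : rows n s3 (m + 1) = [] := by simp [rows, hl]
        rw [e1, e2]
        exact ⟨by omega, by simpa using hp, by rw [hr]; simp, fun x => by rw [hr]; simp⟩
    · have hj := j.2
      have hjm : j.val ≠ m := by omega
      have e2 : initTabs D (s3.m .cmp) (.inr j) = some ((D j).image (encVec (s3.m .cmp))) := rfl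
      have hr : rows n s3 j = (L j).map (encVec (s3.m .cmp)) := by
        have e : rows n s3 j = rows n s1 j := by
          rw [hs3, rows_setr (by simp), rows_setr (by simpa using hjm)]
          exact rows_congr (fr2 _ (by simp) (by simp) (by simp) (by simp))
            fun v => fm2 _ (by simp) (by simp)
        rw [e, (a3 j).1, m3, fm2 _ (by simp) (by simp)]
      have hp : s3.r (.pres j) = 1 := by
        have : s3.r (.pres j) = s2.r (.pres j) := by simp [hs3, hjm]
        rw [this, fr2 _ (by simp) (by simp) (by simp) (by simp), (a3 j).2]
      rw [e2]
      refine ⟨by simp only [initLoc]; omega, Rep.ofList hr ?_ hp fun x => ?_⟩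
      · refine List.Nodup.map_on (fun t ht t' ht' e => ?_) (hL j).1
        exact encVec_injOn (hn2.injOn nm2) j (((hL j).2 t).1 ht) (((hL j).2 t').1 ht') e
      · simp only [List.mem_map, Finset.mem_image]
        exact exists_congr fun t => and_congr_left fun _ => by rw [(hL j).2, Finset.mem_coe]
  · have : s3.r .ne = s2.r .ne := by simp [hs3]
    rw [this, fr2 _ (by simp) (by simp) (by simp) (by simp), a4]
    refine exists_congr fun j => ?_
    rw [← Finset.card_eq_zero, ← (hL j).card, List.length_eq_zero_iff]
  · have : s3.r .idn = s2.r .idn := by simp [hs3]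
    rw [this, idn2]; exact a5
  · rw [m3, fm2 _ (by simp) (by simp), fm1 _ (Or.inl rfl)]

/-- One round of the main loop, with the size limit `bud`; the limit is doubled after a failure. -/
noncomputable def round (S : Schema n m) (K : ℕ) : Prog :=
  cst .out 1 ;; cst .ocnt 0 ;; cst .fail 0 ;;
    compile (.inl Finset.univ) (allOps S K) (initLoc n m) (m + 2) ;;
    mov .go .fail ;; ite' .fail (double .bud) skp

/-- Try the size limits `1, 2, 4, …` until the computation succeeds. -/
noncomputable def search (S : Schema n m) (K : ℕ) : Prog :=
  cst .bud 1 ;; cst .go 1 ;; whl .go (round S K) ;; cst .t1 0 ;; sto .out .t1 .ocnt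

theorem small_initTabs {D : Inst S} {s : State} (h : Ready D s) {E : ℕ} (hE : D.size ≤ E)
    (hE1 : 1 ≤ E) (i : Finset (Fin n) ⊕ Fin m) :
    Small (s.r .idn) E (initTabs D (s.m .cmp) i) := by
  have hp := h.names.pos
  rcases i with U | j
  · simp only [initTabs]
    split_ifs
    · rintro _ ⟨⟩
      refine ⟨fun x hx v => ?_, by simpa using hE1⟩
      rw [Finset.mem_singleton] at hx
      rw [hx]
      exact hp
    · rintro _ ⟨⟩
  · rintro _ ⟨⟩
    refine ⟨fun x hx v => ?_, Finset.card_image_le.trans ((D.card_le_size j).trans hE)⟩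
    obtain ⟨t, ht, rfl⟩ := Finset.mem_image.1 hx
    simp only [encVec]
    split_ifs with hv
    · exact h.names.lt _ (h.named j t ht _)
    · exact hp

theorem outList_store {s : State} {a : ℕ} {w : List ℕ} (h : outList s = a :: w) (c : ℕ) :
    outList (s.setm .out 0 c) = c :: w := by
  have hl : s.r .out = w.length + 1 := by
    have := congrArg List.length h
    simpa [outList] using this
  rw [outList, hl, List.range_succ_eq_map, List.map_cons, List.map_map] at h
  rw [outList, State.r_setm, hl, List.range_succ_eq_map, List.map_cons, List.map_map]
  have h2 := (List.cons.inj h).2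
  refine congrArg₂ List.cons (by rw [State.m_setm, if_pos ⟨rfl, rfl⟩]) (Eq.trans ?_ h2)
  refine List.map_congr_left fun i _ => ?_
  simp only [Function.comp]
  rw [State.m_setm, if_neg (by simp)]

theorem hasOutput_of_outList {s : State} {w : List ℕ} (h : outList s = w) : s.HasOutput w := by
  subst h
  refine ⟨by simp [outList]; rfl, fun i hi => ?_⟩
  have hi' : i < s.r .out := by simpa [outList] using hi
  rw [List.getD_eq_getElem _ _ hi]
  simp [outList]
  rfl

/-- A bound for the number of steps of a round. -/
noncomputable def roundCost (S : Schema n m) (K d r E : ℕ) : ℕ :=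
  compileCost n d (E + 2 ^ r) (allOps S K).length + 4 * 2 ^ r + 8

theorem compileCost_mono {d E E' : ℕ} (h : E ≤ E') (k : ℕ) :
    compileCost n d E k ≤ compileCost n d E' k := by
  have h1 : stepCost n d E ≤ stepCost n d E' := by
    unfold stepCost; gcongr
  induction k with
  | zero => exact h1
  | succ k ih =>
    have h2 : Nat.log 2 E ≤ Nat.log 2 E' := Nat.log_mono_right h
    simp only [compileCost]
    gcongr

theorem allOps_wf (K : ℕ) : ∀ op ∈ allOps S K, op.WF (attrs S) := by
  intro op hop
  rcases List.mem_append.1 hop with h | h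
  · exact mainOps_wf K op h
  · obtain ⟨i, -, rfl⟩ := List.mem_map.1 h
    exact ⟨by simp [attrs], subset_rfl⟩

/-- If `2 ^ r` is the first power of two for which the computation succeeds, then the search stops
after `r + 1` rounds. -/
theorem run_search {K r : ℕ} {D : Inst S} {s : State} (hs : Ready D s)
    (hr : Success (2 ^ r) (.inl Finset.univ) (allOps S K) (initTabs D (s.m .cmp)))
    (hlt : ∀ i < r, ¬ Success (2 ^ i) (.inl Finset.univ) (allOps S K) (initTabs D (s.m .cmp))) :
    Run (search S K) s ((r + 1) * (roundCost S K (s.r .idn) r D.size + 1) + 5) fun s' =>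
      ∃ l, OutList (2 ^ r) (.inl Finset.univ) (allOps S K) (initTabs D (s.m .cmp)) l ∧
        outList s' = l.length :: l.flatMap (decode (s.m .dec)) := by
  set κ := s.m .cmp with hκ
  set d := s.r .idn with hd
  set c := roundCost S K d r D.size with hc
  refine (run_seq (T := 1) (T' := 1 + (((r + 1) * (c + 1) + 1) + (1 + 1))) (run_cst (run_seq
    (run_cst ?_)))).mono (by omega) fun _ h => h
  refine run_seq ((run_whl (k := r + 1) (c := c) (fun k s' => k ≤ r + 1 ∧
    (s'.r .go = 0 ↔ k = 0) ∧ Good d s' ∧ Stored s' (initLoc n m) (m + 2) (initTabs D κ) ∧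
    s'.m .dec = s.m .dec ∧ (0 < k → s'.r .bud = 2 ^ (r + 1 - k)) ∧ (k = 0 →
    ∃ a l, OutList (2 ^ r) (.inl Finset.univ) (allOps S K) (initTabs D κ) l ∧
      outList s' = a :: l.flatMap (decode (s.m .dec)) ∧ s'.r .ocnt = l.length)) ?_ ?_ ?_).post ?_)
  · rintro k s' ⟨-, h, -⟩
    exact h
  · rintro k s1 - ⟨h1, -, h2, h3, h4, h5, -⟩
    set i := r + 1 - (k + 1) with hi
    have hir : i ≤ r := by omega
    have hpow : 2 ^ i ≤ 2 ^ r := Nat.pow_le_pow_right (by norm_num) hir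
    have hb1 : s1.r .bud = 2 ^ i := h5 (Nat.succ_pos k)
    have hE1 : 1 ≤ D.size + 2 ^ i := le_add_left Nat.one_le_two_pow
    have hcost : compileCost n d (D.size + 2 ^ i) (allOps S K).length ≤
        compileCost n d (D.size + 2 ^ r) (allOps S K).length := compileCost_mono (by omega) _
    refine (run_seq (T := 1) (T' := 1 + (1 + (compileCost n d (D.size + 2 ^ i)
      (allOps S K).length + (1 + ((2 ^ i * 4 + 2) + 1))))) (run_cst (run_seq (run_cst (run_seq
      (run_cst ?_)))))).mono (by rw [hc, roundCost]; omega) fun _ h => h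
    set s2 := ((s1.setr .out 1).setr .ocnt 0).setr .fail 0 with hs2
    have k2 : KeptOut (m + 2) s1 s2 :=
      ⟨fun a _ b1 b2 b3 => by simp [hs2, b1, b2, b3], fun _ _ _ => rfl⟩
    refine run_seq ((run_compile (v₀ := .inl Finset.univ) (M := 2 ^ i) (E := D.size + 2 ^ i)
      (Nat.le_add_left _ _) (allOps S K) (allOps_wf K) (initLoc n m) (m + 2) (initTabs D κ)
      (supp_initTabs D κ) (small_initTabs hs (Nat.le_add_right _ _) hE1) s2
      (h2.of_eq rfl rfl (fun _ _ => rfl) (by simp [hs2])) (h3.keptOut k2)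
      (by simp [hs2, hb1])).post ?_)
    rintro s3 ⟨g3, k3, l, hl, ⟨o1, o2, o3⟩⟩
    have st3 : Stored s3 (initLoc n m) (m + 2) (initTabs D κ) := h3.keptOut (k2.trans k3)
    have dec3 : s3.m .dec = s.m .dec := by rw [k3.2 _ (by simp [Ar.free]) (by simp)]; exact h4
    have bud3 : s3.r .bud = 2 ^ i := by
      rw [k3.1 _ (by simp [Rg.free]) (by simp) (by simp) (by simp)]; simp [hs2, hb1]
    have fail2 : s2.r .fail = 0 := by simp [hs2]
    have out2 : outList s2 = [s2.m .out 0] := by simp [outList, hs2]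
    have dec2 : s2.m .dec = s.m .dec := h4
    have ocnt2 : s2.r .ocnt = 0 := by simp [hs2]
    rw [out2, dec2] at o1
    rw [ocnt2, zero_add] at o2
    simp only [fail2, true_and] at o3
    refine run_seq (run_mov ?_)
    set s4 := s3.setr .go (s3.r .fail) with hs4
    have f4 : s4.r .fail = s3.r .fail := by simp [hs4]
    have st4 : Stored s4 (initLoc n m) (m + 2) (initTabs D κ) := by
      intro i
      obtain ⟨a1, a2⟩ := st3 i
      have e : rows n s4 (initLoc n m i) = rows n s3 (initLoc n m i) := rows_setr (by simp)
      exact ⟨a1, by rw [← a2.pres]; simp [hs4], by rw [e]; exact a2.nodup,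
        fun x => by rw [e]; exact a2.mem x⟩
    have g4 : Good d s4 := g3.of_eq rfl rfl (fun _ _ => rfl) (by simp [hs4])
    by_cases hk : k = 0
    · subst hk
      have hir : i = r := by omega
      rw [hir] at o3 hl
      have hz : s3.r .fail = 0 := o3.2 hr
      refine run_ite (fun h => absurd (f4.trans hz) h) fun _ => Run.mono (run_skp ?_)
        (show 1 ≤ 2 ^ i * 4 + 2 by omega) fun _ h => h
      refine ⟨by omega, by simp [hs4, hz], g4.of_eq rfl rfl (fun _ _ => rfl) (by simp),
        ?_, dec3, fun h => absurd h (lt_irrefl 0), fun _ => ⟨s2.m .out 0, l, hl, ?_, ?_⟩⟩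
      · exact st4.keptOut ((Kept.refl _ _).setr (by simp [Rg.free]) _).keptOut
      · rw [← List.singleton_append, ← o1]
        exact outList_congr (by simp [hs4]) rfl
      · simp [hs4, o2]
    · have hir : i < r := by omega
      have hnz : s3.r .fail ≠ 0 := fun h => hlt i hir (o3.1 h)
      refine run_ite (fun _ => ?_) fun h => absurd (f4.symm.trans h) hnz
      have hb4 : s4.r .bud = 2 ^ i := by simp [hs4, bud3]
      have := run_double (a := .bud) (by simp) (by simp) (s := s4)
      rw [hb4] at this
      refine this.frame.post ?_
      rintro s5 ⟨b5, f5⟩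
      have fr5 : ∀ a : Rg, a ≠ .t1 → a ≠ .t2 → a ≠ .bud → s5.r a = s4.r a :=
        fun a b1 b2 b3 => f5.1 a (by simp [double, b1, b2, b3])
      have fm5 : s5.m = s4.m := funext fun a => f5.2 a (by simp [double])
      refine ⟨by omega, ?_, g4.of_eq (by rw [fm5]) (by rw [fm5]) (fun _ _ => by rw [fm5])
        (fr5 _ (by simp) (by simp) (by simp)), fun i => ?_, by rw [fm5]; exact dec3, fun _ => ?_,
        fun h => absurd h hk⟩
      · rw [fr5 _ (by simp) (by simp) (by simp)]
        simp [hs4, hnz, hk]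
      · obtain ⟨a1, a2⟩ := st4 i
        have e : rows n s5 (initLoc n m i) = rows n s4 (initLoc n m i) :=
          rows_congr (fr5 _ (by simp) (by simp) (by simp)) fun v => by rw [fm5]
        exact ⟨a1, by rw [← a2.pres]; exact fr5 _ (by simp) (by simp) (by simp),
          by rw [e]; exact a2.nodup, fun x => by rw [e]; exact a2.mem x⟩
      · have : r + 1 - k = i + 1 := by omega
        rw [b5, this, pow_succ, mul_comm]
  · refine ⟨le_rfl, by simp, hs.good.of_eq rfl rfl (fun _ _ => rfl) (by simp), fun i => ?_, rfl,
      fun _ => by simp, fun h => absurd h (Nat.succ_ne_zero r)⟩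
    obtain ⟨a1, a2⟩ := hs.stored i
    have e : rows n ((s.setr .bud 1).setr .go 1) (initLoc n m i) = rows n s (initLoc n m i) := by
      rw [rows_setr (by simp), rows_setr (by simp)]
    exact ⟨a1, by rw [← a2.pres]; simp, by rw [e]; exact a2.nodup,
      fun x => by rw [e]; exact a2.mem x⟩
  · rintro s1 ⟨-, -, -, -, -, -, h⟩
    obtain ⟨a, l, hl, ho, hc⟩ := h rfl
    refine run_seq (run_cst (run_sto ⟨l, hl, ?_⟩))
    have e : (s1.setr .t1 0).r .t1 = 0 := by simp
    rw [e]
    have e2 : (s1.setr .t1 0).r .ocnt = l.length := by simp [hc]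
    rw [e2]
    exact outList_store (by rw [← ho]; exact outList_congr (by simp) rfl) _

/-- The program: if some relation is empty, then so is the output. -/
noncomputable def program (S : Schema n m) (K : ℕ) : Prog :=
  setup S ;; ite' .ne (search S K) (cst .out 1)

/-- The vectors that are consistent with the initial tables are the renamed tuples of the full join.
-/
theorem fits_initTabs {D : Inst S} {s : State} (h : Ready D s) (x : Vec n) :
    Fits (attrs S) (initTabs D (s.m .cmp)) x ↔
      ∃ t ∈ fullJoin D, x = fun v => s.m .cmp (t v) := by
  constructor
  · intro hx
    have h1 : ∀ j, ∃ t ∈ D j, encVec (s.m .cmp) t = mask (S.vars j) x := fun j =>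
      Finset.mem_image.1 (hx (.inr j) _ rfl)
    have h2 : ∀ j, ∀ t ∈ D j, encVec (s.m .cmp) t = mask (S.vars j) x →
        ∀ v (hv : v ∈ S.vars j), x v = s.m .cmp (t ⟨v, hv⟩) := by
      intro j t _ e v hv
      have := congrFun e v
      simp only [encVec, mask, hv, dif_pos, if_true] at this
      exact this.symm
    refine ⟨fun v => s.m .dec (x v), fun j => ?_, funext fun v => ?_⟩
    · obtain ⟨t, ht, e⟩ := h1 j
      have : proj (S.vars j) (fun v => s.m .dec (x v)) = t := by
        funext v
        simp only [proj]
        rw [h2 j t ht e v.1 v.2, h.names.dec _ (h.named j t ht _)]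
      rw [this]
      exact ht
    · obtain ⟨j, hj⟩ := S.covers v
      obtain ⟨t, ht, e⟩ := h1 j
      change x v = s.m .cmp (s.m .dec (x v))
      rw [h2 j t ht e v hj, h.names.dec _ (h.named j t ht _)]
  · rintro ⟨t, ht, rfl⟩ (U | j) R hR
    · simp only [initTabs] at hR
      split_ifs at hR with hU
      cases hR
      subst hU
      rw [Finset.mem_singleton]
      funext v
      simp [mask, attrs]
    · cases hR
      refine Finset.mem_image.2 ⟨_, ht j, ?_⟩
      funext v
      by_cases hv : v ∈ S.vars j <;> simp [encVec, mask, attrs, proj, hv]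

theorem encodeOutput_eq {dec : ℕ → ℕ} (l : List (Vec n)) :
    encodeOutput (l.map fun x v => dec (x v)) = l.length :: l.flatMap (decode dec) := by
  simp [encodeOutput, List.flatMap_map]
  rfl

theorem enumerates_output {K M : ℕ} {D : Inst S} {s : State} (h : Ready D s) {l : List (Vec n)}
    (hl : OutList M (.inl Finset.univ) (allOps S K) (initTabs D (s.m .cmp)) l)
    (hs : Success M (.inl Finset.univ) (allOps S K) (initTabs D (s.m .cmp))) :
    Enumerates (l.map fun x v => s.m .dec (x v)) (fullJoin D) := by
  have hL : ∀ i, i ∈ allIdx n m := fun i => Finset.mem_toList.2 (Finset.mem_univ i)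
  have hmem := OutList.mem_iff_fits (att := attrs S) rfl hL (mainOps_wf K) (supp_initTabs D _) hl hs
  have hnd := OutList.nodup (att := attrs S) rfl hL (mainOps_wf K) (supp_initTabs D _) hl
  have hdec : ∀ t ∈ fullJoin D, (fun v => s.m .dec (s.m .cmp (t v))) = t := fun t ht => by
    funext v
    obtain ⟨j, hj⟩ := S.covers v
    exact h.names.dec _ (h.named j _ (ht j) ⟨v, hj⟩)
  refine ⟨List.Nodup.map_on (fun x hx y hy e => ?_) hnd, fun t => ?_⟩
  · obtain ⟨t, ht, rfl⟩ := (fits_initTabs h x).1 ((hmem x).1 hx)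
    obtain ⟨t', ht', rfl⟩ := (fits_initTabs h y).1 ((hmem y).1 hy)
    rw [hdec t ht, hdec t' ht'] at e
    rw [e]
  · rw [List.mem_map]
    constructor
    · rintro ⟨x, hx, rfl⟩
      obtain ⟨t, ht, rfl⟩ := (fits_initTabs h x).1 ((hmem x).1 hx)
      rw [hdec t ht]
      exact ht
    · intro ht
      exact ⟨_, (hmem _).2 ((fits_initTabs h _).2 ⟨t, ht, rfl⟩), hdec t ht⟩

/-- A bound for the number of steps of the program in terms of the size of the instance and of the
last size limit. -/
noncomputable def totalCost (S : Schema n m) (K r E : ℕ) : ℕ :=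
  setupCost n m E + (r + 1) * ((2 * (Nat.log 2 (E + 2 ^ r) + 3)) ^ (allOps S K).length *
    stepCost n (1 + m * (E * n)) (E + 2 ^ r) + 4 * 2 ^ r + 9) + 6

theorem roundCost_le {K d r E : ℕ} (hd : d ≤ 1 + m * (E * n)) :
    roundCost S K d r E + 1 ≤ (2 * (Nat.log 2 (E + 2 ^ r) + 3)) ^ (allOps S K).length *
      stepCost n (1 + m * (E * n)) (E + 2 ^ r) + 4 * 2 ^ r + 9 := by
  have h1 := compileCost_le n d (E + 2 ^ r) (allOps S K).length
  have h2 : Nat.log 2 d ≤ Nat.log 2 (1 + m * (E * n)) := Nat.log_mono_right hd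
  have h3 : stepCost n d (E + 2 ^ r) ≤ stepCost n (1 + m * (E * n)) (E + 2 ^ r) := by
    unfold stepCost walkCost
    gcongr
  have h4 := h1.trans (Nat.mul_le_mul_left _ h3)
  rw [roundCost]
  omega

/-- The search stops at the first power of two that suffices; by `hK` this is at most a constant
factor above the polymatroid bound, for all constraints and weights at once. -/
theorem exec_program {K : ℕ}
    (hK : ∀ (D : Inst S) (κ : ℕ → ℕ), (∀ j, (D j).Nonempty) → Set.InjOn κ D.vals →
      ∀ (Δ : Finset (Mon n)) (N w : Mon n → ℝ≥0), D.Satisfies Δ N → IsShannon Δ w →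
      ∀ M : ℕ, 2 ^ (K + 1) * (bound Δ N w : ℝ) ≤ M → 1 ≤ M →
      Success M (.inl Finset.univ) (allOps S K) (initTabs D κ))
    {D : Inst S} {L : (j : Fin m) → List (Tuple (S.vars j))}
    (hL : ∀ j, Enumerates (L j) (D j : Set (Tuple (S.vars j)))) :
    ∃ t s q r, Exec (program S K) (startState (encodeInst L)) t s ∧ Enumerates q (fullJoin D) ∧
      s.HasOutput (encodeOutput q) ∧ t ≤ totalCost S K r D.size ∧
      ∀ (Δ : Finset (Mon n)) (N w : Mon n → ℝ≥0), D.Satisfies Δ N → IsShannon Δ w →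
        (2 : ℝ) ^ r ≤ 2 ^ (K + 2) * ((bound Δ N w : ℝ) + 1) := by
  classical
  obtain ⟨t₁, s₁, e₁, ht₁, h₁⟩ := run_setup hL
  by_cases hne : ∃ j, D j = ∅
  · have hz : s₁.r .ne = 0 := h₁.ne.2 hne
    refine ⟨_, _, [], 0, .seq e₁ (.condFalse hz (.const ..)), ⟨List.nodup_nil, fun t => ?_⟩, ?_, ?_,
      ?_⟩
    · obtain ⟨j, hj⟩ := hne
      simp only [List.not_mem_nil, false_iff]
      intro ht
      have := ht j
      rw [hj] at this
      simp at this
    · refine hasOutput_of_outList ?_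
      have : outList (s₁.setr .out 1) = [s₁.m .out 0] := by simp [outList]
      refine this.trans ?_
      rw [h₁.out]
      rfl
    · rw [totalCost]
      omega
    · intro Δ N w _ _
      have h1 : (0 : ℝ) ≤ bound Δ N w := NNReal.coe_nonneg _
      have h2 : (1 : ℝ) ≤ 2 ^ (K + 2) := one_le_pow₀ (by norm_num)
      rw [pow_zero]
      nlinarith
  · have hne' : ∀ j, (D j).Nonempty := fun j =>
      Finset.nonempty_iff_ne_empty.2 fun h => hne ⟨j, h⟩
    have hnz : s₁.r .ne ≠ 0 := fun h => hne (h₁.ne.1 h)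
    have hinj := h₁.names.injOn h₁.named
    have hex : ∃ r, Success (2 ^ r) (.inl Finset.univ) (allOps S K)
        (initTabs D (s₁.m .cmp)) := by
      obtain ⟨Δ, N, w, hsat, hsh, -⟩ := exists_trivial_bound D
      obtain ⟨r, hr⟩ := pow_unbounded_of_one_lt (2 ^ (K + 1) * (bound Δ N w : ℝ))
        (one_lt_two (α := ℝ))
      exact ⟨r, hK D _ hne' hinj Δ N w hsat hsh (2 ^ r) (by push_cast; exact hr.le)
        Nat.one_le_two_pow⟩
    set r := Nat.find hex with hrdef
    have hr := Nat.find_spec hex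
    obtain ⟨t₂, s₂, e₂, ht₂, l, hl, ho⟩ := run_search h₁ hr fun i hi => Nat.find_min hex hi
    refine ⟨_, s₂, l.map fun x v => s₁.m .dec (x v), r, .seq e₁ (.condTrue hnz e₂),
      enumerates_output h₁ hl hr, ?_, ?_, ?_⟩
    · rw [encodeOutput_eq]
      exact hasOutput_of_outList ho
    · have h2 := Nat.mul_le_mul_left (r + 1) (roundCost_le (S := S) (K := K) (r := r) h₁.idn)
      have h3 : t₂ ≤ (r + 1) * (roundCost S K (s₁.r .idn) r D.size + 1) + 5 := ht₂
      rw [totalCost]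
      omega
    · intro Δ N w hsat hsh
      have hB := one_le_bound D hne' hsat (w := w)
      have h2 : (1 : ℝ) ≤ 2 ^ (K + 2) := one_le_pow₀ (by norm_num)
      rcases Nat.eq_zero_or_pos r with h0 | hpos
      · rw [h0, pow_zero]
        nlinarith
      · have hlt := Nat.find_min hex (m := r - 1) (by omega)
        have h3 : (2 : ℝ) ^ (r - 1) < 2 ^ (K + 1) * (bound Δ N w : ℝ) := by
          by_contra hcon
          exact hlt (hK D _ hne' hinj Δ N w hsat hsh (2 ^ (r - 1))
            (by push_cast; exact not_lt.1 hcon) Nat.one_le_two_pow)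
        have h4 : (2 : ℝ) ^ r = 2 * 2 ^ (r - 1) := by
          rw [← pow_succ']
          congr 1
          omega
        have h5 : (2 : ℝ) ^ (K + 2) = 2 * 2 ^ (K + 1) := by rw [← pow_succ']
        have h6 : (0 : ℝ) < 2 ^ (K + 1) := by positivity
        rw [h4, h5]
        nlinarith

end Main

/-! ### The running time -/

/-- Logarithms of polynomially bounded numbers are logarithmic. -/
theorem natLog_le {a p : ℕ} {c x : ℝ} (hc : 1 ≤ c) (hx : 1 ≤ x) (h : (a : ℝ) ≤ c * x ^ p) :
    (Nat.log 2 a : ℝ) ≤ 2 * (Real.log c + p) * (1 + Real.log x) := by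
  have hlc := Real.log_nonneg hc
  have hlx := Real.log_nonneg hx
  rcases Nat.eq_zero_or_pos a with rfl | ha
  · rw [Nat.log_zero_right, Nat.cast_zero]
    positivity
  have h1 : (2 : ℝ) ^ Nat.log 2 a ≤ c * x ^ p := by
    refine le_trans ?_ h
    exact_mod_cast Nat.pow_log_le_self 2 ha.ne'
  have h2 := Real.log_le_log (by positivity) h1
  rw [Real.log_pow, Real.log_mul (by positivity) (by positivity), Real.log_pow] at h2
  have h3 : (1 : ℝ) / 2 ≤ Real.log 2 := by linarith [Real.log_two_gt_d9]
  have h4 : (0 : ℝ) ≤ Nat.log 2 a := Nat.cast_nonneg _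
  have h5 : (0 : ℝ) ≤ p := Nat.cast_nonneg _
  nlinarith [mul_nonneg hlc hlx, mul_nonneg h4 (sub_nonneg.2 h3), mul_nonneg h5 hlx]

/-- The number of steps is almost linear in the size of the instance and the last size limit, if
this limit is polynomially bounded. -/
theorem totalCost_le {n m : ℕ} (S : Schema n m) (K : ℕ) :
    ∃ (C : ℝ) (k : ℕ), 0 ≤ C ∧ ∀ r E : ℕ, (2 : ℝ) ^ r ≤ 2 ^ (K + 2) * (((E : ℝ) + 1) ^ m + 1) →
      (totalCost S K r E : ℝ) ≤ C * (E + 2 ^ r + 1) * (1 + Real.log (E + 1)) ^ k := by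
  set q := (allOps S K).length
  set c₁ : ℝ := 2 ^ (K + 2) with hc₁
  have hc1 : 1 ≤ c₁ := one_le_pow₀ (by norm_num)
  set a : ℝ := 2 * (Real.log (1 + 2 * c₁) + (m + 1 : ℕ)) with ha
  set b : ℝ := 2 * (Real.log (1 + m * n) + (1 : ℕ)) with hb
  have hla : 0 ≤ Real.log (1 + 2 * c₁) := Real.log_nonneg (by linarith)
  have hlb : 0 ≤ Real.log (1 + (m : ℝ) * n) :=
    Real.log_nonneg (le_add_of_nonneg_right (by positivity))
  have ha0 : 0 ≤ a := by positivity
  have hb0 : 0 ≤ b := by positivity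
  set A : ℝ := 2 * (a + 3) with hA
  set W : ℝ := n * ((b + 1) * 11 + 2) + 2 with hW
  set F : ℝ := m * (10 * n + 13) + 8 * (1 + m * n) + 11 with hF
  refine ⟨F + (a + 1) * (A ^ q * (12 * (W + 6 * n + 20)) + 13) + 6, q + 2, by positivity,
    fun r E hr => ?_⟩
  set x : ℝ := (E : ℝ) + 1 with hx
  have hx1 : 1 ≤ x := le_add_of_nonneg_left (Nat.cast_nonneg _)
  set l : ℝ := 1 + Real.log x with hl
  have hl1 : 1 ≤ l := le_add_of_nonneg_right (Real.log_nonneg hx1)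
  set G : ℝ := E + 2 ^ r + 1 with hG
  have hE0 : (0 : ℝ) ≤ E := Nat.cast_nonneg _
  have hr0 : (1 : ℝ) ≤ 2 ^ r := one_le_pow₀ (by norm_num)
  have hG1 : 1 ≤ G := by rw [hG]; linarith
  have hxm : x ^ m ≤ x ^ (m + 1) := pow_le_pow_right₀ hx1 (Nat.le_succ m)
  have hx1m : 1 ≤ x ^ (m + 1) := one_le_pow₀ hx1
  have hxx : x ≤ x ^ (m + 1) := le_self_pow₀ hx1 (Nat.succ_ne_zero m)
  have h2r : (2 : ℝ) ^ r ≤ 2 * c₁ * x ^ (m + 1) := hr.trans (by nlinarith)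
  have hL : (Nat.log 2 (E + 2 ^ r) : ℝ) ≤ a * l := by
    refine natLog_le (by linarith) hx1 ?_
    push_cast
    linarith
  have hR : (r : ℝ) ≤ a * l := by
    have := natLog_le (a := 2 ^ r) (p := m + 1) (c := 1 + 2 * c₁) (by linarith) hx1
      (by push_cast; linarith)
    rwa [Nat.log_pow (by norm_num)] at this
  have hd : (Nat.log 2 (1 + m * (E * n)) : ℝ) ≤ b * l := by
    refine natLog_le (le_add_of_nonneg_right (by positivity)) hx1 ?_
    have : (0 : ℝ) ≤ m * n := by positivity
    push_cast
    rw [hx]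
    nlinarith
  have hwalk : (walkCost n (1 + m * (E * n)) : ℝ) ≤ W * l := by
    rw [walkCost]
    push_cast
    have h1 : (Nat.log 2 (1 + m * (E * n)) : ℝ) + 1 ≤ (b + 1) * l := by linarith
    calc (n : ℝ) * ((Nat.log 2 (1 + m * (E * n)) + 1) * 11 + 2) + 2
        ≤ n * ((b + 1) * l * 11 + 2 * l) + 2 * l := by gcongr <;> linarith
      _ = W * l := by rw [hW]; ring
  have hstep : (stepCost n (1 + m * (E * n)) (E + 2 ^ r) : ℝ) ≤
      12 * (W + 6 * n + 20) * G * l := by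
    rw [stepCost]
    push_cast
    calc (12 : ℝ) * ((E + 2 ^ r + 1) * (walkCost n (1 + m * (E * n)) + 6 * n + 20))
        ≤ 12 * (G * (W * l + 6 * n * l + 20 * l)) := by
          have h1 : 6 * (n : ℝ) ≤ 6 * n * l := le_mul_of_one_le_right (by positivity) hl1
          exact mul_le_mul_of_nonneg_left (mul_le_mul_of_nonneg_left
            (show _ ≤ _ by linarith) (by positivity)) (by norm_num)
      _ = _ := by ring
  have hpow : ((2 : ℝ) * (Nat.log 2 (E + 2 ^ r) + 3)) ^ q ≤ A ^ q * l ^ q := by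
    rw [← mul_pow]
    refine pow_le_pow_left₀ (by positivity) ?_ q
    rw [hA]
    linarith
  have hW0 : 0 ≤ W := by positivity
  have hlq : 1 ≤ l ^ (q + 1) := one_le_pow₀ hl1
  have hlq2 : 1 ≤ l ^ (q + 2) := one_le_pow₀ hl1
  have hsetup : (setupCost n m E : ℝ) ≤ F * G := by
    rw [setupCost]
    push_cast
    have h1 : (0 : ℝ) ≤ m * (10 * n + 6) + 8 * (m * n) := by positivity
    have h2 : (E : ℝ) ≤ G := by rw [hG]; linarith
    have h3 : (0 : ℝ) ≤ m * 7 + 8 + 11 := by positivity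
    calc (m : ℝ) * (E * (10 * n + 6) + 7) + (1 + m * (E * n)) * 8 + 11
        = (m * (10 * n + 6) + 8 * (m * n)) * E + (m * 7 + 8 + 11) * 1 := by ring
      _ ≤ (m * (10 * n + 6) + 8 * (m * n)) * G + (m * 7 + 8 + 11) * G := by gcongr
      _ = F * G := by rw [hF]; ring
  have hround : ((2 : ℝ) * (Nat.log 2 (E + 2 ^ r) + 3)) ^ q *
      stepCost n (1 + m * (E * n)) (E + 2 ^ r) + 4 * 2 ^ r + 9 ≤
      (A ^ q * (12 * (W + 6 * n + 20)) + 13) * (G * l ^ (q + 1)) := by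
    have h1 : (2 : ℝ) ^ r ≤ G := by rw [hG]; linarith
    have h2 : G ≤ G * l ^ (q + 1) := le_mul_of_one_le_right (by linarith) hlq
    calc ((2 : ℝ) * (Nat.log 2 (E + 2 ^ r) + 3)) ^ q *
          stepCost n (1 + m * (E * n)) (E + 2 ^ r) + 4 * 2 ^ r + 9
        ≤ A ^ q * l ^ q * (12 * (W + 6 * n + 20) * G * l) + 4 * (G * l ^ (q + 1)) +
          9 * (G * l ^ (q + 1)) := by
          gcongr
          · linarith
          · linarith
      _ = _ := by ring
  have hrl : (r : ℝ) + 1 ≤ (a + 1) * l := by linarith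
  rw [totalCost]
  push_cast
  have hGl : G ≤ G * l ^ (q + 2) := le_mul_of_one_le_right (by linarith) hlq2
  have hF0 : 0 ≤ F := by positivity
  calc (setupCost n m E : ℝ) + (r + 1) * ((2 * (Nat.log 2 (E + 2 ^ r) + 3)) ^ q *
        stepCost n (1 + m * (E * n)) (E + 2 ^ r) + 4 * 2 ^ r + 9) + 6
      ≤ F * (G * l ^ (q + 2)) + (a + 1) * l * ((A ^ q * (12 * (W + 6 * n + 20)) + 13) *
        (G * l ^ (q + 1))) + 6 * (G * l ^ (q + 2)) := by
        gcongr
        · exact hsetup.trans (by gcongr)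
        · linarith
    _ = _ := by ring

end Panda

theorem corollary4p2 {n m : ℕ} (S : Panda.Schema n m) :
    (∀ (D : Panda.Inst S) (Δ : Finset (Panda.Mon n)) (N w : Panda.Mon n → ℝ≥0),
      D.Satisfies Δ N → Panda.IsShannon Δ w →
      (((Panda.fullJoin D).encard : ℕ∞) : ℝ≥0∞) ≤ (Panda.bound Δ N w : ℝ≥0∞)) ∧
    ∃ (P : Panda.Prog) (C : ℝ) (k : ℕ),
      ∀ (D : Panda.Inst S) (L : (j : Fin m) → List (Panda.Tuple (S.vars j))),
        (∀ j, Panda.Enumerates (L j) (D j : Set (Panda.Tuple (S.vars j)))) →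
        ∃ (t : ℕ) (s : Panda.State) (q : List (Fin n → ℕ)),
          Panda.Exec P (Panda.startState (Panda.encodeInst L)) t s ∧
          Panda.Enumerates q (Panda.fullJoin D) ∧
          s.HasOutput (Panda.encodeOutput q) ∧
          ∀ (Δ : Finset (Panda.Mon n)) (N w : Panda.Mon n → ℝ≥0),
            D.Satisfies Δ N → Panda.IsShannon Δ w →
            (t : ℝ) ≤ C * ((D.size : ℝ) + (Panda.bound Δ N w : ℝ) + 1) *
              (1 + Real.log ((D.size : ℝ) + 1)) ^ k := by
  refine ⟨fun D Δ N w hD hS => Panda.encard_le_bound D Δ N w hD hS, ?_⟩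
  obtain ⟨K, hK⟩ := Panda.exists_success n
  obtain ⟨C, k, hC, hcost⟩ := Panda.totalCost_le S K
  refine ⟨Panda.program S K, C * (1 + 2 ^ (K + 2)), k, fun D L hL => ?_⟩
  obtain ⟨t, s, q, r, he, hq, ho, ht, hr⟩ := Panda.exec_program
    (fun D κ h1 h2 Δ N w h3 h4 M h5 h6 => hK S D κ h1 h2 Δ N w h3 h4 M h5 h6) hL
  refine ⟨t, s, q, he, hq, ho, fun Δ N w hsat hsh => ?_⟩
  have hpoly : (2 : ℝ) ^ r ≤ 2 ^ (K + 2) * (((D.size : ℝ) + 1) ^ m + 1) := by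
    obtain ⟨Δ', N', w', h1, h2, h3⟩ := Panda.exists_trivial_bound D
    exact (hr Δ' N' w' h1 h2).trans (by gcongr)
  have hl : 0 ≤ Real.log ((D.size : ℝ) + 1) :=
    Real.log_nonneg (le_add_of_nonneg_left (Nat.cast_nonneg _))
  have hB : (0 : ℝ) ≤ Panda.bound Δ N w := NNReal.coe_nonneg _
  have hE : (0 : ℝ) ≤ D.size := Nat.cast_nonneg _
  calc (t : ℝ) ≤ Panda.totalCost S K r D.size := by exact_mod_cast ht
    _ ≤ C * (D.size + 2 ^ r + 1) * (1 + Real.log (D.size + 1)) ^ k := hcost r D.size hpoly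
    _ ≤ C * ((1 + 2 ^ (K + 2)) * (D.size + Panda.bound Δ N w + 1)) *
        (1 + Real.log (D.size + 1)) ^ k := by
        gcongr
        have := hr Δ N w hsat hsh
        have h0 : (0 : ℝ) < 2 ^ (K + 2) := by positivity
        nlinarith
    _ = _ := by ring
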